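/- Let $\mu>0$, $T>0$, $J_t=[0,t]$, $J_T=[0,T]$. Consider on the real line the Cauchy problem $$\partial_t u-\mu\,\partial_x^2(u+g)+(u+g)\,\partial_x(u+g)=f(t,x),\qquad u(0,x)=u_0(x), \tag{3.1}$$ the equation being understood in the sense of distributions on $(0,T)\times\mathbb R$, and the initial condition as $u(0)=u_0$ and $u(t)\to u_0$ in $L^2_{\rm loc}(\mathbb R)$ as $t\to0^+$. Notation: $\|h\|_{L^2_{\rm ul}}=\sup_{y\in\mathbb R}\|h\|_{L^2([y,y+1])}$ and $\|h\|_{H^1_{\rm ul}}=\sup_{y\in\mathbb R}\|h\|_{H^1([y,y+1])}$; $C_*(J_T,L^2_{\rm ul})$ is the space of curves $J_T\to L^2_{\rm ul}$ that are bounded and continuous on $(0,T]$ and have a limit in $L^2_{\rm loc}$ as $t\to0^+$; $\|w\|_{L^2_{\rm ul}L^2(J_t)}=\sup_{y\in\mathbb R}\|w\|_{L^2(J_t\times[y,y+1])}$; $W^{k,\infty}=W^{k,\infty}(\mathbb R)$. For a space $X$ of functions of $x$, $L^p(J_T,X)$ is the space of (jointly) measurable functions of $(t,x)$ for which $t\mapsto\|h(t)\|_X$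 belongs to $L^p(J_T)$. **Theorem.** Let $u_0\in L^\infty(\mathbb R)$, $f\in L^1(J_T,L^\infty)$ and $g\in L^\infty(J_T\times\mathbb R)\cap L^2(J_T,W^{1,\infty})\cap L^1(J_T,W^{2,\infty})$. Then the Cauchy problem (3.1) has a solution $u$ such that, for every $p\in[1,\frac43)$, $$u\in L^\infty(J_T\times\mathbb R)\cap C_*(J_T,L^2_{\rm ul})\cap L^p(J_T,H^1_{\rm ul}),\qquad \bigl\|\partial_xu(\cdot,x)\bigr\|_{L^2(J_T)}\in L^2_{\rm ul}, \tag{3.9}$$ and it is unique: if $w$ is a solution satisfying (3.9) for some $p\in[1,\frac43)$, then $w(t)=u(t)$ almost everywhere on $\mathbb R$ for every $t\in J_T$. Moreover, the mapping $(u_0,f,g)\mapsto u$ is uniformly Lipschitz continuous on every ball, in the following sense. For every $R\ge0$ there is a constant $C$, depending only on $R$, $T$ and $\mu$, such that if $u_1,u_2$ are the solutions corresponding to data $(u_{0i},f_i,g_i)$, $i=1,2$, as above whose norms $\|u_{0i}\|_{L^\infty}$, $\|f_i\|_{L^1(J_T,L^\infty)}$, $\|g_i\|_{L^\infty(J_T\times\mathbb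 R)}$, $\|g_i\|_{L^2(J_T,W^{1,\infty})}$, $\|g_i\|_{L^1(J_T,W^{2,\infty})}$ do not exceed $R$, then for every $t\in J_T$, with $v=u_1-u_2$, $v_0=u_{01}-u_{02}$, $f=f_1-f_2$, $g=g_1-g_2$, $$\sup_{s\in J_t}\|v(s)\|_{L^2_{\rm ul}}+\|\partial_xv\|_{L^2_{\rm ul}L^2(J_t)}\le C\Bigl(\|v_0\|_{L^2_{\rm ul}}+\min\bigl\{\|f\|_{L^2_{\rm ul}L^2(J_t)},\|f\|_{L^1(J_t,L^\infty)}\bigr\}+\|g\|_{L^1(J_t,W^{2,\infty})}+\|g\|_{L^2(J_t,W^{1,\infty})}\Bigr),$$ where $\|f\|_{L^2_{\rm ul}L^2(J_t)}$ may be infinite. -/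

import Mathlib

open MeasureTheory Filter Topology Set
open scoped ENNReal NNReal ContDiff

namespace UlBurgers

/-- `f'` is the weak (distributional) derivative of `f` on the real line. -/
structure HasWeakDeriv (f f' : ℝ → ℝ) : Prop where
  locInt : LocallyIntegrable f volume
  locInt' : LocallyIntegrable f' volume
  integral_eq : ∀ φ : ℝ → ℝ, ContDiff ℝ ∞ φ → HasCompactSupport φ →
    ∫ x, f x * deriv φ x = -∫ x, f' x * φ x

/-- The norm of `L²_ul(ℝ)`: the supremum over `y` of the norms in `L²([y, y + 1])`. -/
noncomputable def l2ul (f : ℝ → ℝ) : ℝ≥0∞ :=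
  ⨆ y : ℝ, eLpNorm f 2 (volume.restrict (Icc y (y + 1)))

/-- The norm of `H¹_ul(ℝ)` of a function `f` with weak derivative `f'`. -/
noncomputable def h1ul (f f' : ℝ → ℝ) : ℝ≥0∞ :=
  ⨆ y : ℝ, (eLpNorm f 2 (volume.restrict (Icc y (y + 1))) ^ 2 +
    eLpNorm f' 2 (volume.restrict (Icc y (y + 1))) ^ 2) ^ (1 / 2 : ℝ)

/-- The norm of `L²_ul L²([0, t])`: the supremum over `y` of the norms in
`L²([0, t] × [y, y + 1])`. -/
noncomputable def l2ulL2 (t : ℝ) (w : ℝ → ℝ → ℝ) : ℝ≥0∞ :=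
  ⨆ y : ℝ, eLpNorm (Function.uncurry w) 2 (volume.restrict (Icc 0 t ×ˢ Icc y (y + 1)))

/-- The norm of `L^∞(ℝ)`. -/
noncomputable def linf (f : ℝ → ℝ) : ℝ≥0∞ := eLpNorm f ⊤ volume

/-- The norm of `L^p([0, t]; X)` of a curve whose `X`-norm at time `s` is `N s`. -/
noncomputable def timeNorm (p : ℝ≥0∞) (t : ℝ) (N : ℝ → ℝ≥0∞) : ℝ≥0∞ :=
  eLpNorm N p (volume.restrict (Icc 0 t))

/-- The strip `[0, T] × ℝ` with Lebesgue measure. -/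
noncomputable def strip (T : ℝ) : Measure (ℝ × ℝ) :=
  volume.restrict (Icc 0 T ×ˢ univ)

/-- The space `C_*([0, T], L²_ul)`: curves in `L²_ul` that are bounded and continuous on `(0, T]`
and have a limit in `L²_loc` as `t → 0⁺`. -/
structure MemCStar (T : ℝ) (u : ℝ → ℝ → ℝ) : Prop where
  meas : ∀ t ∈ Icc 0 T, AEStronglyMeasurable (u t) volume
  mem : ∀ t ∈ Icc 0 T, l2ul (u t) < ⊤
  bounded : ∃ M : ℝ≥0, ∀ t ∈ Ioc 0 T, l2ul (u t) ≤ M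
  cont : ∀ t ∈ Ioc 0 T,
    Tendsto (fun s => l2ul (fun x => u s x - u t x)) (𝓝[Ioc 0 T] t) (𝓝 0)
  limit : ∃ l : ℝ → ℝ, ∀ r : ℝ, 0 < r →
    MemLp l 2 (volume.restrict (Icc (-r) r)) ∧
    Tendsto (fun t => eLpNorm (fun x => u t x - l x) 2 (volume.restrict (Icc (-r) r)))
      (𝓝[>] 0) (𝓝 0)

/-- Data of the Cauchy problem: the initial state `u0`, the source `f`, and the function `g`
together with (representatives of) its first two weak derivatives in `x`; these are determined
by `g` up to null sets, see `Admissible`. -/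
structure Data where
  u0 : ℝ → ℝ
  f : ℝ → ℝ → ℝ
  g : ℝ → ℝ → ℝ
  gx : ℝ → ℝ → ℝ
  gxx : ℝ → ℝ → ℝ

/-- The norm of `W^{1,∞}(ℝ)` of a function with weak derivative `f'`. -/
noncomputable def w1inf (f f' : ℝ → ℝ) : ℝ≥0∞ := linf f + linf f'

/-- The norm of `W^{2,∞}(ℝ)` of a function with weak derivatives `f'` and `f''`. -/
noncomputable def w2inf (f f' f'' : ℝ → ℝ) : ℝ≥0∞ := linf f + linf f' + linf f''

/-- `u0 ∈ L^∞`, `f ∈ L¹(J_T, L^∞)`, and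
`g ∈ L^∞(J_T × ℝ) ∩ L²(J_T, W^{1,∞}) ∩ L¹(J_T, W^{2,∞})`, where `J_T = [0, T]`. -/
structure Data.Admissible (T : ℝ) (d : Data) : Prop where
  u0_mem : MemLp d.u0 ⊤ volume
  f_meas : AEStronglyMeasurable (Function.uncurry d.f) (strip T)
  f_mem : MemLp (fun t => linf (d.f t)) 1 (volume.restrict (Icc 0 T))
  g_mem : MemLp (Function.uncurry d.g) ⊤ (strip T)
  gx_meas : AEStronglyMeasurable (Function.uncurry d.gx) (strip T)
  gxx_meas : AEStronglyMeasurable (Function.uncurry d.gxx) (strip T)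
  gx_deriv : ∀ᵐ t ∂(volume.restrict (Icc 0 T)), HasWeakDeriv (d.g t) (d.gx t)
  gxx_deriv : ∀ᵐ t ∂(volume.restrict (Icc 0 T)), HasWeakDeriv (d.gx t) (d.gxx t)
  g_mem_w1 : MemLp (fun t => w1inf (d.g t) (d.gx t)) 2 (volume.restrict (Icc 0 T))
  g_mem_w2 : MemLp (fun t => w2inf (d.g t) (d.gx t) (d.gxx t)) 1 (volume.restrict (Icc 0 T))

/-- The data belong to the balls of radius `R` centred at zero in the corresponding spaces. -/
structure Data.InBall (T : ℝ) (R : ℝ≥0) (d : Data) : Prop where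
  u0_le : linf d.u0 ≤ R
  f_le : timeNorm 1 T (fun t => linf (d.f t)) ≤ R
  g_le : eLpNorm (Function.uncurry d.g) ⊤ (strip T) ≤ R
  g_w1_le : timeNorm 2 T (fun t => w1inf (d.g t) (d.gx t)) ≤ R
  g_w2_le : timeNorm 1 T (fun t => w2inf (d.g t) (d.gx t) (d.gxx t)) ≤ R

/-- The equation `∂ₜu - μ ∂ₓ²(u + g) + B(u + g) = f`, `B(v) = v ∂ₓv`, in the sense of
distributions on `(0, T) × ℝ`; `ux` is the weak derivative of `u` in `x`. -/
def SolvesEquation (μ T : ℝ) (d : Data) (u ux : ℝ → ℝ → ℝ) : Prop :=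
  ∀ φ : ℝ → ℝ → ℝ, ContDiff ℝ ∞ (Function.uncurry φ) →
    HasCompactSupport (Function.uncurry φ) →
    tsupport (Function.uncurry φ) ⊆ Ioo 0 T ×ˢ univ →
    ∫ z : ℝ × ℝ,
      (-(u z.1 z.2 * deriv (fun s => φ s z.2) z.1)
        - μ * ((u z.1 z.2 + d.g z.1 z.2) * iteratedDeriv 2 (φ z.1) z.2)
        + (u z.1 z.2 + d.g z.1 z.2) * (ux z.1 z.2 + d.gx z.1 z.2) * φ z.1 z.2
        - d.f z.1 z.2 * φ z.1 z.2) ∂(strip T) = 0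

/-- `u`, with weak derivative `ux` in `x`, is a solution of the Cauchy problem with data `d` in
`L^∞(J_T × ℝ) ∩ C_*(J_T, L²_ul) ∩ L^p(J_T, H¹_ul)` such that
`‖∂ₓu(·, x)‖_{L²(J_T)} ∈ L²_ul`. -/
structure IsSolution (μ T : ℝ) (d : Data) (p : ℝ≥0∞) (u ux : ℝ → ℝ → ℝ) : Prop where
  bounded : MemLp (Function.uncurry u) ⊤ (strip T)
  cstar : MemCStar T u
  ux_meas : AEStronglyMeasurable (Function.uncurry ux) (strip T)
  ux_deriv : ∀ᵐ t ∂(volume.restrict (Icc 0 T)), HasWeakDeriv (u t) (ux t)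
  mem_h1ul : MemLp (fun t => h1ul (u t) (ux t)) p (volume.restrict (Icc 0 T))
  ux_mem : l2ulL2 T ux < ⊤
  equation : SolvesEquation μ T d u ux
  initial_eq : u 0 =ᵐ[volume] d.u0
  initial_lim : ∀ r : ℝ, 0 < r →
    Tendsto (fun t => eLpNorm (fun x => u t x - d.u0 x) 2 (volume.restrict (Icc (-r) r)))
      (𝓝[>] 0) (𝓝 0)

/-- The norm `‖g‖_{L¹([0, t], W^{2,∞})} + ‖g‖_{L²([0, t], W^{1,∞})}`. -/
noncomputable def tripleNorm (t : ℝ) (g gx gxx : ℝ → ℝ → ℝ) : ℝ≥0∞ :=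
  timeNorm 1 t (fun s => w2inf (g s) (gx s) (gxx s)) + timeNorm 2 t (fun s => w1inf (g s) (gx s))

end UlBurgers

namespace UlBurgers

/-! Uniqueness and stability rest on a localised energy estimate. In divergence form the equation is
`∂ₜu = ∂ₓF + f` with flux `F = μ(uₓ + gₓ) - (u + g)²/2`. For two solutions bounded by `M` (after
adding `g`), the difference `z` solves `∂ₜz = ∂ₓA + B`, where `B` is the difference of the sources
and `A - μ zₓ` is at most `(μ + M)(|z| + κ)`, with `κ(t)` the `W^{1,∞}` norm of the difference of
the `g`s. Testing with `ζ² z`, where `ζ` is a cutoff of a unit cell, bounds the energy in that cell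
by energies in the cell and its two neighbours. Since all cells are treated alike, the supremum over
cells, weighted by `exp(-l t)` with `l` large, absorbs the right-hand side
(`exists_energy_constant`, `lipschitz_aux`). The energy identity itself (`Evolution.energy`) comes
from mollifying in space: the mollified solution is absolutely continuous in time at each point,
obeys the chain rule, and the limit is taken with a dominated convergence theorem whose majorants
vary with the mollification.

Existence goes through the mild formulation for a truncated problem. The nonlinearity `v²/2` is
replaced by a primitive `ftr K` of the identity clamped at height `K`, which is globally Lipschitz,
and `μ gₓₓ` is counted as a source. In the norm weighted by `exp(l t)` the Duhamel map is a
contraction, because exponentials are eigenfunctions of convolution with `t₊^{-1/2}`, with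
eigenvalue `√(π / l)`. The iteration also preserves a Lipschitz bound `V(t)` in space which behaves
like `t^{-1/2}` plus a half-order integral of an integrable function; hence `V` lies in `L^{4/3}(0,
T)`, whence the bound in `L^p(H¹_ul)` (`MildData.exists_fixedPoint`). Duality with the fundamental
solution makes the fixed point a distributional solution. Its derivative is bounded by an integrable
function of time, and the mollified energy identity then yields `l2ulL2 T ux < ⊤`.

The truncation is removed by a comparison principle (`Evolution.nonpos`). The functions `±u - m(t)`,
with `m + G = (U + G + 1) exp ∫(κ + φ)`, are subsolutions in the sense needed there, so `|u| + G`
has a bound that does not involve `K` (`MildSol.abs_le_comparison`). Choosing `K` equal to this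
bound makes the truncation inactive.

Finally, uniqueness identifies every solution with the constructed one, so every solution obeys the
bound by the radius `R` of the ball of data (`IsSolution.ae_add_g_le`). This turns the stability
constant, which depends on `M`, into one depending only on `R`, `T` and `μ`. -/

section

/-! ### Mollification on the real line -/

/-- A bump function of radius `1 / (n + 1)`. -/
noncomputable def bump (n : ℕ) : ContDiffBump (0 : ℝ) :=
  ⟨1 / (2 * (n + 1)), 1 / (n + 1), by positivity, by
    apply one_div_lt_one_div_of_lt <;> [positivity; (have : (0:ℝ) ≤ n := n.cast_nonneg; linarith)]⟩

/-- The mollifying kernel of width `1 / (n + 1)`. -/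
noncomputable def mker (n : ℕ) : ℝ → ℝ := (bump n).normed volume

/-- Mollification of a function on the real line. -/
noncomputable def moll (n : ℕ) (f : ℝ → ℝ) (x : ℝ) : ℝ := ∫ y, f y * mker n (x - y)

lemma mker_contDiff (n : ℕ) : ContDiff ℝ ∞ (mker n) := (bump n).contDiff_normed

lemma mker_nonneg (n : ℕ) (x : ℝ) : 0 ≤ mker n x := (bump n).nonneg_normed x

lemma mker_hasCompactSupport (n : ℕ) : HasCompactSupport (mker n) :=
  (bump n).hasCompactSupport_normed

lemma tsupport_mker (n : ℕ) : tsupport (mker n) = Icc (-(1 / (n + 1) : ℝ)) (1 / (n + 1)) := by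
  rw [mker, ContDiffBump.tsupport_normed_eq, Real.closedBall_eq_Icc]
  simp [bump]

lemma mker_eq_zero {n : ℕ} {x : ℝ} (hx : 1 / (n + 1 : ℝ) < |x|) : mker n x = 0 := by
  apply image_eq_zero_of_notMem_tsupport
  rw [tsupport_mker]
  intro h
  exact absurd (abs_le.2 h) (not_le.2 hx)

lemma integral_mker (n : ℕ) : ∫ x, mker n x = 1 := (bump n).integral_normed

lemma integral_mker_sub (n : ℕ) (x : ℝ) : ∫ y, mker n (x - y) = 1 := by
  rw [integral_sub_left_eq_self (mker n) volume x, integral_mker]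

lemma moll_eq_convolution (n : ℕ) (f : ℝ → ℝ) :
    moll n f = convolution (mker n) f (ContinuousLinearMap.lsmul ℝ ℝ) volume := by
  ext x
  rw [convolution_eq_swap, moll]
  simp [mul_comm]

lemma bump_rOut_tendsto : Tendsto (fun n => (bump n).rOut) atTop (𝓝 0) := by
  exact tendsto_one_div_add_atTop_nhds_zero_nat

/-- Lebesgue differentiation applies because the outer radius of the bump is exactly twice the inner
one, so the kernels are comparable to averages over balls. -/
lemma moll_ae_tendsto {f : ℝ → ℝ} (hf : LocallyIntegrable f volume) :
    ∀ᵐ x, Tendsto (fun n => moll n f x) atTop (𝓝 (f x)) := by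
  have := ContDiffBump.ae_convolution_tendsto_right_of_locallyIntegrable (K := 2)
    bump_rOut_tendsto (Eventually.of_forall fun n => ?_) hf
  · simp only [moll_eq_convolution]
    exact this
  · simp only [bump]; field_simp; norm_num

lemma moll_tendsto_of_continuousAt {f : ℝ → ℝ} (hf : AEStronglyMeasurable f volume) {x : ℝ}
    (hx : ContinuousAt f x) : Tendsto (fun n => moll n f x) atTop (𝓝 (f x)) := by
  simp only [moll_eq_convolution]
  refine ContDiffBump.convolution_tendsto_right bump_rOut_tendsto
    (Eventually.of_forall fun _ => hf) ?_ tendsto_const_nhds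
  exact hx.tendsto.comp tendsto_snd

lemma mker_sub_integrable_mul {f : ℝ → ℝ} (hf : LocallyIntegrable f volume) {k : ℝ → ℝ}
    (hk : Continuous k) (hk' : HasCompactSupport k) (x : ℝ) :
    Integrable (fun y => f y * k (x - y)) volume := by
  have h1 : HasCompactSupport (fun y => k (x - y)) :=
    hk'.comp_homeomorph (Homeomorph.subLeft x)
  have := hf.integrable_smul_left_of_hasCompactSupport (hk.comp (continuous_const.sub continuous_id))
    h1
  simpa [mul_comm] using this

lemma moll_abs_le {n : ℕ} {f : ℝ → ℝ} {M : ℝ} (h : ∀ᵐ x, |f x| ≤ M) (x : ℝ) :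
    |moll n f x| ≤ M := by
  -- A non-integrable function would have integral zero by convention, whereas this kernel
  -- integrates to one.
  have hint : Integrable (fun y => mker n (x - y)) := by
    by_contra hc
    have := integral_undef hc
    rw [integral_mker_sub] at this
    exact one_ne_zero this
  calc |moll n f x| ≤ ∫ y, M * mker n (x - y) := by
        rw [← Real.norm_eq_abs]
        apply norm_integral_le_of_norm_le (hint.const_mul M)
        filter_upwards [h] with y hy
        rw [norm_mul, Real.norm_eq_abs, Real.norm_eq_abs, abs_of_nonneg (mker_nonneg n _)]
        exact mul_le_mul_of_nonneg_right hy (mker_nonneg n _)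
    _ = M := by rw [integral_const_mul, integral_mker_sub, mul_one]

lemma moll_hasDerivAt (n : ℕ) {f : ℝ → ℝ} (hf : LocallyIntegrable f volume) (x : ℝ) :
    HasDerivAt (moll n f) (∫ y, f y * deriv (mker n) (x - y)) x := by
  exact HasCompactSupport.hasDerivAt_convolution_right (ContinuousLinearMap.mul ℝ ℝ) hf
    (mker_hasCompactSupport n) ((mker_contDiff n).of_le (by simp)) x

lemma moll_continuous (n : ℕ) {f : ℝ → ℝ} (hf : LocallyIntegrable f volume) :
    Continuous (moll n f) :=
  continuous_iff_continuousAt.2 fun x => (moll_hasDerivAt n hf x).continuousAt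

lemma deriv_mker_continuous (n : ℕ) : Continuous (deriv (mker n)) :=
  (mker_contDiff n).continuous_deriv (by simp)

lemma deriv_mker_hasCompactSupport (n : ℕ) : HasCompactSupport (deriv (mker n)) :=
  (mker_hasCompactSupport n).deriv

lemma mker_sub_contDiff (n : ℕ) (x : ℝ) : ContDiff ℝ ∞ (fun y => mker n (x - y)) :=
  (mker_contDiff n).comp (contDiff_const.sub contDiff_id)

lemma mker_sub_hasCompactSupport (n : ℕ) (x : ℝ) : HasCompactSupport (fun y => mker n (x - y)) :=
  (mker_hasCompactSupport n).comp_homeomorph (Homeomorph.subLeft x)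

lemma deriv_mker_sub (n : ℕ) (x y : ℝ) :
    deriv (fun y => mker n (x - y)) y = -deriv (mker n) (x - y) := by
  rw [deriv_comp_const_sub]

lemma tsupport_mker_sub (n : ℕ) (x : ℝ) :
    tsupport (fun y => mker n (x - y)) ⊆ Icc (x - 1 / (n + 1)) (x + 1 / (n + 1)) := by
  apply closure_minimal _ isClosed_Icc
  intro y hy
  have : |x - y| ≤ 1 / (n + 1) := by
    by_contra h
    exact hy (mker_eq_zero (not_le.1 h))
  rw [abs_le] at this
  constructor <;> linarith

/-- Local version: mollification commutes with weak differentiation. -/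
lemma moll_hasDerivAt_of_weak (n : ℕ) {f f' : ℝ → ℝ} (hf : LocallyIntegrable f volume) {U : Set ℝ}
    (h : ∀ φ : ℝ → ℝ, ContDiff ℝ ∞ φ → HasCompactSupport φ → tsupport φ ⊆ U →
      ∫ x, f x * deriv φ x = -∫ x, f' x * φ x) {x : ℝ}
    (hx : Icc (x - 1 / (n + 1)) (x + 1 / (n + 1)) ⊆ U) :
    HasDerivAt (moll n f) (moll n f' x) x := by
  convert! moll_hasDerivAt n hf x using 1
  -- The test function is the reflected kernel centred at `x`; reflection changes the sign of its
  -- derivative and cancels the sign in the weak formulation.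
  have := h _ (mker_sub_contDiff n x) (mker_sub_hasCompactSupport n x)
    ((tsupport_mker_sub n x).trans hx)
  simp only [deriv_mker_sub, mul_neg, integral_neg, neg_inj] at this
  exact this.symm

lemma HasWeakDeriv.moll_hasDerivAt (n : ℕ) {f f' : ℝ → ℝ} (h : HasWeakDeriv f f') (x : ℝ) :
    HasDerivAt (moll n f) (moll n f' x) x :=
  moll_hasDerivAt_of_weak n h.locInt (U := univ)
    (fun φ h1 h2 _ => h.integral_eq φ h1 h2) (subset_univ _)

/-! ### Absolutely continuous functions and weak derivatives -/

lemma locallyIntegrable_of_intervalIntegrable {f : ℝ → ℝ}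
    (h : ∀ a b : ℝ, IntervalIntegrable f volume a b) : LocallyIntegrable f volume := by
  intro x
  refine ⟨Ioc (x - 1) (x + 1), Ioc_mem_nhds (by linarith) (by linarith), ?_⟩
  have := (h (x - 1) (x + 1)).1
  exact this

lemma LocallyIntegrable.intervalIntegrable {f : ℝ → ℝ} (hf : LocallyIntegrable f volume)
    (a b : ℝ) : IntervalIntegrable f volume a b :=
  intervalIntegrable_iff.2
    ((hf.integrableOn_isCompact isCompact_uIcc).mono_set uIoc_subset_uIcc)

lemma exists_Ioc_of_hasCompactSupport {φ : ℝ → ℝ} (h : HasCompactSupport φ) :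
    ∃ r : ℝ, 0 < r ∧ tsupport φ ⊆ Ioo (-r) r := by
  obtain ⟨r, hr⟩ := h.isCompact.isBounded.subset_closedBall 0
  refine ⟨|r| + 1, by positivity, hr.trans ?_⟩
  rw [Real.closedBall_eq_Icc]
  intro x hx
  have := le_abs_self r
  constructor <;> [linarith [hx.1]; linarith [hx.2]]

/-- Integration by parts for absolutely continuous functions on an interval around the support of
the test function, where the boundary terms vanish. -/
lemma hasWeakDeriv_of_ac {F F' : ℝ → ℝ} (hF : ∀ a b, AbsolutelyContinuousOnInterval F a b)
    (hd : ∀ᵐ x, HasDerivAt F (F' x) x) : HasWeakDeriv F F' := by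
  have hderiv : deriv F =ᵐ[volume] F' := by
    filter_upwards [hd] with x hx using hx.deriv
  have hcont : Continuous F := by
    rw [continuous_iff_continuousAt]
    intro x
    have := (hF (x - 1) (x + 1)).continuousOn
    exact this.continuousAt (by
      rw [uIcc_of_le (by linarith)]
      exact Icc_mem_nhds (by linarith) (by linarith))
  have hF'int : ∀ a b, IntervalIntegrable F' volume a b := fun a b =>
    ((hF a b).intervalIntegrable_deriv).congr_ae (ae_restrict_of_ae hderiv)
  refine ⟨hcont.locallyIntegrable, locallyIntegrable_of_intervalIntegrable hF'int, ?_⟩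
  intro φ hφ hφc
  obtain ⟨r, hr, hsub⟩ := exists_Ioc_of_hasCompactSupport hφc
  have hφac : AbsolutelyContinuousOnInterval φ (-r) r :=
    ContDiffOn.absolutelyContinuousOnInterval (hφ.of_le (by simp)).contDiffOn
  have h0 : ∀ x, x ∉ Ioo (-r) r → φ x = 0 := fun x hx =>
    image_eq_zero_of_notMem_tsupport fun h => hx (hsub h)
  have h0' : ∀ x, x ∉ Ioo (-r) r → deriv φ x = 0 := fun x hx =>
    image_eq_zero_of_notMem_tsupport fun h => hx (hsub (tsupport_deriv_subset (𝕜 := ℝ) h))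
  have key := (hF (-r) r).integral_mul_deriv_eq_deriv_mul hφac
  rw [h0 r (by simp), h0 (-r) (by simp)] at key
  rw [← intervalIntegral.integral_eq_integral_of_support_subset (a := -r) (b := r),
    ← intervalIntegral.integral_eq_integral_of_support_subset (a := -r) (b := r)
      (f := fun x => F' x * φ x), key]
  · simp only [mul_zero, sub_self, zero_sub, neg_inj]
    apply intervalIntegral.integral_congr_ae
    filter_upwards [hderiv] with x hx _
    rw [hx]
  · intro x hx
    by_contra h
    exact hx (by simp [h0 x (fun h' => h (Ioo_subset_Ioc_self h'))])
  · intro x hx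
    by_contra h
    exact hx (by simp [h0' x (fun h' => h (Ioo_subset_Ioc_self h'))])

lemma ac_primitive {h : ℝ → ℝ} (hh : LocallyIntegrable h volume) (c₀ c a b : ℝ) :
    AbsolutelyContinuousOnInterval (fun x => c₀ + ∫ y in c..x, h y) a b := by
  have hI := LocallyIntegrable.intervalIntegrable hh
  have h1 := (hI (min c (min a b)) (max c (max a b))).absolutelyContinuousOnInterval_intervalIntegral
    (c := c) (by rw [uIcc_of_le (by simp)]; simp)
  have h2 : AbsolutelyContinuousOnInterval (fun _ : ℝ => c₀) a b :=
    ((contDiff_const (n := 1) (𝕜 := ℝ)).contDiffOn).absolutelyContinuousOnInterval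
  refine h2.add (h1.mono ?_)
  rw [uIcc_of_le (a := min c (min a b)) (by simp), uIcc]
  exact Icc_subset_Icc (by simp) (by simp)

lemma hasWeakDeriv_primitive {h : ℝ → ℝ} (hh : LocallyIntegrable h volume) (c₀ c : ℝ) :
    HasWeakDeriv (fun x => c₀ + ∫ y in c..x, h y) h := by
  apply hasWeakDeriv_of_ac (ac_primitive hh c₀ c)
  filter_upwards [_root_.LocallyIntegrable.ae_hasDerivAt_integral hh] with x hx
  exact (hx c).const_add c₀

/-- No `L¹` estimate is needed: the left side is an increment of the mollified primitive, and the
primitive is continuous, so its mollifications converge at both end points. This supplies the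
convergence of integrals of majorants in the passage to the limit of the energy identity. -/
lemma integral_moll_tendsto {h : ℝ → ℝ} (hh : LocallyIntegrable h volume) (a b : ℝ) :
    Tendsto (fun n => ∫ x in a..b, moll n h x) atTop (𝓝 (∫ x in a..b, h x)) := by
  set H : ℝ → ℝ := fun x => 0 + ∫ y in a..x, h y
  have hH : HasWeakDeriv H h := hasWeakDeriv_primitive hh 0 a
  have hc : Continuous H := by
    rw [continuous_iff_continuousAt]
    intro x
    have := (ac_primitive hh 0 a (x - 1) (x + 1)).continuousOn
    exact this.continuousAt (by
      rw [uIcc_of_le (by linarith)]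
      exact Icc_mem_nhds (by linarith) (by linarith))
  have h1 : ∀ n, ∫ x in a..b, moll n h x = moll n H b - moll n H a := fun n =>
    intervalIntegral.integral_eq_sub_of_hasDerivAt (fun x _ => hH.moll_hasDerivAt n x)
      ((moll_continuous n hh).intervalIntegrable a b)
  have h2 : ∫ x in a..b, h x = H b - H a := by simp [H]
  simp only [h1, h2]
  exact (moll_tendsto_of_continuousAt hc.aestronglyMeasurable hc.continuousAt).sub
    (moll_tendsto_of_continuousAt hc.aestronglyMeasurable hc.continuousAt)

/-- A function with a weak derivative agrees almost everywhere with a primitive of it. -/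
lemma HasWeakDeriv.exists_ae_eq {f f' : ℝ → ℝ} (h : HasWeakDeriv f f') :
    ∃ c : ℝ, ∀ᵐ x, f x = c + ∫ y in (0:ℝ)..x, f' y := by
  have h1 := moll_ae_tendsto h.locInt
  -- Any point at which the mollifications converge can serve as base point; the fundamental theorem
  -- of calculus for the mollifications then passes to the limit between `a` and almost every `x`.
  obtain ⟨a, ha⟩ := h1.exists
  refine ⟨f a - ∫ y in (0:ℝ)..a, f' y, ?_⟩
  filter_upwards [h1] with x hx
  have h3 : ∀ n, ∫ y in a..x, moll n f' y = moll n f x - moll n f a := fun n =>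
    intervalIntegral.integral_eq_sub_of_hasDerivAt (fun x _ => h.moll_hasDerivAt n x)
      ((moll_continuous n h.locInt').intervalIntegrable a x)
  have h4 := integral_moll_tendsto h.locInt' a x
  simp only [h3] at h4
  have h5 := tendsto_nhds_unique h4 (hx.sub ha)
  have hI := LocallyIntegrable.intervalIntegrable h.locInt'
  have h6 := intervalIntegral.integral_add_adjacent_intervals (hI 0 a) (hI a x)
  linarith

/-- The inner function is bounded on the interval, and a `C¹` function is Lipschitz on a bounded
range. -/
lemma AbsolutelyContinuousOnInterval.comp_contDiff {m η : ℝ → ℝ} {a b : ℝ}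
    (hm : AbsolutelyContinuousOnInterval m a b) (hη : ContDiff ℝ 1 η) :
    AbsolutelyContinuousOnInterval (fun x => η (m x)) a b := by
  obtain ⟨C, hC⟩ := hm.exists_bound
  have hcd : Continuous (deriv η) := hη.continuous_deriv le_rfl
  obtain ⟨L, hL⟩ := (isCompact_Icc (a := -C) (b := C)).exists_bound_of_continuousOn
    hcd.continuousOn
  have hlip : LipschitzOnWith (L.toNNReal) η (Icc (-C) C) := by
    refine (convex_Icc _ _).lipschitzOnWith_of_nnnorm_deriv_le
      (fun x _ => (hη.differentiable one_ne_zero).differentiableAt) fun x hx => ?_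
    rw [← NNReal.coe_le_coe, coe_nnnorm]
    exact (hL x hx).trans (Real.le_coe_toNNReal L)
  rw [absolutelyContinuousOnInterval_iff] at hm ⊢
  intro ε hε
  obtain ⟨δ, hδ, h⟩ := hm (ε / (L.toNNReal + 1)) (by positivity)
  refine ⟨δ, hδ, fun E hE hEδ => ?_⟩
  have h1 := h E hE hEδ
  have hmem : ∀ x ∈ uIcc a b, m x ∈ Icc (-C) C := fun x hx => by
    have := hC x hx
    rwa [Real.norm_eq_abs, abs_le] at this
  calc ∑ i ∈ Finset.range E.1, dist (η (m (E.2 i).1)) (η (m (E.2 i).2))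
      ≤ ∑ i ∈ Finset.range E.1, L.toNNReal * dist (m (E.2 i).1) (m (E.2 i).2) := by
        apply Finset.sum_le_sum
        intro i hi
        have := hE.1 i hi
        exact hlip.dist_le_mul _ (hmem _ this.1) _ (hmem _ this.2)
    _ = L.toNNReal * ∑ i ∈ Finset.range E.1, dist (m (E.2 i).1) (m (E.2 i).2) := by
        rw [Finset.mul_sum]
    _ ≤ L.toNNReal * (ε / (L.toNNReal + 1)) := by gcongr
    _ < ε := by
        rw [← mul_div_assoc, div_lt_iff₀ (by positivity)]
        nlinarith [(L.toNNReal).coe_nonneg]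

/-- Chain rule for weak derivatives. -/
lemma HasWeakDeriv.comp {f f' Φ : ℝ → ℝ} (h : HasWeakDeriv f f') (hΦ : ContDiff ℝ 1 Φ) :
    HasWeakDeriv (fun x => Φ (f x)) (fun x => deriv Φ (f x) * f' x) := by
  obtain ⟨c, hc⟩ := h.exists_ae_eq
  -- The chain rule is proved for the absolutely continuous representative and transferred by almost
  -- everywhere equality.
  have h1 : HasWeakDeriv (fun x => Φ (c + ∫ y in (0:ℝ)..x, f' y))
      (fun x => deriv Φ (f x) * f' x) := by
    apply hasWeakDeriv_of_ac
      fun a b => AbsolutelyContinuousOnInterval.comp_contDiff (ac_primitive h.locInt' c 0 a b) hΦ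
    filter_upwards [hc, _root_.LocallyIntegrable.ae_hasDerivAt_integral h.locInt'] with x hx hx'
    rw [hx]
    exact ((hΦ.differentiable one_ne_zero).differentiableAt.hasDerivAt).comp x
      ((hx' 0).const_add c)
  have h2 : (fun x => Φ (f x)) =ᵐ[volume] (fun x => Φ (c + ∫ y in (0:ℝ)..x, f' y)) := by
    filter_upwards [hc] with x hx
    rw [hx]
  refine ⟨h1.locInt.congr h2.symm, h1.locInt', fun φ h3 h4 => ?_⟩
  rw [← h1.integral_eq φ h3 h4]
  apply integral_congr_ae
  filter_upwards [h2] with x hx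
  rw [hx]

lemma HasWeakDeriv.congr {f f' g g' : ℝ → ℝ} (h : HasWeakDeriv f f') (hf : f =ᵐ[volume] g)
    (hf' : f' =ᵐ[volume] g') : HasWeakDeriv g g' := by
  refine ⟨h.locInt.congr hf, h.locInt'.congr hf', fun φ h3 h4 => ?_⟩
  have h5 := h.integral_eq φ h3 h4
  rw [integral_congr_ae (g := fun x => f x * deriv φ x)
    (by filter_upwards [hf] with x hx; rw [hx]), integral_congr_ae (f := fun x => g' x * φ x)
    (g := fun x => f' x * φ x) (by filter_upwards [hf'] with x hx; rw [hx])]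
  exact h5

lemma integrable_mul_of_hasCompactSupport {f φ : ℝ → ℝ} (hf : LocallyIntegrable f volume)
    (hφ : Continuous φ) (hc : HasCompactSupport φ) : Integrable (fun x => f x * φ x) := by
  simpa [mul_comm] using hf.integrable_smul_left_of_hasCompactSupport hφ hc

lemma HasWeakDeriv.const_mul {f f' : ℝ → ℝ} (h : HasWeakDeriv f f') (c : ℝ) :
    HasWeakDeriv (fun x => c * f x) (fun x => c * f' x) := by
  refine ⟨h.locInt.smul c, h.locInt'.smul c, fun φ h3 h4 => ?_⟩
  simp only [mul_assoc, integral_const_mul, h.integral_eq φ h3 h4, mul_neg]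

lemma HasWeakDeriv.add {f f' g g' : ℝ → ℝ} (h : HasWeakDeriv f f') (h' : HasWeakDeriv g g') :
    HasWeakDeriv (fun x => f x + g x) (fun x => f' x + g' x) := by
  refine ⟨h.locInt.add h'.locInt, h.locInt'.add h'.locInt', fun φ h3 h4 => ?_⟩
  have h5 := h3.continuous_deriv (by simp)
  simp only [add_mul]
  rw [integral_add (integrable_mul_of_hasCompactSupport h.locInt h5 h4.deriv)
    (integrable_mul_of_hasCompactSupport h'.locInt h5 h4.deriv),
    integral_add (integrable_mul_of_hasCompactSupport h.locInt' h3.continuous h4)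
    (integrable_mul_of_hasCompactSupport h'.locInt' h3.continuous h4), h.integral_eq φ h3 h4,
    h'.integral_eq φ h3 h4, neg_add]

lemma HasWeakDeriv.sub {f f' g g' : ℝ → ℝ} (h : HasWeakDeriv f f') (h' : HasWeakDeriv g g') :
    HasWeakDeriv (fun x => f x - g x) (fun x => f' x - g' x) := by
  have := h.add (h'.const_mul (-1))
  simpa [sub_eq_add_neg] using this

lemma hasWeakDeriv_const (c : ℝ) : HasWeakDeriv (fun _ => c) (fun _ => 0) := by
  have := hasWeakDeriv_primitive (h := fun _ => 0) (locallyIntegrable_const 0) c 0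
  simpa using this

lemma hasWeakDeriv_of_lipschitz {f : ℝ → ℝ} {K : ℝ≥0} (h : LipschitzWith K f) :
    HasWeakDeriv f (deriv f) := by
  apply hasWeakDeriv_of_ac fun a b => (h.lipschitzOnWith).absolutelyContinuousOnInterval
  filter_upwards [h.ae_differentiableAt_real] with x hx using hx.hasDerivAt

/-- The translates of a function with bounded weak derivative. -/
lemma HasWeakDeriv.abs_sub_le {f f' : ℝ → ℝ} (h : HasWeakDeriv f f') {κ : ℝ}
    (hκ : ∀ᵐ x, |f' x| ≤ κ) (d : ℝ) : ∀ᵐ x, |f (x + d) - f x| ≤ κ * |d| := by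
  obtain ⟨c, hc⟩ := h.exists_ae_eq
  have hc' : ∀ᵐ x, f (x + d) = c + ∫ y in (0:ℝ)..(x + d), f' y :=
    (measurePreserving_add_right volume d).quasiMeasurePreserving.ae hc
  have hI := LocallyIntegrable.intervalIntegrable h.locInt'
  filter_upwards [hc, hc'] with x h1 h2
  rw [h1, h2, add_sub_add_left_eq_sub, intervalIntegral.integral_interval_sub_left (hI _ _) (hI _ _)]
  have := intervalIntegral.norm_integral_le_of_norm_le_const_ae (a := x) (b := x + d) (C := κ)
    (f := f') (by filter_upwards [hκ] with y hy _ using hy)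
  simpa using this

/-- A continuous function on `[0, T]` with integrable weak derivative is a primitive of it. -/
lemma eq_add_integral_of_weak {T : ℝ} (hT : 0 < T) {m h : ℝ → ℝ} (hm : ContinuousOn m (Icc 0 T))
    (hh : IntegrableOn h (Icc 0 T))
    (H : ∀ θ : ℝ → ℝ, ContDiff ℝ ∞ θ → HasCompactSupport θ → tsupport θ ⊆ Ioo 0 T →
      ∫ x in Icc 0 T, m x * deriv θ x = -∫ x in Icc 0 T, h x * θ x) :
    ∀ t ∈ Icc 0 T, m t = m 0 + ∫ s in (0:ℝ)..t, h s := by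
  -- The extensions by zero may jump at `0` and `T`, so the weak equation is available only for
  -- kernels supported inside `(0, T)`. This is the use of the set `U` in `moll_hasDerivAt_of_weak`.
  set m' := (Icc 0 T).indicator m
  set h' := (Icc 0 T).indicator h
  have hm'i : LocallyIntegrable m' volume :=
    ((hm.integrableOn_Icc).integrable_indicator measurableSet_Icc).locallyIntegrable
  have hh'i : LocallyIntegrable h' volume :=
    (hh.integrable_indicator measurableSet_Icc).locallyIntegrable
  have H' : ∀ θ : ℝ → ℝ, ContDiff ℝ ∞ θ → HasCompactSupport θ → tsupport θ ⊆ Ioo 0 T →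
      ∫ x, m' x * deriv θ x = -∫ x, h' x * θ x := by
    intro θ h1 h2 h3
    rw [← setIntegral_eq_integral_of_forall_compl_eq_zero (s := Icc 0 T),
      ← setIntegral_eq_integral_of_forall_compl_eq_zero (s := Icc 0 T) (f := fun x => h' x * θ x),
      setIntegral_congr_fun (g := fun x => m x * deriv θ x) measurableSet_Icc,
      setIntegral_congr_fun (f := fun x => h' x * θ x) (g := fun x => h x * θ x) measurableSet_Icc]
    · exact H θ h1 h2 h3
    · intro x hx; simp [h', hx]
    · intro x hx; simp [m', hx]
    · intro x hx; simp [h', hx]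
    · intro x hx; simp [m', hx]
  have key : ∀ a ∈ Ioo 0 T, ∀ b ∈ Ioo 0 T, a ≤ b → m b - m a = ∫ s in a..b, h s := by
    intro a ha b hb hab
    have hsub : ∀ᶠ n : ℕ in atTop, Icc (a - 1 / (n + 1)) (b + 1 / (n + 1)) ⊆ Ioo 0 T := by
      have h1 := tendsto_one_div_add_atTop_nhds_zero_nat (𝕜 := ℝ)
      filter_upwards [h1.eventually_lt_const (ha.1), h1.eventually_lt_const (sub_pos.2 hb.2)]
        with n hn hn' x hx
      constructor <;> [linarith [hx.1]; linarith [hx.2]]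
    have h1 : ∀ x ∈ Ioo 0 T, Tendsto (fun n => moll n m' x) atTop (𝓝 (m x)) := by
      intro x hx
      have hn : Icc 0 T ∈ 𝓝 x := Icc_mem_nhds hx.1 hx.2
      have he : m' =ᶠ[𝓝 x] m := by
        filter_upwards [hn] with y hy
        simp [m', hy]
      rw [← he.eq_of_nhds]
      exact moll_tendsto_of_continuousAt hm'i.aestronglyMeasurable
        ((hm.continuousAt hn).congr he.symm)
    have h2 := integral_moll_tendsto hh'i a b
    have h3 : ∀ᶠ n : ℕ in atTop, ∫ x in a..b, moll n h' x = moll n m' b - moll n m' a := by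
      filter_upwards [hsub] with n hn
      refine intervalIntegral.integral_eq_sub_of_hasDerivAt (fun x hx => ?_)
        ((moll_continuous n hh'i).intervalIntegrable a b)
      rw [uIcc_of_le hab] at hx
      exact moll_hasDerivAt_of_weak n hm'i H'
        ((Icc_subset_Icc (by linarith [hx.1]) (by linarith [hx.2])).trans hn)
    have h4 := tendsto_nhds_unique (h2.congr' h3) ((h1 b hb).sub (h1 a ha))
    rw [← h4]
    apply intervalIntegral.integral_congr
    intro x hx
    rw [uIcc_of_le hab] at hx
    have : x ∈ Icc 0 T := ⟨ha.1.le.trans hx.1, hx.2.trans hb.2.le⟩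
    simp [h', this]
  have hI : ∀ a ∈ Icc 0 T, ∀ b ∈ Icc 0 T, IntervalIntegrable h volume a b := by
    intro a ha b hb
    rw [intervalIntegrable_iff]
    refine hh.mono_set ?_
    intro x hx
    have hx := uIoc_subset_uIcc hx
    exact (convex_Icc 0 T).ordConnected.uIcc_subset ha hb hx
  set a := T / 2
  have ha : a ∈ Ioo 0 T := ⟨by positivity, by simp only [a]; linarith⟩
  have ha' := Ioo_subset_Icc_self ha
  have h0 : (0:ℝ) ∈ Icc 0 T := ⟨le_rfl, hT.le⟩
  have hcont : ContinuousOn (fun t => m t - ∫ s in (0:ℝ)..t, h s) (Icc 0 T) := by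
    refine hm.sub ?_
    have := intervalIntegral.continuousOn_primitive_interval (a := 0) (b := T) (f := h)
      (μ := volume) (by rwa [uIcc_of_le hT.le])
    rwa [uIcc_of_le hT.le] at this
  -- The identity between interior points makes this difference constant on `(0, T)`; continuity
  -- carries it to the end points.
  have heq : EqOn (fun t => m t - ∫ s in (0:ℝ)..t, h s) (fun _ => m a - ∫ s in (0:ℝ)..a, h s)
      (Icc 0 T) := by
    refine EqOn.of_subset_closure (s := Ioo 0 T) ?_ hcont continuousOn_const Ioo_subset_Icc_self
      (by rw [closure_Ioo hT.ne])
    intro t ht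
    have ht' := Ioo_subset_Icc_self ht
    have h5 := intervalIntegral.integral_add_adjacent_intervals (hI 0 h0 a ha') (hI a ha' t ht')
    have h6 : m t - m a = ∫ s in a..t, h s := by
      rcases le_total a t with h7 | h7
      · exact key a ha t ht h7
      · rw [intervalIntegral.integral_symm, ← key t ht a ha h7]; ring
    simp only
    linarith
  intro t ht
  have h1 := heq ht
  have h2 := heq h0
  simp only [intervalIntegral.integral_same, sub_zero] at h1 h2
  linarith

/-! ### A generalized dominated convergence theorem -/

/-- The convergence of `∫ G n` together with pointwise convergence gives `G n → g` in `L¹`, since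
`(g - G n)₊` is dominated by `g`. Then `|F n - f| ≤ G n + g ≤ |G n - g| + 2g`, hence `|F n - f| ≤ |G
n - g| + min |F n - f| (2g)`, and the last term is dominated by a fixed function. -/
lemma tendsto_integral_of_generalized_dominated {α : Type*} [MeasurableSpace α] {ν : Measure α}
    {F : ℕ → α → ℝ} {f : α → ℝ} {G : ℕ → α → ℝ} {g : α → ℝ}
    (hF : ∀ n, AEStronglyMeasurable (F n) ν) (hG : ∀ n, Integrable (G n) ν) (hg : Integrable g ν)
    (hFG : ∀ n, ∀ᵐ x ∂ν, |F n x| ≤ G n x)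
    (hFf : ∀ᵐ x ∂ν, Tendsto (fun n => F n x) atTop (𝓝 (f x)))
    (hGg : ∀ᵐ x ∂ν, Tendsto (fun n => G n x) atTop (𝓝 (g x)))
    (hint : Tendsto (fun n => ∫ x, G n x ∂ν) atTop (𝓝 (∫ x, g x ∂ν))) :
    Tendsto (fun n => ∫ x, F n x ∂ν) atTop (𝓝 (∫ x, f x ∂ν)) := by
  have hFG' : ∀ᵐ x ∂ν, ∀ n, |F n x| ≤ G n x := ae_all_iff.2 hFG
  have hf : AEStronglyMeasurable f ν := aestronglyMeasurable_of_tendsto_ae atTop hF hFf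
  have hg0 : ∀ᵐ x ∂ν, |f x| ≤ g x := by
    filter_upwards [hFG', hFf, hGg] with x h1 h2 h3
    exact le_of_tendsto_of_tendsto' h2.abs h3 h1
  have hfi : Integrable f ν := hg.mono' hf hg0
  have hFi : ∀ n, Integrable (F n) ν := fun n => (hG n).mono' (hF n) (hFG n)
  have e1 : Tendsto (fun n => ∫ x, max (g x - G n x) 0 ∂ν) atTop (𝓝 0) := by
    have e0 : ∫ _, (0:ℝ) ∂ν = 0 := integral_zero α ℝ
    nth_rewrite 2 [← e0]
    refine tendsto_integral_of_dominated_convergence g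
      (fun n => ((hg.sub (hG n)).pos_part).aestronglyMeasurable) hg (fun n => ?_) ?_
    · filter_upwards [hFG', hg0] with x h1 h2
      have := (abs_nonneg _).trans (h1 n)
      have := (abs_nonneg _).trans h2
      rw [Real.norm_eq_abs, abs_of_nonneg (le_max_right _ _)]
      exact max_le (by linarith) this
    · filter_upwards [hGg] with x h
      have := ((tendsto_const_nhds (x := g x)).sub h).max (tendsto_const_nhds (x := (0:ℝ)))
      simpa using this
  have e2 : Tendsto (fun n => ∫ x, |G n x - g x| ∂ν) atTop (𝓝 0) := by
    have h1 : ∀ n, ∫ x, |G n x - g x| ∂ν =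
        (∫ x, G n x ∂ν - ∫ x, g x ∂ν) + 2 * ∫ x, max (g x - G n x) 0 ∂ν := by
      intro n
      rw [← integral_sub (hG n) hg, ← integral_const_mul]
      refine Eq.trans ?_ (integral_add ((hG n).sub hg) (((hg.sub (hG n)).pos_part).const_mul 2))
      congr 1 with x
      change |G n x - g x| = G n x - g x + 2 * max (g x - G n x) 0
      rcases le_total (g x) (G n x) with h | h
      · rw [abs_of_nonneg (by linarith), max_eq_right (by linarith)]; ring
      · rw [abs_of_nonpos (by linarith), max_eq_left (by linarith)]; ring
    simp only [h1]
    have := (hint.sub_const (∫ x, g x ∂ν)).add (e1.const_mul 2)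
    simpa using this
  have e3 : Tendsto (fun n => ∫ x, min |F n x - f x| (2 * g x) ∂ν) atTop (𝓝 0) := by
    have e0 : ∫ _, (0:ℝ) ∂ν = 0 := integral_zero α ℝ
    rw [← e0]
    refine tendsto_integral_of_dominated_convergence (fun x => 2 * g x)
      (fun n => (((hFi n).sub hfi).abs.inf (hg.const_mul 2)).aestronglyMeasurable)
      (hg.const_mul 2) (fun n => ?_) ?_
    · filter_upwards [hg0] with x h2
      have := (abs_nonneg _).trans h2
      rw [Real.norm_eq_abs, abs_of_nonneg (le_min (abs_nonneg _) (by linarith))]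
      exact min_le_right _ _
    · filter_upwards [hFf, hg0] with x h h2
      have h3 := (abs_nonneg _).trans h2
      have := ((h.sub_const (f x)).abs).min (tendsto_const_nhds (x := 2 * g x))
      simpa [h3] using this
  rw [tendsto_iff_norm_sub_tendsto_zero]
  refine squeeze_zero (fun _ => norm_nonneg _) (fun n => ?_) (by simpa using e2.add e3)
  rw [← integral_sub (hFi n) hfi]
  refine ((norm_integral_le_integral_norm _).trans ?_).trans_eq (integral_add ((hG n).sub hg).abs
    (((hFi n).sub hfi).abs.inf (hg.const_mul 2)))
  apply integral_mono_ae ((hFi n).sub hfi).norm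
    (((hG n).sub hg).abs.add (((hFi n).sub hfi).abs.inf (hg.const_mul 2)))
  filter_upwards [hFG', hg0] with x h1 h2
  have h3 : |F n x - f x| ≤ G n x + g x := (abs_sub _ _).trans (add_le_add (h1 n) h2)
  simp only [Real.norm_eq_abs, Pi.add_apply, Pi.sub_apply]
  change |F n x - f x| ≤ |G n x - g x| + min |F n x - f x| (2 * g x)
  rcases le_total |F n x - f x| (2 * g x) with h | h
  · rw [min_eq_left h]; linarith [abs_nonneg (G n x - g x)]
  · rw [min_eq_right h]; linarith [le_abs_self (G n x - g x)]

end

section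

/-! ### More on mollification -/

lemma locallyIntegrable_of_integrableOn_Icc {f : ℝ → ℝ}
    (h : ∀ n : ℕ, IntegrableOn f (Icc (-(n : ℝ)) n)) : LocallyIntegrable f volume := by
  apply locallyIntegrable_of_intervalIntegrable
  intro a b
  obtain ⟨n, hn⟩ := exists_nat_ge (max |a| |b|)
  rw [intervalIntegrable_iff]
  refine (h n).mono_set (uIoc_subset_uIcc.trans ?_)
  have ha := abs_le.1 ((le_max_left _ _).trans hn)
  have hb := abs_le.1 ((le_max_right _ _).trans hn)
  exact (ordConnected_Icc).uIcc_subset ha hb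

lemma LocallyIntegrable.integrableOn_Icc {f : ℝ → ℝ} (hf : LocallyIntegrable f volume) (a b : ℝ) :
    IntegrableOn f (Icc a b) := hf.integrableOn_isCompact isCompact_Icc

/-- The bound is uniform in `|x| ≤ r` and involves one integral of `|f|` only; applied to time
slices it gives an integrable majorant in time. -/
lemma abs_kernel_integral_le {f k : ℝ → ℝ} (hf : LocallyIntegrable f volume) {D r x : ℝ}
    (hk : ∀ y, |k y| ≤ D) (hk0 : ∀ y, 1 < |y| → k y = 0) (hx : |x| ≤ r) :
    |∫ y, f y * k (x - y)| ≤ D * ∫ y in Icc (-(r + 1)) (r + 1), |f y| := by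
  have hx' := abs_le.1 hx
  have h1 : ∫ y, f y * k (x - y) = ∫ y in Icc (-(r + 1)) (r + 1), f y * k (x - y) := by
    rw [setIntegral_eq_integral_of_forall_compl_eq_zero]
    intro y hy
    rw [hk0, mul_zero]
    by_contra h
    have := abs_le.1 (not_lt.1 h)
    exact hy ⟨by linarith, by linarith⟩
  rw [h1, ← integral_const_mul, ← Real.norm_eq_abs]
  apply norm_integral_le_of_norm_le
  · exact ((LocallyIntegrable.integrableOn_Icc hf _ _).abs.const_mul D)
  · filter_upwards with y
    rw [norm_mul, mul_comm, Real.norm_eq_abs, Real.norm_eq_abs]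
    exact mul_le_mul_of_nonneg_right (hk _) (abs_nonneg _)

lemma mker_eq_zero_of_one_lt {n : ℕ} {x : ℝ} (hx : 1 < |x|) : mker n x = 0 := by
  apply mker_eq_zero
  refine lt_of_le_of_lt ?_ hx
  rw [div_le_one (by positivity)]
  linarith [n.cast_nonneg (α := ℝ)]

lemma deriv_mker_eq_zero {n : ℕ} {x : ℝ} (hx : 1 < |x|) : deriv (mker n) x = 0 := by
  have h : mker n =ᶠ[𝓝 x] fun _ => 0 := by
    filter_upwards [(continuous_abs.isOpen_preimage _ isOpen_Ioi).mem_nhds hx] with y hy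
    exact mker_eq_zero_of_one_lt hy
  rw [h.deriv_eq]; simp

lemma exists_abs_mker_le (n : ℕ) : ∃ D : ℝ, 0 ≤ D ∧ (∀ y, |mker n y| ≤ D) ∧
    ∀ y, |deriv (mker n) y| ≤ D := by
  obtain ⟨D1, h1⟩ := (mker_hasCompactSupport n).exists_bound_of_continuous
    (mker_contDiff n).continuous
  obtain ⟨D2, h2⟩ := (deriv_mker_hasCompactSupport n).exists_bound_of_continuous
    (deriv_mker_continuous n)
  exact ⟨max D1 D2, le_max_of_le_left ((norm_nonneg _).trans (h1 0)),
    fun y => (h1 y).trans (le_max_left _ _), fun y => (h2 y).trans (le_max_right _ _)⟩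

lemma moll_integrable {f : ℝ → ℝ} (hf : LocallyIntegrable f volume) (n : ℕ) (x : ℝ) :
    Integrable (fun y => f y * mker n (x - y)) :=
  mker_sub_integrable_mul hf (mker_contDiff n).continuous (mker_hasCompactSupport n) x

lemma dmoll_integrable {f : ℝ → ℝ} (hf : LocallyIntegrable f volume) (n : ℕ) (x : ℝ) :
    Integrable (fun y => f y * deriv (mker n) (x - y)) :=
  mker_sub_integrable_mul hf (deriv_mker_continuous n) (deriv_mker_hasCompactSupport n) x

lemma moll_add {f g : ℝ → ℝ} (hf : LocallyIntegrable f volume) (hg : LocallyIntegrable g volume)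
    (n : ℕ) (x : ℝ) : moll n (fun y => f y + g y) x = moll n f x + moll n g x := by
  simp only [moll, add_mul]
  exact integral_add (moll_integrable hf n x) (moll_integrable hg n x)

lemma abs_moll_le_moll_abs (f : ℝ → ℝ) (n : ℕ) (x : ℝ) :
    |moll n f x| ≤ moll n (fun y => |f y|) x := by
  simp only [moll]
  rw [← Real.norm_eq_abs]
  refine (norm_integral_le_integral_norm _).trans_eq ?_
  congr 1 with y
  rw [norm_mul, Real.norm_eq_abs, Real.norm_eq_abs, abs_of_nonneg (mker_nonneg n _)]

lemma integrable_mker_sub (n : ℕ) (x : ℝ) : Integrable (fun y => mker n (x - y)) :=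
  (mker_sub_contDiff n x).continuous.integrable_of_hasCompactSupport
    (mker_sub_hasCompactSupport n x)

/-- Jensen's inequality for the square. -/
lemma moll_sq_le {f : ℝ → ℝ} (hf : LocallyIntegrable f volume)
    (hf2 : LocallyIntegrable (fun y => f y ^ 2) volume) (n : ℕ) (x : ℝ) :
    moll n f x ^ 2 ≤ moll n (fun y => f y ^ 2) x := by
  set c := moll n f x with hc
  have h1 : 0 ≤ ∫ y, (f y - c) ^ 2 * mker n (x - y) :=
    integral_nonneg fun y => mul_nonneg (sq_nonneg _) (mker_nonneg n _)
  have h2 : ∫ y, (f y - c) ^ 2 * mker n (x - y) = moll n (fun y => f y ^ 2) x - c ^ 2 := by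
    have e : ∀ y, (f y - c) ^ 2 * mker n (x - y) =
        f y ^ 2 * mker n (x - y) - 2 * c * (f y * mker n (x - y)) + c ^ 2 * mker n (x - y) := by
      intro y; ring
    simp only [e]
    have i1 := moll_integrable hf2 n x
    have i2 := (moll_integrable hf n x).const_mul (2 * c)
    have i3 := (integrable_mker_sub n x).const_mul (c ^ 2)
    have := integral_add (i1.sub i2) i3
    simp only [Pi.sub_apply] at this
    rw [this, integral_sub i1 i2, integral_const_mul, integral_const_mul, integral_mker_sub]
    change moll n (fun y => f y ^ 2) x - 2 * c * moll n f x + _ = _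
    rw [← hc]; ring
  linarith

lemma moll_le_of_le {f : ℝ → ℝ} (hf : LocallyIntegrable f volume) {n : ℕ} {x C : ℝ}
    (h : ∀ y, |x - y| ≤ 1 → f y ≤ C) : moll n f x ≤ C := by
  have : moll n f x ≤ ∫ y, C * mker n (x - y) := by
    apply integral_mono (moll_integrable hf n x) ((integrable_mker_sub n x).const_mul C)
    intro y
    by_cases hy : |x - y| ≤ 1
    · exact mul_le_mul_of_nonneg_right (h y hy) (mker_nonneg n _)
    · simp [mker_eq_zero_of_one_lt (not_le.1 hy)]
  rwa [integral_const_mul, integral_mker_sub, mul_one] at this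

lemma le_moll_of_le {f : ℝ → ℝ} (hf : LocallyIntegrable f volume) {n : ℕ} {x C : ℝ}
    (h : ∀ y, |x - y| ≤ 1 → C ≤ f y) : C ≤ moll n f x := by
  have : ∫ y, C * mker n (x - y) ≤ moll n f x := by
    apply integral_mono ((integrable_mker_sub n x).const_mul C) (moll_integrable hf n x)
    intro y
    by_cases hy : |x - y| ≤ 1
    · exact mul_le_mul_of_nonneg_right (h y hy) (mker_nonneg n _)
    · simp [mker_eq_zero_of_one_lt (not_le.1 hy)]
  rwa [integral_const_mul, integral_mker_sub, mul_one] at this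

/-- The primitive `H` of a nonnegative function is monotone, and mollification looks at distance at
most one, so the mollified primitive at `b` is at most `H (b + 1)` and at `a` at least `H (a - 1)`.
-/
lemma integral_moll_le {h : ℝ → ℝ} (hh : LocallyIntegrable h volume) (h0 : ∀ x, 0 ≤ h x)
    (n : ℕ) (a b : ℝ) :
    ∫ x in a..b, moll n h x ≤ ∫ x in (a - 1)..(b + 1), h x := by
  set H : ℝ → ℝ := fun x => 0 + ∫ y in a..x, h y with hHdef
  have hH : HasWeakDeriv H h := hasWeakDeriv_primitive hh 0 a
  have hI := LocallyIntegrable.intervalIntegrable hh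
  have hmono : Monotone H := by
    intro x y hxy
    have := intervalIntegral.integral_add_adjacent_intervals (hI a x) (hI x y)
    have h2 : 0 ≤ ∫ s in x..y, h s := intervalIntegral.integral_nonneg hxy fun u _ => h0 u
    simp only [H]; linarith
  rw [intervalIntegral.integral_eq_sub_of_hasDerivAt (fun x _ => hH.moll_hasDerivAt n x)
      ((moll_continuous n hh).intervalIntegrable a b)]
  have e1 : moll n H b ≤ H (b + 1) := moll_le_of_le hH.locInt fun y hy => hmono (by
    have := abs_le.1 hy; linarith)
  have e2 : H (a - 1) ≤ moll n H a := le_moll_of_le hH.locInt fun y hy => hmono (by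
    have := abs_le.1 hy; linarith)
  have e3 : H (b + 1) - H (a - 1) = ∫ x in (a - 1)..(b + 1), h x := by
    simp only [H, add_sub_add_left_eq_sub]
    rw [intervalIntegral.integral_interval_sub_left (hI _ _) (hI _ _)]
  linarith

/-! ### Slices of functions on the strip -/

lemma strip_eq_prod (T : ℝ) : strip T = (volume.restrict (Icc 0 T)).prod volume := by
  rw [strip, Measure.volume_eq_prod, ← Measure.prod_restrict, Measure.restrict_univ]

lemma restrict_Icc_prod (T a b : ℝ) : (volume : Measure (ℝ × ℝ)).restrict (Icc 0 T ×ˢ Icc a b) =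
    (volume.restrict (Icc 0 T)).prod (volume.restrict (Icc a b)) := by
  rw [Measure.volume_eq_prod, ← Measure.prod_restrict]

/-- Integrability on `[0, T] × [-r, r]` for all `r`. -/
def LocIntStrip (T : ℝ) (A : ℝ → ℝ → ℝ) : Prop :=
  ∀ r : ℝ, IntegrableOn (Function.uncurry A) (Icc 0 T ×ˢ Icc (-r) r) volume

lemma LocIntStrip.ae_locallyIntegrable {T : ℝ} {A : ℝ → ℝ → ℝ} (h : LocIntStrip T A) :
    ∀ᵐ s ∂volume.restrict (Icc 0 T), LocallyIntegrable (A s) volume := by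
  have h1 : ∀ᵐ s ∂volume.restrict (Icc 0 T), ∀ n : ℕ, IntegrableOn (A s) (Icc (-(n : ℝ)) n) := by
    rw [ae_all_iff]
    intro n
    have := h n
    rw [IntegrableOn, restrict_Icc_prod] at this
    exact this.prod_right_ae
  filter_upwards [h1] with s hs using locallyIntegrable_of_integrableOn_Icc hs

lemma LocIntStrip.integrable_slice {T : ℝ} {A : ℝ → ℝ → ℝ} (h : LocIntStrip T A) (r : ℝ) :
    Integrable (fun s => ∫ y in Icc (-r) r, |A s y|) (volume.restrict (Icc 0 T)) := by
  have := h r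
  rw [IntegrableOn, restrict_Icc_prod] at this
  exact this.integral_norm_prod_left

lemma LocIntStrip.abs {T : ℝ} {A : ℝ → ℝ → ℝ} (h : LocIntStrip T A) :
    LocIntStrip T (fun s y => |A s y|) := fun r => (h r).abs

lemma LocIntStrip.add {T : ℝ} {A B : ℝ → ℝ → ℝ} (h : LocIntStrip T A) (h' : LocIntStrip T B) :
    LocIntStrip T (fun s y => A s y + B s y) := fun r => (h r).add (h' r)

lemma LocIntStrip.mono {T t : ℝ} {A : ℝ → ℝ → ℝ} (h : LocIntStrip T A) (ht : t ≤ T) :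
    LocIntStrip t A := fun r =>
  (h r).mono_set (prod_mono (Icc_subset_Icc le_rfl ht) subset_rfl)

lemma measurable_kernel_integral {A : ℝ → ℝ → ℝ} (hA : Measurable (Function.uncurry A))
    {k : ℝ → ℝ} (hk : Continuous k) :
    Measurable (fun p : ℝ × ℝ => ∫ y, A p.1 y * k (p.2 - y)) := by
  have : Measurable (fun q : (ℝ × ℝ) × ℝ => A q.1.1 q.2 * k (q.1.2 - q.2)) := by
    have h1 : Measurable (fun q : (ℝ × ℝ) × ℝ => A q.1.1 q.2) :=
      hA.comp ((measurable_fst.comp measurable_fst).prodMk measurable_snd)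
    exact h1.mul (hk.measurable.comp ((measurable_snd.comp measurable_fst).sub measurable_snd))
  exact (StronglyMeasurable.integral_prod_right' (ν := volume) this.stronglyMeasurable).measurable

/-- Passing to a measurable representative changes almost every slice only on a null set, so for
almost every time the kernel integral is unchanged at every `x`. -/
lemma aestronglyMeasurable_kernel_integral {T : ℝ} {z : ℝ → ℝ → ℝ}
    (hz : AEStronglyMeasurable (Function.uncurry z) (strip T)) {k : ℝ → ℝ} (hk : Continuous k) :
    AEStronglyMeasurable (fun p : ℝ × ℝ => ∫ y, z p.1 y * k (p.2 - y)) (strip T) := by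
  rw [strip_eq_prod] at *
  have h1 := hz.ae_eq_mk
  have h2 := Measure.ae_ae_of_ae_prod h1
  have h3 : Measurable (Function.uncurry fun s y => hz.mk (Function.uncurry z) (s, y)) :=
    hz.stronglyMeasurable_mk.measurable
  refine ⟨_, (measurable_kernel_integral h3 hk).stronglyMeasurable, ?_⟩
  have h4 : ∀ᵐ s ∂volume.restrict (Icc 0 T), ∀ x,
      ∫ y, z s y * k (x - y) = ∫ y, hz.mk (Function.uncurry z) (s, y) * k (x - y) := by
    filter_upwards [h2] with s hs x
    apply integral_congr_ae
    filter_upwards [hs] with y hy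
    rw [← hy]; rfl
  have h5 := Measure.quasiMeasurePreserving_fst (μ := volume.restrict (Icc 0 T))
    (ν := (volume : Measure ℝ))
  filter_upwards [h5.ae h4] with p hp using hp p.2

end

section

/-! ### Energy identities for weak evolution equations -/

/-- `z` is bounded and solves `∂ₜ z = ∂ₓ A + B` weakly on `[0, T] × ℝ`. -/
structure Evolution (T M : ℝ) (z zx A B : ℝ → ℝ → ℝ) : Prop where
  z_meas : AEStronglyMeasurable (Function.uncurry z) (strip T)
  z_meas_slice : ∀ t ∈ Icc 0 T, AEStronglyMeasurable (z t) volume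
  z_le : ∀ t ∈ Icc 0 T, ∀ᵐ x, |z t x| ≤ M
  zx_meas : Measurable (Function.uncurry zx)
  A_meas : Measurable (Function.uncurry A)
  B_meas : Measurable (Function.uncurry B)
  A_int : LocIntStrip T A
  B_int : LocIntStrip T B
  z_deriv : ∀ᵐ t ∂volume.restrict (Icc 0 T), HasWeakDeriv (z t) (zx t)
  evol : ∀ χ : ℝ → ℝ, ContDiff ℝ ∞ χ → HasCompactSupport χ → ∀ t ∈ Icc 0 T,
    ∫ x, z t x * χ x = (∫ x, z 0 x * χ x) +
      ∫ s in (0:ℝ)..t, ∫ x, (-(A s x * deriv χ x) + B s x * χ x)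

/-- The convolution of `f` with the derivative of the mollifying kernel. -/
noncomputable def dmoll (n : ℕ) (f : ℝ → ℝ) (x : ℝ) : ℝ := ∫ y, f y * deriv (mker n) (x - y)

/-- The integrand of the energy identity for the entropy `η` with derivatives `η'`, `η''` and the
weight `ρ`. -/
noncomputable def energyIntegrand (η' η'' ρ z zx A B : ℝ → ℝ) (x : ℝ) : ℝ :=
  -(A x * (deriv ρ x * η' (z x) + ρ x * (η'' (z x) * zx x))) + B x * (ρ x * η' (z x))

/-- A primitive of an integrable function is absolutely continuous, hence so is its image under a
`C¹` function. It is applied in time at a fixed point of space, and to the exponential weights of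
the comparison argument. -/
lemma chain_primitive {b η η' : ℝ → ℝ} {c t : ℝ} (hb : IntervalIntegrable b volume 0 t)
    (hη : ∀ x, HasDerivAt η (η' x) x) (hη' : Continuous η') {m : ℝ → ℝ}
    (hm : ∀ s ∈ uIcc 0 t, m s = c + ∫ r in (0:ℝ)..s, b r) :
    η (m t) - η (m 0) = ∫ s in (0:ℝ)..t, η' (m s) * b s := by
  have hηd : deriv η = η' := funext fun x => (hη x).deriv
  have hη1 : ContDiff ℝ 1 η := contDiff_one_iff_deriv.2 ⟨fun x => (hη x).differentiableAt,
    hηd ▸ hη'⟩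
  have hac0 : AbsolutelyContinuousOnInterval (fun s => c + ∫ r in (0:ℝ)..s, b r) 0 t := by
    have h2 : AbsolutelyContinuousOnInterval (fun _ : ℝ => c) 0 t :=
      ((contDiff_const (n := 1) (𝕜 := ℝ)).contDiffOn).absolutelyContinuousOnInterval
    exact h2.add (hb.absolutelyContinuousOnInterval_intervalIntegral (by simp))
  have hac := AbsolutelyContinuousOnInterval.comp_contDiff hac0 hη1
  have h := hac.integral_deriv_eq_sub
  rw [hm t (by simp), hm 0 (by simp), ← h]
  apply intervalIntegral.integral_congr_ae
  filter_upwards [hb.ae_hasDerivAt_integral] with s hs hs'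
  have hs'' := uIoc_subset_uIcc hs'
  have h3 := (hη _).comp s ((hs hs'' 0 (by simp)).const_add c)
  rw [hm s hs'']
  exact h3.deriv

variable {T M : ℝ} {z zx A B : ℝ → ℝ → ℝ}

lemma Evolution.z_locallyIntegrable (h : Evolution T M z zx A B) {t : ℝ} (ht : t ∈ Icc 0 T) :
    LocallyIntegrable (z t) volume := by
  have h1 : LocallyIntegrable (fun _ : ℝ => M) volume := locallyIntegrable_const M
  refine h1.mono (h.z_meas_slice t ht) ?_
  filter_upwards [h.z_le t ht] with x hx
  rw [Real.norm_eq_abs, Real.norm_eq_abs]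
  exact hx.trans (le_abs_self M)

lemma integrableOn_of_abs_le_slice {T r : ℝ} {α : ℝ → ℝ} {P : ℝ × ℝ → ℝ}
    (hα : Integrable α (volume.restrict (Icc 0 T)))
    (hP : AEStronglyMeasurable P ((volume.restrict (Icc 0 T)).prod (volume.restrict (Icc (-r) r))))
    (h : ∀ᵐ s ∂volume.restrict (Icc 0 T), ∀ x, |x| ≤ r → |P (s, x)| ≤ α s) :
    Integrable P ((volume.restrict (Icc 0 T)).prod (volume.restrict (Icc (-r) r))) := by
  refine (hα.comp_fst (volume.restrict (Icc (-r) r))).mono' hP ?_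
  have h5 := Measure.quasiMeasurePreserving_fst (μ := volume.restrict (Icc 0 T))
    (ν := volume.restrict (Icc (-r) r))
  have h6 := Measure.quasiMeasurePreserving_snd (μ := volume.restrict (Icc 0 T))
    (ν := volume.restrict (Icc (-r) r))
  filter_upwards [h5.ae h, h6.ae (ae_restrict_mem measurableSet_Icc)] with p h1 h2
  exact h1 p.2 (abs_le.2 h2)

lemma integral_interval_eq_Icc {t : ℝ} (ht : 0 ≤ t) (f : ℝ → ℝ) :
    ∫ s in (0:ℝ)..t, f s = ∫ s in Icc 0 t, f s := by
  rw [intervalIntegral.integral_of_le ht, integral_Icc_eq_integral_Ioc]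

/-- Tested with the kernel centred at `x`, the weak equation exhibits the mollified solution at the
fixed point `x` as a primitive in time. -/
lemma Evolution.moll_eq (h : Evolution T M z zx A B) (n : ℕ) (x : ℝ) {t : ℝ} (ht : t ∈ Icc 0 T) :
    moll n (z t) x = moll n (z 0) x +
      ∫ s in (0:ℝ)..t, (dmoll n (A s) x + moll n (B s) x) := by
  have := h.evol _ (mker_sub_contDiff n x) (mker_sub_hasCompactSupport n x) t ht
  rw [moll, moll, this, integral_interval_eq_Icc ht.1, integral_interval_eq_Icc ht.1]
  congr 1
  apply integral_congr_ae
  filter_upwards [ae_restrict_of_ae_restrict_of_subset (Icc_subset_Icc_right ht.2)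
    h.A_int.ae_locallyIntegrable, ae_restrict_of_ae_restrict_of_subset (Icc_subset_Icc_right ht.2)
    h.B_int.ae_locallyIntegrable] with s h1 h2
  rw [dmoll, moll, ← integral_add (dmoll_integrable h1 n x) (moll_integrable h2 n x)]
  simp only [deriv_mker_sub, mul_neg, neg_neg]

/-- A majorant uniform over a bounded range of `x` and integrable in time is what both the chain
rule in time and Fubini's theorem require. -/
lemma Evolution.integrable_rate (h : Evolution T M z zx A B) (n : ℕ) (r : ℝ) :
    ∃ β : ℝ → ℝ, Integrable β (volume.restrict (Icc 0 T)) ∧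
      ∀ᵐ s ∂volume.restrict (Icc 0 T), ∀ x, |x| ≤ r →
        |dmoll n (A s) x| + |moll n (A s) x| + |moll n (B s) x| ≤ β s := by
  obtain ⟨D, hD0, hD1, hD2⟩ := exists_abs_mker_le n
  refine ⟨fun s => D * (∫ y in Icc (-(r + 1)) (r + 1), |A s y|) +
    D * (∫ y in Icc (-(r + 1)) (r + 1), |A s y|) + D * ∫ y in Icc (-(r + 1)) (r + 1), |B s y|,
    ((((h.A_int.integrable_slice _).const_mul D).add
    ((h.A_int.integrable_slice _).const_mul D)).add ((h.B_int.integrable_slice _).const_mul D)), ?_⟩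
  filter_upwards [h.A_int.ae_locallyIntegrable, h.B_int.ae_locallyIntegrable] with s h1 h2 x hx
  exact add_le_add (add_le_add
    (abs_kernel_integral_le h1 hD2 (fun y hy => deriv_mker_eq_zero hy) hx)
    (abs_kernel_integral_le h1 hD1 (fun y hy => mker_eq_zero_of_one_lt hy) hx))
    (abs_kernel_integral_le h2 hD1 (fun y hy => mker_eq_zero_of_one_lt hy) hx)

lemma Evolution.intervalIntegrable_rate (h : Evolution T M z zx A B) (n : ℕ) (x : ℝ) {t : ℝ}
    (ht : t ∈ Icc 0 T) :
    IntervalIntegrable (fun s => dmoll n (A s) x + moll n (B s) x) volume 0 t := by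
  obtain ⟨β, hβ, hle⟩ := h.integrable_rate n |x|
  rw [intervalIntegrable_iff, uIoc_of_le ht.1]
  have : IntegrableOn (fun s => dmoll n (A s) x + moll n (B s) x) (Icc 0 T) := by
    refine Integrable.mono' hβ ?_ ?_
    · apply Measurable.aestronglyMeasurable
      have m1 := (measurable_kernel_integral h.A_meas (deriv_mker_continuous n)).comp
        (measurable_prodMk_right (y := x))
      have m2 := (measurable_kernel_integral h.B_meas (mker_contDiff n).continuous).comp
        (measurable_prodMk_right (y := x))
      exact m1.add m2
    · filter_upwards [hle] with s hs
      refine (abs_add_le _ _).trans (le_trans ?_ (hs x le_rfl))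
      linarith [abs_nonneg (moll n (A s) x)]
  exact this.mono_set (Ioc_subset_Icc_self.trans (Icc_subset_Icc_right ht.2))

/-- The energy identity for the mollified solution. -/
lemma Evolution.energy_moll (h : Evolution T M z zx A B) {η η' η'' ρ : ℝ → ℝ}
    (hη : ∀ x, HasDerivAt η (η' x) x) (hη' : ∀ x, HasDerivAt η' (η'' x) x)
    (hη'' : Continuous η'') (hρ : ContDiff ℝ ∞ ρ) (hρc : HasCompactSupport ρ) (n : ℕ) {t : ℝ}
    (ht : t ∈ Icc 0 T) :
    (∫ x, ρ x * η (moll n (z t) x)) = (∫ x, ρ x * η (moll n (z 0) x)) +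
      ∫ s in Icc 0 t, ∫ x, energyIntegrand η' η'' ρ (moll n (z s)) (moll n (zx s)) (moll n (A s))
        (moll n (B s)) x := by
  have hη'c : Continuous η' := continuous_iff_continuousAt.2 fun x => (hη' x).continuousAt
  have hηc : Continuous η := continuous_iff_continuousAt.2 fun x => (hη x).continuousAt
  have h0 : (0:ℝ) ∈ Icc 0 T := ⟨le_rfl, ht.1.trans ht.2⟩
  have hsub : Icc 0 t ⊆ Icc 0 T := Icc_subset_Icc_right ht.2
  have hac : (volume.restrict (Icc 0 t)) ≪ volume.restrict (Icc 0 T) :=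
    Measure.absolutelyContinuous_of_le (Measure.restrict_mono hsub le_rfl)
  obtain ⟨r, hr, hrs⟩ := exists_Ioc_of_hasCompactSupport hρc
  have hρ0 : ∀ x, x ∉ Icc (-r) r → ρ x = 0 := fun x hx =>
    image_eq_zero_of_notMem_tsupport fun h => hx (Ioo_subset_Icc_self (hrs h))
  have hcz : ∀ s ∈ Icc 0 T, Continuous (moll n (z s)) := fun s hs =>
    moll_continuous n (h.z_locallyIntegrable hs)
  have hint : ∀ s ∈ Icc 0 T, Integrable (fun x => ρ x * η (moll n (z s) x)) := fun s hs =>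
    (hρ.continuous.mul (hηc.comp (hcz s hs))).integrable_of_hasCompactSupport hρc.mul_right
  set b : ℝ → ℝ → ℝ := fun s x => dmoll n (A s) x + moll n (B s) x
  have slice_eq : ∀ x, η (moll n (z t) x) - η (moll n (z 0) x) =
      ∫ s in (0:ℝ)..t, η' (moll n (z s) x) * b s x := by
    intro x
    refine chain_primitive (c := moll n (z 0) x) (m := fun s => moll n (z s) x) (h.intervalIntegrable_rate n x ht) hη hη'c
      fun s hs => ?_
    rw [uIcc_of_le ht.1] at hs
    exact h.moll_eq n x (hsub hs)
  have weighted_eq : (∫ x, ρ x * η (moll n (z t) x)) - (∫ x, ρ x * η (moll n (z 0) x)) =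
      ∫ x, ∫ s in Icc 0 t, ρ x * (η' (moll n (z s) x) * b s x) := by
    rw [← integral_sub (hint t ht) (hint 0 h0)]
    congr 1 with x
    rw [← mul_sub, slice_eq, integral_interval_eq_Icc ht.1, integral_const_mul]
  -- After restriction to the support of `ρ` the integrand is bounded by a constant times `β s` on a
  -- set of finite measure, so Fubini's theorem applies.
  have swap_eq : ∫ x, ∫ s in Icc 0 t, ρ x * (η' (moll n (z s) x) * b s x) =
      ∫ s in Icc 0 t, ∫ x, ρ x * (η' (moll n (z s) x) * b s x) := by
    have hset : ∀ f : ℝ → ℝ, ∫ x, ρ x * f x = ∫ x in Icc (-r) r, ρ x * f x := by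
      intro f
      rw [setIntegral_eq_integral_of_forall_compl_eq_zero]
      intro x hx
      rw [hρ0 x hx, zero_mul]
    simp only [hset, integral_const_mul]
    simp only [← integral_const_mul]
    rw [integral_integral_swap]
    obtain ⟨C1, hC1⟩ := hρc.exists_bound_of_continuous hρ.continuous
    obtain ⟨C2, hC2⟩ := (isCompact_Icc (a := -M) (b := M)).exists_bound_of_continuousOn
      hη'c.continuousOn
    obtain ⟨β, hβ, hle⟩ := h.integrable_rate n r
    have key : Integrable (fun p : ℝ × ℝ => ρ p.2 * (η' (moll n (z p.1) p.2) * b p.1 p.2))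
        ((volume.restrict (Icc 0 t)).prod (volume.restrict (Icc (-r) r))) := by
      refine integrableOn_of_abs_le_slice (α := fun s => C1 * (C2 * β s))
        (((hβ.mono_measure (Measure.restrict_mono hsub le_rfl)).const_mul C2).const_mul C1) ?_ ?_
      · have hz := aestronglyMeasurable_kernel_integral h.z_meas (mker_contDiff n).continuous
        rw [strip_eq_prod] at hz
        have hz' : AEStronglyMeasurable (fun p : ℝ × ℝ => moll n (z p.1) p.2)
            ((volume.restrict (Icc 0 t)).prod (volume.restrict (Icc (-r) r))) :=
          hz.mono_measure (Measure.prod_mono (Measure.restrict_mono hsub le_rfl)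
            Measure.restrict_le_self)
        have m1 := measurable_kernel_integral h.A_meas (deriv_mker_continuous n)
        have m2 := measurable_kernel_integral h.B_meas (mker_contDiff n).continuous
        exact (hρ.continuous.comp continuous_snd).aestronglyMeasurable.mul
          ((hη'c.comp_aestronglyMeasurable hz').mul (m1.add m2).aestronglyMeasurable)
      · filter_upwards [hac.ae_le hle, ae_restrict_mem measurableSet_Icc] with s hs hs' x hx
        have e1 : |η' (moll n (z s) x)| ≤ C2 :=
          hC2 _ (abs_le.1 (moll_abs_le (h.z_le s (hsub hs')) x))
        have e2 : |b s x| ≤ β s := by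
          refine (abs_add_le _ _).trans (le_trans ?_ (hs x hx))
          linarith [abs_nonneg (moll n (A s) x)]
        rw [abs_mul, abs_mul]
        have e3 := (abs_nonneg _).trans e1
        have e4 : |ρ x| ≤ C1 := hC1 x
        have e5 := (abs_nonneg _).trans e4
        gcongr
    have := key.swap
    exact this
  have ae_inner_eq : ∀ᵐ s ∂volume.restrict (Icc 0 t),
      ∫ x, ρ x * (η' (moll n (z s) x) * b s x) =
      ∫ x, energyIntegrand η' η'' ρ (moll n (z s)) (moll n (zx s)) (moll n (A s))
        (moll n (B s)) x := by
    filter_upwards [hac.ae_le h.z_deriv, hac.ae_le h.A_int.ae_locallyIntegrable,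
      hac.ae_le h.B_int.ae_locallyIntegrable, ae_restrict_mem measurableSet_Icc] with s h1 h2 h3 h4
    have cz := hcz s (hsub h4)
    have cA := moll_continuous n h2
    have cB := moll_continuous n h3
    have czx := moll_continuous n h1.locInt'
    have cdA : Continuous (dmoll n (A s)) := by
      have := HasCompactSupport.continuous_convolution_right (ContinuousLinearMap.mul ℝ ℝ)
        (deriv_mker_hasCompactSupport n) h2 (deriv_mker_continuous n)
      exact this
    have cρ' := hρ.continuous_deriv (by simp)
    have hP : ∀ x, HasDerivAt (fun x => ρ x * η' (moll n (z s) x))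
        (deriv ρ x * η' (moll n (z s) x) + ρ x * (η'' (moll n (z s) x) * moll n (zx s) x)) x := by
      intro x
      exact ((hρ.differentiable (by simp)).differentiableAt.hasDerivAt).mul
        ((hη' _).comp x (h1.moll_hasDerivAt n x))
    have hQ : ∀ x, HasDerivAt (moll n (A s)) (dmoll n (A s) x) x := moll_hasDerivAt n h2
    have i1 : Integrable (fun x => (ρ x * η' (moll n (z s) x)) * dmoll n (A s) x) :=
      ((hρ.continuous.mul (hη'c.comp cz)).mul cdA).integrable_of_hasCompactSupport
        (hρc.mul_right.mul_right)
    have i2' : Integrable (fun x => (deriv ρ x * η' (moll n (z s) x) +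
        ρ x * (η'' (moll n (z s) x) * moll n (zx s) x)) * moll n (A s) x) :=
      (((cρ'.mul (hη'c.comp cz)).add (hρ.continuous.mul ((hη''.comp cz).mul czx))).mul
        cA).integrable_of_hasCompactSupport ((hρc.deriv.mul_right.add hρc.mul_right).mul_right)
    have i3 : Integrable (fun x => (ρ x * η' (moll n (z s) x)) * moll n (A s) x) :=
      ((hρ.continuous.mul (hη'c.comp cz)).mul cA).integrable_of_hasCompactSupport
        (hρc.mul_right.mul_right)
    have i4 : Integrable (fun x => moll n (B s) x * (ρ x * η' (moll n (z s) x))) :=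
      (cB.mul (hρ.continuous.mul (hη'c.comp cz))).integrable_of_hasCompactSupport
        (hρc.mul_right.mul_left)
    -- The derivative on the mollified flux is moved to `ρ η'(z)`; this produces the terms with `ρ'`
    -- and with `η'' zₓ`.
    have ibp := integral_mul_deriv_eq_deriv_mul_of_integrable (fun x _ => hP x) (fun x _ => hQ x) i1 i2' i3
    simp only [energyIntegrand, b]
    rw [integral_add (f := fun x => -(moll n (A s) x * (deriv ρ x * η' (moll n (z s) x) +
        ρ x * (η'' (moll n (z s) x) * moll n (zx s) x)))) _ i4, integral_neg]
    · rw [integral_congr_ae (g := fun x => (ρ x * η' (moll n (z s) x)) * dmoll n (A s) x +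
        moll n (B s) x * (ρ x * η' (moll n (z s) x))) (ae_of_all _ fun x => by ring),
        integral_add i1 i4, ibp]
      congr 2
      congr 1 with x
      ring
    · refine Integrable.neg ?_
      exact i2'.congr (ae_of_all _ fun x => by ring)
  rw [← integral_congr_ae ae_inner_eq, ← swap_eq, ← weighted_eq]
  ring

lemma abs_energyIntegrand_le {η' η'' ρ : ℝ → ℝ} {z zx A B : ℝ → ℝ} {x C₁ C₂ : ℝ}
    (h1 : |ρ x| ≤ C₁) (h2 : |deriv ρ x| ≤ C₁) (h3 : |η' (z x)| ≤ C₂) (h4 : |η'' (z x)| ≤ C₂) :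
    |energyIntegrand η' η'' ρ z zx A B x| ≤
      C₁ * C₂ * (|A x| + |B x| + A x ^ 2 + zx x ^ 2) := by
  have p1 := (abs_nonneg _).trans h1
  have p2 := (abs_nonneg _).trans h3
  rw [energyIntegrand]
  have e1 : |A x * (deriv ρ x * η' (z x) + ρ x * (η'' (z x) * zx x))| ≤
      C₁ * C₂ * (|A x| + |A x| * |zx x|) := by
    rw [abs_mul]
    have : |deriv ρ x * η' (z x) + ρ x * (η'' (z x) * zx x)| ≤ C₁ * C₂ + C₁ * (C₂ * |zx x|) := by
      refine (abs_add_le _ _).trans ?_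
      rw [abs_mul, abs_mul, abs_mul]
      gcongr
    calc _ ≤ |A x| * (C₁ * C₂ + C₁ * (C₂ * |zx x|)) := by gcongr
      _ = _ := by ring
  have e2 : |B x * (ρ x * η' (z x))| ≤ C₁ * C₂ * |B x| := by
    rw [abs_mul, abs_mul]
    calc _ ≤ |B x| * (C₁ * C₂) := by gcongr
      _ = _ := by ring
  have e3 : |A x| * |zx x| ≤ A x ^ 2 + zx x ^ 2 := by
    nlinarith [sq_nonneg (|A x| - |zx x|), sq_abs (A x), sq_abs (zx x), sq_nonneg (A x),
      sq_nonneg (zx x)]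
  calc _ ≤ C₁ * C₂ * (|A x| + |A x| * |zx x|) + C₁ * C₂ * |B x| := by
        refine (abs_add_le _ _).trans (add_le_add ?_ e2)
        rwa [abs_neg]
    _ ≤ C₁ * C₂ * (|A x| + (A x ^ 2 + zx x ^ 2)) + C₁ * C₂ * |B x| := by gcongr
    _ = _ := by ring

lemma tendsto_integral_weight_moll {f ρ η : ℝ → ℝ} {M : ℝ} (hf : LocallyIntegrable f volume)
    (hM : ∀ᵐ x, |f x| ≤ M) (hη : Continuous η) (hρ : Continuous ρ) (hρc : HasCompactSupport ρ) :
    Tendsto (fun n => ∫ x, ρ x * η (moll n f x)) atTop (𝓝 (∫ x, ρ x * η (f x))) := by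
  obtain ⟨C, hC⟩ := (isCompact_Icc (a := -M) (b := M)).exists_bound_of_continuousOn
    hη.continuousOn
  refine tendsto_integral_of_dominated_convergence (fun x => |ρ x| * C) (fun n => ?_) ?_
    (fun n => ?_) ?_
  · exact (hρ.mul (hη.comp (moll_continuous n hf))).aestronglyMeasurable
  · exact ((hρ.integrable_of_hasCompactSupport hρc).abs).mul_const C
  · filter_upwards with x
    rw [norm_mul]
    exact mul_le_mul_of_nonneg_left (hC _ (abs_le.1 (moll_abs_le hM x))) (abs_nonneg _)
  · filter_upwards [moll_ae_tendsto hf] with x hx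
    exact ((hη.tendsto _).comp hx).const_mul _

lemma LocallyIntegrable.abs {f : ℝ → ℝ} (hf : LocallyIntegrable f volume) :
    LocallyIntegrable (fun x => |f x|) volume := fun x => by
  obtain ⟨s, hs, h⟩ := hf x
  exact ⟨s, hs, Integrable.abs h⟩

/-- The integrand contains the product of `A` and `zₓ`, for which no fixed majorant is at hand. By
Jensen's inequality the mollification of `|A| + |B| + A² + zₓ²` is a majorant up to a constant, and
it converges almost everywhere and in integral. The second conclusion is uniform in `n` and serves
as majorant for the integration in time. -/
lemma tendsto_integral_energyIntegrand {η' η'' ρ z zx A B : ℝ → ℝ} {M C₁ C₂ r : ℝ} (hr : 0 < r)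
    (hη' : Continuous η') (hη'' : Continuous η'') (hρ : ContDiff ℝ ∞ ρ)
    (hρs : tsupport ρ ⊆ Ioo (-r) r)
    (hρ1 : ∀ x, |ρ x| ≤ C₁) (hρ2 : ∀ x, |deriv ρ x| ≤ C₁)
    (hC1 : ∀ y, |y| ≤ M → |η' y| ≤ C₂) (hC2 : ∀ y, |y| ≤ M → |η'' y| ≤ C₂)
    (hz : LocallyIntegrable z volume) (hzM : ∀ᵐ x, |z x| ≤ M)
    (hzx : LocallyIntegrable zx volume) (hzx2 : LocallyIntegrable (fun x => zx x ^ 2) volume)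
    (hA : LocallyIntegrable A volume) (hA2 : LocallyIntegrable (fun x => A x ^ 2) volume)
    (hB : LocallyIntegrable B volume) :
    Tendsto (fun n => ∫ x, energyIntegrand η' η'' ρ (moll n z) (moll n zx) (moll n A)
      (moll n B) x) atTop (𝓝 (∫ x, energyIntegrand η' η'' ρ z zx A B x)) ∧
    ∀ n, |∫ x, energyIntegrand η' η'' ρ (moll n z) (moll n zx) (moll n A) (moll n B) x| ≤
      C₁ * C₂ * ∫ x in Icc (-(r + 1)) (r + 1), (|A x| + |B x| + A x ^ 2 + zx x ^ 2) := by
  set h : ℝ → ℝ := fun x => |A x| + |B x| + A x ^ 2 + zx x ^ 2 with hdef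
  have lA : LocallyIntegrable (fun x => |A x|) volume := LocallyIntegrable.abs hA
  have lB : LocallyIntegrable (fun x => |B x|) volume := LocallyIntegrable.abs hB
  have lAB : LocallyIntegrable (fun x => |A x| + |B x|) volume := lA.add lB
  have lABA : LocallyIntegrable (fun x => |A x| + |B x| + A x ^ 2) volume := lAB.add hA2
  have hh : LocallyIntegrable h volume := lABA.add hzx2
  have h0 : ∀ x, 0 ≤ h x := fun x => by positivity
  have hρ0 : ∀ x, x ∉ Icc (-r) r → ρ x = 0 := fun x hx =>
    image_eq_zero_of_notMem_tsupport fun h => hx (Ioo_subset_Icc_self (hρs h))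
  have hρ0' : ∀ x, x ∉ Icc (-r) r → deriv ρ x = 0 := fun x hx =>
    image_eq_zero_of_notMem_tsupport fun h =>
      hx (Ioo_subset_Icc_self (hρs (tsupport_deriv_subset (𝕜 := ℝ) h)))
  have hset : ∀ z zx A B : ℝ → ℝ, ∫ x, energyIntegrand η' η'' ρ z zx A B x =
      ∫ x in Icc (-r) r, energyIntegrand η' η'' ρ z zx A B x := by
    intro z zx A B
    rw [setIntegral_eq_integral_of_forall_compl_eq_zero]
    intro x hx
    simp [energyIntegrand, hρ0 x hx, hρ0' x hx]
  have hC0 : 0 ≤ C₁ * C₂ := mul_nonneg ((abs_nonneg _).trans (hρ1 0)) (by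
    have hM : ∃ y, |y| ≤ M := by
      obtain ⟨x, hx⟩ := hzM.exists
      exact ⟨_, hx⟩
    obtain ⟨y, hy⟩ := hM
    exact (abs_nonneg _).trans (hC1 y hy))
  have hbd : ∀ n x, |energyIntegrand η' η'' ρ (moll n z) (moll n zx) (moll n A) (moll n B) x| ≤
      C₁ * C₂ * moll n h x := by
    intro n x
    have hzn := moll_abs_le (n := n) hzM x
    refine (abs_energyIntegrand_le (hρ1 x) (hρ2 x) (hC1 _ hzn) (hC2 _ hzn)).trans ?_
    refine mul_le_mul_of_nonneg_left ?_ hC0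
    rw [hdef, moll_add lABA hzx2, moll_add lAB hA2, moll_add lA lB]
    exact add_le_add (add_le_add (add_le_add (abs_moll_le_moll_abs _ _ _)
      (abs_moll_le_moll_abs _ _ _)) (moll_sq_le hA hA2 n x)) (moll_sq_le hzx hzx2 n x)
  have hGint : ∀ n, IntegrableOn (fun x => C₁ * C₂ * moll n h x) (Icc (-r) r) := fun n =>
    ((moll_continuous n hh).continuousOn.integrableOn_Icc).const_mul _
  constructor
  · simp only [hset]
    refine tendsto_integral_of_generalized_dominated (G := fun n x => C₁ * C₂ * moll n h x)
      (g := fun x => C₁ * C₂ * h x) (fun n => ?_) hGint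
      ((LocallyIntegrable.integrableOn_Icc hh _ _).const_mul _) (fun n => ae_of_all _ (hbd n))
      ?_ ?_ ?_
    · have cz := moll_continuous n hz
      have czx := moll_continuous n hzx
      have cA := moll_continuous n hA
      have cB := moll_continuous n hB
      have cρ := hρ.continuous
      have cρ' := hρ.continuous_deriv (by simp)
      have : Continuous (energyIntegrand η' η'' ρ (moll n z) (moll n zx) (moll n A)
          (moll n B)) := by
        unfold energyIntegrand
        fun_prop
      exact this.aestronglyMeasurable
    · refine ae_restrict_of_ae ?_
      filter_upwards [moll_ae_tendsto hz, moll_ae_tendsto hzx, moll_ae_tendsto hA,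
        moll_ae_tendsto hB] with x h1 h2 h3 h4
      have e1 := (hη'.tendsto _).comp h1
      have e2 := (hη''.tendsto _).comp h1
      exact ((h3.mul ((e1.const_mul _).add ((e2.mul h2).const_mul _))).neg).add
        (h4.mul (e1.const_mul _))
    · refine ae_restrict_of_ae ?_
      filter_upwards [moll_ae_tendsto hh] with x h1
      exact h1.const_mul _
    · simp only [integral_const_mul]
      refine Tendsto.const_mul _ ?_
      have := integral_moll_tendsto hh (-r) r
      simpa only [intervalIntegral.integral_of_le (show -r ≤ r by linarith),
        ← integral_Icc_eq_integral_Ioc] using this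
  · intro n
    rw [hset]
    rw [← Real.norm_eq_abs]
    refine (norm_integral_le_of_norm_le (hGint n) (ae_of_all _ fun x => ?_)).trans ?_
    · exact hbd n x
    rw [integral_const_mul]
    refine mul_le_mul_of_nonneg_left ?_ hC0
    have := integral_moll_le hh h0 n (-r) r
    rw [intervalIntegral.integral_of_le (by linarith), intervalIntegral.integral_of_le
      (by linarith), ← integral_Icc_eq_integral_Ioc, ← integral_Icc_eq_integral_Ioc] at this
    rw [neg_add]
    exact this

/-- The energy identity. -/
lemma Evolution.energy (h : Evolution T M z zx A B)
    (hA2 : LocIntStrip T (fun s y => A s y ^ 2)) (hzx2 : LocIntStrip T (fun s y => zx s y ^ 2))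
    {η η' η'' ρ : ℝ → ℝ}
    (hη : ∀ x, HasDerivAt η (η' x) x) (hη' : ∀ x, HasDerivAt η' (η'' x) x)
    (hη'' : Continuous η'') (hρ : ContDiff ℝ ∞ ρ) (hρc : HasCompactSupport ρ) {t : ℝ}
    (ht : t ∈ Icc 0 T) :
    IntegrableOn (fun s => ∫ x, energyIntegrand η' η'' ρ (z s) (zx s) (A s) (B s) x) (Icc 0 t) ∧
    (∫ x, ρ x * η (z t x)) = (∫ x, ρ x * η (z 0 x)) +
      ∫ s in Icc 0 t, ∫ x, energyIntegrand η' η'' ρ (z s) (zx s) (A s) (B s) x := by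
  have hη'c : Continuous η' := continuous_iff_continuousAt.2 fun x => (hη' x).continuousAt
  have hηc : Continuous η := continuous_iff_continuousAt.2 fun x => (hη x).continuousAt
  have h0 : (0:ℝ) ∈ Icc 0 T := ⟨le_rfl, ht.1.trans ht.2⟩
  have hsub : Icc 0 t ⊆ Icc 0 T := Icc_subset_Icc_right ht.2
  have hac : (volume.restrict (Icc 0 t)) ≪ volume.restrict (Icc 0 T) :=
    Measure.absolutelyContinuous_of_le (Measure.restrict_mono hsub le_rfl)
  obtain ⟨r, hr, hrs⟩ := exists_Ioc_of_hasCompactSupport hρc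
  obtain ⟨D1, hD1⟩ := hρc.exists_bound_of_continuous hρ.continuous
  obtain ⟨D2, hD2⟩ := hρc.deriv.exists_bound_of_continuous (hρ.continuous_deriv (by simp))
  obtain ⟨E1, hE1⟩ := (isCompact_Icc (a := -M) (b := M)).exists_bound_of_continuousOn
    hη'c.continuousOn
  obtain ⟨E2, hE2⟩ := (isCompact_Icc (a := -M) (b := M)).exists_bound_of_continuousOn
    hη''.continuousOn
  have hlim : ∀ s ∈ Icc 0 T, Tendsto (fun n => ∫ x, ρ x * η (moll n (z s) x)) atTop
      (𝓝 (∫ x, ρ x * η (z s x))) := fun s hs =>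
    tendsto_integral_weight_moll (h.z_locallyIntegrable hs) (h.z_le s hs) hηc hρ.continuous hρc
  have key : ∀ᵐ s ∂volume.restrict (Icc 0 t), Tendsto (fun n => ∫ x, energyIntegrand η' η'' ρ
      (moll n (z s)) (moll n (zx s)) (moll n (A s)) (moll n (B s)) x) atTop
      (𝓝 (∫ x, energyIntegrand η' η'' ρ (z s) (zx s) (A s) (B s) x)) ∧
      ∀ n, |∫ x, energyIntegrand η' η'' ρ (moll n (z s)) (moll n (zx s)) (moll n (A s))
        (moll n (B s)) x| ≤ max D1 D2 * max E1 E2 * ∫ x in Icc (-(r + 1)) (r + 1),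
          (|A s x| + |B s x| + A s x ^ 2 + zx s x ^ 2) := by
    filter_upwards [hac.ae_le h.z_deriv, hac.ae_le h.A_int.ae_locallyIntegrable,
      hac.ae_le h.B_int.ae_locallyIntegrable, hac.ae_le hA2.ae_locallyIntegrable,
      hac.ae_le hzx2.ae_locallyIntegrable, ae_restrict_mem measurableSet_Icc]
      with s h1 h2 h3 h4 h5 h6
    exact tendsto_integral_energyIntegrand hr hη'c hη'' hρ hrs
      (fun x => (hD1 x).trans (le_max_left _ _)) (fun x => (hD2 x).trans (le_max_right _ _))
      (fun y hy => (hE1 y (abs_le.1 hy)).trans (le_max_left _ _))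
      (fun y hy => (hE2 y (abs_le.1 hy)).trans (le_max_right _ _))
      (h.z_locallyIntegrable (hsub h6)) (h.z_le s (hsub h6)) h1.locInt' h5 h2 h4 h3
  have hmeas : ∀ n, AEStronglyMeasurable (fun s => ∫ x, energyIntegrand η' η'' ρ (moll n (z s))
      (moll n (zx s)) (moll n (A s)) (moll n (B s)) x) (volume.restrict (Icc 0 t)) := by
    intro n
    have hz := aestronglyMeasurable_kernel_integral h.z_meas (mker_contDiff n).continuous
    rw [strip_eq_prod] at hz
    have hz' : AEStronglyMeasurable (fun p : ℝ × ℝ => moll n (z p.1) p.2)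
        ((volume.restrict (Icc 0 t)).prod volume) :=
      hz.mono_measure (Measure.prod_mono (Measure.restrict_mono hsub le_rfl) le_rfl)
    have m0 := (measurable_kernel_integral h.zx_meas
      (mker_contDiff n).continuous).aestronglyMeasurable
      (μ := (volume.restrict (Icc 0 t)).prod volume)
    have m1 := (measurable_kernel_integral h.A_meas
      (mker_contDiff n).continuous).aestronglyMeasurable
      (μ := (volume.restrict (Icc 0 t)).prod volume)
    have m2 := (measurable_kernel_integral h.B_meas
      (mker_contDiff n).continuous).aestronglyMeasurable
      (μ := (volume.restrict (Icc 0 t)).prod volume)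
    have m3 := (hρ.continuous.comp continuous_snd).aestronglyMeasurable
      (μ := (volume.restrict (Icc 0 t)).prod (volume : Measure ℝ))
    have m4 := ((hρ.continuous_deriv (by simp)).comp continuous_snd).aestronglyMeasurable
      (μ := (volume.restrict (Icc 0 t)).prod (volume : Measure ℝ))
    have m5 := hη'c.comp_aestronglyMeasurable hz'
    have m6 := hη''.comp_aestronglyMeasurable hz'
    have := ((m1.mul ((m4.mul m5).add (m3.mul (m6.mul m0)))).neg).add (m2.mul (m3.mul m5))
    exact this.integral_prod_right'
  have hbdi : Integrable (fun s => max D1 D2 * max E1 E2 * ∫ x in Icc (-(r + 1)) (r + 1),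
      (|A s x| + |B s x| + A s x ^ 2 + zx s x ^ 2)) (volume.restrict (Icc 0 t)) := by
    have := ((h.A_int.abs.add h.B_int.abs).add hA2).add hzx2
    have := (this.integrable_slice (r + 1)).const_mul (max D1 D2 * max E1 E2)
    refine (this.mono_measure (Measure.restrict_mono hsub le_rfl)).congr ?_
    refine ae_of_all _ fun s => ?_
    simp only
    congr 2 with x
    rw [abs_of_nonneg (by positivity)]
  refine ⟨hbdi.mono' (aestronglyMeasurable_of_tendsto_ae atTop hmeas
    (by filter_upwards [key] with s hs using hs.1)) ?_, ?_⟩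
  · filter_upwards [key] with s hs
    exact le_of_tendsto' (hs.1.abs) hs.2
  have hlimR := tendsto_integral_of_dominated_convergence
    (F := fun n s => ∫ x, energyIntegrand η' η'' ρ (moll n (z s)) (moll n (zx s)) (moll n (A s))
        (moll n (B s)) x)
    (fun s => max D1 D2 * max E1 E2 * ∫ x in Icc (-(r + 1)) (r + 1),
          (|A s x| + |B s x| + A s x ^ 2 + zx s x ^ 2)) hmeas hbdi
    (fun n => by filter_upwards [key] with s hs using hs.2 n)
    (by filter_upwards [key] with s hs using hs.1)
  have e1 := hlim t ht
  simp only [fun n => h.energy_moll hη hη' hη'' hρ hρc n ht] at e1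
  exact tendsto_nhds_unique e1 ((hlim 0 h0).add hlimR)

end

section

/-! ### Cutoff functions adapted to unit cells -/

/-- A smooth cutoff equal to one on `[y, y + 1]` and supported in `[y - 1, y + 2]`. -/
noncomputable def cutoff (y x : ℝ) : ℝ :=
  (⟨1 / 2, 3 / 2, by norm_num, by norm_num⟩ : ContDiffBump (1 / 2 : ℝ)) (x - y)

lemma cutoff_contDiff (y : ℝ) : ContDiff ℝ ∞ (cutoff y) :=
  (ContDiffBump.contDiff _).comp (contDiff_id.sub contDiff_const)

lemma cutoff_nonneg (y x : ℝ) : 0 ≤ cutoff y x := ContDiffBump.nonneg _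

lemma cutoff_le_one (y x : ℝ) : cutoff y x ≤ 1 := ContDiffBump.le_one _

lemma cutoff_eq_one {y x : ℝ} (hx : x ∈ Icc y (y + 1)) : cutoff y x = 1 := by
  apply ContDiffBump.one_of_mem_closedBall
  rw [Metric.mem_closedBall, Real.dist_eq, abs_le]
  constructor <;> simp only <;> linarith [hx.1, hx.2]

lemma cutoff_eq_zero {y x : ℝ} (hx : x ∉ Icc (y - 1) (y + 2)) : cutoff y x = 0 := by
  apply ContDiffBump.zero_of_le_dist
  rw [Real.dist_eq]
  by_contra h
  have := abs_lt.1 (not_le.1 h)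
  simp only at this
  exact hx ⟨by linarith [this.1], by linarith [this.2]⟩

lemma tsupport_cutoff (y : ℝ) : tsupport (cutoff y) ⊆ Icc (y - 1) (y + 2) :=
  closure_minimal (fun x hx => by
    by_contra h
    exact hx (cutoff_eq_zero h)) isClosed_Icc

lemma cutoff_hasCompactSupport (y : ℝ) : HasCompactSupport (cutoff y) :=
  isCompact_Icc.of_isClosed_subset (isClosed_tsupport _) (tsupport_cutoff y)

lemma exists_abs_deriv_cutoff_le : ∃ c : ℝ, 0 ≤ c ∧ ∀ y x, |deriv (cutoff y) x| ≤ c := by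
  obtain ⟨c, hc⟩ := (cutoff_hasCompactSupport 0).deriv.exists_bound_of_continuous
    ((cutoff_contDiff 0).continuous_deriv (by simp))
  refine ⟨c, (norm_nonneg _).trans (hc 0), fun y x => ?_⟩
  have : cutoff y = fun x => cutoff 0 (x - y) := by ext x; simp [cutoff]
  rw [this, deriv_comp_sub_const]
  exact hc _

lemma deriv_cutoff_sq (y x : ℝ) :
    deriv (fun x => cutoff y x ^ 2) x = 2 * cutoff y x * deriv (cutoff y) x := by
  have := (((cutoff_contDiff y).differentiable (by simp)).differentiableAt (x := x)).hasDerivAt.pow 2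
  rw [show (fun x => cutoff y x ^ 2) = cutoff y ^ 2 from rfl, this.deriv]
  simp

lemma cutoff_sq_contDiff (y : ℝ) : ContDiff ℝ ∞ (fun x => cutoff y x ^ 2) :=
  (cutoff_contDiff y).pow 2

lemma cutoff_sq_hasCompactSupport (y : ℝ) : HasCompactSupport (fun x => cutoff y x ^ 2) := by
  have := (cutoff_hasCompactSupport y).mul_left (f := cutoff y)
  convert! this using 2 with x
  simp [sq]

/-! ### Splitting into cells -/

lemma integral_Icc_three {f : ℝ → ℝ} (hf : LocallyIntegrable f volume) (y : ℝ) :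
    ∫ x in Icc (y - 1) (y + 2), f x = (∫ x in Icc (y - 1) (y - 1 + 1), f x) +
      (∫ x in Icc y (y + 1), f x) + ∫ x in Icc (y + 1) (y + 1 + 1), f x := by
  have hI := LocallyIntegrable.intervalIntegrable hf
  have e : ∀ a b : ℝ, a ≤ b → ∫ x in Icc a b, f x = ∫ x in a..b, f x := fun a b hab => by
    rw [intervalIntegral.integral_of_le hab, integral_Icc_eq_integral_Ioc]
  rw [e _ _ (by linarith), e _ _ (by linarith), e _ _ (by linarith), e _ _ (by linarith),
    sub_add_cancel, intervalIntegral.integral_add_adjacent_intervals (hI _ _) (hI _ _),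
    intervalIntegral.integral_add_adjacent_intervals (hI _ _) (hI _ _)]
  congr 1; ring

lemma integral_Icc_three_le {f : ℝ → ℝ} (hf : LocallyIntegrable f volume) {S : ℝ}
    (h : ∀ y, ∫ x in Icc y (y + 1), f x ≤ S) (y : ℝ) :
    ∫ x in Icc (y - 1) (y + 2), f x ≤ 3 * S := by
  rw [integral_Icc_three hf]
  linarith [h y, h (y - 1), h (y + 1)]

lemma integral_mul_cutoff_sq_le {f : ℝ → ℝ} (hf : LocallyIntegrable f volume)
    (h0 : ∀ x, 0 ≤ f x) (y : ℝ) :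
    ∫ x, cutoff y x ^ 2 * f x ≤ ∫ x in Icc (y - 1) (y + 2), f x := by
  rw [← setIntegral_eq_integral_of_forall_compl_eq_zero (s := Icc (y - 1) (y + 2))]
  · apply integral_mono_of_nonneg (ae_of_all _ fun x => mul_nonneg (sq_nonneg _) (h0 x))
      (LocallyIntegrable.integrableOn_Icc hf _ _) (ae_of_all _ fun x => ?_)
    have := cutoff_nonneg y x
    have := cutoff_le_one y x
    have e : cutoff y x ^ 2 ≤ 1 := by nlinarith
    exact mul_le_of_le_one_left (h0 x) e
  · intro x hx; rw [cutoff_eq_zero hx]; ring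

lemma integrable_cutoff_sq_mul {f : ℝ → ℝ} (hf : LocallyIntegrable f volume) (y : ℝ) :
    Integrable (fun x => cutoff y x ^ 2 * f x) := by
  simpa [mul_comm] using integrable_mul_of_hasCompactSupport hf (cutoff_sq_contDiff y).continuous
    (cutoff_sq_hasCompactSupport y)

lemma le_integral_cutoff_sq_mul {f : ℝ → ℝ} (hf : LocallyIntegrable f volume)
    (h0 : ∀ x, 0 ≤ f x) (y : ℝ) :
    ∫ x in Icc y (y + 1), f x ≤ ∫ x, cutoff y x ^ 2 * f x := by
  calc ∫ x in Icc y (y + 1), f x = ∫ x in Icc y (y + 1), cutoff y x ^ 2 * f x := by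
        apply setIntegral_congr_fun measurableSet_Icc
        intro x hx
        simp [cutoff_eq_one hx]
    _ ≤ _ := setIntegral_le_integral (integrable_cutoff_sq_mul hf y)
        (ae_of_all _ fun x => mul_nonneg (sq_nonneg _) (h0 x))

/-! ### The weighted energy estimate -/

/-- Write `A = μ vₓ + R` with `|R| ≤ K(|v| + κ)`. The terms containing `ζ vₓ` are controlled by
completing a square, at the price of half of the dissipation `μ ζ² vₓ²`; everything else is of order
zero in `v` and `κ`. -/
lemma energy_pointwise {μ K c ζ ζ' v vx A f κ : ℝ} (hμ : 0 < μ) (hK : 0 ≤ K) (hκ : 0 ≤ κ)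
    (hζ0 : 0 ≤ ζ) (hζ : ζ ≤ 1) (hζ' : |ζ'| ≤ c) (hA : |A - μ * vx| ≤ K * (|v| + κ)) :
    -(A * (2 * ζ * ζ' * v + ζ ^ 2 * (1 * vx))) + f * (ζ ^ 2 * v) ≤
      -(μ / 2 * (ζ ^ 2 * vx ^ 2)) + (((2 * μ * c + K) ^ 2 + K ^ 2) / μ + 3 * c * K) *
        (v ^ 2 + κ ^ 2) + |f| * |v| := by
  obtain ⟨R, hR⟩ : ∃ R, A = μ * vx + R := ⟨A - μ * vx, by ring⟩
  subst hR
  rw [add_sub_cancel_left] at hA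
  have hc : 0 ≤ c := (abs_nonneg _).trans hζ'
  have e1 : f * (ζ ^ 2 * v) ≤ |f| * |v| := by
    refine (le_abs_self _).trans ?_
    rw [abs_mul, abs_mul, abs_of_nonneg (sq_nonneg ζ)]
    refine mul_le_mul_of_nonneg_left ?_ (abs_nonneg _)
    exact mul_le_of_le_one_left (abs_nonneg _) (by nlinarith)
  -- `X` is the total coefficient of `-(ζ vₓ)` apart from the leading quadratic term.
  set X := 2 * μ * ζ' * v + R * ζ with hX
  have hXle : |X| ≤ (2 * μ * c + K) * |v| + K * κ := by
    calc |X| ≤ |2 * μ * ζ' * v| + |R * ζ| := abs_add_le _ _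
      _ = 2 * μ * |ζ'| * |v| + |R| * ζ := by
          simp only [abs_mul, abs_of_nonneg hζ0, abs_of_pos hμ, abs_two]
      _ ≤ 2 * μ * c * |v| + K * (|v| + κ) * 1 := by gcongr
      _ = _ := by ring
  have hX2 : X ^ 2 ≤ 2 * ((2 * μ * c + K) ^ 2 + K ^ 2) * (v ^ 2 + κ ^ 2) := by
    have h1 : X ^ 2 ≤ ((2 * μ * c + K) * |v| + K * κ) ^ 2 := by
      rw [← sq_abs X]
      exact pow_le_pow_left₀ (abs_nonneg _) hXle 2
    have h2 := sq_nonneg ((2 * μ * c + K) * |v| - K * κ)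
    have h3 := sq_abs v
    nlinarith [mul_nonneg (sq_nonneg (2 * μ * c + K)) (sq_nonneg κ),
      mul_nonneg (sq_nonneg K) (sq_nonneg v)]
  have hY : -(2 * R * ζ * ζ' * v) ≤ 3 * c * K * (v ^ 2 + κ ^ 2) := by
    calc -(2 * R * ζ * ζ' * v) ≤ |2 * R * ζ * ζ' * v| := neg_le_abs _
      _ = 2 * |R| * ζ * |ζ'| * |v| := by
          rw [abs_mul, abs_mul, abs_mul, abs_mul, abs_of_nonneg hζ0]; simp
      _ ≤ 2 * (K * (|v| + κ)) * 1 * c * |v| := by gcongr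
      _ = c * K * (2 * |v| ^ 2 + 2 * κ * |v|) := by ring
      _ ≤ c * K * (3 * (v ^ 2 + κ ^ 2)) := by
          apply mul_le_mul_of_nonneg_left _ (by positivity)
          rw [sq_abs]
          nlinarith [sq_nonneg (|v| - κ), sq_abs v, sq_nonneg κ]
      _ = _ := by ring
  have hZ : -(ζ * vx) * X ≤ μ / 2 * (ζ ^ 2 * vx ^ 2) + X ^ 2 / (2 * μ) := by
    have : 0 ≤ (μ * (ζ * vx) + X) ^ 2 / (2 * μ) := by positivity
    have e : (μ * (ζ * vx) + X) ^ 2 / (2 * μ) =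
        μ / 2 * (ζ ^ 2 * vx ^ 2) + (ζ * vx) * X + X ^ 2 / (2 * μ) := by
      field_simp; ring
    linarith
  have hX3 : X ^ 2 / (2 * μ) ≤ ((2 * μ * c + K) ^ 2 + K ^ 2) / μ * (v ^ 2 + κ ^ 2) := by
    rw [div_le_iff₀ (by positivity)]
    calc X ^ 2 ≤ _ := hX2
      _ = _ := by field_simp
  have e2 : -((μ * vx + R) * (2 * ζ * ζ' * v + ζ ^ 2 * (1 * vx))) =
      -(μ * (ζ ^ 2 * vx ^ 2)) + -(ζ * vx) * X + -(2 * R * ζ * ζ' * v) := by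
    rw [hX]; ring
  rw [e2]
  linarith

variable {T M : ℝ} {z zx A B : ℝ → ℝ → ℝ}

lemma Evolution.mono (h : Evolution T M z zx A B) {t : ℝ} (ht : t ≤ T) :
    Evolution t M z zx A B where
  z_meas := h.z_meas.mono_measure (Measure.restrict_mono
    (prod_mono (Icc_subset_Icc_right ht) subset_rfl) le_rfl)
  z_meas_slice s hs := h.z_meas_slice s (Icc_subset_Icc_right ht hs)
  z_le s hs := h.z_le s (Icc_subset_Icc_right ht hs)
  zx_meas := h.zx_meas
  A_meas := h.A_meas
  B_meas := h.B_meas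
  A_int := h.A_int.mono ht
  B_int := h.B_int.mono ht
  z_deriv := ae_restrict_of_ae_restrict_of_subset (Icc_subset_Icc_right ht) h.z_deriv
  evol χ h1 h2 s hs := h.evol χ h1 h2 s (Icc_subset_Icc_right ht hs)

end

section

/-! ### Uniformly local energy bounds -/

/-- Passing from almost every slice to almost every point of the strip needs a measurable
exceptional set, hence the detour through a measurable representative. -/
lemma ae_strip_abs_le {T M : ℝ} {z : ℝ → ℝ → ℝ}
    (hz : AEStronglyMeasurable (Function.uncurry z) (strip T))
    (h : ∀ᵐ s ∂volume.restrict (Icc 0 T), ∀ᵐ x, |z s x| ≤ M) :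
    ∀ᵐ p ∂strip T, |z p.1 p.2| ≤ M := by
  rw [strip_eq_prod] at *
  have h1 := hz.ae_eq_mk
  have h2 := Measure.ae_ae_of_ae_prod h1
  have h3 : ∀ᵐ p ∂(volume.restrict (Icc 0 T)).prod volume,
      |hz.mk (Function.uncurry z) p| ≤ M := by
    rw [Measure.ae_prod_iff_ae_ae]
    · filter_upwards [h, h2] with s hs hs2
      filter_upwards [hs, hs2] with x hx hx2
      rw [← hx2]; exact hx
    · exact measurableSet_le (hz.stronglyMeasurable_mk.measurable.abs) measurable_const
  filter_upwards [h1, h3] with p hp hp3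
  rw [← hp] at hp3
  exact hp3

lemma restrict_prod_le_strip (T : ℝ) (s : Set ℝ) :
    volume.restrict (Icc 0 T ×ˢ s) ≤ strip T :=
  Measure.restrict_mono (prod_mono subset_rfl (subset_univ _)) le_rfl

lemma volume_strip_lt_top (T a b : ℝ) : volume (Icc 0 T ×ˢ Icc a b) < ⊤ :=
  (isCompact_Icc.prod isCompact_Icc).measure_lt_top

lemma locIntStrip_of_bounded {T M : ℝ} {z : ℝ → ℝ → ℝ}
    (hz : AEStronglyMeasurable (Function.uncurry z) (strip T))
    (h : ∀ᵐ p ∂strip T, |z p.1 p.2| ≤ M) : LocIntStrip T z := by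
  intro r
  have : IsFiniteMeasure (volume.restrict (Icc 0 T ×ˢ Icc (-r) r)) :=
    isFiniteMeasure_restrict.2 (volume_strip_lt_top T _ _).ne
  refine Integrable.of_bound (hz.mono_measure (restrict_prod_le_strip T _)) M ?_
  exact (Measure.absolutelyContinuous_of_le (restrict_prod_le_strip T _)).ae_le h

lemma LocIntStrip.mul_bounded {T M : ℝ} {A z : ℝ → ℝ → ℝ} (hA : LocIntStrip T A)
    (hz : AEStronglyMeasurable (Function.uncurry z) (strip T))
    (h : ∀ᵐ p ∂strip T, |z p.1 p.2| ≤ M) : LocIntStrip T (fun s x => A s x * z s x) := by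
  intro r
  exact Integrable.mul_bdd (c := M) (hA r) (hz.mono_measure (restrict_prod_le_strip T _))
    ((Measure.absolutelyContinuous_of_le (restrict_prod_le_strip T _)).ae_le h)

lemma LocIntStrip.integrable_cell {T : ℝ} {A : ℝ → ℝ → ℝ} (h : LocIntStrip T A) (a b : ℝ) :
    Integrable (fun s => ∫ y in Icc a b, A s y) (volume.restrict (Icc 0 T)) := by
  have h1 : IntegrableOn (Function.uncurry A) (Icc 0 T ×ˢ Icc a b) volume := by
    refine (h (max |a| |b|)).mono_set (prod_mono subset_rfl (Icc_subset_Icc ?_ ?_))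
    · linarith [le_max_left |a| |b|, neg_abs_le a]
    · linarith [le_max_right |a| |b|, le_abs_self b]
  rw [IntegrableOn, restrict_Icc_prod] at h1
  exact h1.integral_prod_left

lemma integrable_energyIntegrand {η' η'' ρ z zx A B : ℝ → ℝ} {M : ℝ}
    (hη' : Continuous η') (hη'' : Continuous η'') (hρ : ContDiff ℝ ∞ ρ)
    (hρc : HasCompactSupport ρ) (hz : AEStronglyMeasurable z volume) (hzM : ∀ᵐ x, |z x| ≤ M)
    (hzx : AEStronglyMeasurable zx volume) (hzx2 : LocallyIntegrable (fun x => zx x ^ 2) volume)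
    (hA : LocallyIntegrable A volume) (hA2 : LocallyIntegrable (fun x => A x ^ 2) volume)
    (hB : LocallyIntegrable B volume) :
    Integrable (energyIntegrand η' η'' ρ z zx A B) := by
  obtain ⟨r, hr, hρs⟩ := exists_Ioc_of_hasCompactSupport hρc
  obtain ⟨D1, hD1⟩ := hρc.exists_bound_of_continuous hρ.continuous
  obtain ⟨D2, hD2⟩ := hρc.deriv.exists_bound_of_continuous (hρ.continuous_deriv (by simp))
  obtain ⟨E1, hE1⟩ := (isCompact_Icc (a := -M) (b := M)).exists_bound_of_continuousOn
    hη'.continuousOn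
  obtain ⟨E2, hE2⟩ := (isCompact_Icc (a := -M) (b := M)).exists_bound_of_continuousOn
    hη''.continuousOn
  have hsup : Function.support (energyIntegrand η' η'' ρ z zx A B) ⊆ Icc (-r) r := by
    intro x hx
    by_contra h
    apply hx
    have h1 : ρ x = 0 :=
      image_eq_zero_of_notMem_tsupport fun h' => h (Ioo_subset_Icc_self (hρs h'))
    have h2 : deriv ρ x = 0 := image_eq_zero_of_notMem_tsupport fun h' =>
      h (Ioo_subset_Icc_self (hρs (tsupport_deriv_subset (𝕜 := ℝ) h')))
    simp [energyIntegrand, h1, h2]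
  rw [← integrableOn_iff_integrable_of_support_subset hsup]
  have hh : LocallyIntegrable (fun x => |A x| + |B x| + A x ^ 2 + zx x ^ 2) volume :=
    (((LocallyIntegrable.abs hA).add (LocallyIntegrable.abs hB)).add hA2).add hzx2
  refine Integrable.mono' ((LocallyIntegrable.integrableOn_Icc hh (-r) r).const_mul
    (max D1 D2 * max E1 E2)) ?_ ?_
  · have m1 := hη'.comp_aestronglyMeasurable hz
    have m2 := hη''.comp_aestronglyMeasurable hz
    have m3 := hρ.continuous.aestronglyMeasurable (μ := volume)
    have m4 := (hρ.continuous_deriv (by simp)).aestronglyMeasurable (μ := volume)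
    exact (((hA.aestronglyMeasurable.mul ((m4.mul m1).add (m3.mul (m2.mul hzx)))).neg).add
      (hB.aestronglyMeasurable.mul (m3.mul m1))).restrict
  · refine ae_restrict_of_ae ?_
    filter_upwards [hzM] with x hx
    exact abs_energyIntegrand_le ((hD1 x).trans (le_max_left _ _))
      ((hD2 x).trans (le_max_right _ _)) ((hE1 _ (abs_le.1 hx)).trans (le_max_left _ _))
      ((hE2 _ (abs_le.1 hx)).trans (le_max_right _ _))

variable {T M : ℝ} {z zx A B : ℝ → ℝ → ℝ}

lemma Evolution.ae_strip_le (h : Evolution T M z zx A B) : ∀ᵐ p ∂strip T, |z p.1 p.2| ≤ M :=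
  ae_strip_abs_le h.z_meas (by
    filter_upwards [ae_restrict_mem measurableSet_Icc] with s hs using h.z_le s hs)

lemma Evolution.z_int (h : Evolution T M z zx A B) : LocIntStrip T z :=
  locIntStrip_of_bounded h.z_meas h.ae_strip_le

lemma Evolution.z_sq_int (h : Evolution T M z zx A B) : LocIntStrip T (fun s x => z s x ^ 2) := by
  have := h.z_int.mul_bounded h.z_meas h.ae_strip_le
  simpa [sq] using this

lemma Evolution.B_mul_int (h : Evolution T M z zx A B) :
    LocIntStrip T (fun s x => |B s x| * |z s x|) := by
  have := (h.B_int.mul_bounded h.z_meas h.ae_strip_le).abs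
  simpa [abs_mul] using this

lemma Evolution.z_sq_locallyIntegrable (h : Evolution T M z zx A B) {t : ℝ} (ht : t ∈ Icc 0 T) :
    LocallyIntegrable (fun x => z t x ^ 2) volume := by
  have h1 : LocallyIntegrable (fun _ : ℝ => M ^ 2) volume := locallyIntegrable_const _
  refine h1.mono ((h.z_meas_slice t ht).pow 2) ?_
  filter_upwards [h.z_le t ht] with x hx
  rw [Real.norm_eq_abs, Real.norm_eq_abs, abs_of_nonneg (sq_nonneg _), abs_of_nonneg (sq_nonneg _)]
  exact sq_le_sq' (abs_le.1 hx).1 (abs_le.1 hx).2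

/-- The dissipation is retained only on the unit cell, where the cutoff is one, while the errors
live on the support of the cutoff. That support lies in an interval of length three, whence the
factor of `κ²`. -/
lemma Evolution.integral_energy_slice_le (h : Evolution T M z zx A B)
    (hzx2 : LocIntStrip T (fun s y => zx s y ^ 2)) {μ K c : ℝ} (hμ : 0 < μ) (hK : 0 ≤ K)
    (hc : ∀ y x, |deriv (cutoff y) x| ≤ c) {κ : ℝ → ℝ} (hκ : ∀ s, 0 ≤ κ s)
    (hA2 : LocIntStrip T (fun s y => A s y ^ 2))
    (hA : ∀ᵐ s ∂volume.restrict (Icc 0 T), ∀ᵐ x, |A s x - μ * zx s x| ≤ K * (|z s x| + κ s))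
    (y : ℝ) : ∀ᵐ s ∂volume.restrict (Icc 0 T),
      ∫ x, energyIntegrand (fun z => z) (fun _ => 1) (fun x => cutoff y x ^ 2) (z s) (zx s) (A s)
        (B s) x ≤ -(μ / 2 * ∫ x in Icc y (y + 1), zx s x ^ 2) +
        (((2 * μ * c + K) ^ 2 + K ^ 2) / μ + 3 * c * K) *
          ((∫ x in Icc (y - 1) (y + 2), z s x ^ 2) + 3 * κ s ^ 2) +
        ∫ x in Icc (y - 1) (y + 2), |B s x| * |z s x| := by
  set C := ((2 * μ * c + K) ^ 2 + K ^ 2) / μ + 3 * c * K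
  filter_upwards [hA, hzx2.ae_locallyIntegrable, hA2.ae_locallyIntegrable,
    h.z_sq_int.ae_locallyIntegrable, h.B_mul_int.ae_locallyIntegrable, h.z_deriv,
    ae_restrict_mem measurableSet_Icc, h.A_int.ae_locallyIntegrable,
    h.B_int.ae_locallyIntegrable] with s h1 h2 h3 h4 h5 h6 h7 h8 h9
  have hset : ∫ x, energyIntegrand (fun z => z) (fun _ => 1) (fun x => cutoff y x ^ 2) (z s) (zx s)
      (A s) (B s) x = ∫ x in Icc (y - 1) (y + 2), energyIntegrand (fun z => z) (fun _ => 1)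
        (fun x => cutoff y x ^ 2) (z s) (zx s) (A s) (B s) x := by
    rw [setIntegral_eq_integral_of_forall_compl_eq_zero]
    intro x hx
    simp only [energyIntegrand, deriv_cutoff_sq, cutoff_eq_zero hx]
    ring
  have i1 : IntegrableOn (fun x => cutoff y x ^ 2 * zx s x ^ 2) (Icc (y - 1) (y + 2)) :=
    (integrable_cutoff_sq_mul h2 y).integrableOn
  have i2 := LocallyIntegrable.integrableOn_Icc h4 (y - 1) (y + 2)
  have i3 := LocallyIntegrable.integrableOn_Icc h5 (y - 1) (y + 2)
  have i4 : IntegrableOn (fun _ : ℝ => κ s ^ 2) (Icc (y - 1) (y + 2)) := by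
    exact integrableOn_const (by simp)
  have iA : IntegrableOn (fun x => -(μ / 2 * (cutoff y x ^ 2 * zx s x ^ 2))) (Icc (y - 1) (y + 2)) :=
    (i1.const_mul _).neg
  have iB : IntegrableOn (fun x => C * (z s x ^ 2 + κ s ^ 2)) (Icc (y - 1) (y + 2)) :=
    (i2.add i4).const_mul _
  have hle : ∫ x in Icc (y - 1) (y + 2), energyIntegrand (fun z => z) (fun _ => 1)
        (fun x => cutoff y x ^ 2) (z s) (zx s) (A s) (B s) x ≤
      ∫ x in Icc (y - 1) (y + 2), (-(μ / 2 * (cutoff y x ^ 2 * zx s x ^ 2)) +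
        C * (z s x ^ 2 + κ s ^ 2) + |B s x| * |z s x|) := by
    have hub : ∀ᵐ x ∂volume.restrict (Icc (y - 1) (y + 2)), energyIntegrand (fun z => z) (fun _ => 1)
        (fun x => cutoff y x ^ 2) (z s) (zx s) (A s) (B s) x ≤
        -(μ / 2 * (cutoff y x ^ 2 * zx s x ^ 2)) + C * (z s x ^ 2 + κ s ^ 2) +
          |B s x| * |z s x| := by
      refine ae_restrict_of_ae ?_
      filter_upwards [h1] with x hx
      simp only [energyIntegrand, deriv_cutoff_sq]
      exact energy_pointwise hμ hK (hκ s) (cutoff_nonneg y x) (cutoff_le_one y x) (hc y x) hx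
    by_cases hint : IntegrableOn (energyIntegrand (fun z => z) (fun _ => 1)
        (fun x => cutoff y x ^ 2) (z s) (zx s) (A s) (B s)) (Icc (y - 1) (y + 2))
    · exact integral_mono_ae hint ((iA.add iB).add i3) hub
    · exfalso
      apply hint
      exact (integrable_energyIntegrand (M := M) continuous_id continuous_const
        (cutoff_sq_contDiff y) (cutoff_sq_hasCompactSupport y) (h.z_meas_slice s h7) (h.z_le s h7)
        h6.locInt'.aestronglyMeasurable h2 h8 h3 h9).integrableOn
  rw [hset]
  refine hle.trans ?_
  have iAB : IntegrableOn (fun x => -(μ / 2 * (cutoff y x ^ 2 * zx s x ^ 2)) +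
      C * (z s x ^ 2 + κ s ^ 2)) (Icc (y - 1) (y + 2)) := iA.add iB
  rw [integral_add iAB i3, integral_add iA iB, integral_neg, integral_const_mul,
    integral_const_mul, integral_add i2 i4]
  have e1 : ∫ x in Icc (y - 1) (y + 2), κ s ^ 2 = 3 * κ s ^ 2 := by
    rw [setIntegral_const]
    simp only [smul_eq_mul, Measure.real, Real.volume_Icc]
    rw [ENNReal.toReal_ofReal (by linarith)]
    ring
  have e2 : ∫ x in Icc y (y + 1), zx s x ^ 2 ≤
      ∫ x in Icc (y - 1) (y + 2), cutoff y x ^ 2 * zx s x ^ 2 := by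
    rw [setIntegral_eq_integral_of_forall_compl_eq_zero (s := Icc (y - 1) (y + 2))]
    · exact le_integral_cutoff_sq_mul h2 (fun x => sq_nonneg _) y
    · intro x hx; rw [cutoff_eq_zero hx]; ring
  rw [e1]
  have := mul_le_mul_of_nonneg_left e2 (show 0 ≤ μ / 2 by positivity)
  linarith

lemma integral_Icc_exp_le {l s : ℝ} (hl : 0 < l) (hs : 0 ≤ s) :
    ∫ r in Icc 0 s, Real.exp (l * r) ≤ Real.exp (l * s) / l := by
  rw [← integral_interval_eq_Icc hs]
  have hd : ∀ r ∈ uIcc 0 s, HasDerivAt (fun r => Real.exp (l * r) / l) (Real.exp (l * r)) r := by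
    intro r _
    have := (((hasDerivAt_id r).const_mul l).exp).div_const l
    convert! this using 1
    simp only [id, mul_one]
    field_simp
  rw [intervalIntegral.integral_eq_sub_of_hasDerivAt hd
    (Continuous.intervalIntegrable (by fun_prop) _ _)]
  have : 0 < Real.exp (l * 0) / l := by positivity
  linarith

/-- Uniformly local energy estimate: the solution is controlled by its initial value, by `κ` and
by the source. -/
lemma exists_energy_constant {μ K T : ℝ} (hμ : 0 < μ) (hK : 0 ≤ K) (hT : 0 ≤ T) :
    ∃ C : ℝ, 0 ≤ C ∧ ∀ (t M : ℝ) (z zx A B : ℝ → ℝ → ℝ) (κ : ℝ → ℝ) (n F G : ℝ),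
      t ∈ Icc 0 T → Evolution t M z zx A B →
      LocIntStrip t (fun s y => A s y ^ 2) → LocIntStrip t (fun s y => zx s y ^ 2) →
      (∀ s, 0 ≤ κ s) → IntegrableOn (fun s => κ s ^ 2) (Icc 0 t) →
      (∀ᵐ s ∂volume.restrict (Icc 0 t), ∀ᵐ x, |A s x - μ * zx s x| ≤ K * (|z s x| + κ s)) →
      0 ≤ F → (∀ y, ∫ x in Icc y (y + 1), z 0 x ^ 2 ≤ n) → ∫ s in Icc 0 t, κ s ^ 2 ≤ G →
      (∀ S : ℝ, 0 ≤ S → (∀ s ∈ Icc 0 t, ∀ y, ∫ x in Icc y (y + 1), z s x ^ 2 ≤ S) →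
        ∀ ε : ℝ, 0 < ε → ∀ s ∈ Icc 0 t, ∀ y,
        ∫ r in Icc 0 s, ∫ x in Icc y (y + 1), |B r x| * |z r x| ≤ ε * (1 + T) * S + F / ε) →
      (∀ s ∈ Icc 0 t, ∀ y, ∫ x in Icc y (y + 1), z s x ^ 2 ≤ C * (n + F + G)) ∧
      ∀ y, ∫ s in Icc 0 t, ∫ x in Icc y (y + 1), zx s x ^ 2 ≤ C * (n + F + G) := by
  obtain ⟨c, hc0, hc⟩ := exists_abs_deriv_cutoff_le
  set D := ((2 * μ * c + K) ^ 2 + K ^ 2) / μ + 3 * c * K with hD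
  have hD0 : 0 ≤ D := by positivity
  -- The constants are tuned for absorption: time integration of the weight gains `1 / l`, so the
  -- zero order terms of three cells contribute at most `S / 16` times the weight, and `ε` is chosen
  -- so that the source contributes exactly `S / 16`. Since the tested quantity is half of the
  -- energy, these add up to `S / 4` in the basic inequality.
  set l := 48 * D + 1 with hl
  have hl0 : 0 < l := by positivity
  set E := Real.exp (l * T) with hE
  have hE1 : 1 ≤ E := Real.one_le_exp (by positivity)
  set ε := 1 / (48 * E * (1 + T)) with hε
  have hε0 : 0 < ε := by positivity
  set a₀ := 6 + 12 * D + 12 / ε with ha₀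
  refine ⟨max (a₀ * E) ((a₀ + a₀ * E) / μ), by positivity, ?_⟩
  intro t M z zx A B κ n F G ht h hA2 hzx2 hκ hκ2 hA hF0 hn hG hF
  have hsub : ∀ {s}, s ∈ Icc 0 t → Icc 0 s ⊆ Icc 0 t := fun hs => Icc_subset_Icc_right hs.2
  have h0t : (0:ℝ) ∈ Icc 0 t := ⟨le_rfl, ht.1⟩
  have hn0 : 0 ≤ n := (integral_nonneg fun x => sq_nonneg (z 0 x)).trans (hn 0)
  have hG0 : 0 ≤ G := (integral_nonneg fun x => sq_nonneg (κ x)).trans hG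
  -- the basic inequality
  have basic : ∀ S : ℝ, 0 ≤ S →
      (∀ s ∈ Icc 0 t, ∀ y, ∫ x in Icc y (y + 1), z s x ^ 2 ≤ S * Real.exp (l * s)) →
      ∀ s ∈ Icc 0 t, ∀ y, (∫ x in Icc y (y + 1), z s x ^ 2) +
        μ * (∫ r in Icc 0 s, ∫ x in Icc y (y + 1), zx r x ^ 2) ≤
        (3 * n + 6 * D * G + 6 * (F / ε)) + S / 4 * Real.exp (l * s) := by
    intro S hS hSb s hs y
    have hac : (volume.restrict (Icc 0 s)) ≪ volume.restrict (Icc 0 t) :=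
      Measure.absolutelyContinuous_of_le (Measure.restrict_mono (hsub hs) le_rfl)
    obtain ⟨hEi, hEn⟩ := h.energy hA2 hzx2 (η := fun x => x ^ 2 / 2) (η' := fun x => x)
      (η'' := fun _ => 1) (fun x => by simpa using ((hasDerivAt_id x).pow 2).div_const 2)
      (fun x => hasDerivAt_id x) continuous_const (cutoff_sq_contDiff y)
      (cutoff_sq_hasCompactSupport y) hs
    have hslice := hac.ae_le (h.integral_energy_slice_le hzx2 hμ hK hc hκ hA2 hA y)
    have j1 : IntegrableOn (fun r => ∫ x in Icc y (y + 1), zx r x ^ 2) (Icc 0 s) :=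
      (hzx2.mono hs.2).integrable_cell _ _
    have j2 : IntegrableOn (fun r => ∫ x in Icc (y - 1) (y + 2), z r x ^ 2) (Icc 0 s) :=
      (h.z_sq_int.mono hs.2).integrable_cell _ _
    have j3 : IntegrableOn (fun r => ∫ x in Icc (y - 1) (y + 2), |B r x| * |z r x|) (Icc 0 s) :=
      (h.B_mul_int.mono hs.2).integrable_cell _ _
    have j3' : ∀ y, IntegrableOn (fun r => ∫ x in Icc y (y + 1), |B r x| * |z r x|) (Icc 0 s) :=
      fun y => (h.B_mul_int.mono hs.2).integrable_cell _ _
    have j4 : IntegrableOn (fun r => 3 * κ r ^ 2) (Icc 0 s) := (hκ2.mono_set (hsub hs)).const_mul 3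
    have j24 : IntegrableOn (fun r => (∫ x in Icc (y - 1) (y + 2), z r x ^ 2) + 3 * κ r ^ 2)
        (Icc 0 s) := j2.add j4
    have j1n : IntegrableOn (fun r => -(μ / 2 * ∫ x in Icc y (y + 1), zx r x ^ 2)) (Icc 0 s) :=
      (j1.const_mul _).neg
    have j124 : IntegrableOn (fun r => -(μ / 2 * ∫ x in Icc y (y + 1), zx r x ^ 2) +
        D * ((∫ x in Icc (y - 1) (y + 2), z r x ^ 2) + 3 * κ r ^ 2)) (Icc 0 s) :=
      j1n.add (j24.const_mul _)
    have hmono := integral_mono_ae hEi (j124.add j3) hslice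
    have e0 := integral_add j124 j3
    simp only [Pi.add_apply] at hmono
    rw [e0, integral_add j1n (j24.const_mul _), integral_neg, integral_const_mul,
      integral_const_mul, integral_add j2 j4, integral_const_mul] at hmono
    -- the individual terms
    have t1 : ∫ r in Icc 0 s, κ r ^ 2 ≤ G :=
      (setIntegral_mono_set hκ2 (ae_of_all _ fun r => sq_nonneg _)
        (hsub hs).eventuallyLE).trans hG
    have t2 : ∫ r in Icc 0 s, ∫ x in Icc (y - 1) (y + 2), z r x ^ 2 ≤
        3 * S * (Real.exp (l * s) / l) := by
      have k1 : ∫ r in Icc 0 s, ∫ x in Icc (y - 1) (y + 2), z r x ^ 2 ≤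
          ∫ r in Icc 0 s, 3 * S * Real.exp (l * r) := by
        apply setIntegral_mono_on j2 _ measurableSet_Icc
        · intro r hr
          have hr' := hsub hs hr
          have := integral_Icc_three_le (h.z_sq_locallyIntegrable hr') (hSb r hr') y
          linarith
        · exact Continuous.integrableOn_Icc (by fun_prop)
      rw [integral_const_mul] at k1
      exact k1.trans (mul_le_mul_of_nonneg_left (integral_Icc_exp_le hl0 hs.1) (by positivity))
    -- The hypothesis on the source asks for a bound of the cell energies that does not depend on
    -- time, so the weight is replaced by its maximum `E`; the choice of `ε` compensates for `E`.
    have t3 : ∫ r in Icc 0 s, ∫ x in Icc (y - 1) (y + 2), |B r x| * |z r x| ≤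
        3 * (ε * (1 + T) * (S * E) + F / ε) := by
      have hSE : ∀ s ∈ Icc 0 t, ∀ y, ∫ x in Icc y (y + 1), z s x ^ 2 ≤ S * E := fun s hs y =>
        (hSb s hs y).trans (mul_le_mul_of_nonneg_left (Real.exp_le_exp.2
          (mul_le_mul_of_nonneg_left (hs.2.trans ht.2) hl0.le)) hS)
      have k := hF (S * E) (by positivity) hSE ε hε0 s hs
      have k2 : ∫ r in Icc 0 s, ∫ x in Icc (y - 1) (y + 2), |B r x| * |z r x| =
          ∫ r in Icc 0 s, ((∫ x in Icc (y - 1) (y - 1 + 1), |B r x| * |z r x|) +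
            (∫ x in Icc y (y + 1), |B r x| * |z r x|) +
            ∫ x in Icc (y + 1) (y + 1 + 1), |B r x| * |z r x|) := by
        apply integral_congr_ae
        filter_upwards [hac.ae_le h.B_mul_int.ae_locallyIntegrable] with r hr
        exact integral_Icc_three hr y
      have j33 : IntegrableOn (fun r => (∫ x in Icc (y - 1) (y - 1 + 1), |B r x| * |z r x|) +
          ∫ x in Icc y (y + 1), |B r x| * |z r x|) (Icc 0 s) := (j3' _).add (j3' _)
      rw [k2, integral_add j33 (j3' _), integral_add (j3' _) (j3' _)]
      linarith [k (y - 1), k y, k (y + 1)]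
    have t4 : ∫ x, cutoff y x ^ 2 * (z 0 x ^ 2 / 2) ≤ 3 / 2 * n := by
      have e : ∀ x, cutoff y x ^ 2 * (z 0 x ^ 2 / 2) = 1 / 2 * (cutoff y x ^ 2 * z 0 x ^ 2) :=
        fun x => by ring
      simp only [e, integral_const_mul]
      have := (integral_mul_cutoff_sq_le (h.z_sq_locallyIntegrable h0t) (fun x => sq_nonneg _)
        y).trans (integral_Icc_three_le (h.z_sq_locallyIntegrable h0t) hn y)
      linarith
    have t5 : 1 / 2 * (∫ x in Icc y (y + 1), z s x ^ 2) ≤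
        ∫ x, cutoff y x ^ 2 * (z s x ^ 2 / 2) := by
      have e : ∀ x, cutoff y x ^ 2 * (z s x ^ 2 / 2) = 1 / 2 * (cutoff y x ^ 2 * z s x ^ 2) :=
        fun x => by ring
      simp only [e, integral_const_mul]
      have := le_integral_cutoff_sq_mul (h.z_sq_locallyIntegrable hs) (fun x => sq_nonneg _) y
      linarith
    have t6 : D * (3 * S * (Real.exp (l * s) / l)) ≤ S / 16 * Real.exp (l * s) := by
      have : D / l ≤ 1 / 48 := by
        rw [div_le_div_iff₀ hl0 (by norm_num)]; linarith
      calc D * (3 * S * (Real.exp (l * s) / l)) = 3 * S * Real.exp (l * s) * (D / l) := by ring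
        _ ≤ 3 * S * Real.exp (l * s) * (1 / 48) := by gcongr
        _ = _ := by ring
    have t7 : 3 * (ε * (1 + T) * (S * E)) = S / 16 := by
      rw [hε]; field_simp; ring
    have t8 : S / 16 ≤ S / 16 * Real.exp (l * s) :=
      le_mul_of_one_le_right (by positivity) (Real.one_le_exp (mul_nonneg hl0.le hs.1))
    have t9 := mul_le_mul_of_nonneg_left t2 hD0
    have t10 := mul_le_mul_of_nonneg_left t1 hD0
    linarith
  set a := 3 * n + 6 * D * G + 6 * (F / ε) with ha
  have ha0 : 0 ≤ a := by positivity
  -- the weighted supremum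
  set W : Set ℝ := {w | ∃ s ∈ Icc 0 t, ∃ y, w = (∫ x in Icc y (y + 1), z s x ^ 2) *
    Real.exp (-(l * s))} with hW
  -- The qualitative bound `M` enters only here: it makes the supremum finite, so that it can be
  -- absorbed, and does not affect the constant.
  have hbdd : BddAbove W := by
    refine ⟨M ^ 2, ?_⟩
    rintro w ⟨s, hs, y, rfl⟩
    have h1 : ∫ x in Icc y (y + 1), z s x ^ 2 ≤ M ^ 2 := by
      have : ∫ x in Icc y (y + 1), z s x ^ 2 ≤ ∫ x in Icc y (y + 1), M ^ 2 := by
        apply integral_mono_ae (LocallyIntegrable.integrableOn_Icc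
          (h.z_sq_locallyIntegrable hs) _ _) (integrableOn_const (by simp))
        refine ae_restrict_of_ae ?_
        filter_upwards [h.z_le s hs] with x hx
        exact sq_le_sq' (abs_le.1 hx).1 (abs_le.1 hx).2
      simpa using this
    have h2 : Real.exp (-(l * s)) ≤ 1 := Real.exp_le_one_iff.2 (by nlinarith [hs.1])
    calc _ ≤ M ^ 2 * 1 := by gcongr
      _ = M ^ 2 := mul_one _
  have hne : W.Nonempty := ⟨_, 0, h0t, 0, rfl⟩
  set S := sSup W with hSdef
  have hS0 : 0 ≤ S := by
    refine le_csSup_of_le hbdd ⟨0, h0t, 0, rfl⟩ ?_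
    exact mul_nonneg (integral_nonneg fun x => sq_nonneg _) (Real.exp_pos _).le
  have hSb : ∀ s ∈ Icc 0 t, ∀ y, ∫ x in Icc y (y + 1), z s x ^ 2 ≤ S * Real.exp (l * s) := by
    intro s hs y
    have := le_csSup hbdd ⟨s, hs, y, rfl⟩
    rw [Real.exp_neg, ← div_eq_mul_inv, div_le_iff₀ (Real.exp_pos _)] at this
    exact this
  have hdiss : ∀ s ∈ Icc 0 t, ∀ y, 0 ≤ μ * ∫ r in Icc 0 s, ∫ x in Icc y (y + 1), zx r x ^ 2 :=
    fun s hs y => mul_nonneg hμ.le (integral_nonneg fun r => integral_nonneg fun x => sq_nonneg _)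
  -- The supremum of the weighted energies is inserted into its own estimate.
  have hSle : S ≤ a + S / 4 := by
    apply csSup_le hne
    rintro w ⟨s, hs, y, rfl⟩
    rw [Real.exp_neg, ← div_eq_mul_inv, div_le_iff₀ (Real.exp_pos _)]
    have h1 := basic S hS0 hSb s hs y
    have h2 := hdiss s hs y
    have h3 : a ≤ a * Real.exp (l * s) :=
      le_mul_of_one_le_right ha0 (Real.one_le_exp (mul_nonneg hl0.le hs.1))
    linarith
  have hS2 : S ≤ 2 * a := by linarith
  have ha2 : 2 * a ≤ a₀ * (n + F + G) := by
    rw [ha, ha₀]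
    have e1 : 0 ≤ 12 / ε * n := by positivity
    have e2 : 0 ≤ 12 / ε * G := by positivity
    have e3 : 12 / ε * F = 12 * (F / ε) := by ring
    have e4 := mul_nonneg hD0 hn0
    have e5 := mul_nonneg hD0 hF0
    nlinarith
  have hEs : ∀ s ∈ Icc 0 t, Real.exp (l * s) ≤ E := fun s hs =>
    Real.exp_le_exp.2 (mul_le_mul_of_nonneg_left (hs.2.trans ht.2) hl0.le)
  have hN0 : 0 ≤ n + F + G := by positivity
  constructor
  · intro s hs y
    calc _ ≤ S * Real.exp (l * s) := hSb s hs y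
      _ ≤ (a₀ * (n + F + G)) * E :=
          mul_le_mul (hS2.trans ha2) (hEs s hs) (Real.exp_pos _).le (by positivity)
      _ = (a₀ * E) * (n + F + G) := by ring
      _ ≤ _ := mul_le_mul_of_nonneg_right (le_max_left _ _) hN0
  · intro y
    have htt : t ∈ Icc 0 t := ⟨ht.1, le_rfl⟩
    have h1 := basic S hS0 hSb t htt y
    have h2 : 0 ≤ ∫ x in Icc y (y + 1), z t x ^ 2 := integral_nonneg fun x => sq_nonneg _
    have h3 : S / 4 * Real.exp (l * t) ≤ (a₀ * (n + F + G)) * E :=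
      mul_le_mul (by linarith) (hEs t htt) (Real.exp_pos _).le (by positivity)
    have h4 : μ * (∫ r in Icc 0 t, ∫ x in Icc y (y + 1), zx r x ^ 2) ≤
        (a₀ + a₀ * E) * (n + F + G) := by nlinarith
    calc (∫ r in Icc 0 t, ∫ x in Icc y (y + 1), zx r x ^ 2) ≤
        ((a₀ + a₀ * E) * (n + F + G)) / μ := by rw [le_div_iff₀ hμ]; linarith
      _ = (a₀ + a₀ * E) / μ * (n + F + G) := by ring
      _ ≤ _ := mul_le_mul_of_nonneg_right (le_max_right _ _) hN0

end

section

/-! ### Uniformly local norms -/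

lemma eLpNorm_two_sq {α : Type*} [MeasurableSpace α] (f : α → ℝ) (ν : Measure α) :
    eLpNorm f 2 ν ^ 2 = ∫⁻ x, ‖f x‖ₑ ^ 2 ∂ν := by
  have := eLpNorm_nnreal_pow_eq_lintegral (f := f) (μ := ν) (p := 2) two_ne_zero
  simpa using this

lemma enorm_sq_eq_ofReal (a : ℝ) : ‖a‖ₑ ^ 2 = ENNReal.ofReal (a ^ 2) := by
  rw [← sq_abs, ENNReal.ofReal_pow (abs_nonneg a), Real.enorm_eq_ofReal_abs]

lemma eLpNorm_two_sq_eq_ofReal {α : Type*} [MeasurableSpace α] {f : α → ℝ} {ν : Measure α}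
    (hf : Integrable (fun x => f x ^ 2) ν) :
    eLpNorm f 2 ν ^ 2 = ENNReal.ofReal (∫ x, f x ^ 2 ∂ν) := by
  rw [eLpNorm_two_sq, ofReal_integral_eq_lintegral_ofReal hf (ae_of_all _ fun x => sq_nonneg _)]
  simp only [enorm_sq_eq_ofReal]

lemma Icc_subset_iUnion_cells {r : ℝ} {N : ℕ} (hN : 2 * r ≤ N) :
    Icc (-r) r ⊆ ⋃ i ∈ Finset.range (N + 1), Icc (-r + i) (-r + i + 1) := by
  intro x hx
  have h0 : 0 ≤ x + r := by linarith [hx.1]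
  simp only [mem_iUnion]
  refine ⟨⌊x + r⌋₊, Finset.mem_range.2 ?_, ?_, ?_⟩
  · rw [Nat.lt_succ_iff]
    have : (⌊x + r⌋₊ : ℝ) ≤ N := (Nat.floor_le h0).trans (by linarith [hx.2])
    exact_mod_cast this
  · linarith [Nat.floor_le h0]
  · linarith [Nat.lt_floor_add_one (x + r)]

lemma lintegral_biUnion_le {α : Type*} [MeasurableSpace α] {ν : Measure α} (N : ℕ)
    (c : ℕ → Set α) (f : α → ℝ≥0∞) {b : ℝ≥0∞} (hb : ∀ i, ∫⁻ x in c i, f x ∂ν ≤ b) :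
    ∫⁻ x in ⋃ i ∈ Finset.range N, c i, f x ∂ν ≤ N * b := by
  induction N with
  | zero => simp
  | succ n ih =>
    rw [Finset.range_add_one, Finset.set_biUnion_insert]
    refine (lintegral_union_le _ _ _).trans ?_
    rw [add_comm]
    push_cast
    rw [add_mul, one_mul]
    exact add_le_add ih (hb n)

lemma lintegral_Icc_le_l2ul (f : ℝ → ℝ) {r : ℝ} {N : ℕ} (hN : 2 * r ≤ N) :
    ∫⁻ x in Icc (-r) r, ‖f x‖ₑ ^ 2 ≤ (N + 1 : ℕ) * l2ul f ^ 2 := by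
  refine (lintegral_mono_set (Icc_subset_iUnion_cells hN)).trans ?_
  refine lintegral_biUnion_le (N + 1) (fun i => Icc (-r + i) (-r + i + 1)) _ fun i => ?_
  rw [← eLpNorm_two_sq]
  gcongr
  exact le_iSup (fun y => eLpNorm f 2 (volume.restrict (Icc y (y + 1)))) _

lemma eLpNorm_Icc_le_l2ul (f : ℝ → ℝ) {r : ℝ} {N : ℕ} (hN : 2 * r ≤ N) :
    eLpNorm f 2 (volume.restrict (Icc (-r) r)) ≤ (N + 1 : ℕ) * l2ul f := by
  have h := lintegral_Icc_le_l2ul f hN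
  rw [← eLpNorm_two_sq] at h
  have h2 : ((N + 1 : ℕ) : ℝ≥0∞) * l2ul f ^ 2 ≤ ((N + 1 : ℕ) * l2ul f) ^ 2 := by
    rw [mul_pow]
    gcongr
    rw [sq]
    exact le_mul_of_one_le_right (by simp) (by simp)
  exact (ENNReal.pow_le_pow_left_iff two_ne_zero).1 (h.trans h2)

lemma lintegral_strip_le_l2ulL2 (T : ℝ) (w : ℝ → ℝ → ℝ) {r : ℝ} {N : ℕ} (hN : 2 * r ≤ N) :
    ∫⁻ p in Icc 0 T ×ˢ Icc (-r) r, ‖w p.1 p.2‖ₑ ^ 2 ≤ (N + 1 : ℕ) * l2ulL2 T w ^ 2 := by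
  have hsub : Icc 0 T ×ˢ Icc (-r) r ⊆
      ⋃ i ∈ Finset.range (N + 1), Icc 0 T ×ˢ Icc (-r + (i:ℝ)) (-r + i + 1) := by
    rintro ⟨s, x⟩ ⟨hs, hx⟩
    have := Icc_subset_iUnion_cells hN hx
    simp only [mem_iUnion] at this ⊢
    obtain ⟨i, hi, h⟩ := this
    exact ⟨i, hi, hs, h⟩
  refine (lintegral_mono_set hsub).trans ?_
  refine lintegral_biUnion_le (N + 1) (fun i => Icc 0 T ×ˢ Icc (-r + (i:ℝ)) (-r + i + 1)) _
    fun i => ?_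
  have := eLpNorm_two_sq (Function.uncurry w)
    (volume.restrict (Icc 0 T ×ˢ Icc (-r + (i:ℝ)) (-r + i + 1)))
  simp only [Function.uncurry] at this
  rw [← this]
  gcongr
  exact le_iSup (fun y => eLpNorm (Function.uncurry w) 2
    (volume.restrict (Icc 0 T ×ˢ Icc y (y + 1)))) _

lemma LocIntStrip.of_sq {T : ℝ} {A : ℝ → ℝ → ℝ}
    (hm : AEStronglyMeasurable (Function.uncurry A) (strip T))
    (h : LocIntStrip T (fun s x => A s x ^ 2)) : LocIntStrip T A := by
  intro r
  have h1 : IntegrableOn (fun _ : ℝ × ℝ => (1:ℝ)) (Icc 0 T ×ˢ Icc (-r) r) volume :=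
    integrableOn_const (volume_strip_lt_top T _ _).ne
  refine (h1.add (h r)).mono' (hm.mono_measure (restrict_prod_le_strip T _)) (ae_of_all _ ?_)
  intro p
  simp only [Pi.add_apply, Function.uncurry, Real.norm_eq_abs]
  nlinarith [sq_nonneg (|A p.1 p.2| - 1), sq_abs (A p.1 p.2)]

lemma locIntStrip_sq_of_l2ulL2 {T : ℝ} {w : ℝ → ℝ → ℝ}
    (hm : AEStronglyMeasurable (Function.uncurry w) (strip T)) (h : l2ulL2 T w < ⊤) :
    LocIntStrip T (fun s x => w s x ^ 2) := by
  intro r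
  obtain ⟨N, hN⟩ := exists_nat_ge (2 * r)
  have h1 := lintegral_strip_le_l2ulL2 T w hN
  refine ⟨(hm.pow 2).mono_measure (restrict_prod_le_strip T _), ?_⟩
  rw [HasFiniteIntegral]
  simp only [Function.uncurry, enorm_pow]
  refine h1.trans_lt ?_
  exact ENNReal.mul_lt_top (by simp) (ENNReal.pow_lt_top h)

/-- This converts membership in a space `L¹(J_T, L^∞)` into local integrability on the strip. -/
lemma locIntStrip_of_ae_le {T : ℝ} {h : ℝ → ℝ → ℝ} {b : ℝ → ℝ≥0∞}
    (hm : AEStronglyMeasurable (Function.uncurry h) (strip T))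
    (hb : ∀ᵐ s ∂volume.restrict (Icc 0 T), ∀ᵐ x, ‖h s x‖ₑ ≤ b s)
    (hfin : ∫⁻ s in Icc 0 T, b s ≠ ⊤) : LocIntStrip T h := by
  intro r
  have hm' := hm.mono_measure (restrict_prod_le_strip T (Icc (-r) r))
  refine ⟨hm', ?_⟩
  rw [HasFiniteIntegral]
  rw [restrict_Icc_prod] at hm' ⊢
  rw [lintegral_prod _ hm'.enorm]
  have : ∫⁻ s in Icc 0 T, ∫⁻ x in Icc (-r) r, ‖Function.uncurry h (s, x)‖ₑ ≤
      ∫⁻ s in Icc 0 T, b s * volume (Icc (-r) r) := by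
    apply lintegral_mono_ae
    filter_upwards [hb] with s hs
    refine (lintegral_mono_ae (ae_restrict_of_ae hs)).trans ?_
    rw [setLIntegral_const]
  refine this.trans_lt ?_
  rw [lintegral_mul_const' _ _ (by simp)]
  exact ENNReal.mul_lt_top hfin.lt_top (by simp)

/-! ### Continuity in time with values in `L²_loc` -/

/-- Continuity on `[0, T]` with values in `L²_loc`. -/
def LocCont (T : ℝ) (u : ℝ → ℝ → ℝ) : Prop :=
  ∀ t ∈ Icc 0 T, ∀ r : ℝ, 0 < r →
    Tendsto (fun s => eLpNorm (fun x => u s x - u t x) 2 (volume.restrict (Icc (-r) r)))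
      (𝓝[Ioc 0 T] t) (𝓝 0)

/-- A neighbourhood of `t` meets the open interval in a nonempty open set, which has positive
measure. -/
lemma frequently_nhdsWithin_of_ae {T t : ℝ} (hT : 0 < T) (ht : t ∈ Icc 0 T) {P : ℝ → Prop}
    (hP : ∀ᵐ s ∂volume.restrict (Icc 0 T), P s) : ∃ᶠ s in 𝓝[Ioc 0 T] t, P s := by
  intro hn
  obtain ⟨U, hU, htU, hsub⟩ := mem_nhdsWithin.1 hn
  have hne : (U ∩ Ioo 0 T).Nonempty := by
    have : t ∈ closure (Ioo 0 T) := by rwa [closure_Ioo hT.ne]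
    exact mem_closure_iff.1 this U hU htU
  have hpos : 0 < volume (U ∩ Ioo 0 T) := (hU.inter isOpen_Ioo).measure_pos volume hne
  have hz : volume.restrict (Icc 0 T) {s | ¬ P s} = 0 := hP
  have h1 : U ∩ Ioo 0 T ⊆ {s | ¬ P s} ∩ Icc 0 T := fun s hs =>
    ⟨hsub ⟨hs.1, Ioo_subset_Ioc_self hs.2⟩, Ioo_subset_Icc_self hs.2⟩
  have h2 : volume (U ∩ Ioo 0 T) ≤ volume.restrict (Icc 0 T) {s | ¬ P s} :=
    (measure_mono h1).trans (Measure.le_restrict_apply _ _)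
  rw [hz] at h2
  exact absurd h2 (not_le.2 hpos)

lemma ae_of_forall_Icc {P : ℝ → Prop}
    (h : ∀ r : ℝ, 0 < r → ∀ᵐ x ∂volume.restrict (Icc (-r) r), P x) : ∀ᵐ x, P x := by
  have h1 : ∀ᵐ x : ℝ, ∀ n : ℕ, x ∈ Icc (-((n : ℝ) + 1)) (n + 1) → P x := by
    rw [ae_all_iff]
    intro n
    exact (ae_restrict_iff' measurableSet_Icc).1 (h (n + 1) (by positivity))
  filter_upwards [h1] with x hx
  obtain ⟨n, hn⟩ := exists_nat_ge |x|
  have := abs_le.1 hn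
  exact hx n ⟨by linarith, by linarith⟩

/-- If `|u s| ≤ M` almost everywhere, the excess `(|u t| - M)₊` is at most `|u t - u s|`. Such times
`s` accumulate at `t`, so continuity forces the excess to vanish. A bound on the strip thus holds at
every time, including `0`. -/
lemma LocCont.abs_le {T M : ℝ} {u : ℝ → ℝ → ℝ} (h : LocCont T u) (hT : 0 < T)
    (hm : ∀ t ∈ Icc 0 T, AEStronglyMeasurable (u t) volume)
    (hM : ∀ᵐ s ∂volume.restrict (Icc 0 T), ∀ᵐ x, |u s x| ≤ M) :
    ∀ t ∈ Icc 0 T, ∀ᵐ x, |u t x| ≤ M := by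
  intro t ht
  apply ae_of_forall_Icc
  intro r hr
  have hfr := frequently_nhdsWithin_of_ae hT ht hM
  have hz : eLpNorm (fun x => max (|u t x| - M) 0) 2 (volume.restrict (Icc (-r) r)) = 0 := by
    refine le_antisymm (le_of_forall_gt_imp_ge_of_dense fun ε hε => ?_) zero_le
    have he := (h t ht r hr).eventually (gt_mem_nhds hε)
    obtain ⟨s, hs1, hs2⟩ := (hfr.and_eventually he).exists
    refine le_trans (eLpNorm_mono_ae ?_) hs2.le
    refine ae_restrict_of_ae ?_
    filter_upwards [hs1] with x hx
    rw [Real.norm_eq_abs, Real.norm_eq_abs, abs_of_nonneg (le_max_right _ _)]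
    refine max_le ?_ (abs_nonneg _)
    have := abs_sub_abs_le_abs_sub (u t x) (u s x)
    rw [abs_sub_comm] at this
    linarith
  rw [eLpNorm_eq_zero_iff] at hz
  · filter_upwards [hz] with x hx
    have := le_max_left (|u t x| - M) 0
    simp only [Pi.zero_apply] at hx
    linarith
  · have h1 := ((hm t ht).norm.sub (aestronglyMeasurable_const (b := M))).restrict
      (s := Icc (-r) r)
    exact h1.sup aestronglyMeasurable_const
  · exact two_ne_zero

/-- On the bounded support of `χ` the `L²` norm controls the `L¹` norm, and `χ` is bounded. -/
lemma LocCont.continuousOn_integral {T M : ℝ} {u : ℝ → ℝ → ℝ} (h : LocCont T u)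
    (hm : ∀ t ∈ Icc 0 T, AEStronglyMeasurable (u t) volume)
    (hM : ∀ t ∈ Icc 0 T, ∀ᵐ x, |u t x| ≤ M) {χ : ℝ → ℝ} (hχ : Continuous χ)
    (hχc : HasCompactSupport χ) : ContinuousOn (fun t => ∫ x, u t x * χ x) (Icc 0 T) := by
  obtain ⟨r, hr, hrs⟩ := exists_Ioc_of_hasCompactSupport hχc
  obtain ⟨C, hC⟩ := hχc.exists_bound_of_continuous hχ
  have hint : ∀ t ∈ Icc 0 T, Integrable (fun x => u t x * χ x) := fun t ht =>
    (hχ.integrable_of_hasCompactSupport hχc).bdd_mul (c := M) (hm t ht) (hM t ht)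
  have key : ∀ t ∈ Icc 0 T, ContinuousWithinAt (fun t => ∫ x, u t x * χ x) (Ioc 0 T) t := by
    intro t ht
    rw [ContinuousWithinAt, tendsto_iff_edist_tendsto_0]
    set c : ℝ≥0∞ := ENNReal.ofReal C * volume.restrict (Icc (-r) r) univ ^ (1 / 2 : ℝ) with hc
    have hcfin : c ≠ ⊤ := by
      simp only [hc, Measure.restrict_apply_univ]
      exact ENNReal.mul_ne_top (by simp) (ENNReal.rpow_ne_top_of_nonneg (by norm_num) (by simp))
    have hlim := ENNReal.Tendsto.const_mul (h t ht r hr) (Or.inr hcfin)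
    rw [mul_zero] at hlim
    refine tendsto_of_tendsto_of_tendsto_of_le_of_le' tendsto_const_nhds hlim
      (Eventually.of_forall fun _ => zero_le) ?_
    filter_upwards [self_mem_nhdsWithin] with s hs
    have hs' := Ioc_subset_Icc_self hs
    have e1 : edist (∫ x, u s x * χ x) (∫ x, u t x * χ x) =
        ‖∫ x in Icc (-r) r, (u s x - u t x) * χ x‖ₑ := by
      rw [edist_eq_enorm_sub, ← integral_sub (hint s hs') (hint t ht),
        setIntegral_eq_integral_of_forall_compl_eq_zero]
      · simp only [sub_mul]
      · intro x hx
        have : χ x = 0 := image_eq_zero_of_notMem_tsupport fun h' =>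
          hx (Ioo_subset_Icc_self (hrs h'))
        rw [this, mul_zero]
    rw [e1]
    refine (enorm_integral_le_lintegral_enorm _).trans ?_
    have e2 : ∫⁻ x in Icc (-r) r, ‖(u s x - u t x) * χ x‖ₑ ≤
        ENNReal.ofReal C * eLpNorm (fun x => u s x - u t x) 1 (volume.restrict (Icc (-r) r)) := by
      rw [eLpNorm_one_eq_lintegral_enorm, ← lintegral_const_mul' _ _ (by simp)]
      apply lintegral_mono
      intro x
      simp only [enorm_mul]
      rw [mul_comm]
      gcongr
      rw [Real.enorm_eq_ofReal_abs]
      exact ENNReal.ofReal_le_ofReal (hC x)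
    refine e2.trans ?_
    have e3 := eLpNorm_le_eLpNorm_mul_rpow_measure_univ (p := 1) (q := 2)
      (μ := volume.restrict (Icc (-r) r)) (by norm_num)
      (((hm s hs').sub (hm t ht)).restrict (s := Icc (-r) r))
    have e4 : (1 / (1:ℝ≥0∞).toReal - 1 / (2:ℝ≥0∞).toReal) = 1 / 2 := by norm_num
    rw [e4] at e3
    rw [hc]
    calc _ ≤ ENNReal.ofReal C * (eLpNorm (fun x => u s x - u t x) 2
          (volume.restrict (Icc (-r) r)) * volume.restrict (Icc (-r) r) univ ^ (1 / 2 : ℝ)) := by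
            gcongr; exact e3
      _ = _ := by ring
  intro t ht
  have h2 := key t ht
  -- Local continuity speaks of nearby times in `(0, T]` only; inserting the single point `0` does
  -- not affect continuity within the set.
  rw [← continuousWithinAt_insert (y := 0)] at h2
  refine h2.mono ?_
  intro s hs
  rcases eq_or_lt_of_le hs.1 with h3 | h3
  · exact Or.inl h3.symm
  · exact Or.inr ⟨h3, hs.2⟩

end

section

/-! ### From the distributional equation to weak evolution equations -/

lemma integrable_strip_mul {T : ℝ} {A : ℝ → ℝ → ℝ} (hA : LocIntStrip T A) {θ χ : ℝ → ℝ}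
    (hθ : Continuous θ) (hχ : Continuous χ) (hχc : HasCompactSupport χ) :
    Integrable (fun p : ℝ × ℝ => A p.1 p.2 * (θ p.1 * χ p.2)) (strip T) := by
  obtain ⟨r, hr, hrs⟩ := exists_Ioc_of_hasCompactSupport hχc
  obtain ⟨C, hC⟩ := hχc.exists_bound_of_continuous hχ
  obtain ⟨D, hD⟩ := (isCompact_Icc (a := (0:ℝ)) (b := T)).exists_bound_of_continuousOn
    hθ.continuousOn
  have h1 : IntegrableOn (fun p : ℝ × ℝ => A p.1 p.2 * (θ p.1 * χ p.2))
      (Icc 0 T ×ˢ Icc (-r) r) volume := by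
    refine Integrable.mul_bdd (c := D * C) (hA r) ?_ ?_
    · exact ((hθ.comp continuous_fst).mul (hχ.comp continuous_snd)).aestronglyMeasurable
    · filter_upwards [ae_restrict_mem (measurableSet_Icc.prod measurableSet_Icc)] with p hp
      rw [norm_mul]
      have := hD p.1 hp.1
      exact mul_le_mul this (hC _) (norm_nonneg _) ((norm_nonneg _).trans this)
  refine h1.of_forall_sdiff_eq_zero (measurableSet_Icc.prod MeasurableSet.univ) ?_
  rintro ⟨s, x⟩ ⟨⟨hs, -⟩, hx⟩
  have : χ x = 0 := image_eq_zero_of_notMem_tsupport fun h' =>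
    hx ⟨hs, Ioo_subset_Icc_self (hrs h')⟩
  simp [this]

lemma integral_strip_tensor {T : ℝ} {A : ℝ → ℝ → ℝ} (hA : LocIntStrip T A) {θ χ : ℝ → ℝ}
    (hθ : Continuous θ) (hχ : Continuous χ) (hχc : HasCompactSupport χ) :
    ∫ p, A p.1 p.2 * (θ p.1 * χ p.2) ∂strip T = ∫ s in Icc 0 T, (∫ x, A s x * χ x) * θ s := by
  have h := integrable_strip_mul hA hθ hχ hχc
  rw [strip_eq_prod] at h ⊢
  rw [integral_prod _ h]
  congr 1 with s
  rw [← integral_mul_const]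
  congr 1 with x
  ring

lemma integral_strip_weakDeriv {T : ℝ} {w wx : ℝ → ℝ → ℝ} (hw : LocIntStrip T w)
    (hwx : LocIntStrip T wx) (hd : ∀ᵐ s ∂volume.restrict (Icc 0 T), HasWeakDeriv (w s) (wx s))
    {θ χ : ℝ → ℝ} (hθ : Continuous θ) (hχ : ContDiff ℝ ∞ χ) (hχc : HasCompactSupport χ) :
    ∫ p, w p.1 p.2 * (θ p.1 * deriv χ p.2) ∂strip T =
      -∫ p, wx p.1 p.2 * (θ p.1 * χ p.2) ∂strip T := by
  rw [integral_strip_tensor hw hθ (hχ.continuous_deriv (by simp)) hχc.deriv,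
    integral_strip_tensor hwx hθ hχ.continuous hχc, ← integral_neg]
  apply integral_congr_ae
  filter_upwards [hd] with s hs
  rw [hs.integral_eq χ hχ hχc]
  ring

/-- Products of a function of time and a function of space reduce the equation to a scalar one: `t ↦
∫ u χ` has an integrable weak derivative and is continuous, so it is a primitive. This gives the
identity at every time, starting from the actual value at `0`. -/
lemma evol_of_weak {T : ℝ} (hT : 0 < T) {u A B : ℝ → ℝ → ℝ}
    (hc : ∀ χ : ℝ → ℝ, ContDiff ℝ ∞ χ → HasCompactSupport χ →
      ContinuousOn (fun t => ∫ x, u t x * χ x) (Icc 0 T))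
    (hu : LocIntStrip T u) (hA : LocIntStrip T A) (hB : LocIntStrip T B)
    (hw : ∀ θ χ : ℝ → ℝ, ContDiff ℝ ∞ θ → HasCompactSupport θ → tsupport θ ⊆ Ioo 0 T →
      ContDiff ℝ ∞ χ → HasCompactSupport χ →
      -(∫ p, u p.1 p.2 * (deriv θ p.1 * χ p.2) ∂strip T) +
        (∫ p, A p.1 p.2 * (θ p.1 * deriv χ p.2) ∂strip T) -
        (∫ p, B p.1 p.2 * (θ p.1 * χ p.2) ∂strip T) = 0) :
    ∀ χ : ℝ → ℝ, ContDiff ℝ ∞ χ → HasCompactSupport χ → ∀ t ∈ Icc 0 T,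
      ∫ x, u t x * χ x = (∫ x, u 0 x * χ x) +
        ∫ s in (0:ℝ)..t, ∫ x, (-(A s x * deriv χ x) + B s x * χ x) := by
  intro χ hχ hχc
  have cχ := hχ.continuous
  have cχ' := hχ.continuous_deriv (n := ∞) (by simp)
  have hslice : ∀ {D : ℝ → ℝ → ℝ} (_ : LocIntStrip T D) {ψ : ℝ → ℝ} (_ : Continuous ψ)
      (_ : HasCompactSupport ψ), Integrable (fun s => ∫ x, D s x * ψ x)
        (volume.restrict (Icc 0 T)) := by
    intro D hD ψ h1 h2
    have := integrable_strip_mul hD (θ := fun _ => 1) continuous_const h1 h2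
    rw [strip_eq_prod] at this
    simpa using this.integral_prod_left
  have hae : ∀ᵐ s ∂volume.restrict (Icc 0 T), ∫ x, (-(A s x * deriv χ x) + B s x * χ x) =
      -(∫ x, A s x * deriv χ x) + ∫ x, B s x * χ x := by
    filter_upwards [hA.ae_locallyIntegrable, hB.ae_locallyIntegrable] with s h1 h2
    have i1 : Integrable (fun x => -(A s x * deriv χ x)) :=
      (integrable_mul_of_hasCompactSupport h1 cχ' hχc.deriv).neg
    rw [integral_add i1 (integrable_mul_of_hasCompactSupport h2 cχ hχc), integral_neg]
  have iA := hslice hA cχ' hχc.deriv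
  have iB := hslice hB cχ hχc
  have iu := hslice hu cχ hχc
  refine eq_add_integral_of_weak hT (hc χ hχ hχc) ?_ fun θ h1 h2 h3 => ?_
  · exact (iA.neg.add iB).congr (hae.mono fun s hs => hs.symm)
  have cθ := h1.continuous
  have cθ' := h1.continuous_deriv (n := ∞) (by simp)
  have h4 := hw θ χ h1 h2 h3 hχ hχc
  rw [integral_strip_tensor hu cθ' cχ hχc, integral_strip_tensor hA cθ cχ' hχc.deriv,
    integral_strip_tensor hB cθ cχ hχc] at h4
  have hbd : ∀ {D : ℝ → ℝ}, Integrable D (volume.restrict (Icc 0 T)) →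
      Integrable (fun s => D s * θ s) (volume.restrict (Icc 0 T)) := by
    intro D hD
    obtain ⟨C, hC⟩ := h2.exists_bound_of_continuous cθ
    exact hD.mul_bdd (c := C) cθ.aestronglyMeasurable (ae_of_all _ hC)
  have h5 : ∫ s in Icc 0 T, (∫ x, (-(A s x * deriv χ x) + B s x * χ x)) * θ s =
      -(∫ s in Icc 0 T, (∫ x, A s x * deriv χ x) * θ s) +
        ∫ s in Icc 0 T, (∫ x, B s x * χ x) * θ s := by
    have i1 : Integrable (fun s => -((∫ x, A s x * deriv χ x) * θ s))
        (volume.restrict (Icc 0 T)) := (hbd iA).neg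
    rw [← integral_neg, ← integral_add i1 (hbd iB)]
    apply integral_congr_ae
    filter_upwards [hae] with s hs
    rw [hs]; ring
  rw [h5]
  linarith

lemma tensor_test {T : ℝ} {θ χ : ℝ → ℝ} (h1 : ContDiff ℝ ∞ θ) (h2 : HasCompactSupport θ)
    (h3 : tsupport θ ⊆ Ioo 0 T) (hχ : ContDiff ℝ ∞ χ) (hχc : HasCompactSupport χ) :
    ContDiff ℝ ∞ (Function.uncurry fun s x => θ s * χ x) ∧
    HasCompactSupport (Function.uncurry fun s x => θ s * χ x) ∧
    tsupport (Function.uncurry fun s x => θ s * χ x) ⊆ Ioo 0 T ×ˢ univ := by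
  have hsub : tsupport (Function.uncurry fun s x => θ s * χ x) ⊆ tsupport θ ×ˢ tsupport χ := by
    apply closure_minimal _ ((isClosed_tsupport _).prod (isClosed_tsupport _))
    rintro ⟨s, x⟩ h
    simp only [Function.uncurry, Function.mem_support, ne_eq, mul_eq_zero, not_or] at h
    exact ⟨subset_tsupport _ h.1, subset_tsupport _ h.2⟩
  refine ⟨?_, (h2.isCompact.prod hχc.isCompact).of_isClosed_subset (isClosed_tsupport _) hsub,
    hsub.trans (prod_mono h3 (subset_univ _))⟩
  exact (h1.comp contDiff_fst).mul (hχ.comp contDiff_snd)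

lemma ae_enorm_le_linf (f : ℝ → ℝ) : ∀ᵐ x, ‖f x‖ₑ ≤ linf f := by
  have := ae_le_eLpNormEssSup (f := f) (μ := volume)
  simpa [linf, eLpNorm_exponent_top] using this

lemma ae_slice_abs_le {T : ℝ} {u : ℝ → ℝ → ℝ} {M : ℝ}
    (h : ∀ᵐ p ∂strip T, |u p.1 p.2| ≤ M) :
    ∀ᵐ s ∂volume.restrict (Icc 0 T), ∀ᵐ x, |u s x| ≤ M := by
  rw [strip_eq_prod] at h
  exact Measure.ae_ae_of_ae_prod h

lemma ae_strip_abs_le_of_eLpNorm {T M : ℝ} {u : ℝ → ℝ → ℝ} (hM0 : 0 ≤ M)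
    (h : eLpNorm (Function.uncurry u) ⊤ (strip T) ≤ ENNReal.ofReal M) :
    ∀ᵐ p ∂strip T, |u p.1 p.2| ≤ M := by
  have h1 := ae_le_eLpNormEssSup (f := Function.uncurry u) (μ := strip T)
  rw [eLpNorm_exponent_top] at h
  filter_upwards [h1] with p hp
  have := hp.trans h
  rw [Real.enorm_eq_ofReal_abs] at this
  exact (ENNReal.ofReal_le_ofReal_iff hM0).1 this

lemma MemLp.exists_ae_abs_le {T : ℝ} {u : ℝ → ℝ → ℝ}
    (h : MemLp (Function.uncurry u) ⊤ (strip T)) :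
    ∃ M : ℝ, 0 ≤ M ∧ ∀ᵐ p ∂strip T, |u p.1 p.2| ≤ M :=
  ⟨_, ENNReal.toReal_nonneg, ae_strip_abs_le_of_eLpNorm ENNReal.toReal_nonneg
    (ENNReal.ofReal_toReal h.2.ne).ge⟩

/-! ### Local integrability of the data and of solutions -/

lemma lintegral_ne_top_of_memLp_one {T : ℝ} {N : ℝ → ℝ≥0∞}
    (h : MemLp N 1 (volume.restrict (Icc 0 T))) : ∫⁻ s in Icc 0 T, N s ≠ ⊤ := by
  have := h.2
  rw [eLpNorm_one_eq_lintegral_enorm] at this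
  simpa using this.ne

lemma lintegral_sq_ne_top_of_memLp_two {T : ℝ} {N : ℝ → ℝ≥0∞}
    (h : MemLp N 2 (volume.restrict (Icc 0 T))) : ∫⁻ s in Icc 0 T, N s ^ 2 ≠ ⊤ := by
  have h1 := eLpNorm_nnreal_pow_eq_lintegral (f := N) (μ := volume.restrict (Icc 0 T)) (p := 2)
    two_ne_zero
  have h2 : eLpNorm N 2 (volume.restrict (Icc 0 T)) ^ 2 ≠ ⊤ := ENNReal.pow_ne_top h.2.ne
  simp at h1
  rwa [h1] at h2

variable {μ T : ℝ} {d : Data}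

lemma Data.Admissible.f_int (h : d.Admissible T) : LocIntStrip T d.f :=
  locIntStrip_of_ae_le h.f_meas (ae_of_all _ fun s => ae_enorm_le_linf (d.f s))
    (lintegral_ne_top_of_memLp_one h.f_mem)

lemma Data.Admissible.gx_sq_int (h : d.Admissible T) :
    LocIntStrip T (fun s x => d.gx s x ^ 2) := by
  refine locIntStrip_of_ae_le (h.gx_meas.pow 2) (ae_of_all _ fun s => ?_)
    (lintegral_sq_ne_top_of_memLp_two h.g_mem_w1)
  filter_upwards [ae_enorm_le_linf (d.gx s)] with x hx
  rw [enorm_pow]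
  gcongr
  exact hx.trans le_add_self

lemma Data.Admissible.gx_int (h : d.Admissible T) : LocIntStrip T d.gx :=
  LocIntStrip.of_sq h.gx_meas h.gx_sq_int

lemma Data.Admissible.gxx_int (h : d.Admissible T) : LocIntStrip T d.gxx := by
  refine locIntStrip_of_ae_le h.gxx_meas (ae_of_all _ fun s => ?_)
    (lintegral_ne_top_of_memLp_one h.g_mem_w2)
  filter_upwards [ae_enorm_le_linf (d.gxx s)] with x hx
  exact hx.trans le_add_self

variable {p : ℝ≥0∞} {u ux : ℝ → ℝ → ℝ}

lemma IsSolution.locCont (h : IsSolution μ T d p u ux) : LocCont T u := by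
  intro t ht r hr
  rcases eq_or_lt_of_le ht.1 with h0 | h0
  · subst h0
    refine (h.initial_lim r hr).mono_left (nhdsWithin_mono _ Ioc_subset_Ioi_self) |>.congr ?_
    intro s
    apply eLpNorm_congr_ae
    refine ae_restrict_of_ae ?_
    filter_upwards [h.initial_eq] with x hx
    rw [hx]
  · obtain ⟨N, hN⟩ := exists_nat_ge (2 * r)
    have h1 := ENNReal.Tendsto.const_mul (h.cstar.cont t ⟨h0, ht.2⟩)
      (Or.inr (ENNReal.natCast_ne_top (N + 1)))
    rw [mul_zero] at h1
    exact tendsto_of_tendsto_of_tendsto_of_le_of_le tendsto_const_nhds h1 (fun _ => zero_le)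
      fun s => eLpNorm_Icc_le_l2ul _ hN

lemma IsSolution.ux_sq_int (h : IsSolution μ T d p u ux) :
    LocIntStrip T (fun s x => ux s x ^ 2) := locIntStrip_sq_of_l2ulL2 h.ux_meas h.ux_mem

lemma IsSolution.ux_int (h : IsSolution μ T d p u ux) : LocIntStrip T ux :=
  LocIntStrip.of_sq h.ux_meas h.ux_sq_int

/-- The flux of the equation. -/
noncomputable def flux (μ : ℝ) (d : Data) (u ux : ℝ → ℝ → ℝ) (s x : ℝ) : ℝ :=
  μ * (ux s x + d.gx s x) - (u s x + d.g s x) ^ 2 / 2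

lemma IsSolution.u_int (h : IsSolution μ T d p u ux) : LocIntStrip T u := by
  obtain ⟨M, -, hM⟩ := MemLp.exists_ae_abs_le h.bounded
  exact locIntStrip_of_bounded h.bounded.1 hM

lemma Data.Admissible.g_int (h : d.Admissible T) : LocIntStrip T d.g := by
  obtain ⟨M, -, hM⟩ := MemLp.exists_ae_abs_le h.g_mem
  exact locIntStrip_of_bounded h.g_mem.1 hM

lemma LocIntStrip.const_mul {A : ℝ → ℝ → ℝ} (h : LocIntStrip T A) (c : ℝ) :
    LocIntStrip T (fun s x => c * A s x) := fun r => (h r).const_mul c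

lemma LocIntStrip.sub {A B : ℝ → ℝ → ℝ} (h : LocIntStrip T A) (h' : LocIntStrip T B) :
    LocIntStrip T (fun s y => A s y - B s y) := fun r => (h r).sub (h' r)

lemma LocIntStrip.congr {A B : ℝ → ℝ → ℝ} (h : LocIntStrip T A)
    (h' : Function.uncurry A =ᵐ[strip T] Function.uncurry B) : LocIntStrip T B := fun r =>
  (h r).congr ((Measure.absolutelyContinuous_of_le (restrict_prod_le_strip T _)).ae_le h')

lemma IsSolution.add_g_meas (h : IsSolution μ T d p u ux) (hd : d.Admissible T) :
    AEStronglyMeasurable (Function.uncurry fun s x => u s x + d.g s x) (strip T) :=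
  h.bounded.1.add hd.g_mem.1

/-- `u + g` as a bounded function on the strip. -/
lemma IsSolution.exists_add_g_le (h : IsSolution μ T d p u ux) (hd : d.Admissible T) :
    ∃ M : ℝ, ∀ᵐ q ∂strip T, |u q.1 q.2 + d.g q.1 q.2| ≤ M := by
  obtain ⟨M, -, hM⟩ := MemLp.exists_ae_abs_le h.bounded
  obtain ⟨M', -, hM'⟩ := MemLp.exists_ae_abs_le hd.g_mem
  refine ⟨M + M', ?_⟩
  filter_upwards [hM, hM'] with q h1 h2
  exact (abs_add_le _ _).trans (add_le_add h1 h2)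

lemma IsSolution.half_sq_int (h : IsSolution μ T d p u ux) (hd : d.Admissible T) :
    LocIntStrip T (fun s x => (u s x + d.g s x) ^ 2 / 2) := by
  obtain ⟨M, hM⟩ := h.exists_add_g_le hd
  have := ((h.u_int.add hd.g_int).mul_bounded (z := fun s x => u s x + d.g s x)
    (h.add_g_meas hd) hM).const_mul (1 / 2)
  convert! this using 3
  ring

lemma IsSolution.flux_int (h : IsSolution μ T d p u ux) (hd : d.Admissible T) :
    LocIntStrip T (flux μ d u ux) :=
  ((h.ux_int.add hd.gx_int).const_mul μ).sub (h.half_sq_int hd)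

/-- One of the two space derivatives is moved back onto `u + g`, and `(u + g)(uₓ + gₓ)` is the
derivative of `(u + g)² / 2` by the chain rule; the equation thereby takes divergence form. -/
lemma IsSolution.weak_tensor (h : IsSolution μ T d p u ux) (hd : d.Admissible T)
    {θ χ : ℝ → ℝ} (h1 : ContDiff ℝ ∞ θ) (h2 : HasCompactSupport θ) (h3 : tsupport θ ⊆ Ioo 0 T)
    (hχ : ContDiff ℝ ∞ χ) (hχc : HasCompactSupport χ) :
    -(∫ q, u q.1 q.2 * (deriv θ q.1 * χ q.2) ∂strip T) +
      (∫ q, flux μ d u ux q.1 q.2 * (θ q.1 * deriv χ q.2) ∂strip T) -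
      (∫ q, d.f q.1 q.2 * (θ q.1 * χ q.2) ∂strip T) = 0 := by
  obtain ⟨M, hM⟩ := h.exists_add_g_le hd
  have cθ := h1.continuous
  have cθ' := h1.continuous_deriv (n := ∞) (by simp)
  have cχ := hχ.continuous
  have hχ' : ContDiff ℝ ∞ (deriv χ) := hχ.deriv' 
  have cχ' := hχ'.continuous
  have cχ'' := hχ'.continuous_deriv (n := ∞) (by simp)
  have hw := h.u_int.add hd.g_int
  have hwx := h.ux_int.add hd.gx_int
  have hwwx := hwx.mul_bounded (z := fun s x => u s x + d.g s x) (h.add_g_meas hd) hM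
  have hwd : ∀ᵐ s ∂volume.restrict (Icc 0 T), HasWeakDeriv (fun x => u s x + d.g s x)
      (fun x => ux s x + d.gx s x) := by
    filter_upwards [h.ux_deriv, hd.gx_deriv] with s e1 e2 using e1.add e2
  have hwd2 : ∀ᵐ s ∂volume.restrict (Icc 0 T), HasWeakDeriv (fun x => (u s x + d.g s x) ^ 2 / 2)
      (fun x => (ux s x + d.gx s x) * (u s x + d.g s x)) := by
    filter_upwards [hwd] with s e1
    have hΦ : ContDiff ℝ 1 (fun y : ℝ => y ^ 2 / 2) := by fun_prop
    have hΦ' : deriv (fun y : ℝ => y ^ 2 / 2) = fun y => y := by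
      ext y
      simp
    have := e1.comp hΦ
    rw [hΦ'] at this
    simpa only [mul_comm] using this
  have w1 := integral_strip_weakDeriv hw hwx hwd cθ hχ' hχc.deriv
  have w2 := integral_strip_weakDeriv (h.half_sq_int hd) hwwx hwd2 cθ hχ hχc
  obtain ⟨t1, t2, t3⟩ := tensor_test h1 h2 h3 hχ hχc
  have eq := h.equation (fun s x => θ s * χ x) t1 t2 t3
  have i1 := integrable_strip_mul h.u_int cθ' cχ hχc
  have i2 := integrable_strip_mul hw cθ cχ'' hχc.deriv.deriv
  have i3 := integrable_strip_mul hwwx cθ cχ hχc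
  have i4 := integrable_strip_mul hd.f_int cθ cχ hχc
  have i5 := integrable_strip_mul hwx cθ cχ' hχc.deriv
  have i6 := integrable_strip_mul (h.half_sq_int hd) cθ cχ' hχc.deriv
  have e1 : ∫ z : ℝ × ℝ,
      (-(u z.1 z.2 * deriv (fun s => θ s * χ z.2) z.1)
        - μ * ((u z.1 z.2 + d.g z.1 z.2) * iteratedDeriv 2 (fun x => θ z.1 * χ x) z.2)
        + (u z.1 z.2 + d.g z.1 z.2) * (ux z.1 z.2 + d.gx z.1 z.2) * (θ z.1 * χ z.2)
        - d.f z.1 z.2 * (θ z.1 * χ z.2)) ∂(strip T) =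
      -(∫ q, u q.1 q.2 * (deriv θ q.1 * χ q.2) ∂strip T) -
      μ * (∫ q, (u q.1 q.2 + d.g q.1 q.2) * (θ q.1 * deriv (deriv χ) q.2) ∂strip T) +
      (∫ q, (ux q.1 q.2 + d.gx q.1 q.2) * (u q.1 q.2 + d.g q.1 q.2) * (θ q.1 * χ q.2) ∂strip T) -
      (∫ q, d.f q.1 q.2 * (θ q.1 * χ q.2) ∂strip T) := by
    have j1 := i1.neg.sub (i2.const_mul μ)
    have j2 := j1.add i3
    have k1 := integral_sub j2 i4
    have k2 := integral_add j1 i3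
    have k3 := integral_sub i1.neg (i2.const_mul μ)
    simp only [Pi.add_apply, Pi.sub_apply, Pi.neg_apply] at k1 k2 k3
    rw [integral_neg, integral_const_mul] at k3
    rw [← k3, ← k2, ← k1]
    congr 1 with z
    have d1 : deriv (fun s => θ s * χ z.2) z.1 = deriv θ z.1 * χ z.2 :=
      deriv_mul_const ((h1.differentiable (by simp)) _) _
    have d2 : iteratedDeriv 2 (fun x => θ z.1 * χ x) z.2 = θ z.1 * deriv (deriv χ) z.2 := by
      rw [iteratedDeriv_succ, iteratedDeriv_one]
      have : deriv (fun x => θ z.1 * χ x) = fun x => θ z.1 * deriv χ x := by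
        ext x
        exact deriv_const_mul _ ((hχ.differentiable (by simp)) _)
      rw [this]
      exact deriv_const_mul _ ((hχ'.differentiable (by simp)) _)
    rw [d1, d2]
    ring
  have e2 : ∫ q, flux μ d u ux q.1 q.2 * (θ q.1 * deriv χ q.2) ∂strip T =
      μ * (∫ q, (ux q.1 q.2 + d.gx q.1 q.2) * (θ q.1 * deriv χ q.2) ∂strip T) -
      ∫ q, (u q.1 q.2 + d.g q.1 q.2) ^ 2 / 2 * (θ q.1 * deriv χ q.2) ∂strip T := by
    rw [← integral_const_mul, ← integral_sub (i5.const_mul μ) i6]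
    congr 1 with q
    rw [flux]; ring
  rw [e1, w1] at eq
  rw [e2, w2]
  linarith

end

section

/-! ### The Lipschitz estimate for bounded solutions -/

/-- For a measurable representative `k`, the slice norm is at most `a` exactly when the section of
`{|k| > a}` is null, and the measure of a section depends measurably on the parameter. -/
lemma aemeasurable_linf {T : ℝ} {h : ℝ → ℝ → ℝ}
    (hm : AEStronglyMeasurable (Function.uncurry h) (strip T)) :
    AEMeasurable (fun s => linf (h s)) (volume.restrict (Icc 0 T)) := by
  set k := hm.mk with hk
  have hkm : Measurable k := hm.stronglyMeasurable_mk.measurable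
  have hae : Function.uncurry h =ᵐ[strip T] k := hm.ae_eq_mk
  clear_value k
  rw [strip_eq_prod] at hae
  refine ⟨fun s => linf fun x => k (s, x), ?_, ?_⟩
  · apply measurable_of_Iic
    intro a
    have : (fun s => linf fun x => k (s, x)) ⁻¹' Iic a =
        {s | volume (Prod.mk s ⁻¹' {q : ℝ × ℝ | a < ‖k q‖ₑ}) = 0} := by
      ext s
      simp only [mem_preimage, mem_Iic, mem_ofPred_eq, linf, eLpNorm_exponent_top]
      constructor
      · intro hs
        have := (ae_le_eLpNormEssSup (f := fun x => k (s, x)) (μ := volume)).mono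
          fun x hx => hx.trans hs
        simpa [ae_iff] using this
      · intro hs
        apply eLpNormEssSup_le_of_ae_enorm_bound
        rw [ae_iff]
        simpa using hs
    rw [this]
    have h1 : MeasurableSet {q : ℝ × ℝ | a < ‖k q‖ₑ} := measurableSet_lt measurable_const hkm.enorm
    exact measurable_measure_prodMk_left h1 (measurableSet_singleton 0)
  · filter_upwards [Measure.ae_ae_of_ae_prod hae] with s hs
    exact eLpNorm_congr_ae hs

lemma strip_mono {t T : ℝ} (h : t ≤ T) : strip t ≤ strip T :=
  Measure.restrict_mono (prod_mono (Icc_subset_Icc_right h) subset_rfl) le_rfl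

lemma LocIntStrip.of_abs_le {T : ℝ} {A B : ℝ → ℝ → ℝ}
    (hm : AEStronglyMeasurable (Function.uncurry A) (strip T)) (hB : LocIntStrip T B)
    (h : ∀ᵐ q ∂strip T, |A q.1 q.2| ≤ B q.1 q.2) : LocIntStrip T A := fun r =>
  Integrable.mono' (hB r) (hm.mono_measure (restrict_prod_le_strip T _))
    ((Measure.absolutelyContinuous_of_le (restrict_prod_le_strip T _)).ae_le h)

lemma locIntStrip_const (T c : ℝ) : LocIntStrip T fun _ _ => c := fun _ =>
  integrableOn_const (volume_strip_lt_top T _ _).ne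

lemma LocIntStrip.slice {t : ℝ} {A : ℝ → ℝ → ℝ} (hA : LocIntStrip t A) (y : ℝ) :
    ∀ᵐ r ∂volume.restrict (Icc 0 t), IntegrableOn (A r) (Icc y (y + 1)) := by
  filter_upwards [hA.ae_locallyIntegrable] with r hr
  exact hr.integrableOn_isCompact isCompact_Icc

variable {t M : ℝ} {z zx A B : ℝ → ℝ → ℝ}

/-- Young's inequality `|B||z| ≤ ε z² + B²/ε`, integrated over the cell and in time. -/
lemma Evolution.source_le_of_sq (h : Evolution t M z zx A B) {T F : ℝ} (ht : t ≤ T)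
    (hB2 : LocIntStrip t fun s x => B s x ^ 2)
    (hF : ∀ y, ∫ r in Icc 0 t, ∫ x in Icc y (y + 1), B r x ^ 2 ≤ F) {S : ℝ} (hS : 0 ≤ S)
    (hzS : ∀ s ∈ Icc 0 t, ∀ y, ∫ x in Icc y (y + 1), z s x ^ 2 ≤ S) {ε : ℝ} (hε : 0 < ε)
    {s : ℝ} (hs : s ∈ Icc 0 t) (y : ℝ) :
    ∫ r in Icc 0 s, ∫ x in Icc y (y + 1), |B r x| * |z r x| ≤ ε * (1 + T) * S + F / ε := by
  have hBz := h.B_mul_int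
  have hz2 := h.z_sq_int
  have hsub : Icc 0 s ⊆ Icc 0 t := Icc_subset_Icc_right hs.2
  have i1 : IntegrableOn (fun r => ∫ x in Icc y (y + 1), |B r x| * |z r x|) (Icc 0 s) :=
    (hBz.integrable_cell y (y + 1)).mono_measure (Measure.restrict_mono hsub le_rfl)
  have i2 : IntegrableOn (fun r => ∫ x in Icc y (y + 1), B r x ^ 2) (Icc 0 t) :=
    hB2.integrable_cell y (y + 1)
  have i3 : IntegrableOn (fun r => ε * S + (∫ x in Icc y (y + 1), B r x ^ 2) / ε) (Icc 0 s) :=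
    (integrableOn_const (by simp)).add ((i2.mono_set hsub).div_const ε)
  have hle : ∀ᵐ r ∂volume.restrict (Icc 0 s), ∫ x in Icc y (y + 1), |B r x| * |z r x| ≤
      ε * S + (∫ x in Icc y (y + 1), B r x ^ 2) / ε := by
    filter_upwards [ae_restrict_of_ae_restrict_of_subset hsub (hBz.slice y),
      ae_restrict_of_ae_restrict_of_subset hsub (hz2.slice y),
      ae_restrict_of_ae_restrict_of_subset hsub (hB2.slice y), ae_restrict_mem measurableSet_Icc]
      with r h1 h2 h3 hr
    calc ∫ x in Icc y (y + 1), |B r x| * |z r x|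
        ≤ ∫ x in Icc y (y + 1), (ε * z r x ^ 2 + B r x ^ 2 / ε) := by
          refine integral_mono h1 ((h2.const_mul ε).add (h3.div_const ε)) fun x => ?_
          change |B r x| * |z r x| ≤ ε * z r x ^ 2 + B r x ^ 2 / ε
          have e1 : B r x ^ 2 / ε = ε * (|B r x| / ε) ^ 2 := by
            rw [div_pow, sq_abs]; field_simp
          have e2 : |B r x| * |z r x| = ε * ((|B r x| / ε) * |z r x|) := by field_simp
          rw [e1, e2, ← sq_abs (z r x), ← mul_add]
          gcongr
          nlinarith [sq_nonneg (|B r x| / ε - |z r x|), sq_nonneg (|B r x| / ε),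
            sq_nonneg (|z r x|)]
      _ = ε * (∫ x in Icc y (y + 1), z r x ^ 2) + (∫ x in Icc y (y + 1), B r x ^ 2) / ε := by
          rw [integral_add (h2.const_mul ε) (h3.div_const ε), integral_const_mul,
            integral_div]
      _ ≤ _ := by
          gcongr
          exact hzS r (hsub hr) y
  calc ∫ r in Icc 0 s, ∫ x in Icc y (y + 1), |B r x| * |z r x|
      ≤ ∫ r in Icc 0 s, (ε * S + (∫ x in Icc y (y + 1), B r x ^ 2) / ε) :=
        integral_mono_ae i1 i3 hle
    _ = s * (ε * S) + (∫ r in Icc 0 s, ∫ x in Icc y (y + 1), B r x ^ 2) / ε := by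
        rw [integral_add (integrable_const _) ((i2.mono_set hsub).div_const ε), integral_div]
        simp [hs.1]
    _ ≤ ε * (1 + T) * S + F / ε := by
        have e3 : ∫ r in Icc 0 s, ∫ x in Icc y (y + 1), B r x ^ 2 ≤ F :=
          (setIntegral_mono_set i2 (ae_of_all _ fun r => integral_nonneg fun x => sq_nonneg _)
            hsub.eventuallyLE).trans (hF y)
        have e4 : s * (ε * S) ≤ ε * (1 + T) * S := by
          have : s ≤ 1 + T := by linarith [hs.2]
          nlinarith [mul_nonneg hε.le hS]
        gcongr

/-- The elementary bound `|z| ≤ δ z² + 1/δ` on a cell of length one yields `P (δ S + 1/δ)`, with `P`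
the `L¹(L^∞)` bound of the source; `δ` remains free to be adapted to `P`. -/
lemma Evolution.source_le_of_linf (h : Evolution t M z zx A B) {T : ℝ} (ht : t ≤ T) {φ : ℝ → ℝ}
    (hφ0 : ∀ s, 0 ≤ φ s) (hφ : IntegrableOn φ (Icc 0 t))
    (hBφ : ∀ᵐ r ∂volume.restrict (Icc 0 t), ∀ᵐ x, |B r x| ≤ φ r) {S : ℝ} (hS : 0 ≤ S)
    (hzS : ∀ s ∈ Icc 0 t, ∀ y, ∫ x in Icc y (y + 1), z s x ^ 2 ≤ S) {ε : ℝ} (hε : 0 < ε)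
    {s : ℝ} (hs : s ∈ Icc 0 t) (y : ℝ) :
    ∫ r in Icc 0 s, ∫ x in Icc y (y + 1), |B r x| * |z r x| ≤
      ε * (1 + T) * S + (∫ r in Icc 0 t, φ r) ^ 2 / ε := by
  have hBz := h.B_mul_int
  have hz2 := h.z_sq_int
  have hsub : Icc 0 s ⊆ Icc 0 t := Icc_subset_Icc_right hs.2
  set P := ∫ r in Icc 0 t, φ r with hP
  have hP0 : 0 ≤ P := integral_nonneg hφ0
  have hT0 : 0 ≤ T := (hs.1.trans hs.2).trans ht
  have i1 : IntegrableOn (fun r => ∫ x in Icc y (y + 1), |B r x| * |z r x|) (Icc 0 s) :=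
    (hBz.integrable_cell y (y + 1)).mono_measure (Measure.restrict_mono hsub le_rfl)
  have hP' : ∫ r in Icc 0 s, φ r ≤ P :=
    setIntegral_mono_set hφ (ae_of_all _ hφ0) hsub.eventuallyLE
  have key : ∀ δ : ℝ, 0 < δ →
      ∫ r in Icc 0 s, ∫ x in Icc y (y + 1), |B r x| * |z r x| ≤ P * (δ * S + 1 / δ) := by
    intro δ hδ
    have hle : ∀ᵐ r ∂volume.restrict (Icc 0 s), ∫ x in Icc y (y + 1), |B r x| * |z r x| ≤
        φ r * (δ * S + 1 / δ) := by
      filter_upwards [ae_restrict_of_ae_restrict_of_subset hsub (hBz.slice y),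
        ae_restrict_of_ae_restrict_of_subset hsub (hz2.slice y),
        ae_restrict_of_ae_restrict_of_subset hsub hBφ, ae_restrict_mem measurableSet_Icc]
        with r h1 h2 h3 hr
      have i4 : IntegrableOn (fun x => δ * z r x ^ 2 + 1 / δ) (Icc y (y + 1)) :=
        (h2.const_mul δ).add (integrableOn_const (by simp))
      calc ∫ x in Icc y (y + 1), |B r x| * |z r x|
          ≤ ∫ x in Icc y (y + 1), φ r * (δ * z r x ^ 2 + 1 / δ) := by
            apply integral_mono_ae h1 (i4.const_mul (φ r))
            filter_upwards [ae_restrict_of_ae h3] with x hx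
            have : |z r x| ≤ δ * z r x ^ 2 + 1 / δ := by
              have e1 : δ * z r x ^ 2 + 1 / δ - |z r x| =
                  ((δ * |z r x| - 1 / 2) ^ 2 + 3 / 4) / δ := by
                rw [← sq_abs]; field_simp; ring
              have : 0 ≤ ((δ * |z r x| - 1 / 2) ^ 2 + 3 / 4) / δ := by positivity
              linarith
            exact mul_le_mul hx this (abs_nonneg _) (hφ0 r)
        _ = φ r * (δ * (∫ x in Icc y (y + 1), z r x ^ 2) + 1 / δ) := by
            rw [integral_const_mul, integral_add (h2.const_mul δ) (integrable_const _),
              integral_const_mul]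
            simp
        _ ≤ _ := by
            have := hφ0 r
            gcongr
            exact hzS r (hsub hr) y
    calc ∫ r in Icc 0 s, ∫ x in Icc y (y + 1), |B r x| * |z r x|
        ≤ ∫ r in Icc 0 s, φ r * (δ * S + 1 / δ) :=
          integral_mono_ae i1 ((hφ.mono_set hsub).mul_const _) hle
      _ = (∫ r in Icc 0 s, φ r) * (δ * S + 1 / δ) := integral_mul_const _ _
      _ ≤ _ := by gcongr
  rcases hP0.eq_or_lt with h0 | h0
  · have := key 1 one_pos
    rw [← h0] at this ⊢
    have e : 0 ≤ ε * (1 + T) * S := by positivity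
    simpa using this.trans (by simpa using e)
  -- With `δ = ε / P` the bound becomes `ε S + P² / ε`, of the same form as for a source in `L²_ul
  -- L²`. The case `P = 0` is separate because of the division.
  · refine (key (ε / P) (by positivity)).trans ?_
    have e1 : P * (ε / P * S + 1 / (ε / P)) = ε * S + P ^ 2 / ε := by field_simp
    rw [e1]
    have e2 : 0 ≤ ε * T * S := by positivity
    nlinarith

end

/-! ### The difference of two solutions as a weak evolution -/

section

variable {μ T : ℝ} {d d₁ d₂ : Data} {p : ℝ≥0∞} {u ux u₁ u₁x u₂ u₂x : ℝ → ℝ → ℝ}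

lemma flux_meas (h : IsSolution μ T d p u ux) (hd : d.Admissible T) :
    AEStronglyMeasurable (Function.uncurry (flux μ d u ux)) (strip T) := by
  have h1 : AEStronglyMeasurable (fun q : ℝ × ℝ => μ * (ux q.1 q.2 + d.gx q.1 q.2) -
      (u q.1 q.2 + d.g q.1 q.2) ^ 2 / 2) (strip T) := by
    have e1 : AEStronglyMeasurable (fun q : ℝ × ℝ => ux q.1 q.2) (strip T) := h.ux_meas
    have e2 : AEStronglyMeasurable (fun q : ℝ × ℝ => d.gx q.1 q.2) (strip T) := hd.gx_meas
    have e3 : AEStronglyMeasurable (fun q : ℝ × ℝ => (u q.1 q.2 + d.g q.1 q.2) ^ 2) (strip T) :=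
      (h.add_g_meas hd).pow 2
    simp_rw [div_eq_mul_inv]
    exact ((e1.add e2).const_mul μ).sub (e3.mul_const _)
  exact h1

/-- The energy identity requires a square integrable flux: `uₓ` and `gₓ` are locally in `L²` of the
strip, and the quadratic part is bounded. -/
lemma flux_sq_int (h : IsSolution μ T d p u ux) (hd : d.Admissible T) :
    LocIntStrip T fun s x => flux μ d u ux s x ^ 2 := by
  obtain ⟨M, hM⟩ := h.exists_add_g_le hd
  have hm : AEStronglyMeasurable (Function.uncurry fun s x => flux μ d u ux s x ^ 2) (strip T) :=
    (flux_meas h hd).pow 2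
  refine LocIntStrip.of_abs_le hm
    (((h.ux_sq_int.const_mul (3 * μ ^ 2)).add (hd.gx_sq_int.const_mul (3 * μ ^ 2))).add
      (locIntStrip_const T (3 * M ^ 4))) ?_
  filter_upwards [hM] with q hq
  rw [abs_of_nonneg (sq_nonneg _), flux]
  have h1 : (u q.1 q.2 + d.g q.1 q.2) ^ 2 ≤ M ^ 2 := by
    rw [← sq_abs]; gcongr
  have h2 : ((u q.1 q.2 + d.g q.1 q.2) ^ 2) ^ 2 ≤ (M ^ 2) ^ 2 := by gcongr
  set a := μ * ux q.1 q.2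
  set b := μ * d.gx q.1 q.2
  set c := (u q.1 q.2 + d.g q.1 q.2) ^ 2
  have e : μ * (ux q.1 q.2 + d.gx q.1 q.2) = a + b := by ring
  have e' : 3 * μ ^ 2 * ux q.1 q.2 ^ 2 + 3 * μ ^ 2 * d.gx q.1 q.2 ^ 2 = 3 * a ^ 2 + 3 * b ^ 2 := by
    ring
  rw [e, e']
  nlinarith [sq_nonneg (a - b), sq_nonneg (a + c / 2), sq_nonneg (b + c / 2), sq_nonneg c]

lemma IsSolution.exists_abs_le (h : IsSolution μ T d p u ux) (hT : 0 < T) :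
    ∃ M : ℝ, 0 ≤ M ∧ ∀ t ∈ Icc 0 T, ∀ᵐ x, |u t x| ≤ M := by
  obtain ⟨M, hM0, hM⟩ := MemLp.exists_ae_abs_le h.bounded
  exact ⟨M, hM0, h.locCont.abs_le hT h.cstar.meas (ae_slice_abs_le hM)⟩

/-- The difference of two solutions as a weak evolution. -/
lemma exists_evolution_sub (hT : 0 < T) (h₁ : IsSolution μ T d₁ p u₁ u₁x)
    (h₂ : IsSolution μ T d₂ p u₂ u₂x) (hd₁ : d₁.Admissible T) (hd₂ : d₂.Admissible T) :
    ∃ (N : ℝ) (zx A B : ℝ → ℝ → ℝ), Evolution T N (fun s x => u₁ s x - u₂ s x) zx A B ∧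
      (Function.uncurry zx =ᵐ[strip T] fun q => u₁x q.1 q.2 - u₂x q.1 q.2) ∧
      (Function.uncurry A =ᵐ[strip T]
        fun q => flux μ d₁ u₁ u₁x q.1 q.2 - flux μ d₂ u₂ u₂x q.1 q.2) ∧
      (Function.uncurry B =ᵐ[strip T] fun q => d₁.f q.1 q.2 - d₂.f q.1 q.2) := by
  obtain ⟨M₁, hM₁, hu₁⟩ := h₁.exists_abs_le hT
  obtain ⟨M₂, hM₂, hu₂⟩ := h₂.exists_abs_le hT
  have mzx : AEStronglyMeasurable (fun q : ℝ × ℝ => u₁x q.1 q.2 - u₂x q.1 q.2) (strip T) :=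
    h₁.ux_meas.sub h₂.ux_meas
  have mA : AEStronglyMeasurable
      (fun q : ℝ × ℝ => flux μ d₁ u₁ u₁x q.1 q.2 - flux μ d₂ u₂ u₂x q.1 q.2) (strip T) :=
    (flux_meas h₁ hd₁).sub (flux_meas h₂ hd₂)
  have mB : AEStronglyMeasurable (fun q : ℝ × ℝ => d₁.f q.1 q.2 - d₂.f q.1 q.2) (strip T) :=
    hd₁.f_meas.sub hd₂.f_meas
  -- An `Evolution` asks for measurable `zx`, `A` and `B`, so these are replaced by representatives;
  -- `z` itself is kept, because its value at every single time matters.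
  have ezx := mzx.ae_eq_mk.symm
  have eA := mA.ae_eq_mk.symm
  have eB := mB.ae_eq_mk.symm
  have kzx := mzx.stronglyMeasurable_mk.measurable
  have kA := mA.stronglyMeasurable_mk.measurable
  have kB := mB.stronglyMeasurable_mk.measurable
  generalize mzx.mk = zx' at *
  generalize mA.mk = A' at *
  generalize mB.mk = B' at *
  have iA : LocIntStrip T fun s x => A' (s, x) := ((h₁.flux_int hd₁).sub (h₂.flux_int hd₂)).congr
    (by filter_upwards [eA] with q hq using hq.symm)
  have iB : LocIntStrip T fun s x => B' (s, x) := (hd₁.f_int.sub hd₂.f_int).congr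
    (by filter_upwards [eB] with q hq using hq.symm)
  have hle : ∀ t ∈ Icc 0 T, ∀ᵐ x, |u₁ t x - u₂ t x| ≤ M₁ + M₂ := by
    intro t ht
    filter_upwards [hu₁ t ht, hu₂ t ht] with x e1 e2
    exact (abs_sub _ _).trans (add_le_add e1 e2)
  refine ⟨M₁ + M₂, fun s x => zx' (s, x), fun s x => A' (s, x), fun s x => B' (s, x), ?_, ezx,
    eA, eB⟩
  refine ⟨h₁.bounded.1.sub h₂.bounded.1, fun t ht => (h₁.cstar.meas t ht).sub (h₂.cstar.meas t ht),
    hle, kzx, kA, kB, iA, iB, ?_, ?_⟩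
  · have e := ezx
    rw [strip_eq_prod] at e
    filter_upwards [h₁.ux_deriv, h₂.ux_deriv, Measure.ae_ae_of_ae_prod e] with s e1 e2 e3
    exact (e1.sub e2).congr (EventuallyEq.refl _ _) (by filter_upwards [e3] with x hx using hx.symm)
  · have hc : ∀ χ : ℝ → ℝ, ContDiff ℝ ∞ χ → HasCompactSupport χ →
        ContinuousOn (fun t => ∫ x, (u₁ t x - u₂ t x) * χ x) (Icc 0 T) := by
      intro χ hχ hχc
      refine ((h₁.locCont.continuousOn_integral h₁.cstar.meas hu₁ hχ.continuous hχc).sub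
        (h₂.locCont.continuousOn_integral h₂.cstar.meas hu₂ hχ.continuous hχc)).congr ?_
      intro t ht
      have i1 : Integrable (fun x => u₁ t x * χ x) :=
        (hχ.continuous.integrable_of_hasCompactSupport hχc).bdd_mul (c := M₁)
          (h₁.cstar.meas t ht) (hu₁ t ht)
      have i2 : Integrable (fun x => u₂ t x * χ x) :=
        (hχ.continuous.integrable_of_hasCompactSupport hχc).bdd_mul (c := M₂)
          (h₂.cstar.meas t ht) (hu₂ t ht)
      simp only [sub_mul]
      exact integral_sub i1 i2
    refine evol_of_weak hT hc (h₁.u_int.sub h₂.u_int) iA iB ?_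
    intro θ χ h1 h2 h3 hχ hχc
    have w1 := h₁.weak_tensor hd₁ h1 h2 h3 hχ hχc
    have w2 := h₂.weak_tensor hd₂ h1 h2 h3 hχ hχc
    have cθ := h1.continuous
    have cθ' := h1.continuous_deriv (n := ∞) (by simp)
    have cχ' := hχ.continuous_deriv (n := ∞) (by simp)
    have j1 := integral_sub (integrable_strip_mul h₁.u_int cθ' hχ.continuous hχc)
      (integrable_strip_mul h₂.u_int cθ' hχ.continuous hχc)
    have j2 := integral_sub (integrable_strip_mul (h₁.flux_int hd₁) cθ cχ' hχc.deriv)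
      (integrable_strip_mul (h₂.flux_int hd₂) cθ cχ' hχc.deriv)
    have j3 := integral_sub (integrable_strip_mul hd₁.f_int cθ hχ.continuous hχc)
      (integrable_strip_mul hd₂.f_int cθ hχ.continuous hχc)
    have k1 : ∫ q, (u₁ q.1 q.2 - u₂ q.1 q.2) * (deriv θ q.1 * χ q.2) ∂strip T = _ :=
      (integral_congr_ae (ae_of_all _ fun q => sub_mul _ _ _)).trans j1
    have k2 : ∫ q, A' (q.1, q.2) * (θ q.1 * deriv χ q.2) ∂strip T = _ :=
      (integral_congr_ae (by filter_upwards [eA] with q hq; rw [hq, sub_mul])).trans j2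
    have k3 : ∫ q, B' (q.1, q.2) * (θ q.1 * χ q.2) ∂strip T = _ :=
      (integral_congr_ae (by filter_upwards [eB] with q hq; rw [hq, sub_mul])).trans j3
    rw [k1, k2, k3]
    linarith

end

/-! ### The Lipschitz estimate and uniqueness -/

section

variable {μ T : ℝ} {d d₁ d₂ : Data} {p : ℝ≥0∞} {u ux u₁ u₁x u₂ u₂x : ℝ → ℝ → ℝ}

lemma le_ofReal_of_sq_le {a : ℝ≥0∞} {b : ℝ} (hb : 0 ≤ b) (h : a ^ 2 ≤ ENNReal.ofReal (b ^ 2)) :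
    a ≤ ENNReal.ofReal b := by
  rw [ENNReal.ofReal_pow hb] at h
  exact (ENNReal.pow_le_pow_left_iff two_ne_zero).1 h

lemma timeNorm_one (t : ℝ) (N : ℝ → ℝ≥0∞) : timeNorm 1 t N = ∫⁻ s in Icc 0 t, N s := by
  rw [timeNorm, eLpNorm_one_eq_lintegral_enorm]
  simp

lemma timeNorm_two_sq (t : ℝ) (N : ℝ → ℝ≥0∞) : timeNorm 2 t N ^ 2 = ∫⁻ s in Icc 0 t, N s ^ 2 := by
  have h1 := eLpNorm_nnreal_pow_eq_lintegral (f := N) (μ := volume.restrict (Icc 0 t)) (p := 2)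
    two_ne_zero
  simpa [timeNorm] using h1

/-- A nonnegative function with finite integral as the integral of its real part. -/
lemma integrable_toReal_and_integral {t : ℝ} {N : ℝ → ℝ≥0∞}
    (hm : AEMeasurable N (volume.restrict (Icc 0 t))) (hN : ∫⁻ s in Icc 0 t, N s ≠ ⊤) :
    IntegrableOn (fun s => (N s).toReal) (Icc 0 t) ∧
      ∫ s in Icc 0 t, (N s).toReal = (∫⁻ s in Icc 0 t, N s).toReal ∧
      ∀ᵐ s ∂volume.restrict (Icc 0 t), N s ≠ ⊤ := by
  have h := ae_lt_top' hm hN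
  exact ⟨integrable_toReal_of_lintegral_ne_top hm hN, integral_toReal hm h, h.mono fun s hs => hs.ne⟩

lemma eLpNorm_strip_sq {t : ℝ} {w : ℝ → ℝ → ℝ} (h : LocIntStrip t fun s x => w s x ^ 2) (y : ℝ) :
    eLpNorm (Function.uncurry w) 2 (volume.restrict (Icc 0 t ×ˢ Icc y (y + 1))) ^ 2 =
      ENNReal.ofReal (∫ s in Icc 0 t, ∫ x in Icc y (y + 1), w s x ^ 2) := by
  have hi : IntegrableOn (fun q : ℝ × ℝ => w q.1 q.2 ^ 2) (Icc 0 t ×ˢ Icc y (y + 1)) := by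
    refine IntegrableOn.mono_set (h (|y| + 1)) (prod_mono subset_rfl (Icc_subset_Icc ?_ ?_))
    · linarith [neg_abs_le y]
    · linarith [le_abs_self y]
  rw [eLpNorm_two_sq_eq_ofReal (f := Function.uncurry w) hi]
  congr 1
  rw [restrict_Icc_prod, integral_prod]
  · rfl
  · rwa [← restrict_Icc_prod]

/-- With `a` and `b` the two sums `uᵢ + gᵢ`, the flux difference minus `μ zₓ` equals `μ` times the
difference of the `gₓ` minus `(a + b)/2 · (a - b)`, and `|(a + b)/2| ≤ M`. So
`exists_energy_constant` applies with `K = μ + M`, the three data terms being squares of norms. The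
quantity `Q` is either of the two norms of the source difference, which gives the minimum
afterwards; the second derivative of `g` plays no role in this estimate. -/
lemma lipschitz_aux (hμ : 0 < μ) (hT : 0 < T) {M : ℝ} (hM : 0 ≤ M) : ∃ C : ℝ≥0,
    ∀ (d₁ d₂ : Data) (p : ℝ≥0∞) (u₁ u₁x u₂ u₂x : ℝ → ℝ → ℝ), d₁.Admissible T → d₂.Admissible T →
      IsSolution μ T d₁ p u₁ u₁x → IsSolution μ T d₂ p u₂ u₂x →
      (∀ᵐ q ∂strip T, |u₁ q.1 q.2 + d₁.g q.1 q.2| ≤ M) →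
      (∀ᵐ q ∂strip T, |u₂ q.1 q.2 + d₂.g q.1 q.2| ≤ M) →
      ∀ t ∈ Icc 0 T, ∀ Q : ℝ≥0∞, (Q = l2ulL2 t (d₁.f - d₂.f) ∨
        Q = timeNorm 1 t (fun s => linf (d₁.f s - d₂.f s))) →
      (⨆ s ∈ Icc 0 t, l2ul (u₁ s - u₂ s)) + l2ulL2 t (u₁x - u₂x) ≤
        C * (l2ul (d₁.u0 - d₂.u0) + Q +
          timeNorm 2 t (fun s => w1inf ((d₁.g - d₂.g) s) ((d₁.gx - d₂.gx) s))) := by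
  obtain ⟨C₀, hC₀, hE⟩ := exists_energy_constant (K := μ + M) hμ (by positivity) hT.le
  -- Each of the two terms on the left costs `√C₀`. The added one keeps the constant positive, so
  -- that its product with an infinite right-hand side is infinite.
  refine ⟨(2 * √C₀ + 1).toNNReal, ?_⟩
  intro d₁ d₂ p u₁ u₁x u₂ u₂x hd₁ hd₂ h₁ h₂ hM₁ hM₂ t ht Q hQ
  set N₀ := l2ul (d₁.u0 - d₂.u0) with hN₀
  set N : ℝ → ℝ≥0∞ := fun s => w1inf ((d₁.g - d₂.g) s) ((d₁.gx - d₂.gx) s) with hN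
  set G₀ := timeNorm 2 t N with hG₀
  by_cases htop : N₀ + Q + G₀ = ⊤
  · rw [htop, ENNReal.mul_top]
    · exact le_top
    · simp only [ne_eq, ENNReal.coe_eq_zero, Real.toNNReal_eq_zero, not_le]
      positivity
  have hN₀t : N₀ ≠ ⊤ := fun h => htop (by simp [h])
  have hQt : Q ≠ ⊤ := fun h => htop (by simp [h])
  have hGt : G₀ ≠ ⊤ := fun h => htop (by simp [h])
  obtain ⟨L, zx, A, B, ev, ezx, eA, eB⟩ := exists_evolution_sub hT h₁ h₂ hd₁ hd₂
  have tT : t ≤ T := ht.2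
  have sub : Icc 0 t ⊆ Icc 0 T := Icc_subset_Icc_right tT
  have acs : strip t ≪ strip T := Measure.absolutelyContinuous_of_le (strip_mono tT)
  have evt := ev.mono tT
  have mN : AEMeasurable N (volume.restrict (Icc 0 t)) := by
    have m1 : AEStronglyMeasurable (Function.uncurry (d₁.g - d₂.g)) (strip T) :=
      hd₁.g_mem.1.sub hd₂.g_mem.1
    have m2 : AEStronglyMeasurable (Function.uncurry (d₁.gx - d₂.gx)) (strip T) :=
      hd₁.gx_meas.sub hd₂.gx_meas
    exact (aemeasurable_linf (m1.mono_measure (strip_mono tT))).add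
      (aemeasurable_linf (m2.mono_measure (strip_mono tT)))
  have hG2 : ∫⁻ s in Icc 0 t, N s ^ 2 = G₀ ^ 2 := (timeNorm_two_sq t N).symm
  obtain ⟨iκ, eκ, fκ⟩ := integrable_toReal_and_integral (mN.pow_const 2)
    (hG2 ▸ ENNReal.pow_ne_top hGt)
  simp only [ENNReal.toReal_pow] at iκ eκ
  rw [hG2, ENNReal.toReal_pow] at eκ
  -- regularity of the flux
  have hA2 : LocIntStrip t fun s y => A s y ^ 2 := by
    have i1 : LocIntStrip T fun s y => A s y ^ 2 := by
      refine LocIntStrip.of_abs_le ((ev.A_meas.aestronglyMeasurable).pow 2)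
        (((flux_sq_int h₁ hd₁).const_mul 2).add ((flux_sq_int h₂ hd₂).const_mul 2)) ?_
      filter_upwards [eA] with q hq
      have hq' : A q.1 q.2 = _ := hq
      rw [abs_of_nonneg (sq_nonneg _), hq']
      nlinarith [sq_nonneg (flux μ d₁ u₁ u₁x q.1 q.2 + flux μ d₂ u₂ u₂x q.1 q.2)]
    exact i1.mono tT
  have hzx2 : LocIntStrip t fun s y => zx s y ^ 2 := by
    have i1 : LocIntStrip T fun s y => zx s y ^ 2 := by
      refine LocIntStrip.of_abs_le ((ev.zx_meas.aestronglyMeasurable).pow 2)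
        ((h₁.ux_sq_int.const_mul 2).add (h₂.ux_sq_int.const_mul 2)) ?_
      filter_upwards [ezx] with q hq
      have hq' : zx q.1 q.2 = _ := hq
      rw [abs_of_nonneg (sq_nonneg _), hq']
      nlinarith [sq_nonneg (u₁x q.1 q.2 + u₂x q.1 q.2)]
    exact i1.mono tT
  have hAz : ∀ᵐ s ∂volume.restrict (Icc 0 t), ∀ᵐ x,
      |A s x - μ * zx s x| ≤ (μ + M) * (|u₁ s x - u₂ s x| + (N s).toReal) := by
    have all : ∀ᵐ q ∂strip t, |A q.1 q.2 - μ * zx q.1 q.2| ≤ (μ + M) *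
        (|u₁ q.1 q.2 - u₂ q.1 q.2| + (|d₁.g q.1 q.2 - d₂.g q.1 q.2| +
          |d₁.gx q.1 q.2 - d₂.gx q.1 q.2|)) := by
      filter_upwards [acs.ae_le eA, acs.ae_le ezx, acs.ae_le hM₁, acs.ae_le hM₂] with q e1 e2 e3 e4
      have e1' : A q.1 q.2 = _ := e1
      have e2' : zx q.1 q.2 = _ := e2
      rw [e1', e2', flux, flux]
      set a := u₁ q.1 q.2 + d₁.g q.1 q.2 with ha
      set b := u₂ q.1 q.2 + d₂.g q.1 q.2 with hb
      have eq : μ * (u₁x q.1 q.2 + d₁.gx q.1 q.2) - a ^ 2 / 2 -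
          (μ * (u₂x q.1 q.2 + d₂.gx q.1 q.2) - b ^ 2 / 2) - μ * (u₁x q.1 q.2 - u₂x q.1 q.2) =
          μ * (d₁.gx q.1 q.2 - d₂.gx q.1 q.2) - (a + b) / 2 * (a - b) := by ring
      have hab : |(a + b) / 2| ≤ M := by
        rw [abs_le] at e3 e4 ⊢
        constructor <;> linarith [e3.1, e3.2, e4.1, e4.2]
      have hd : |a - b| ≤ |u₁ q.1 q.2 - u₂ q.1 q.2| + |d₁.g q.1 q.2 - d₂.g q.1 q.2| := by
        have : a - b = (u₁ q.1 q.2 - u₂ q.1 q.2) + (d₁.g q.1 q.2 - d₂.g q.1 q.2) := by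
          rw [ha, hb]; ring
        rw [this]
        exact abs_add_le _ _
      rw [eq]
      refine (abs_sub _ _).trans ?_
      rw [abs_mul, abs_mul, abs_of_pos hμ]
      have e5 := mul_le_mul hab hd (abs_nonneg _) hM
      have e6 : 0 ≤ μ * (|u₁ q.1 q.2 - u₂ q.1 q.2| + |d₁.g q.1 q.2 - d₂.g q.1 q.2|) := by
        positivity
      have e7 : 0 ≤ M * |d₁.gx q.1 q.2 - d₂.gx q.1 q.2| := by positivity
      nlinarith
    rw [strip_eq_prod] at all
    filter_upwards [Measure.ae_ae_of_ae_prod all, fκ] with s e1 e2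
    have e2' : N s ≠ ⊤ := fun h => e2 (by simp [h])
    have hfin : linf ((d₁.g - d₂.g) s) ≠ ⊤ ∧ linf ((d₁.gx - d₂.gx) s) ≠ ⊤ :=
      ENNReal.add_ne_top.1 e2'
    filter_upwards [e1, ae_enorm_le_linf ((d₁.g - d₂.g) s), ae_enorm_le_linf ((d₁.gx - d₂.gx) s)]
      with x e3 e4 e5
    refine e3.trans ?_
    have e6 : (N s).toReal = (linf ((d₁.g - d₂.g) s)).toReal +
        (linf ((d₁.gx - d₂.gx) s)).toReal := ENNReal.toReal_add hfin.1 hfin.2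
    have e7 := ENNReal.toReal_mono hfin.1 e4
    have e8 := ENNReal.toReal_mono hfin.2 e5
    rw [toReal_enorm, Real.norm_eq_abs] at e7 e8
    rw [e6]
    gcongr
    · exact e7
    · exact e8
  -- the initial value
  have bd : ∀ s ∈ Icc 0 t, LocallyIntegrable (fun x => (u₁ s x - u₂ s x) ^ 2) volume :=
    fun s hs => evt.z_sq_locallyIntegrable hs
  have hn : ∀ y, ∫ x in Icc y (y + 1), (u₁ 0 x - u₂ 0 x) ^ 2 ≤ N₀.toReal ^ 2 := by
    intro y
    have e1 := eLpNorm_two_sq_eq_ofReal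
      ((bd 0 ⟨le_rfl, ht.1⟩).integrableOn_isCompact (isCompact_Icc (a := y) (b := y + 1)))
    have e2 : eLpNorm (fun x => u₁ 0 x - u₂ 0 x) 2 (volume.restrict (Icc y (y + 1))) ≤ N₀ := by
      have : eLpNorm (fun x => u₁ 0 x - u₂ 0 x) 2 (volume.restrict (Icc y (y + 1))) =
          eLpNorm (d₁.u0 - d₂.u0) 2 (volume.restrict (Icc y (y + 1))) := by
        apply eLpNorm_congr_ae
        filter_upwards [ae_restrict_of_ae h₁.initial_eq, ae_restrict_of_ae h₂.initial_eq]
          with x e1 e2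
        rw [e1, e2, Pi.sub_apply]
      rw [this]
      exact le_iSup (fun y => eLpNorm (d₁.u0 - d₂.u0) 2 (volume.restrict (Icc y (y + 1)))) y
    have e3 := pow_le_pow_left' e2 2
    rw [e1] at e3
    rw [← ENNReal.toReal_pow]
    exact (ENNReal.ofReal_le_iff_le_toReal (ENNReal.pow_ne_top hN₀t)).1 e3
  -- the source
  have hF : ∀ S : ℝ, 0 ≤ S →
      (∀ s ∈ Icc 0 t, ∀ y, ∫ x in Icc y (y + 1), (u₁ s x - u₂ s x) ^ 2 ≤ S) →
      ∀ ε : ℝ, 0 < ε → ∀ s ∈ Icc 0 t, ∀ y,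
        ∫ r in Icc 0 s, ∫ x in Icc y (y + 1), |B r x| * |u₁ r x - u₂ r x| ≤
          ε * (1 + T) * S + Q.toReal ^ 2 / ε := by
    have eB' := acs.ae_le eB
    rcases hQ with hQ | hQ
    · have e1 : l2ulL2 t B = Q := by
        rw [hQ]
        unfold l2ulL2
        congr 1 with y
        apply eLpNorm_congr_ae
        exact (Measure.absolutelyContinuous_of_le (restrict_prod_le_strip t _)).ae_le eB'
      have hB2 : LocIntStrip t fun s x => B s x ^ 2 :=
        locIntStrip_sq_of_l2ulL2 ev.B_meas.aestronglyMeasurable (e1 ▸ hQt.lt_top)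
      intro S hS hzS ε hε s hs y
      refine evt.source_le_of_sq tT hB2 (fun y => ?_) hS hzS hε hs y
      have e2 := eLpNorm_strip_sq hB2 y
      have e3 : eLpNorm (Function.uncurry B) 2
          (volume.restrict (Icc 0 t ×ˢ Icc y (y + 1))) ≤ Q := by
        rw [← e1]
        exact le_iSup (fun y => eLpNorm (Function.uncurry B) 2
          (volume.restrict (Icc 0 t ×ˢ Icc y (y + 1)))) y
      have e4 := pow_le_pow_left' e3 2
      rw [e2] at e4
      rw [← ENNReal.toReal_pow]
      exact (ENNReal.ofReal_le_iff_le_toReal (ENNReal.pow_ne_top hQt)).1 e4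
    · have mf : AEStronglyMeasurable (Function.uncurry fun s => d₁.f s - d₂.f s) (strip T) :=
        hd₁.f_meas.sub hd₂.f_meas
      rw [timeNorm_one] at hQ
      obtain ⟨iφ, eφ, fφ⟩ := integrable_toReal_and_integral
        (aemeasurable_linf (mf.mono_measure (strip_mono tT))) (hQ ▸ hQt)
      rw [← hQ] at eφ
      rw [strip_eq_prod] at eB'
      have hBφ : ∀ᵐ r ∂volume.restrict (Icc 0 t), ∀ᵐ x,
          |B r x| ≤ (linf (d₁.f r - d₂.f r)).toReal := by
        filter_upwards [Measure.ae_ae_of_ae_prod eB', fφ] with r e1 e2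
        filter_upwards [e1, ae_enorm_le_linf (d₁.f r - d₂.f r)] with x e3 e4
        have e3' : B r x = _ := e3
        have e5 := ENNReal.toReal_mono e2 e4
        rwa [toReal_enorm, Real.norm_eq_abs, Pi.sub_apply, ← e3'] at e5
      intro S hS hzS ε hε s hs y
      have := evt.source_le_of_linf tT (fun r => ENNReal.toReal_nonneg) iφ hBφ hS hzS hε hs y
      rwa [eφ] at this
  obtain ⟨r1, r2⟩ := hE t L _ zx A B (fun s => (N s).toReal) (N₀.toReal ^ 2) (Q.toReal ^ 2)
    (G₀.toReal ^ 2) ht evt hA2 hzx2 (fun s => ENNReal.toReal_nonneg) iκ hAz (sq_nonneg _) hn eκ.le hF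
  set X := N₀.toReal + Q.toReal + G₀.toReal with hX
  have hX0 : 0 ≤ X := by positivity
  have hle : C₀ * (N₀.toReal ^ 2 + Q.toReal ^ 2 + G₀.toReal ^ 2) ≤ (√C₀ * X) ^ 2 := by
    rw [mul_pow, Real.sq_sqrt hC₀]
    gcongr
    have a1 : 0 ≤ N₀.toReal := ENNReal.toReal_nonneg
    have a2 : 0 ≤ Q.toReal := ENNReal.toReal_nonneg
    have a3 : 0 ≤ G₀.toReal := ENNReal.toReal_nonneg
    nlinarith [mul_nonneg a1 a2, mul_nonneg a1 a3, mul_nonneg a2 a3]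
  have hXe : ENNReal.ofReal X = N₀ + Q + G₀ := by
    rw [hX, ENNReal.ofReal_add (by positivity) (by positivity),
      ENNReal.ofReal_add (by positivity) (by positivity), ENNReal.ofReal_toReal hN₀t,
      ENNReal.ofReal_toReal hQt, ENNReal.ofReal_toReal hGt]
  have p1 : (⨆ s ∈ Icc 0 t, l2ul (u₁ s - u₂ s)) ≤ ENNReal.ofReal (√C₀ * X) := by
    refine iSup₂_le fun s hs => iSup_le fun y => le_ofReal_of_sq_le (by positivity) ?_
    have e1 := eLpNorm_two_sq_eq_ofReal
      ((bd s hs).integrableOn_isCompact (isCompact_Icc (a := y) (b := y + 1)))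
    exact e1.le.trans (ENNReal.ofReal_le_ofReal ((r1 s hs y).trans hle))
  have p2 : l2ulL2 t (u₁x - u₂x) ≤ ENNReal.ofReal (√C₀ * X) := by
    refine iSup_le fun y => le_ofReal_of_sq_le (by positivity) ?_
    have e1 : eLpNorm (Function.uncurry (u₁x - u₂x)) 2
        (volume.restrict (Icc 0 t ×ˢ Icc y (y + 1))) = eLpNorm (Function.uncurry zx) 2
        (volume.restrict (Icc 0 t ×ˢ Icc y (y + 1))) := by
      apply eLpNorm_congr_ae
      filter_upwards [((Measure.absolutelyContinuous_of_le (restrict_prod_le_strip t _)).trans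
        acs).ae_le ezx] with q hq using hq.symm
    rw [e1, eLpNorm_strip_sq hzx2 y]
    exact ENNReal.ofReal_le_ofReal ((r2 y).trans hle)
  rw [← hXe]
  calc _ ≤ ENNReal.ofReal (√C₀ * X) + ENNReal.ofReal (√C₀ * X) := add_le_add p1 p2
    _ = ENNReal.ofReal (2 * √C₀ * X) := by
        rw [← ENNReal.ofReal_add (by positivity) (by positivity)]; congr 1; ring
    _ ≤ ENNReal.ofReal ((2 * √C₀ + 1) * X) := by
        apply ENNReal.ofReal_le_ofReal
        gcongr
        linarith
    _ = _ := by
        rw [ENNReal.ofReal_mul (by positivity)]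
        rfl

/-- The Lipschitz estimate with a constant depending on a bound of the solutions. -/
lemma lipschitz_of_bounded (hμ : 0 < μ) (hT : 0 < T) {M : ℝ} (hM : 0 ≤ M) : ∃ C : ℝ≥0,
    ∀ (d₁ d₂ : Data) (p : ℝ≥0∞) (u₁ u₁x u₂ u₂x : ℝ → ℝ → ℝ), d₁.Admissible T → d₂.Admissible T →
      IsSolution μ T d₁ p u₁ u₁x → IsSolution μ T d₂ p u₂ u₂x →
      (∀ᵐ q ∂strip T, |u₁ q.1 q.2 + d₁.g q.1 q.2| ≤ M) →
      (∀ᵐ q ∂strip T, |u₂ q.1 q.2 + d₂.g q.1 q.2| ≤ M) →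
      ∀ t ∈ Icc 0 T,
      (⨆ s ∈ Icc 0 t, l2ul (u₁ s - u₂ s)) + l2ulL2 t (u₁x - u₂x) ≤
        C * (l2ul (d₁.u0 - d₂.u0) + min (l2ulL2 t (d₁.f - d₂.f))
          (timeNorm 1 t (fun s => linf (d₁.f s - d₂.f s))) +
          tripleNorm t (d₁.g - d₂.g) (d₁.gx - d₂.gx) (d₁.gxx - d₂.gxx)) := by
  obtain ⟨C, h⟩ := lipschitz_aux hμ hT hM
  refine ⟨C, fun d₁ d₂ p u₁ u₁x u₂ u₂x hd₁ hd₂ h₁ h₂ hM₁ hM₂ t ht => ?_⟩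
  refine (h d₁ d₂ p u₁ u₁x u₂ u₂x hd₁ hd₂ h₁ h₂ hM₁ hM₂ t ht _ (min_choice _ _)).trans ?_
  gcongr
  exact le_add_self

lemma l2ul_eq_zero {f : ℝ → ℝ} (hm : AEStronglyMeasurable f volume) (h : l2ul f = 0) :
    f =ᵐ[volume] 0 := by
  refine ae_of_forall_Icc fun r hr => ?_
  obtain ⟨N, hN⟩ := exists_nat_ge (2 * r)
  have := eLpNorm_Icc_le_l2ul f hN
  rw [h, mul_zero] at this
  exact (eLpNorm_eq_zero_iff hm.restrict two_ne_zero).1 (le_antisymm this zero_le)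

lemma linf_zero : linf 0 = 0 := by simp [linf]

/-- Uniqueness of the solution. -/
lemma IsSolution.unique (hμ : 0 < μ) (hT : 0 < T) (hd : d.Admissible T)
    (h₁ : IsSolution μ T d p u₁ u₁x) (h₂ : IsSolution μ T d p u₂ u₂x) :
    ∀ t ∈ Icc 0 T, u₁ t =ᵐ[volume] u₂ t := by
  intro t ht
  obtain ⟨M₁, hM₁⟩ := h₁.exists_add_g_le hd
  obtain ⟨M₂, hM₂⟩ := h₂.exists_add_g_le hd
  obtain ⟨C, hC⟩ := lipschitz_of_bounded hμ hT (M := max 0 (max M₁ M₂)) (le_max_left _ _)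
  have h := hC d d p u₁ u₁x u₂ u₂x hd hd h₁ h₂
    (hM₁.mono fun q hq => hq.trans ((le_max_left _ _).trans (le_max_right _ _)))
    (hM₂.mono fun q hq => hq.trans ((le_max_right _ _).trans (le_max_right _ _))) t ht
  have z1 : l2ul 0 = 0 := by simp [l2ul]
  have z2 : timeNorm 1 t (fun s => linf (d.f s - d.f s)) = 0 := by
    simp [timeNorm, linf_zero]
  have z3 : ∀ q, timeNorm q t (fun _ => 0) = 0 := fun q => by simp [timeNorm]
  have z4 : tripleNorm t (d.g - d.g) (d.gx - d.gx) (d.gxx - d.gxx) = 0 := by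
    simp [tripleNorm, w1inf, w2inf, linf_zero, z3]
  rw [z2, z4] at h
  simp only [sub_self, z1, min_zero, add_zero, mul_zero] at h
  have h2 : l2ul (u₁ t - u₂ t) ≤ 0 :=
    ((le_iSup₂ (f := fun s (_ : s ∈ Icc 0 t) => l2ul (u₁ s - u₂ s)) t ⟨ht.1, le_rfl⟩).trans
      le_self_add).trans h
  have h3 := l2ul_eq_zero ((h₁.cstar.meas t ht).sub (h₂.cstar.meas t ht)) (le_antisymm h2 zero_le)
  filter_upwards [h3] with x hx
  exact sub_eq_zero.1 hx

end

section

/-! ### The heat kernel -/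

/-- The kernel of `∂ₜ - μ ∂ₓ²`, extended by zero to `r ≤ 0`. -/
noncomputable def hk (μ r y : ℝ) : ℝ :=
  (√(4 * Real.pi * μ * r))⁻¹ * Real.exp (-y ^ 2 / (4 * μ * r))

/-- The derivative in `y` of the heat kernel. -/
noncomputable def hkx (μ r y : ℝ) : ℝ := -(y / (2 * μ * r)) * hk μ r y

/-- The `L¹` norm of the derivative of the heat kernel at time one. -/
noncomputable def hkc (μ : ℝ) : ℝ := ∫ y, |hkx μ 1 y|

variable {μ : ℝ}

/-- The square root of a nonpositive number and the inverse of zero are both zero by convention.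
Causality is therefore built into the kernel, and Duhamel integrals can be taken over the whole
plane. -/
lemma hk_of_nonpos (hμ : 0 < μ) {r : ℝ} (hr : r ≤ 0) (y : ℝ) : hk μ r y = 0 := by
  have : 4 * Real.pi * μ * r ≤ 0 := mul_nonpos_of_nonneg_of_nonpos (by positivity) hr
  rw [hk, Real.sqrt_eq_zero_of_nonpos this]
  simp

lemma hkx_of_nonpos (hμ : 0 < μ) {r : ℝ} (hr : r ≤ 0) (y : ℝ) : hkx μ r y = 0 := by
  rw [hkx, hk_of_nonpos hμ hr, mul_zero]

lemma hk_nonneg (μ r y : ℝ) : 0 ≤ hk μ r y := by unfold hk; positivity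

lemma measurable_hk (μ : ℝ) : Measurable (fun q : ℝ × ℝ => hk μ q.1 q.2) := by
  unfold hk; fun_prop

lemma measurable_hkx (μ : ℝ) : Measurable (fun q : ℝ × ℝ => hkx μ q.1 q.2) := by
  have := measurable_hk μ
  unfold hkx
  exact ((measurable_snd.div (measurable_const.mul measurable_fst)).neg).mul this

lemma measurable_hk_right (μ r : ℝ) : Measurable (hk μ r) :=
  (measurable_hk μ).comp (measurable_const.prodMk measurable_id)

lemma hk_scale (μ : ℝ) {r : ℝ} (hr : 0 < r) (y : ℝ) :
    hk μ r y = (√r)⁻¹ * hk μ 1 (y / √r) := by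
  unfold hk
  rw [div_pow, Real.sq_sqrt hr.le, Real.sqrt_mul' _ hr.le, mul_inv, mul_one, mul_one]
  have : -y ^ 2 / (4 * μ * r) = -(y ^ 2 / r) / (4 * μ) := by
    rw [neg_div, neg_div, div_div]; ring_nf
  rw [this]; ring

lemma hkx_scale (μ : ℝ) {r : ℝ} (hr : 0 < r) (y : ℝ) :
    hkx μ r y = r⁻¹ * hkx μ 1 (y / √r) := by
  unfold hkx
  rw [hk_scale μ hr]
  have h0 : √r ≠ 0 := (Real.sqrt_pos.2 hr).ne'
  have h1 : r⁻¹ = (√r)⁻¹ * (√r)⁻¹ := by rw [← mul_inv, Real.mul_self_sqrt hr.le]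
  have e1 : y / (2 * μ * r) = y / (2 * μ) * r⁻¹ := by rw [← div_div, div_eq_mul_inv]
  have e2 : y / √r / (2 * μ * 1) = y / (2 * μ) * (√r)⁻¹ := by
    rw [mul_one, div_right_comm, div_eq_mul_inv _ (√r)]
  rw [e1, e2, h1]
  ring

lemma integral_hk_one (hμ : 0 < μ) : Integrable (hk μ 1) ∧ ∫ y, hk μ 1 y = 1 := by
  have e : hk μ 1 = fun y => (√(4 * Real.pi * μ))⁻¹ * Real.exp (-(1 / (4 * μ)) * y ^ 2) := by
    ext y
    unfold hk
    rw [mul_one, mul_one]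
    congr 2; ring
  rw [e]
  refine ⟨(integrable_exp_neg_mul_sq (by positivity)).const_mul _, ?_⟩
  rw [integral_const_mul, integral_gaussian]
  have : Real.pi / (1 / (4 * μ)) = 4 * Real.pi * μ := by field_simp
  rw [this]
  exact inv_mul_cancel₀ (Real.sqrt_pos.2 (by positivity)).ne'

lemma integrable_hkx_one (hμ : 0 < μ) : Integrable (hkx μ 1) := by
  have e : hkx μ 1 = fun y => -((2 * μ)⁻¹ * (√(4 * Real.pi * μ))⁻¹) *
      (y * Real.exp (-(1 / (4 * μ)) * y ^ 2)) := by
    ext y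
    unfold hkx hk
    rw [mul_one, mul_one, mul_one]
    have : -y ^ 2 / (4 * μ) = -(1 / (4 * μ)) * y ^ 2 := by ring
    rw [this]; ring
  rw [e]
  exact (integrable_mul_exp_neg_mul_sq (by positivity)).const_mul _

lemma hkc_nonneg (μ : ℝ) : 0 ≤ hkc μ := integral_nonneg fun _ => abs_nonneg _

lemma integrable_hk (hμ : 0 < μ) (r : ℝ) : Integrable (hk μ r) := by
  rcases le_or_gt r 0 with hr | hr
  · rw [show hk μ r = fun _ => 0 from funext (hk_of_nonpos hμ hr)]
    exact integrable_zero _ _ _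
  · rw [show hk μ r = fun y => (√r)⁻¹ * hk μ 1 (y / √r) from funext (hk_scale μ hr)]
    exact ((integral_hk_one hμ).1.comp_div (Real.sqrt_pos.2 hr).ne').const_mul _

lemma integrable_hkx (hμ : 0 < μ) (r : ℝ) : Integrable (hkx μ r) := by
  rcases le_or_gt r 0 with hr | hr
  · rw [show hkx μ r = fun _ => 0 from funext (hkx_of_nonpos hμ hr)]
    exact integrable_zero _ _ _
  · rw [show hkx μ r = fun y => r⁻¹ * hkx μ 1 (y / √r) from funext (hkx_scale μ hr)]
    exact ((integrable_hkx_one hμ).comp_div (Real.sqrt_pos.2 hr).ne').const_mul _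

lemma integral_hk (hμ : 0 < μ) {r : ℝ} (hr : 0 < r) : ∫ y, hk μ r y = 1 := by
  have h0 : 0 < √r := Real.sqrt_pos.2 hr
  simp_rw [hk_scale μ hr]
  rw [integral_const_mul, Measure.integral_comp_div (hk μ 1), (integral_hk_one hμ).2, abs_of_pos h0]
  simp [h0.ne']

/-- Parabolic scaling reduces the norm to time one. For `r ≤ 0` both sides vanish by the conventions
on roots and inverses, so no sign condition is needed. -/
lemma integral_abs_hkx (hμ : 0 < μ) (r : ℝ) : ∫ y, |hkx μ r y| = hkc μ * (√r)⁻¹ := by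
  rcases le_or_gt r 0 with hr | hr
  · simp [hkx_of_nonpos hμ hr, Real.sqrt_eq_zero_of_nonpos hr]
  · have h0 : 0 < √r := Real.sqrt_pos.2 hr
    simp_rw [hkx_scale μ hr, abs_mul]
    rw [integral_const_mul, Measure.integral_comp_div (fun y => |hkx μ 1 y|), abs_of_pos h0,
      abs_of_pos (inv_pos.2 hr), hkc, smul_eq_mul]
    have h1 : r⁻¹ = (√r)⁻¹ * (√r)⁻¹ := by rw [← mul_inv, Real.mul_self_sqrt hr.le]
    rw [h1]
    field_simp

lemma lintegral_hk_le (hμ : 0 < μ) (r : ℝ) : ∫⁻ y, ‖hk μ r y‖ₑ ≤ 1 := by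
  rcases le_or_gt r 0 with hr | hr
  · simp [hk_of_nonpos hμ hr]
  · rw [← ofReal_integral_norm_eq_lintegral_enorm (integrable_hk hμ r)]
    simp only [Real.norm_eq_abs, abs_of_nonneg (hk_nonneg μ r _)]
    rw [integral_hk hμ hr]; simp

lemma lintegral_hkx (hμ : 0 < μ) (r : ℝ) :
    ∫⁻ y, ‖hkx μ r y‖ₑ = ENNReal.ofReal (hkc μ * (√r)⁻¹) := by
  rw [← ofReal_integral_norm_eq_lintegral_enorm (integrable_hkx hμ r)]
  simp only [Real.norm_eq_abs]
  rw [integral_abs_hkx hμ]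

lemma hasDerivAt_hk (hμ : 0 < μ) (r y : ℝ) : HasDerivAt (hk μ r) (hkx μ r y) y := by
  rcases le_or_gt r 0 with hr | hr
  · rw [show hk μ r = fun _ => 0 from funext (hk_of_nonpos hμ hr), hkx_of_nonpos hμ hr]
    exact hasDerivAt_const _ _
  · have h1 : HasDerivAt (fun y : ℝ => -y ^ 2 / (4 * μ * r)) (-(y / (2 * μ * r))) y := by
      have := ((hasDerivAt_id y).pow 2).neg.div_const (4 * μ * r)
      refine this.congr_deriv ?_
      simp only [id]
      field_simp
      norm_num
      ring
    have := (h1.exp).const_mul (√(4 * Real.pi * μ * r))⁻¹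
    refine this.congr_deriv ?_
    rw [hkx, hk]; ring

lemma continuous_hkx (hμ : 0 < μ) (r : ℝ) : Continuous (hkx μ r) := by
  have : Continuous (hk μ r) :=
    continuous_iff_continuousAt.2 fun y => (hasDerivAt_hk hμ r y).continuousAt
  unfold hkx
  fun_prop

/-- The modulus of continuity of translations of the heat kernel in `L¹`. -/
lemma lintegral_hk_translate_le (hμ : 0 < μ) (r h : ℝ) :
    ∫⁻ y, ‖hk μ r (y + h) - hk μ r y‖ₑ ≤ ‖h‖ₑ * ENNReal.ofReal (hkc μ * (√r)⁻¹) := by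
  -- The increment is the integral of the derivative along the segment from `y` to `y + h`;
  -- Tonelli's theorem and translation invariance finish the estimate.
  have h1 : ∀ y, ‖hk μ r (y + h) - hk μ r y‖ₑ ≤
      ∫⁻ θ in Ioc (0:ℝ) 1, ‖h * hkx μ r (y + θ * h)‖ₑ := by
    intro y
    have hc : Continuous (fun θ : ℝ => h * hkx μ r (y + θ * h)) :=
      continuous_const.mul ((continuous_hkx hμ r).comp (by fun_prop))
    have e : ∫ θ in (0:ℝ)..1, h * hkx μ r (y + θ * h) = hk μ r (y + h) - hk μ r y := by
      rw [intervalIntegral.integral_eq_sub_of_hasDerivAt (f := fun θ => hk μ r (y + θ * h))]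
      · simp
      · intro θ _
        have := (hasDerivAt_hk hμ r (y + θ * h)).comp θ
          (((hasDerivAt_id θ).mul_const h).const_add y)
        refine this.congr_deriv ?_
        ring
      · exact hc.intervalIntegrable _ _
    rw [← e, intervalIntegral.integral_of_le zero_le_one]
    exact enorm_integral_le_lintegral_enorm _
  have hm : Measurable (fun q : ℝ × ℝ => ‖h * hkx μ r (q.1 + q.2 * h)‖ₑ) :=
    (((continuous_hkx hμ r).comp (by fun_prop : Continuous fun q : ℝ × ℝ => q.1 + q.2 * h)).measurable.const_mul
      h).enorm
  calc ∫⁻ y, ‖hk μ r (y + h) - hk μ r y‖ₑ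
      ≤ ∫⁻ y, ∫⁻ θ in Ioc (0:ℝ) 1, ‖h * hkx μ r (y + θ * h)‖ₑ := lintegral_mono h1
    _ = ∫⁻ θ in Ioc (0:ℝ) 1, ∫⁻ y, ‖h * hkx μ r (y + θ * h)‖ₑ :=
        lintegral_lintegral_swap hm.aemeasurable
    _ = ∫⁻ _ in Ioc (0:ℝ) 1, ‖h‖ₑ * ENNReal.ofReal (hkc μ * (√r)⁻¹) := by
        congr 1 with θ
        simp_rw [enorm_mul]
        rw [lintegral_const_mul' _ _ enorm_ne_top,
          lintegral_add_right_eq_self (fun y => ‖hkx μ r y‖ₑ), lintegral_hkx hμ]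
    _ = _ := by simp

/-! ### The singular time integral -/

/-- The convolution of `f` with `s ↦ s₊^{-1/2}`. -/
noncomputable def abel (f : ℝ → ℝ≥0∞) (t : ℝ) : ℝ≥0∞ :=
  ∫⁻ s, f s * ENNReal.ofReal (√(t - s))⁻¹

lemma abel_add {f g : ℝ → ℝ≥0∞} (hf : Measurable f) (t : ℝ) :
    abel (fun s => f s + g s) t = abel f t + abel g t := by
  unfold abel
  simp_rw [add_mul]
  exact lintegral_add_left (hf.mul (by fun_prop)) _

lemma abel_const_mul {c : ℝ≥0∞} {f : ℝ → ℝ≥0∞} (hf : Measurable f) (t : ℝ) :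
    abel (fun s => c * f s) t = c * abel f t := by
  unfold abel
  simp_rw [mul_assoc]
  exact lintegral_const_mul _ (hf.mul (by fun_prop))

lemma measurable_abel {f : ℝ → ℝ≥0∞} (hf : Measurable f) : Measurable (abel f) := by
  have : Measurable (Function.uncurry fun t s : ℝ => f s * ENNReal.ofReal (√(t - s))⁻¹) :=
    (hf.comp measurable_snd).mul (by fun_prop)
  exact this.lintegral_prod_right

/-- Because the integral extends to `-∞`, an exponential is an eigenfunction; the eigenvalue is a
value of the Gamma function at `1/2`, rescaled. It tends to zero as `l` grows, which is the source
of the contraction on an arbitrarily long time interval. -/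
lemma abel_exp {l : ℝ} (hl : 0 < l) (t : ℝ) :
    abel (fun s => ENNReal.ofReal (Real.exp (l * s))) t =
      ENNReal.ofReal (√(Real.pi / l) * Real.exp (l * t)) := by
  have e1 : abel (fun s => ENNReal.ofReal (Real.exp (l * s))) t =
      ∫⁻ r, ENNReal.ofReal (Real.exp (l * (t - r)) * (√r)⁻¹) := by
    unfold abel
    rw [← lintegral_sub_left_eq_self _ t]
    congr 1 with r
    rw [← ENNReal.ofReal_mul (Real.exp_nonneg _)]
    simp
  have e2 : ∫⁻ r, ENNReal.ofReal (Real.exp (l * (t - r)) * (√r)⁻¹) =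
      ∫⁻ r in Ioi 0, ENNReal.ofReal (Real.exp (l * t) *
        (r ^ ((1 / 2 : ℝ) - 1) * Real.exp (-(l * r)))) := by
    rw [← lintegral_indicator measurableSet_Ioi]
    congr 1 with r
    by_cases hr : r ∈ Ioi 0
    · rw [indicator_of_mem hr]
      have hr' : (0:ℝ) < r := hr
      congr 1
      have : r ^ ((1 / 2 : ℝ) - 1) = (√r)⁻¹ := by
        rw [Real.sqrt_eq_rpow, ← Real.rpow_neg hr'.le]; norm_num
      rw [this, mul_sub, sub_eq_add_neg, Real.exp_add]
      ring
    · rw [indicator_of_notMem hr]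
      have hr' : r ≤ 0 := not_lt.1 hr
      simp [Real.sqrt_eq_zero_of_nonpos hr']
  have h3 := Real.integral_rpow_mul_exp_neg_mul_Ioi (a := 1 / 2) (by norm_num) hl
  have hpos : 0 < √(Real.pi / l) := Real.sqrt_pos.2 (by positivity)
  have h4 : (1 / l) ^ (1 / 2 : ℝ) * Real.Gamma (1 / 2) = √(Real.pi / l) := by
    rw [Real.Gamma_one_half_eq, ← Real.sqrt_eq_rpow, ← Real.sqrt_mul (by positivity)]
    congr 1; ring
  rw [h4] at h3
  have hi : IntegrableOn (fun r : ℝ => r ^ ((1 / 2 : ℝ) - 1) * Real.exp (-(l * r))) (Ioi 0) := by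
    by_contra h
    rw [integral_undef h] at h3
    exact hpos.ne h3
  rw [e1, e2, ← ofReal_integral_eq_lintegral_ofReal (hi.const_mul _)]
  · rw [integral_const_mul, h3, mul_comm]
  · filter_upwards [ae_restrict_mem measurableSet_Ioi] with r hr
    have hr' : (0:ℝ) < r := hr
    positivity

lemma lintegral_inv_sqrt {L : ℝ} (hL : 0 ≤ L) :
    ∫⁻ r, (Iio L).indicator (fun r => ENNReal.ofReal (√r)⁻¹) r = ENNReal.ofReal (2 * √L) := by
  have hi : IntervalIntegrable (fun s : ℝ => s ^ (-(1 / 2) : ℝ)) volume 0 L :=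
    intervalIntegral.intervalIntegrable_rpow' (by norm_num)
  have hv : ∫ s in (0:ℝ)..L, s ^ (-(1 / 2) : ℝ) = 2 * √L := by
    rw [integral_rpow (Or.inl (by norm_num)), Real.sqrt_eq_rpow]
    norm_num
    ring
  have e : ∫⁻ r, (Iio L).indicator (fun r => ENNReal.ofReal (√r)⁻¹) r =
      ∫⁻ r in Ioc 0 L, ENNReal.ofReal (r ^ (-(1 / 2) : ℝ)) := by
    rw [setLIntegral_congr (Ioo_ae_eq_Ioc (a := (0:ℝ)) (b := L)).symm,
      ← lintegral_indicator measurableSet_Ioo]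
    congr 1 with r
    by_cases h1 : r < L
    · rw [indicator_of_mem (by exact h1)]
      by_cases h2 : 0 < r
      · rw [indicator_of_mem (by exact ⟨h2, h1⟩), Real.sqrt_eq_rpow, ← Real.rpow_neg h2.le]
      · rw [indicator_of_notMem (fun h => h2 h.1), Real.sqrt_eq_zero_of_nonpos (not_lt.1 h2)]
        simp
    · rw [indicator_of_notMem (by exact h1), indicator_of_notMem (fun h => h1 h.2)]
  rw [e, ← hv, intervalIntegral.integral_of_le hL]
  refine (ofReal_integral_eq_lintegral_ofReal hi.1 ?_).symm
  filter_upwards [ae_restrict_mem measurableSet_Ioc] with r hr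
  exact Real.rpow_nonneg hr.1.le _

lemma abel_indicator {t : ℝ} (ht : 0 ≤ t) :
    abel ((Ioi 0).indicator fun _ => 1) t = ENNReal.ofReal (2 * √t) := by
  rw [← lintegral_inv_sqrt ht, abel, ← lintegral_sub_left_eq_self _ t]
  congr 1 with r
  by_cases hr : r < t
  · rw [indicator_of_mem (show t - r ∈ Ioi 0 from sub_pos.2 hr), indicator_of_mem (by exact hr)]
    simp
  · rw [indicator_of_notMem (show t - r ∉ Ioi 0 from fun h => hr (sub_pos.1 h)),
      indicator_of_notMem (by exact hr), zero_mul]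

/-- From `√L ≤ √(s - r) + √(t - s)` with `L = t - r`, the product of the two singular factors is at
most `L^{-1/2}` times their sum, and each of them integrates to `2√L` over the interval. This
elementary bound replaces the exact Beta integral. -/
lemma lintegral_inv_sqrt_mul_le (r t : ℝ) :
    ∫⁻ s, ENNReal.ofReal (√(s - r))⁻¹ * ENNReal.ofReal (√(t - s))⁻¹ ≤ 4 := by
  rcases le_or_gt t r with h | h
  · refine le_trans (le_of_eq ?_) zero_le
    rw [lintegral_eq_zero_iff' (by fun_prop)]
    refine ae_of_all _ fun s => ?_
    rcases le_or_gt s r with h1 | h1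
    · simp [Real.sqrt_eq_zero_of_nonpos (sub_nonpos.2 h1)]
    · simp [Real.sqrt_eq_zero_of_nonpos (sub_nonpos.2 (h.trans h1.le))]
  set L := t - r with hL
  have hL0 : 0 < L := sub_pos.2 h
  set a : ℝ → ℝ≥0∞ := (Iio L).indicator (fun r => ENNReal.ofReal (√r)⁻¹) with ha
  have ham : Measurable a := Measurable.indicator (by fun_prop) measurableSet_Iio
  have hpt : ∀ s, ENNReal.ofReal (√(s - r))⁻¹ * ENNReal.ofReal (√(t - s))⁻¹ ≤
      ENNReal.ofReal (√L)⁻¹ * (a (s - r) + a (t - s)) := by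
    intro s
    rcases le_or_gt s r with h1 | h1
    · simp [Real.sqrt_eq_zero_of_nonpos (sub_nonpos.2 h1)]
    rcases le_or_gt t s with h2 | h2
    · simp [Real.sqrt_eq_zero_of_nonpos (sub_nonpos.2 h2)]
    have e1 : a (s - r) = ENNReal.ofReal (√(s - r))⁻¹ :=
      indicator_of_mem (show s - r ∈ Iio L from mem_Iio.2 (by linarith)) _
    have e2 : a (t - s) = ENNReal.ofReal (√(t - s))⁻¹ :=
      indicator_of_mem (show t - s ∈ Iio L from mem_Iio.2 (by linarith)) _
    rw [e1, e2, ← ENNReal.ofReal_mul (by positivity), ← ENNReal.ofReal_add (by positivity)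
      (by positivity), ← ENNReal.ofReal_mul (by positivity)]
    apply ENNReal.ofReal_le_ofReal
    have p1 : 0 < √(s - r) := Real.sqrt_pos.2 (by linarith)
    have p2 : 0 < √(t - s) := Real.sqrt_pos.2 (by linarith)
    have p3 : 0 < √L := Real.sqrt_pos.2 hL0
    have p4 : √L ≤ √(s - r) + √(t - s) := by
      rw [Real.sqrt_le_left (by positivity)]
      nlinarith [Real.sq_sqrt (sub_nonneg.2 h1.le), Real.sq_sqrt (sub_nonneg.2 h2.le),
        mul_pos p1 p2]
    rw [← mul_inv, inv_add_inv p1.ne' p2.ne', inv_mul_eq_div, div_div, le_div_iff₀ (by positivity),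
      inv_mul_eq_div, div_le_iff₀ (by positivity)]
    have := mul_le_mul_of_nonneg_left p4 (mul_pos p1 p2).le
    nlinarith
  have hA : ∫⁻ s, a s = ENNReal.ofReal (2 * √L) := lintegral_inv_sqrt hL0.le
  calc _ ≤ ∫⁻ s, ENNReal.ofReal (√L)⁻¹ * (a (s - r) + a (t - s)) := lintegral_mono hpt
    _ = ENNReal.ofReal (√L)⁻¹ * ((∫⁻ s, a s) + ∫⁻ s, a s) := by
        rw [lintegral_const_mul _ (by fun_prop), lintegral_add_left (by fun_prop),
          lintegral_sub_right_eq_self a, lintegral_sub_left_eq_self a]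
    _ = 4 := by
        rw [hA, ← ENNReal.ofReal_add (by positivity) (by positivity),
          ← ENNReal.ofReal_mul (by positivity)]
        have : (√L)⁻¹ * (2 * √L + 2 * √L) = 4 := by
          have := (Real.sqrt_pos.2 hL0).ne'
          field_simp; norm_num
        rw [this]; norm_num
    _ ≤ 4 := le_rfl

/-- Two half-order integrations amount to one full integration, so singular Lipschitz bounds become
bounded after one more Duhamel integration. -/
lemma abel_abel_le {f : ℝ → ℝ≥0∞} (hf : Measurable f) (t : ℝ) : abel (abel f) t ≤ 4 * ∫⁻ s, f s := by
  have hm : Measurable (Function.uncurry fun s r : ℝ =>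
      f r * ENNReal.ofReal (√(s - r))⁻¹ * ENNReal.ofReal (√(t - s))⁻¹) := by
    have : Measurable fun q : ℝ × ℝ => f q.2 := hf.comp measurable_snd
    exact (this.mul (by fun_prop)).mul (by fun_prop)
  calc abel (abel f) t
      = ∫⁻ s, ∫⁻ r, f r * ENNReal.ofReal (√(s - r))⁻¹ * ENNReal.ofReal (√(t - s))⁻¹ := by
        unfold abel
        congr 1 with s
        rw [lintegral_mul_const' _ _ ENNReal.ofReal_ne_top]
    _ = ∫⁻ r, ∫⁻ s, f r * ENNReal.ofReal (√(s - r))⁻¹ * ENNReal.ofReal (√(t - s))⁻¹ :=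
        lintegral_lintegral_swap hm.aemeasurable
    _ ≤ ∫⁻ r, f r * 4 := by
        refine lintegral_mono fun r => ?_
        simp_rw [mul_assoc]
        rw [lintegral_const_mul _ (by fun_prop)]
        gcongr
        exact lintegral_inv_sqrt_mul_le r t
    _ = 4 * ∫⁻ s, f s := by rw [lintegral_mul_const _ hf, mul_comm]

end

section

/-! ### Test functions and the fundamental solution -/

structure IsTest (Φ : ℝ × ℝ → ℝ) : Prop where
  smooth : ContDiff ℝ ∞ Φ
  supp : HasCompactSupport Φ

/-- The derivative of `Φ` in the direction `v`. -/
noncomputable def pd (v : ℝ × ℝ) (Φ : ℝ × ℝ → ℝ) (p : ℝ × ℝ) : ℝ := fderiv ℝ Φ p v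

variable {Φ : ℝ × ℝ → ℝ} {μ : ℝ}

lemma IsTest.pd (h : IsTest Φ) (v : ℝ × ℝ) : IsTest (pd v Φ) where
  smooth := (h.smooth.fderiv_right (m := ∞) (by simp)).clm_apply contDiff_const
  supp := h.supp.fderiv_apply (𝕜 := ℝ) v

lemma IsTest.differentiable (h : IsTest Φ) : Differentiable ℝ Φ := h.smooth.differentiable (by simp)

lemma IsTest.continuous (h : IsTest Φ) : Continuous Φ := h.smooth.continuous

lemma IsTest.exists_abs_le (h : IsTest Φ) : ∃ C, 0 ≤ C ∧ ∀ p, |Φ p| ≤ C := by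
  obtain ⟨C, hC⟩ := h.supp.exists_bound_of_continuous h.continuous
  exact ⟨C, (abs_nonneg _).trans (hC 0), hC⟩

lemma IsTest.exists_box (h : IsTest Φ) : ∃ R : ℝ, 0 < R ∧ ∀ t x, (R ≤ |t| ∨ R ≤ |x|) → Φ (t, x) = 0 := by
  obtain ⟨R, hR⟩ := h.supp.isCompact.isBounded.subset_closedBall 0
  refine ⟨|R| + 1, by positivity, fun t x hp => ?_⟩
  apply image_eq_zero_of_notMem_tsupport
  intro hm
  have h1 := hR hm
  rw [mem_closedBall_zero_iff, Prod.norm_def] at h1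
  have h2 : |t| ≤ R := (le_max_left _ _).trans h1
  have h3 : |x| ≤ R := (le_max_right _ _).trans h1
  have := le_abs_self R
  rcases hp with hp | hp <;> linarith

lemma IsTest.pd_comm (h : IsTest Φ) (v w : ℝ × ℝ) : UlBurgers.pd v (UlBurgers.pd w Φ) = UlBurgers.pd w (UlBurgers.pd v Φ) := by
  ext p
  have hd : DifferentiableAt ℝ (fderiv ℝ Φ) p :=
    (h.smooth.fderiv_right (m := ∞) (by simp)).differentiable (by simp) p
  have key : ∀ v w, UlBurgers.pd v (UlBurgers.pd w Φ) p = fderiv ℝ (fderiv ℝ Φ) p v w := by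
    intro v w
    unfold UlBurgers.pd
    rw [fderiv_clm_apply hd (by fun_prop)]
    simp
  rw [key, key]
  exact h.smooth.contDiffAt.isSymmSndFDerivAt (by
    rw [minSmoothness_of_isRCLikeNormedField]
    exact ENat.LEInfty.out) v w

lemma IsTest.hasDerivAt_comp (h : IsTest Φ) {f g : ℝ → ℝ} {f' g' r : ℝ} (hf : HasDerivAt f f' r)
    (hg : HasDerivAt g g' r) : HasDerivAt (fun r => Φ (f r, g r))
      (UlBurgers.pd (1, 0) Φ (f r, g r) * f' + UlBurgers.pd (0, 1) Φ (f r, g r) * g') r := by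
  have := (h.differentiable (f r, g r)).hasFDerivAt.comp_hasDerivAt r (hf.prodMk hg)
  refine this.congr_deriv ?_
  unfold UlBurgers.pd
  have e : ((f', g') : ℝ × ℝ) = f' • (1, 0) + g' • (0, 1) := by simp
  rw [e, map_add, map_smul, map_smul]
  simp [mul_comm]

lemma IsTest.hasDerivAt_right (h : IsTest Φ) (t x : ℝ) :
    HasDerivAt (fun x => Φ (t, x)) (UlBurgers.pd (0, 1) Φ (t, x)) x := by
  simpa using h.hasDerivAt_comp (hasDerivAt_const x t) (hasDerivAt_id x)

lemma IsTest.hasDerivAt_left (h : IsTest Φ) (t x : ℝ) :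
    HasDerivAt (fun t => Φ (t, x)) (UlBurgers.pd (1, 0) Φ (t, x)) t := by
  simpa using h.hasDerivAt_comp (hasDerivAt_id t) (hasDerivAt_const t x)

/-- The adjoint heat operator. -/
noncomputable def adj (μ : ℝ) (Φ : ℝ × ℝ → ℝ) (p : ℝ × ℝ) : ℝ :=
  pd (1, 0) Φ p + μ * pd (0, 1) (pd (0, 1) Φ) p

lemma IsTest.adj (h : IsTest Φ) (μ : ℝ) : IsTest (adj μ Φ) where
  smooth := (h.pd (1, 0)).smooth.add (contDiff_const.mul ((h.pd (0, 1)).pd (0, 1)).smooth)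
  supp := (h.pd (1, 0)).supp.add (((h.pd (0, 1)).pd (0, 1)).supp.mul_left)

lemma IsTest.pd_adj (h : IsTest Φ) (μ : ℝ) :
    UlBurgers.pd (0, 1) (UlBurgers.adj μ Φ) = UlBurgers.adj μ (UlBurgers.pd (0, 1) Φ) := by
  have h1 := (h.pd (1, 0)).differentiable
  have h2 := ((h.pd (0, 1)).pd (0, 1)).differentiable
  ext p
  have e : fderiv ℝ (UlBurgers.adj μ Φ) p = fderiv ℝ (UlBurgers.pd (1, 0) Φ) p +
      μ • fderiv ℝ (UlBurgers.pd (0, 1) (UlBurgers.pd (0, 1) Φ)) p := by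
    unfold UlBurgers.adj
    rw [fderiv_fun_add (h1 p) ((h2 p).const_mul μ), fderiv_const_mul (h2 p)]
  rw [UlBurgers.pd, e]
  simp only [add_apply, FunLike.coe_smul, Pi.smul_apply, smul_eq_mul]
  change UlBurgers.pd (0, 1) (UlBurgers.pd (1, 0) Φ) p + _ = _
  rw [h.pd_comm]
  rfl

lemma hk_one_mul_abs (hμ : 0 < μ) : Integrable (fun z => |z| * hk μ 1 z) := by
  have := ((integrable_hkx_one hμ).abs).const_mul (2 * μ)
  refine this.congr (ae_of_all _ fun z => ?_)
  simp only [hkx, mul_one, abs_mul, abs_neg, abs_div, abs_of_nonneg (hk_nonneg μ 1 z),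
    abs_of_pos hμ, abs_two]
  field_simp

lemma integrable_bdd_mul_hk (hμ : 0 < μ) {f : ℝ → ℝ} (hf : Continuous f) {C : ℝ}
    (hC : ∀ z, |f z| ≤ C) (r : ℝ) : Integrable (fun z => f z * hk μ r z) :=
  (integrable_hk hμ r).bdd_mul (c := C) hf.aestronglyMeasurable (ae_of_all _ hC)

lemma integral_scale {r : ℝ} (hr : 0 < r) (f : ℝ → ℝ) :
    ∫ x, f x * hk μ r x = ∫ z, f (√r * z) * hk μ 1 z := by
  have h0 : 0 < √r := Real.sqrt_pos.2 hr
  have := Measure.integral_comp_div (fun z => f (√r * z) * hk μ 1 z) (√r)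
  rw [abs_of_pos h0, smul_eq_mul] at this
  rw [← mul_right_inj' h0.ne', ← this, ← integral_const_mul]
  congr 1 with x
  rw [hk_scale μ hr, mul_div_cancel₀ x h0.ne']
  field_simp

/-- Stein's identity for the heat kernel at time one. -/
lemma stein (hμ : 0 < μ) {f f' : ℝ → ℝ} (hf : ∀ x, HasDerivAt f (f' x) x) (hf' : Continuous f')
    {C : ℝ} (hC : ∀ z, |f z| ≤ C) (hC' : ∀ z, |f' z| ≤ C) :
    ∫ z, f z * (z * hk μ 1 z) = 2 * μ * ∫ z, f' z * hk μ 1 z := by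
  have hc : Continuous f := continuous_iff_continuousAt.2 fun x => (hf x).continuousAt
  have h := integral_mul_deriv_eq_deriv_mul_of_integrable (u := f) (u' := f') (v := hk μ 1)
    (v' := hkx μ 1) (fun x _ => hf x) (fun x _ => hasDerivAt_hk hμ 1 x)
    ((integrable_hkx hμ 1).bdd_mul (c := C) hc.aestronglyMeasurable (ae_of_all _ hC))
    (integrable_bdd_mul_hk hμ hf' hC' 1) (integrable_bdd_mul_hk hμ hc hC 1)
  have e : ∀ z, f z * (z * hk μ 1 z) = -(2 * μ) * (f z * hkx μ 1 z) := by
    intro z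
    rw [hkx]
    field_simp
  simp_rw [e]
  rw [integral_const_mul, h]
  ring

/-- The substitution `x = y + √r z` freezes the kernel at time one, so the time derivative falls on
the test function only. It produces `Φₓ z / (2√r)`, which Stein's identity turns into `μ Φₓₓ`. -/
lemma hasDerivAt_heat_mean (hμ : 0 < μ) (h : IsTest Φ) (s y : ℝ) {r : ℝ} (hr : 0 < r) :
    HasDerivAt (fun r => ∫ z, Φ (s + r, y + √r * z) * hk μ 1 z)
      (∫ z, adj μ Φ (s + r, y + √r * z) * hk μ 1 z) r := by
  have hT := h.pd (1, 0)
  have hX := h.pd (0, 1)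
  have hXX := hX.pd (0, 1)
  obtain ⟨C, hC0, hC⟩ := h.exists_abs_le
  obtain ⟨C1, hC10, hC1⟩ := hT.exists_abs_le
  obtain ⟨C2, hC20, hC2⟩ := hX.exists_abs_le
  obtain ⟨C3, hC30, hC3⟩ := hXX.exists_abs_le
  have hsr : 0 < √r := Real.sqrt_pos.2 hr
  -- On this neighbourhood `√ρ ≥ √r / 2`, so `1 / (2√ρ) ≤ 1 / √r` is a uniform bound.
  have hmem : Ioi (r / 4) ∈ 𝓝 r := Ioi_mem_nhds (by linarith)
  have cont : ∀ {Ψ : ℝ × ℝ → ℝ}, IsTest Ψ → ∀ ρ : ℝ, Continuous fun z => Ψ (s + ρ, y + √ρ * z) :=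
    fun hΨ ρ => hΨ.continuous.comp (by fun_prop)
  have key := hasDerivAt_integral_of_dominated_loc_of_deriv_le (μ := volume) (x₀ := r)
    (F := fun ρ z => Φ (s + ρ, y + √ρ * z) * hk μ 1 z)
    (F' := fun ρ z => (pd (1, 0) Φ (s + ρ, y + √ρ * z) * 1 +
      pd (0, 1) Φ (s + ρ, y + √ρ * z) * (1 / (2 * √ρ) * z)) * hk μ 1 z)
    (bound := fun z => C1 * hk μ 1 z + C2 / √r * (|z| * hk μ 1 z)) hmem
    (Eventually.of_forall fun ρ => ((cont h ρ).measurable.mul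
      (measurable_hk_right μ 1)).aestronglyMeasurable)
    (integrable_bdd_mul_hk hμ (cont h r) (fun z => hC _) 1)
    ((((cont hT r).mul continuous_const).add ((cont hX r).mul (by fun_prop))).measurable.mul
      (measurable_hk_right μ 1)).aestronglyMeasurable
    (ae_of_all _ fun z ρ hρ => ?_)
    (((integrable_hk hμ 1).const_mul _).add ((hk_one_mul_abs hμ).const_mul _))
    (ae_of_all _ fun z ρ hρ => ?_)
  · refine key.2.congr_deriv ?_
    have st := stein hμ (f := fun z => pd (0, 1) Φ (s + r, y + √r * z))
      (f' := fun z => pd (0, 1) (pd (0, 1) Φ) (s + r, y + √r * z) * √r) (C := max C2 (C3 * √r))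
      (fun z => by
        have := (hX.hasDerivAt_right (s + r) (y + √r * z)).comp z
          (((hasDerivAt_id z).const_mul √r).const_add y)
        exact this.congr_deriv (by simp))
      ((cont hXX r).mul continuous_const) (fun z => (hC2 _).trans (le_max_left _ _))
      (fun z => by
        rw [abs_mul, abs_of_pos hsr]
        exact (mul_le_mul_of_nonneg_right (hC3 _) hsr.le).trans (le_max_right _ _))
    have i1 := integrable_bdd_mul_hk hμ (cont hT r) (fun z => hC1 _) 1
    have i2 : Integrable fun z => pd (0, 1) Φ (s + r, y + √r * z) * (z * hk μ 1 z) := by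
      refine Integrable.bdd_mul (c := C2) ?_ (cont hX r).aestronglyMeasurable
        (ae_of_all _ fun z => hC2 _)
      refine (hk_one_mul_abs hμ).mono
        (measurable_id.mul (measurable_hk_right μ 1)).aestronglyMeasurable
        (ae_of_all _ fun z => ?_)
      simp
    have i3 := integrable_bdd_mul_hk hμ (cont hXX r) (fun z => hC3 _) 1
    have e1 : ∀ z, (pd (1, 0) Φ (s + r, y + √r * z) * 1 +
        pd (0, 1) Φ (s + r, y + √r * z) * (1 / (2 * √r) * z)) * hk μ 1 z =
        pd (1, 0) Φ (s + r, y + √r * z) * hk μ 1 z +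
          1 / (2 * √r) * (pd (0, 1) Φ (s + r, y + √r * z) * (z * hk μ 1 z)) := fun z => by ring
    have e2 : ∀ z, adj μ Φ (s + r, y + √r * z) * hk μ 1 z =
        pd (1, 0) Φ (s + r, y + √r * z) * hk μ 1 z +
          μ * (pd (0, 1) (pd (0, 1) Φ) (s + r, y + √r * z) * hk μ 1 z) := fun z => by
      rw [adj]; ring
    simp_rw [e1, e2]
    rw [integral_add i1 (i2.const_mul _), integral_add i1 (i3.const_mul _), integral_const_mul,
      integral_const_mul, st]
    congr 1
    have e3 : ∀ z, pd (0, 1) (pd (0, 1) Φ) (s + r, y + √r * z) * √r * hk μ 1 z =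
        √r * (pd (0, 1) (pd (0, 1) Φ) (s + r, y + √r * z) * hk μ 1 z) := fun z => by ring
    simp_rw [e3]
    rw [integral_const_mul]
    field_simp
  · have hρ' : r / 4 < ρ := hρ
    have hsρ : √r / 2 ≤ √ρ := by
      rw [show √r / 2 = √(r / 4) by
        rw [Real.sqrt_div' _ (by norm_num), show (4:ℝ) = 2 ^ 2 by norm_num, Real.sqrt_sq (by norm_num)]]
      exact Real.sqrt_le_sqrt hρ'.le
    have hk0 := hk_nonneg μ 1 z
    rw [Real.norm_eq_abs, abs_mul, abs_of_nonneg hk0]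
    have : |pd (1, 0) Φ (s + ρ, y + √ρ * z) * 1 +
        pd (0, 1) Φ (s + ρ, y + √ρ * z) * (1 / (2 * √ρ) * z)| ≤ C1 + C2 / √r * |z| := by
      refine (abs_add_le _ _).trans ?_
      rw [mul_one, abs_mul, abs_mul]
      have e1 : |1 / (2 * √ρ)| ≤ 1 / √r := by
        rw [abs_of_nonneg (by positivity)]
        exact one_div_le_one_div_of_le hsr (by linarith)
      have e2 := mul_le_mul_of_nonneg_right e1 (abs_nonneg z)
      have e3 := mul_le_mul (hC2 (s + ρ, y + √ρ * z)) e2 (by positivity) hC20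
      have e4 : C2 * (1 / √r * |z|) = C2 / √r * |z| := by ring
      linarith [hC1 (s + ρ, y + √ρ * z)]
    calc _ ≤ (C1 + C2 / √r * |z|) * hk μ 1 z := mul_le_mul_of_nonneg_right this hk0
      _ = _ := by ring
  · have hρ' : 0 < ρ := lt_trans (by positivity) hρ
    exact ((h.hasDerivAt_comp ((hasDerivAt_id ρ).const_add s)
      (((Real.hasDerivAt_sqrt hρ'.ne').mul_const z).const_add y))).mul_const _

/-- The inner integral is the derivative of the Gaussian mean of `Φ` along the heat flow started at
`(s, y)`. That mean equals `Φ(s, y)` at elapsed time zero and vanishes once time has left the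
support. -/
lemma integral_adj_mul_hk (hμ : 0 < μ) (h : IsTest Φ) (s y : ℝ) :
    ∫ t, ∫ x, adj μ Φ (t, x) * hk μ (t - s) (x - y) = -Φ (s, y) := by
  have hA := h.adj μ
  obtain ⟨C, hC0, hC⟩ := h.exists_abs_le
  obtain ⟨CA, hCA0, hCA⟩ := hA.exists_abs_le
  obtain ⟨R1, hR1, hRz1⟩ := h.exists_box
  obtain ⟨R2, hR2, hRz2⟩ := hA.exists_box
  set m : ℝ → ℝ := fun r => ∫ z, Φ (s + r, y + √r * z) * hk μ 1 z with hm
  set m' : ℝ → ℝ := fun r => ∫ z, adj μ Φ (s + r, y + √r * z) * hk μ 1 z with hm'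
  have cont : ∀ {Ψ : ℝ × ℝ → ℝ}, IsTest Ψ →
      Continuous fun r => ∫ z, Ψ (s + r, y + √r * z) * hk μ 1 z := by
    intro Ψ hΨ
    obtain ⟨D, -, hD⟩ := hΨ.exists_abs_le
    refine continuous_of_dominated (bound := fun z => D * hk μ 1 z) (fun r => ?_)
      (fun r => ae_of_all _ fun z => ?_) ((integrable_hk hμ 1).const_mul _)
      (ae_of_all _ fun z => ?_)
    · exact ((hΨ.continuous.comp (by fun_prop :
        Continuous fun z : ℝ => (s + r, y + √r * z))).measurable.mul
        (measurable_hk_right μ 1)).aestronglyMeasurable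
    · rw [Real.norm_eq_abs, abs_mul, abs_of_nonneg (hk_nonneg μ 1 z)]
      exact mul_le_mul_of_nonneg_right (hD _) (hk_nonneg μ 1 z)
    · exact (hΨ.continuous.comp (by fun_prop)).mul continuous_const
  -- At elapsed times beyond `N` both the test function and its adjoint image vanish identically in
  -- `x`.
  set N := max R1 R2 + |s| with hN
  have hN0 : 0 ≤ N := add_nonneg (hR1.le.trans (le_max_left _ _)) (abs_nonneg _)
  have large : ∀ r, N ≤ r → max R1 R2 ≤ |s + r| := fun r hr => by
    have h1 := neg_abs_le s
    exact le_trans (by linarith) (le_abs_self (s + r))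
  have hmN : m N = 0 := by
    simp only [hm]
    have : ∀ z, Φ (s + N, y + √N * z) = 0 := fun z =>
      hRz1 _ _ (Or.inl ((le_max_left _ _).trans (large N le_rfl)))
    simp [this]
  have hm0 : m 0 = Φ (s, y) := by
    simp only [hm, add_zero, Real.sqrt_zero, zero_mul]
    rw [integral_const_mul, (integral_hk_one hμ).2, mul_one]
  have ftc := intervalIntegral.integral_eq_sub_of_hasDerivAt_of_le hN0 (cont h).continuousOn
    (fun r hr => hasDerivAt_heat_mean hμ h s y hr.1) ((cont hA).intervalIntegrable _ _)
  have e1 : ∀ t, ∫ x, adj μ Φ (t, x) * hk μ (t - s) (x - y) =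
      (Ioc 0 N).indicator m' (t - s) := by
    intro t
    by_cases ht : t - s ∈ Ioc 0 N
    · rw [indicator_of_mem ht]
      have := integral_add_right_eq_self (μ := volume)
        (fun x => adj μ Φ (t, x) * hk μ (t - s) (x - y)) y
      simp only [add_sub_cancel_right] at this
      rw [← this, integral_scale ht.1 (fun x => adj μ Φ (t, x + y))]
      simp only [hm', add_sub_cancel, add_comm y]
    · rw [indicator_of_notMem ht]
      rcases le_or_gt (t - s) 0 with h0 | h0
      · simp [hk_of_nonpos hμ h0]
      · have h1 : N ≤ t - s := (not_le.1 fun h => ht ⟨h0, h⟩).le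
        have h2 := large _ h1
        rw [add_sub_cancel] at h2
        have : ∀ x, adj μ Φ (t, x) = 0 := fun x =>
          hRz2 _ _ (Or.inl ((le_max_right _ _).trans h2))
        simp [this]
  simp_rw [e1]
  rw [integral_sub_right_eq_self (fun t => (Ioc 0 N).indicator m' t) s,
    integral_indicator measurableSet_Ioc, ← intervalIntegral.integral_of_le hN0, ftc]
  change m N - m 0 = _
  rw [hmN, hm0, zero_sub]

/-- Integration by parts in `x` and the commutation of `∂ₓ` with the adjoint operator reduce this to
the preceding identity for `Φₓ`. -/
lemma integral_adj_mul_hkx (hμ : 0 < μ) (h : IsTest Φ) (s y : ℝ) :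
    ∫ t, ∫ x, adj μ Φ (t, x) * hkx μ (t - s) (x - y) = pd (0, 1) Φ (s, y) := by
  have hA := h.adj μ
  obtain ⟨C, -, hC⟩ := hA.exists_abs_le
  obtain ⟨C', -, hC'⟩ := (hA.pd (0, 1)).exists_abs_le
  have e : ∀ t, ∫ x, adj μ Φ (t, x) * hkx μ (t - s) (x - y) =
      -∫ x, adj μ (pd (0, 1) Φ) (t, x) * hk μ (t - s) (x - y) := by
    intro t
    rw [← h.pd_adj μ]
    have i1 : Integrable fun x => hk μ (t - s) (x - y) := (integrable_hk hμ _).comp_sub_right y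
    have i2 : Integrable fun x => hkx μ (t - s) (x - y) := (integrable_hkx hμ _).comp_sub_right y
    have c1 : Continuous fun x => adj μ Φ (t, x) := hA.continuous.comp (by fun_prop)
    have c2 : Continuous fun x => pd (0, 1) (adj μ Φ) (t, x) :=
      (hA.pd (0, 1)).continuous.comp (by fun_prop)
    refine integral_mul_deriv_eq_deriv_mul_of_integrable
      (fun x _ => hA.hasDerivAt_right t x) (fun x _ => ?_)
      (i2.bdd_mul (c := C) c1.aestronglyMeasurable (ae_of_all _ fun x => hC _))
      (i1.bdd_mul (c := C') c2.aestronglyMeasurable (ae_of_all _ fun x => hC' _))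
      (i1.bdd_mul (c := C) c1.aestronglyMeasurable (ae_of_all _ fun x => hC _))
    have := (hasDerivAt_hk hμ (t - s) (x - y)).comp x ((hasDerivAt_id x).sub_const y)
    exact this.congr_deriv (by simp)
  simp_rw [e]
  rw [integral_neg, integral_adj_mul_hk hμ (h.pd (0, 1)), neg_neg]

end

section

/-! ### The truncated nonlinearity -/

/-- The truncation of the identity at height `K`. -/
def clamp (K v : ℝ) : ℝ := max (-K) (min K v)

/-- A primitive of the truncation; it equals `v² / 2` for `|v| ≤ K`. -/
noncomputable def ftr (K v : ℝ) : ℝ := ∫ s in (0:ℝ)..v, clamp K s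

lemma continuous_clamp (K : ℝ) : Continuous (clamp K) := by unfold clamp; fun_prop

lemma abs_clamp_le {K : ℝ} (hK : 0 ≤ K) (v : ℝ) : |clamp K v| ≤ K :=
  abs_le.2 ⟨le_max_left _ _, max_le (by linarith) (min_le_left _ _)⟩

lemma abs_clamp_le_abs {K : ℝ} (hK : 0 ≤ K) (v : ℝ) : |clamp K v| ≤ |v| := by
  unfold clamp
  rcases le_total 0 v with h | h
  · rw [abs_of_nonneg h, abs_of_nonneg (le_max_of_le_right (le_min hK h))]
    exact max_le (by linarith) (min_le_right _ _)
  · rw [abs_of_nonpos h, min_eq_right (h.trans hK), abs_of_nonpos (max_le (by linarith) h)]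
    exact neg_le_neg (le_max_right _ _)

lemma clamp_eq_self {K v : ℝ} (h : |v| ≤ K) : clamp K v = v := by
  rw [clamp, min_eq_right (abs_le.1 h).2, max_eq_right (abs_le.1 h).1]

lemma ftr_zero (K : ℝ) : ftr K 0 = 0 := by simp [ftr]

lemma hasDerivAt_ftr (K v : ℝ) : HasDerivAt (ftr K) (clamp K v) v :=
  intervalIntegral.integral_hasDerivAt_right ((continuous_clamp K).intervalIntegrable _ _)
    ((continuous_clamp K).stronglyMeasurableAtFilter _ _) (continuous_clamp K).continuousAt

lemma deriv_ftr (K : ℝ) : deriv (ftr K) = clamp K := funext fun v => (hasDerivAt_ftr K v).deriv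

lemma contDiff_ftr (K : ℝ) : ContDiff ℝ 1 (ftr K) :=
  contDiff_one_iff_deriv.2 ⟨fun v => (hasDerivAt_ftr K v).differentiableAt,
    deriv_ftr K ▸ continuous_clamp K⟩

lemma abs_ftr_sub_le {K : ℝ} (hK : 0 ≤ K) (a b : ℝ) : |ftr K a - ftr K b| ≤ K * |a - b| := by
  have := Convex.norm_image_sub_le_of_norm_hasDerivWithin_le (f := ftr K) (C := K) (s := univ)
    (fun x _ => (hasDerivAt_ftr K x).hasDerivWithinAt) (fun x _ => abs_clamp_le hK x)
    convex_univ (mem_univ b) (mem_univ a)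
  exact this

lemma measurable_ftr (K : ℝ) : Measurable (ftr K) := (contDiff_ftr K).continuous.measurable

/-! ### Duhamel integrals -/

/-- The heat semigroup. -/
noncomputable def heat (μ : ℝ) (h : ℝ → ℝ) (t x : ℝ) : ℝ := ∫ y, h y * hk μ t (x - y)

/-- The Duhamel integral. -/
noncomputable def duh (μ : ℝ) (H : ℝ → ℝ → ℝ) (t x : ℝ) : ℝ :=
  ∫ q : ℝ × ℝ, H q.1 q.2 * hk μ (t - q.1) (x - q.2)

/-- The Duhamel integral of a source in divergence form. -/
noncomputable def duhx (μ : ℝ) (H : ℝ → ℝ → ℝ) (t x : ℝ) : ℝ :=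
  ∫ q : ℝ × ℝ, H q.1 q.2 * hkx μ (t - q.1) (x - q.2)

variable {μ : ℝ} {H H' : ℝ → ℝ → ℝ} {b : ℝ → ℝ≥0∞}

lemma measurable_hk_shift (μ t x : ℝ) : Measurable fun q : ℝ × ℝ => hk μ (t - q.1) (x - q.2) :=
  (measurable_hk μ).comp ((measurable_const.sub measurable_fst).prodMk
    (measurable_const.sub measurable_snd))

lemma measurable_hkx_shift (μ t x : ℝ) : Measurable fun q : ℝ × ℝ => hkx μ (t - q.1) (x - q.2) :=
  (measurable_hkx μ).comp ((measurable_const.sub measurable_fst).prodMk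
    (measurable_const.sub measurable_snd))

/-- Bounding the source by its slice norm decouples the variables: only the `L¹` norms of the kernel
slices remain. -/
lemma lintegral_mul_kernel_le (hH : Measurable (Function.uncurry H))
    (hb : ∀ᵐ s, ∀ᵐ y, ‖H s y‖ₑ ≤ b s) {k : ℝ × ℝ → ℝ} (hk : Measurable k) :
    ∫⁻ q : ℝ × ℝ, ‖H q.1 q.2 * k q‖ₑ ≤ ∫⁻ s, b s * ∫⁻ y, ‖k (s, y)‖ₑ := by
  have hm : Measurable fun q : ℝ × ℝ => ‖H q.1 q.2 * k q‖ₑ := (hH.mul hk).enorm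
  rw [Measure.volume_eq_prod, lintegral_prod _ hm.aemeasurable]
  refine lintegral_mono_ae ?_
  filter_upwards [hb] with s hs
  have hks : Measurable fun y => ‖k (s, y)‖ₑ := (hk.comp measurable_prodMk_left).enorm
  rw [← lintegral_const_mul _ hks]
  refine lintegral_mono_ae ?_
  filter_upwards [hs] with y hy
  rw [enorm_mul]
  gcongr

lemma measurable_mul_abel (hbm : Measurable b) (t : ℝ) :
    Measurable fun s => b s * ENNReal.ofReal (√(t - s))⁻¹ := hbm.mul (by fun_prop)

lemma lintegral_duhx_le (hμ : 0 < μ) (hH : Measurable (Function.uncurry H))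
    (hb : ∀ᵐ s, ∀ᵐ y, ‖H s y‖ₑ ≤ b s) (hbm : Measurable b) (t x : ℝ) :
    ∫⁻ q : ℝ × ℝ, ‖H q.1 q.2 * hkx μ (t - q.1) (x - q.2)‖ₑ ≤ ENNReal.ofReal (hkc μ) * abel b t := by
  refine (lintegral_mul_kernel_le hH hb (measurable_hkx_shift μ t x)).trans (le_of_eq ?_)
  rw [abel, ← lintegral_const_mul _ (measurable_mul_abel hbm t)]
  congr 1 with s
  rw [lintegral_sub_left_eq_self (fun y => ‖hkx μ (t - s) y‖ₑ), lintegral_hkx hμ,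
    ENNReal.ofReal_mul (hkc_nonneg μ)]
  ring

lemma enorm_duhx_le (hμ : 0 < μ) (hH : Measurable (Function.uncurry H))
    (hb : ∀ᵐ s, ∀ᵐ y, ‖H s y‖ₑ ≤ b s) (hbm : Measurable b) (t x : ℝ) :
    ‖duhx μ H t x‖ₑ ≤ ENNReal.ofReal (hkc μ) * abel b t :=
  (enorm_integral_le_lintegral_enorm _).trans (lintegral_duhx_le hμ hH hb hbm t x)

lemma integrable_duhx (hμ : 0 < μ) (hH : Measurable (Function.uncurry H))
    (hb : ∀ᵐ s, ∀ᵐ y, ‖H s y‖ₑ ≤ b s) (hbm : Measurable b) {t : ℝ} (ht : abel b t ≠ ⊤) (x : ℝ) :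
    Integrable fun q : ℝ × ℝ => H q.1 q.2 * hkx μ (t - q.1) (x - q.2) :=
  ⟨(hH.mul (measurable_hkx_shift μ t x)).aestronglyMeasurable,
    (lintegral_duhx_le hμ hH hb hbm t x).trans_lt
      (ENNReal.mul_lt_top ENNReal.ofReal_lt_top ht.lt_top)⟩

lemma lintegral_duh_le (hμ : 0 < μ) (hH : Measurable (Function.uncurry H))
    (hb : ∀ᵐ s, ∀ᵐ y, ‖H s y‖ₑ ≤ b s) (t x : ℝ) :
    ∫⁻ q : ℝ × ℝ, ‖H q.1 q.2 * hk μ (t - q.1) (x - q.2)‖ₑ ≤ ∫⁻ s in Iio t, b s := by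
  refine (lintegral_mul_kernel_le hH hb (measurable_hk_shift μ t x)).trans ?_
  rw [← lintegral_indicator measurableSet_Iio]
  refine lintegral_mono fun s => ?_
  rw [lintegral_sub_left_eq_self (fun y => ‖hk μ (t - s) y‖ₑ)]
  by_cases hs : s ∈ Iio t
  · rw [indicator_of_mem hs]
    exact mul_le_of_le_one_right' (lintegral_hk_le hμ _)
  · rw [indicator_of_notMem hs]
    have : t - s ≤ 0 := sub_nonpos.2 (not_lt.1 hs)
    simp [hk_of_nonpos hμ this]

lemma integrable_duh (hμ : 0 < μ) (hH : Measurable (Function.uncurry H))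
    (hb : ∀ᵐ s, ∀ᵐ y, ‖H s y‖ₑ ≤ b s) (hfin : ∫⁻ s, b s ≠ ⊤) (t x : ℝ) :
    Integrable fun q : ℝ × ℝ => H q.1 q.2 * hk μ (t - q.1) (x - q.2) :=
  ⟨(hH.mul (measurable_hk_shift μ t x)).aestronglyMeasurable,
    ((lintegral_duh_le hμ hH hb t x).trans (setLIntegral_le_lintegral _ _)).trans_lt hfin.lt_top⟩

lemma enorm_duh_le (hμ : 0 < μ) (hH : Measurable (Function.uncurry H))
    (hb : ∀ᵐ s, ∀ᵐ y, ‖H s y‖ₑ ≤ b s) (t x : ℝ) : ‖duh μ H t x‖ₑ ≤ ∫⁻ s in Iio t, b s :=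
  (enorm_integral_le_lintegral_enorm _).trans (lintegral_duh_le hμ hH hb t x)

/-- Shifting the translation from the kernel to the source makes Lipschitz bounds of this term
depend on those of the source. Differentiating the kernel a second time would give a singularity of
order `1 / r`, which is not integrable. -/
lemma duhx_translate (μ : ℝ) (H : ℝ → ℝ → ℝ) (t x h : ℝ) :
    duhx μ H t (x + h) = duhx μ (fun s y => H s (y + h)) t x := by
  unfold duhx
  rw [← integral_add_right_eq_self (μ := (volume : Measure (ℝ × ℝ)))
    (fun q : ℝ × ℝ => H q.1 q.2 * hkx μ (t - q.1) (x + h - q.2)) (0, h)]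
  congr 1 with q
  simp only [Prod.fst_add, Prod.snd_add, add_zero]
  congr 2
  ring

/-- The translates of a Duhamel integral. -/
lemma enorm_duh_translate_le (hμ : 0 < μ) (hH : Measurable (Function.uncurry H))
    (hb : ∀ᵐ s, ∀ᵐ y, ‖H s y‖ₑ ≤ b s) (hbm : Measurable b) (hfin : ∫⁻ s, b s ≠ ⊤) (t x h : ℝ) :
    ‖duh μ H t (x + h) - duh μ H t x‖ₑ ≤ ‖h‖ₑ * (ENNReal.ofReal (hkc μ) * abel b t) := by
  have e : duh μ H t (x + h) - duh μ H t x =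
      ∫ q : ℝ × ℝ, H q.1 q.2 * (hk μ (t - q.1) (x + h - q.2) - hk μ (t - q.1) (x - q.2)) := by
    unfold duh
    rw [← integral_sub (integrable_duh hμ hH hb hfin t (x + h)) (integrable_duh hμ hH hb hfin t x)]
    congr 1 with q
    ring
  rw [e]
  refine (enorm_integral_le_lintegral_enorm _).trans
    ((lintegral_mul_kernel_le hH hb
      ((measurable_hk_shift μ t (x + h)).sub (measurable_hk_shift μ t x))).trans ?_)
  rw [abel, ← mul_assoc, ← lintegral_const_mul _ (measurable_mul_abel hbm t)]
  refine lintegral_mono fun s => ?_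
  have h1 := lintegral_hk_translate_le hμ (t - s) h
  have h2 : ∫⁻ y, ‖hk μ (t - s) (x + h - y) - hk μ (t - s) (x - y)‖ₑ =
      ∫⁻ y, ‖hk μ (t - s) (y + h) - hk μ (t - s) y‖ₑ := by
    rw [← lintegral_sub_left_eq_self (fun y => ‖hk μ (t - s) (y + h) - hk μ (t - s) y‖ₑ) x]
    congr 1 with y
    rw [sub_add_eq_add_sub]
  change b s * ∫⁻ y, ‖hk μ (t - s) (x + h - y) - hk μ (t - s) (x - y)‖ₑ ≤ _
  rw [h2]
  refine (mul_le_mul_right h1 _).trans (le_of_eq ?_)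
  rw [ENNReal.ofReal_mul (hkc_nonneg μ)]
  ring

lemma integrable_heat (hμ : 0 < μ) {h : ℝ → ℝ} (hh : Measurable h) {U : ℝ} (hU : ∀ x, |h x| ≤ U)
    (t x : ℝ) : Integrable fun y => h y * hk μ t (x - y) :=
  ((integrable_hk hμ t).comp_sub_left x).bdd_mul (c := U) hh.aestronglyMeasurable (ae_of_all _ hU)

lemma abs_heat_le (hμ : 0 < μ) {h : ℝ → ℝ} {U : ℝ} (hU : ∀ x, |h x| ≤ U)
    {t : ℝ} (ht : 0 < t) (x : ℝ) : |heat μ h t x| ≤ U := by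
  have i2 : Integrable fun y => hk μ t (x - y) := (integrable_hk hμ t).comp_sub_left x
  calc |heat μ h t x| ≤ ∫ y, U * hk μ t (x - y) := by
        rw [← Real.norm_eq_abs, heat]
        refine norm_integral_le_of_norm_le (i2.const_mul U) (ae_of_all _ fun y => ?_)
        rw [norm_mul, Real.norm_eq_abs, Real.norm_eq_abs, abs_of_nonneg (hk_nonneg _ _ _)]
        exact mul_le_mul_of_nonneg_right (hU y) (hk_nonneg _ _ _)
    _ = U := by
        rw [integral_const_mul, integral_sub_left_eq_self (hk μ t), integral_hk hμ ht, mul_one]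

lemma enorm_heat_translate_le (hμ : 0 < μ) {u : ℝ → ℝ} (hu : Measurable u) {U : ℝ}
    (hU : ∀ x, |u x| ≤ U) (t x h : ℝ) :
    ‖heat μ u t (x + h) - heat μ u t x‖ₑ ≤
      ‖h‖ₑ * (ENNReal.ofReal U * ENNReal.ofReal (hkc μ) * ENNReal.ofReal (√t)⁻¹) := by
  have e : heat μ u t (x + h) - heat μ u t x =
      ∫ y, u y * (hk μ t (x + h - y) - hk μ t (x - y)) := by
    unfold heat
    rw [← integral_sub (integrable_heat hμ hu hU t (x + h)) (integrable_heat hμ hu hU t x)]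
    congr 1 with y
    ring
  rw [e]
  calc _ ≤ ∫⁻ y, ENNReal.ofReal U * ‖hk μ t (x + h - y) - hk μ t (x - y)‖ₑ := by
        refine (enorm_integral_le_lintegral_enorm _).trans (lintegral_mono fun y => ?_)
        rw [enorm_mul]
        gcongr
        rw [Real.enorm_eq_ofReal_abs]
        exact ENNReal.ofReal_le_ofReal (hU y)
    _ = ENNReal.ofReal U * ∫⁻ y, ‖hk μ t (y + h) - hk μ t y‖ₑ := by
        rw [lintegral_const_mul' _ _ ENNReal.ofReal_ne_top,
          ← lintegral_sub_left_eq_self (fun y => ‖hk μ t (y + h) - hk μ t y‖ₑ) x]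
        congr 2 with y
        rw [sub_add_eq_add_sub]
    _ ≤ _ := by
        refine (mul_le_mul_right (lintegral_hk_translate_le hμ t h) _).trans (le_of_eq ?_)
        rw [ENNReal.ofReal_mul (hkc_nonneg μ)]
        ring

lemma measurable_duhx (hH : Measurable (Function.uncurry H)) :
    Measurable (Function.uncurry (duhx μ H)) := by
  have hm : Measurable (Function.uncurry fun (p q : ℝ × ℝ) =>
      H q.1 q.2 * hkx μ (p.1 - q.1) (p.2 - q.2)) := by
    have h1 : Measurable fun z : (ℝ × ℝ) × (ℝ × ℝ) => H z.2.1 z.2.2 := hH.comp measurable_snd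
    have h2 : Measurable fun z : (ℝ × ℝ) × (ℝ × ℝ) => hkx μ (z.1.1 - z.2.1) (z.1.2 - z.2.2) :=
      (measurable_hkx μ).comp (((measurable_fst.comp measurable_fst).sub
        (measurable_fst.comp measurable_snd)).prodMk
        ((measurable_snd.comp measurable_fst).sub (measurable_snd.comp measurable_snd)))
    exact h1.mul h2
  exact (hm.stronglyMeasurable.integral_prod_right).measurable

lemma measurable_duh (hH : Measurable (Function.uncurry H)) :
    Measurable (Function.uncurry (duh μ H)) := by
  have hm : Measurable (Function.uncurry fun (p q : ℝ × ℝ) =>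
      H q.1 q.2 * hk μ (p.1 - q.1) (p.2 - q.2)) := by
    have h1 : Measurable fun z : (ℝ × ℝ) × (ℝ × ℝ) => H z.2.1 z.2.2 := hH.comp measurable_snd
    have h2 : Measurable fun z : (ℝ × ℝ) × (ℝ × ℝ) => hk μ (z.1.1 - z.2.1) (z.1.2 - z.2.2) :=
      (measurable_hk μ).comp (((measurable_fst.comp measurable_fst).sub
        (measurable_fst.comp measurable_snd)).prodMk
        ((measurable_snd.comp measurable_fst).sub (measurable_snd.comp measurable_snd)))
    exact h1.mul h2
  exact (hm.stronglyMeasurable.integral_prod_right).measurable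

lemma measurable_heat {u : ℝ → ℝ} (hu : Measurable u) : Measurable (Function.uncurry (heat μ u)) := by
  have hm : Measurable (Function.uncurry fun (p : ℝ × ℝ) (y : ℝ) => u y * hk μ p.1 (p.2 - y)) := by
    have h2 : Measurable fun z : (ℝ × ℝ) × ℝ => hk μ z.1.1 (z.1.2 - z.2) :=
      (measurable_hk μ).comp ((measurable_fst.comp measurable_fst).prodMk
        ((measurable_snd.comp measurable_fst).sub measurable_snd))
    exact (hu.comp measurable_snd).mul h2
  exact (hm.stronglyMeasurable.integral_prod_right).measurable

end

section

/-! ### The fixed point of the mild formulation -/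

/-- Everywhere defined and everywhere bounded data of the mild problem: `FF` is the total source,
`φ` a bound of its `L^∞` norms and `κ` a bound of the Lipschitz constants of `g`. -/
structure MildData (T U G : ℝ) (u0 : ℝ → ℝ) (FF g : ℝ → ℝ → ℝ) (φ κ : ℝ → ℝ) : Prop where
  u0_meas : Measurable u0
  u0_le : ∀ x, |u0 x| ≤ U
  FF_meas : Measurable (Function.uncurry FF)
  FF_le : ∀ s y, |FF s y| ≤ φ s
  φ_meas : Measurable φ
  φ_zero : ∀ s, s ∉ Icc 0 T → φ s = 0
  φ_int : ∫⁻ s, ENNReal.ofReal (φ s) ≠ ⊤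
  g_meas : Measurable (Function.uncurry g)
  g_le : ∀ s y, |g s y| ≤ G
  κ_meas : Measurable κ
  κ_nonneg : ∀ s, 0 ≤ κ s
  κ_int : ∫⁻ s, ENNReal.ofReal (κ s) ≠ ⊤
  g_lip : ∀ᵐ s, s ∈ Icc 0 T → ∀ h, ∀ᵐ y, |g s (y + h) - g s y| ≤ κ s * |h|

open Classical in
/-- The truncated flux on `[0, T]`. -/
noncomputable def src (T K : ℝ) (g w : ℝ → ℝ → ℝ) (s y : ℝ) : ℝ :=
  if s ∈ Icc 0 T then ftr K (w s y + g s y) else 0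

/-- The map whose fixed points are the mild solutions. -/
noncomputable def pic (μ T K : ℝ) (u0 : ℝ → ℝ) (FF g w : ℝ → ℝ → ℝ) (t x : ℝ) : ℝ :=
  heat μ u0 t x + duh μ FF t x - duhx μ (src T K g w) t x

/-- A majorant of the Lipschitz constants. -/
noncomputable def lipMaj (α : ℝ≥0∞) (Φ : ℝ → ℝ≥0∞) (C : ℝ≥0∞) (l t : ℝ) : ℝ≥0∞ :=
  α * ENNReal.ofReal (√t)⁻¹ + abel Φ t + C * ENNReal.ofReal (Real.exp (l * t))

variable {μ T U G K l : ℝ} {u0 : ℝ → ℝ} {FF g w w' H : ℝ → ℝ → ℝ} {φ κ : ℝ → ℝ}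

lemma measurable_lipMaj (α : ℝ≥0∞) {Φ : ℝ → ℝ≥0∞} (hΦ : Measurable Φ) (C : ℝ≥0∞) (l : ℝ) :
    Measurable (lipMaj α Φ C l) := by
  have := measurable_abel hΦ
  unfold lipMaj
  fun_prop

/-- The two singular parts of the majorant become constants, and the exponential part reproduces
itself with the small factor `√(π / l)`. -/
lemma abel_lipMaj_le (α : ℝ≥0∞) {Φ : ℝ → ℝ≥0∞} (hΦ : Measurable Φ) (C : ℝ≥0∞) (hl : 0 < l) (t : ℝ) :
    abel (lipMaj α Φ C l) t ≤
      4 * α + 4 * (∫⁻ s, Φ s) + C * ENNReal.ofReal (√(Real.pi / l) * Real.exp (l * t)) := by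
  have m1 : Measurable fun s : ℝ => α * ENNReal.ofReal (√s)⁻¹ := by fun_prop
  have m2 := measurable_abel hΦ
  have e : abel (lipMaj α Φ C l) t = abel (fun s => α * ENNReal.ofReal (√s)⁻¹) t +
      abel (abel Φ) t + C * ENNReal.ofReal (√(Real.pi / l) * Real.exp (l * t)) := by
    have m3 : Measurable fun s : ℝ => α * ENNReal.ofReal (√s)⁻¹ + abel Φ s := m1.add m2
    rw [← abel_exp hl, ← abel_const_mul (by fun_prop), ← abel_add m1, ← abel_add m3]
    rfl
  rw [e]
  gcongr
  · rw [abel_const_mul (by fun_prop), mul_comm]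
    gcongr
    have := lintegral_inv_sqrt_mul_le 0 t
    simp only [sub_zero] at this
    exact this
  · exact abel_abel_le hΦ t

lemma duhx_of_abs_le_exp (hμ : 0 < μ) (hl : 0 < l) (hH : Measurable (Function.uncurry H)) {D : ℝ}
    (hD : 0 ≤ D) (h : ∀ s y, |H s y| ≤ D * Real.exp (l * s)) (t x : ℝ) :
    Integrable (fun q : ℝ × ℝ => H q.1 q.2 * hkx μ (t - q.1) (x - q.2)) ∧
      |duhx μ H t x| ≤ hkc μ * √(Real.pi / l) * D * Real.exp (l * t) := by
  have hb : ∀ᵐ s, ∀ᵐ y, ‖H s y‖ₑ ≤ ENNReal.ofReal D * ENNReal.ofReal (Real.exp (l * s)) := by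
    refine ae_of_all _ fun s => ae_of_all _ fun y => ?_
    rw [Real.enorm_eq_ofReal_abs, ← ENNReal.ofReal_mul hD]
    exact ENNReal.ofReal_le_ofReal (h s y)
  have hbm : Measurable fun s : ℝ => ENNReal.ofReal D * ENNReal.ofReal (Real.exp (l * s)) := by
    fun_prop
  have ha : abel (fun s : ℝ => ENNReal.ofReal D * ENNReal.ofReal (Real.exp (l * s))) t =
      ENNReal.ofReal (D * (√(Real.pi / l) * Real.exp (l * t))) := by
    rw [abel_const_mul (by fun_prop), abel_exp hl, ← ENNReal.ofReal_mul hD]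
  refine ⟨integrable_duhx hμ hH hb hbm (by rw [ha]; exact ENNReal.ofReal_ne_top) x, ?_⟩
  have := enorm_duhx_le hμ hH hb hbm t x
  rw [ha, ← ENNReal.ofReal_mul (hkc_nonneg μ), Real.enorm_eq_ofReal_abs] at this
  have h0 := hkc_nonneg μ
  have := (ENNReal.ofReal_le_ofReal_iff (by positivity)).1 this
  linarith

lemma measurable_src (hg : Measurable (Function.uncurry g)) (hw : Measurable (Function.uncurry w)) :
    Measurable (Function.uncurry (src T K g w)) := by
  have h1 : Measurable fun q : ℝ × ℝ => ftr K (w q.1 q.2 + g q.1 q.2) :=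
    (measurable_ftr K).comp (hw.add hg)
  exact Measurable.ite (measurable_fst measurableSet_Icc) h1 measurable_const

lemma abs_src_le (hK : 0 ≤ K) {C : ℝ} {s y : ℝ} (hw : |w s y| ≤ C) (hg : |g s y| ≤ G) :
    |src T K g w s y| ≤ K * (C + G) := by
  have h0 : 0 ≤ C + G := add_nonneg ((abs_nonneg _).trans hw) ((abs_nonneg _).trans hg)
  unfold src
  split_ifs
  · have := abs_ftr_sub_le hK (w s y + g s y) 0
    rw [ftr_zero, sub_zero, sub_zero] at this
    refine this.trans ?_
    gcongr
    exact (abs_add_le _ _).trans (add_le_add hw hg)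
  · rw [abs_zero]; positivity

/-- The class in which the fixed point is sought. -/
structure Iterate (B l : ℝ) (V : ℝ → ℝ≥0∞) (w : ℝ → ℝ → ℝ) : Prop where
  meas : Measurable (Function.uncurry w)
  nonpos : ∀ t ≤ 0, ∀ x, w t x = 0
  abs_le : ∀ t x, |w t x| ≤ B * Real.exp (l * t)
  lip : ∀ t x h, ‖w t (x + h) - w t x‖ₑ ≤ ‖h‖ₑ * V t

lemma MildData.abs_src_le_exp (md : MildData T U G u0 FF g φ κ) (hK : 0 ≤ K) (hl : 0 < l) {B : ℝ}
    (hB : 0 ≤ B) (hw : ∀ t x, |w t x| ≤ B * Real.exp (l * t)) (s y : ℝ) :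
    |src T K g w s y| ≤ K * (B + G) * Real.exp (l * s) := by
  have hG : 0 ≤ G := (abs_nonneg _).trans (md.g_le 0 0)
  by_cases hs : s ∈ Icc 0 T
  · refine (abs_src_le hK (hw s y) (md.g_le s y)).trans ?_
    have h1 : 1 ≤ Real.exp (l * s) := Real.one_le_exp (mul_nonneg hl.le hs.1)
    have : G ≤ G * Real.exp (l * s) := le_mul_of_one_le_right hG h1
    rw [mul_assoc]
    gcongr
    linarith
  · rw [src, if_neg hs, abs_zero]
    positivity

/-- Only the divergence term depends on `w`. It is Lipschitz with constant `K` before the Duhamel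
integration, which contributes `hkc μ * √(π / l)` in the weighted norm; `hθ` makes the product at
most one half. -/
lemma MildData.abs_pic_sub_le (md : MildData T U G u0 FF g φ κ) (hμ : 0 < μ) (hK : 0 ≤ K) (hl : 0 < l)
    (hθ : hkc μ * K * √(Real.pi / l) ≤ 1 / 2) {B D : ℝ} (hB : 0 ≤ B) (hD : 0 ≤ D)
    (hwm : Measurable (Function.uncurry w)) (hw : ∀ t x, |w t x| ≤ B * Real.exp (l * t))
    (hwm' : Measurable (Function.uncurry w')) (hw' : ∀ t x, |w' t x| ≤ B * Real.exp (l * t))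
    (h : ∀ t x, |w t x - w' t x| ≤ D * Real.exp (l * t)) (t x : ℝ) :
    |pic μ T K u0 FF g w t x - pic μ T K u0 FF g w' t x| ≤ D / 2 * Real.exp (l * t) := by
  have hG : 0 ≤ G := (abs_nonneg _).trans (md.g_le 0 0)
  have m1 := measurable_src (T := T) (K := K) md.g_meas hwm
  have m2 := measurable_src (T := T) (K := K) md.g_meas hwm'
  have i1 := (duhx_of_abs_le_exp hμ hl m1 (by positivity) (md.abs_src_le_exp hK hl hB hw) t x).1
  have i2 := (duhx_of_abs_le_exp hμ hl m2 (by positivity) (md.abs_src_le_exp hK hl hB hw') t x).1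
  have e : pic μ T K u0 FF g w t x - pic μ T K u0 FF g w' t x =
      duhx μ (fun s y => src T K g w' s y - src T K g w s y) t x := by
    unfold pic
    have : duhx μ (fun s y => src T K g w' s y - src T K g w s y) t x =
        duhx μ (src T K g w') t x - duhx μ (src T K g w) t x := by
      unfold duhx
      rw [← integral_sub i2 i1]
      congr 1 with q
      ring
    rw [this]; ring
  have hle : ∀ s y, |src T K g w' s y - src T K g w s y| ≤ K * D * Real.exp (l * s) := by
    intro s y
    unfold src
    split_ifs
    · refine (abs_ftr_sub_le hK _ _).trans ?_
      rw [mul_assoc]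
      gcongr
      have : w' s y + g s y - (w s y + g s y) = -(w s y - w' s y) := by ring
      rw [this, abs_neg]
      exact h s y
    · rw [sub_zero, abs_zero]; positivity
  rw [e]
  have m3 : Measurable (Function.uncurry fun s y => src T K g w' s y - src T K g w s y) :=
    m2.sub m1
  refine (duhx_of_abs_le_exp hμ hl m3 (by positivity) hle t x).2.trans ?_
  have : hkc μ * √(Real.pi / l) * (K * D) = hkc μ * K * √(Real.pi / l) * D := by ring
  rw [this]
  have := mul_le_mul_of_nonneg_right hθ hD
  have e0 := Real.exp_pos (l * t)
  nlinarith

lemma MildData.FF_enorm_le (md : MildData T U G u0 FF g φ κ) :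
    ∀ᵐ s, ∀ᵐ y, ‖FF s y‖ₑ ≤ ENNReal.ofReal (φ s) :=
  ae_of_all _ fun s => ae_of_all _ fun y => by
    rw [Real.enorm_eq_ofReal_abs]; exact ENNReal.ofReal_le_ofReal (md.FF_le s y)

lemma MildData.φ_nonneg (md : MildData T U G u0 FF g φ κ) (s : ℝ) : 0 ≤ φ s :=
  (abs_nonneg _).trans (md.FF_le s 0)

/-- Either the kernel or the source vanishes. In particular the value at time zero is zero and not
`u0`; the initial value is put back by `withInit`. -/
lemma MildData.pic_of_nonpos (md : MildData T U G u0 FF g φ κ) (hμ : 0 < μ) {t : ℝ} (ht : t ≤ 0)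
    (w : ℝ → ℝ → ℝ) (x : ℝ) : pic μ T K u0 FF g w t x = 0 := by
  have h1 : heat μ u0 t x = 0 := by simp [heat, hk_of_nonpos hμ ht]
  have h2 : ∀ q : ℝ × ℝ, FF q.1 q.2 * hk μ (t - q.1) (x - q.2) = 0 := by
    intro q
    rcases le_or_gt t q.1 with h | h
    · rw [hk_of_nonpos hμ (by linarith), mul_zero]
    · have : FF q.1 q.2 = 0 := by
        have := md.FF_le q.1 q.2
        rw [md.φ_zero q.1 (fun h' => by linarith [h'.1])] at this
        exact abs_nonpos_iff.1 this
      rw [this, zero_mul]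
  have h3 : ∀ q : ℝ × ℝ, src T K g w q.1 q.2 * hkx μ (t - q.1) (x - q.2) = 0 := by
    intro q
    rcases le_or_gt t q.1 with h | h
    · rw [hkx_of_nonpos hμ (by linarith), mul_zero]
    · rw [src, if_neg (fun h' => by linarith [h'.1]), zero_mul]
  simp [pic, h1, duh, duhx, h2, h3]

lemma MildData.measurable_pic (md : MildData T U G u0 FF g φ κ)
    (hwm : Measurable (Function.uncurry w)) :
    Measurable (Function.uncurry (pic μ T K u0 FF g w)) :=
  ((measurable_heat md.u0_meas).add (measurable_duh md.FF_meas)).sub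
    (measurable_duhx (measurable_src md.g_meas hwm))

lemma MildData.abs_pic_zero_le (md : MildData T U G u0 FF g φ κ) (hμ : 0 < μ) (hK : 0 ≤ K)
    (hl : 0 < l) (hθ : hkc μ * K * √(Real.pi / l) ≤ 1 / 2) (t x : ℝ) :
    |pic μ T K u0 FF g (fun _ _ => 0) t x| ≤
      (U + (∫⁻ s, ENNReal.ofReal (φ s)).toReal + G) * Real.exp (l * t) := by
  have hG : 0 ≤ G := (abs_nonneg _).trans (md.g_le 0 0)
  have hU : 0 ≤ U := (abs_nonneg _).trans (md.u0_le 0)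
  rcases le_or_gt t 0 with ht | ht
  · rw [md.pic_of_nonpos hμ ht, abs_zero]; positivity
  have h1 := abs_heat_le hμ md.u0_le ht x
  have h2 : |duh μ FF t x| ≤ (∫⁻ s, ENNReal.ofReal (φ s)).toReal := by
    have := (enorm_duh_le hμ md.FF_meas md.FF_enorm_le t x).trans (setLIntegral_le_lintegral _ _)
    have := ENNReal.toReal_mono md.φ_int this
    rwa [toReal_enorm, Real.norm_eq_abs] at this
  have m0 : Measurable (Function.uncurry fun _ _ : ℝ => (0:ℝ)) := measurable_const
  have m1 := measurable_src (T := T) (K := K) md.g_meas m0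
  have h3 := (duhx_of_abs_le_exp hμ hl m1 (by positivity)
    (md.abs_src_le_exp hK hl le_rfl (B := 0) (w := fun _ _ => 0) (by simp)) t x).2
  have h4 : hkc μ * √(Real.pi / l) * (K * (0 + G)) ≤ G := by
    have := mul_le_mul_of_nonneg_right hθ hG
    have e : hkc μ * √(Real.pi / l) * (K * (0 + G)) = hkc μ * K * √(Real.pi / l) * G := by ring
    rw [e]; linarith
  have h5 : 1 ≤ Real.exp (l * t) := Real.one_le_exp (by positivity)
  have h6 := mul_le_mul_of_nonneg_right h4 (Real.exp_pos (l * t)).le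
  have h7 : 0 ≤ U + (∫⁻ s, ENNReal.ofReal (φ s)).toReal := add_nonneg hU ENNReal.toReal_nonneg
  have h8 := le_mul_of_one_le_right h7 h5
  unfold pic
  refine (abs_sub _ _).trans ((add_le_add (abs_add_le _ _) le_rfl).trans ?_)
  rw [add_mul]
  linarith

/-- The increments of the truncated flux are at most `K |h| (V + κ)` for almost every `y`, where `V`
is the Lipschitz majorant of `w`. The parts of the resulting bound coming from `u0`, `FF` and `κ`
are the first two terms of `lipMaj`, and the constant `C` is chosen so that the contribution of `V`
itself fits into the third. -/
lemma MildData.lip_pic (md : MildData T U G u0 FF g φ κ) (hμ : 0 < μ) (hK : 0 ≤ K)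
    (hl : 0 < l) (hθ : hkc μ * K * √(Real.pi / l) ≤ 1 / 2) {α C : ℝ≥0∞} {Φ : ℝ → ℝ≥0∞}
    (hα : α = ENNReal.ofReal U * ENNReal.ofReal (hkc μ))
    (hΦ : Φ = fun s => ENNReal.ofReal (hkc μ) * ENNReal.ofReal (φ s) +
      ENNReal.ofReal (hkc μ * K) * ENNReal.ofReal (κ s))
    (hC : C = 2 * (ENNReal.ofReal (hkc μ * K) * (4 * α + 4 * ∫⁻ s, Φ s)))
    {B : ℝ} (hB : 0 ≤ B) (hw : Iterate B l (lipMaj α Φ C l) w) (t x h : ℝ) :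
    ‖pic μ T K u0 FF g w t (x + h) - pic μ T K u0 FF g w t x‖ₑ ≤ ‖h‖ₑ * lipMaj α Φ C l t := by
  have hG : 0 ≤ G := (abs_nonneg _).trans (md.g_le 0 0)
  rcases le_or_gt t 0 with ht | ht
  · simp [md.pic_of_nonpos hμ ht]
  have mφ : Measurable fun s => ENNReal.ofReal (φ s) := md.φ_meas.ennreal_ofReal
  have mκ : Measurable fun s => ENNReal.ofReal (κ s) := md.κ_meas.ennreal_ofReal
  have mΦ : Measurable Φ := by rw [hΦ]; fun_prop
  have mV := measurable_lipMaj α mΦ C l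
  have mS := measurable_src (T := T) (K := K) md.g_meas hw.meas
  have mS' : Measurable (Function.uncurry fun s y => src T K g w s (y + h)) :=
    mS.comp (measurable_fst.prodMk (measurable_snd.add_const h))
  have bS := md.abs_src_le_exp hK hl hB hw.abs_le
  have i1 := (duhx_of_abs_le_exp hμ hl mS (by positivity) bS t x).1
  have i2 := (duhx_of_abs_le_exp hμ hl mS' (by positivity) (fun s y => bS s (y + h)) t x).1
  have e1 : duhx μ (src T K g w) t (x + h) - duhx μ (src T K g w) t x =
      duhx μ (fun s y => src T K g w s (y + h) - src T K g w s y) t x := by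
    rw [duhx_translate]
    unfold duhx
    rw [← integral_sub i2 i1]
    congr 1 with q
    ring
  have hb : ∀ᵐ s, ∀ᵐ y, ‖src T K g w s (y + h) - src T K g w s y‖ₑ ≤
      (ENNReal.ofReal K * ‖h‖ₑ) * (lipMaj α Φ C l s + ENNReal.ofReal (κ s)) := by
    filter_upwards [md.g_lip] with s hs
    by_cases hsT : s ∈ Icc 0 T
    · filter_upwards [hs hsT h] with y hy
      rw [src, src, if_pos hsT, if_pos hsT]
      have h1 : ‖ftr K (w s (y + h) + g s (y + h)) - ftr K (w s y + g s y)‖ₑ ≤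
          ENNReal.ofReal K * ‖w s (y + h) + g s (y + h) - (w s y + g s y)‖ₑ := by
        rw [Real.enorm_eq_ofReal_abs, Real.enorm_eq_ofReal_abs, ← ENNReal.ofReal_mul hK]
        exact ENNReal.ofReal_le_ofReal (abs_ftr_sub_le hK _ _)
      have h2 : ‖w s (y + h) + g s (y + h) - (w s y + g s y)‖ₑ ≤
          ‖w s (y + h) - w s y‖ₑ + ‖g s (y + h) - g s y‖ₑ := by
        rw [add_sub_add_comm]
        exact enorm_add_le _ _
      have h3 : ‖g s (y + h) - g s y‖ₑ ≤ ENNReal.ofReal (κ s) * ‖h‖ₑ := by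
        rw [Real.enorm_eq_ofReal_abs, Real.enorm_eq_ofReal_abs, ← ENNReal.ofReal_mul (md.κ_nonneg s)]
        exact ENNReal.ofReal_le_ofReal hy
      calc _ ≤ ENNReal.ofReal K * (‖h‖ₑ * lipMaj α Φ C l s + ENNReal.ofReal (κ s) * ‖h‖ₑ) :=
            h1.trans (mul_le_mul_right (h2.trans (add_le_add (hw.lip s y h) h3)) _)
        _ = _ := by ring
    · refine ae_of_all _ fun y => ?_
      rw [src, src, if_neg hsT, if_neg hsT]
      simp
  have mD : Measurable (Function.uncurry fun s y => src T K g w s (y + h) - src T K g w s y) :=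
    mS'.sub mS
  have mVκ : Measurable fun s => lipMaj α Φ C l s + ENNReal.ofReal (κ s) := mV.add mκ
  have b3 := enorm_duhx_le hμ mD hb (mVκ.const_mul _) t x
  rw [abel_const_mul mVκ, abel_add mV] at b3
  have b1 := enorm_heat_translate_le hμ md.u0_meas md.u0_le t x h
  have b2 := enorm_duh_translate_le hμ md.FF_meas md.FF_enorm_le mφ md.φ_int t x h
  have hΦt : abel Φ t = ENNReal.ofReal (hkc μ) * abel (fun s => ENNReal.ofReal (φ s)) t +
      ENNReal.ofReal (hkc μ * K) * abel (fun s => ENNReal.ofReal (κ s)) t := by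
    rw [hΦ, abel_add (mφ.const_mul _), abel_const_mul mφ, abel_const_mul mκ]
  have hE : 1 ≤ ENNReal.ofReal (Real.exp (l * t)) := by
    rw [ENNReal.one_le_ofReal]
    exact Real.one_le_exp (by positivity)
  have h2 : 2 * ENNReal.ofReal (hkc μ * K * √(Real.pi / l)) ≤ 1 := by
    rw [← ENNReal.ofReal_ofNat, ← ENNReal.ofReal_mul (by norm_num)]
    exact ENNReal.ofReal_le_one.2 (by linarith)
  -- With `X` half of `C`, the contribution of `V` is at most `X` plus one half of `C exp(l t)`;
  -- since `exp(l t) ≥ 1` for positive times, the total is at most `C exp(l t)`.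
  have hV : ENNReal.ofReal (hkc μ * K) * abel (lipMaj α Φ C l) t ≤
      C * ENNReal.ofReal (Real.exp (l * t)) := by
    set X := ENNReal.ofReal (hkc μ * K) * (4 * α + 4 * ∫⁻ s, Φ s) with hX
    set E := ENNReal.ofReal (Real.exp (l * t))
    have hk0 : 0 ≤ hkc μ * K := mul_nonneg (hkc_nonneg μ) hK
    calc _ ≤ ENNReal.ofReal (hkc μ * K) * (4 * α + 4 * (∫⁻ s, Φ s) +
          C * ENNReal.ofReal (√(Real.pi / l) * Real.exp (l * t))) := by
          gcongr
          exact abel_lipMaj_le α mΦ C hl t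
      _ = X + (2 * ENNReal.ofReal (hkc μ * K * √(Real.pi / l))) * (X * E) := by
          have a1 : ENNReal.ofReal (√(Real.pi / l) * Real.exp (l * t)) =
              ENNReal.ofReal √(Real.pi / l) * E := ENNReal.ofReal_mul (Real.sqrt_nonneg _)
          have a2 : ENNReal.ofReal (hkc μ * K * √(Real.pi / l)) =
              ENNReal.ofReal (hkc μ * K) * ENNReal.ofReal √(Real.pi / l) := ENNReal.ofReal_mul hk0
          rw [mul_add, ← hX, hC, a1, a2]
          ring
      _ ≤ X * E + 1 * (X * E) := by
          gcongr
          exact le_mul_of_one_le_right' hE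
      _ = C * E := by rw [hC]; ring
  have e2 : pic μ T K u0 FF g w t (x + h) - pic μ T K u0 FF g w t x =
      (heat μ u0 t (x + h) - heat μ u0 t x) + (duh μ FF t (x + h) - duh μ FF t x) -
        duhx μ (fun s y => src T K g w s (y + h) - src T K g w s y) t x := by
    rw [← e1]; unfold pic; ring
  rw [e2]
  refine (enorm_sub_le).trans ((add_le_add ((enorm_add_le _ _).trans (add_le_add b1 b2)) b3).trans ?_)
  rw [lipMaj, hΦt, ← hα]
  have hKc : ENNReal.ofReal (hkc μ * K) = ENNReal.ofReal (hkc μ) * ENNReal.ofReal K :=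
    ENNReal.ofReal_mul (hkc_nonneg μ)
  calc _ = ‖h‖ₑ * (α * ENNReal.ofReal (√t)⁻¹ +
        (ENNReal.ofReal (hkc μ) * abel (fun s => ENNReal.ofReal (φ s)) t +
          ENNReal.ofReal (hkc μ * K) * abel (fun s => ENNReal.ofReal (κ s)) t) +
        ENNReal.ofReal (hkc μ * K) * abel (lipMaj α Φ C l) t) := by
        rw [hKc]; ring
    _ ≤ _ := by gcongr

end

/-! ### Integrability of the Lipschitz majorant and convergence of the Picard iterates -/

section

variable {μ T U G K l : ℝ} {u0 : ℝ → ℝ} {FF g w w' H : ℝ → ℝ → ℝ} {φ κ : ℝ → ℝ}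

lemma lintegral_inv_sqrt_rpow_ne_top :
    ∫⁻ r, (Iio (1:ℝ)).indicator (fun r => ENNReal.ofReal (√r)⁻¹ ^ (4 / 3 : ℝ)) r ≠ ⊤ := by
  have hi : IntervalIntegrable (fun s : ℝ => s ^ (-(2 / 3) : ℝ)) volume 0 1 :=
    intervalIntegral.intervalIntegrable_rpow' (by norm_num)
  have e : ∫⁻ r, (Iio (1:ℝ)).indicator (fun r => ENNReal.ofReal (√r)⁻¹ ^ (4 / 3 : ℝ)) r ≤
      ∫⁻ r in Ioc (0:ℝ) 1, ‖r ^ (-(2 / 3) : ℝ)‖ₑ := by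
    rw [← lintegral_indicator measurableSet_Ioc]
    refine lintegral_mono fun r => ?_
    by_cases h1 : r < 1
    · rw [indicator_of_mem (by exact h1)]
      by_cases h2 : 0 < r
      · rw [indicator_of_mem (by exact ⟨h2, h1.le⟩), ENNReal.ofReal_rpow_of_nonneg (by positivity)
          (by norm_num), Real.enorm_eq_ofReal (by positivity), Real.sqrt_eq_rpow,
          ← Real.rpow_neg h2.le, ← Real.rpow_mul h2.le]
        norm_num
      · rw [Real.sqrt_eq_zero_of_nonpos (not_lt.1 h2)]
        simp
    · rw [indicator_of_notMem (by exact h1)]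
      exact zero_le
  exact (e.trans_lt (hasFiniteIntegral_iff_enorm.1 hi.1.2)).ne

lemma lintegral_inv_sqrt_rpow_shift_le (T s : ℝ) :
    ∫⁻ t in Icc 0 T, ENNReal.ofReal (√(t - s))⁻¹ ^ (4 / 3 : ℝ) ≤ ENNReal.ofReal T +
      ∫⁻ r, (Iio (1:ℝ)).indicator (fun r => ENNReal.ofReal (√r)⁻¹ ^ (4 / 3 : ℝ)) r := by
  set a : ℝ → ℝ≥0∞ := (Iio (1:ℝ)).indicator (fun r => ENNReal.ofReal (√r)⁻¹ ^ (4 / 3 : ℝ)) with ha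
  have ham : Measurable a := Measurable.indicator (by fun_prop) measurableSet_Iio
  calc _ ≤ ∫⁻ t in Icc 0 T, (1 + a (t - s)) := by
        refine lintegral_mono fun t => ?_
        by_cases h : t - s < 1
        · rw [ha, indicator_of_mem (show t - s ∈ Iio 1 from h)]
          exact le_add_self
        · refine le_trans ?_ le_self_add
          have h1 : 1 ≤ √(t - s) := Real.one_le_sqrt.2 (not_lt.1 h)
          have h2 : ENNReal.ofReal (√(t - s))⁻¹ ≤ 1 :=
            ENNReal.ofReal_le_one.2 (inv_le_one_of_one_le₀ h1)
          exact ENNReal.rpow_le_one h2 (by norm_num)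
    _ = ENNReal.ofReal T + ∫⁻ t in Icc 0 T, a (t - s) := by
        rw [lintegral_add_left measurable_const]
        simp
    _ ≤ _ := by
        refine add_le_add le_rfl ?_
        exact (setLIntegral_le_lintegral _ _).trans (lintegral_sub_right_eq_self (μ := volume) a s).le

/-- Hölder's inequality with exponents `4/3` and `4`, after splitting `Φ k` as `(Φ^{3/4} k)
Φ^{1/4}`. It is the pointwise half of Young's convolution inequality. -/
lemma abel_rpow_le {Φ : ℝ → ℝ≥0∞} (hΦ : Measurable Φ) (t : ℝ) :
    abel Φ t ^ (4 / 3 : ℝ) ≤ (∫⁻ s, Φ s * ENNReal.ofReal (√(t - s))⁻¹ ^ (4 / 3 : ℝ)) *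
      (∫⁻ s, Φ s) ^ (1 / 3 : ℝ) := by
  have hpq : (4 / 3 : ℝ).HolderConjugate 4 := by
    rw [Real.holderConjugate_iff]; norm_num
  have m1 : Measurable fun s => Φ s ^ (3 / 4 : ℝ) * ENNReal.ofReal (√(t - s))⁻¹ :=
    (hΦ.pow_const _).mul (by fun_prop)
  have m2 : Measurable fun s => Φ s ^ (1 / 4 : ℝ) := hΦ.pow_const _
  have h := ENNReal.lintegral_mul_le_Lp_mul_Lq volume hpq m1.aemeasurable m2.aemeasurable
  have e1 : ∀ s, ((fun s => Φ s ^ (3 / 4 : ℝ) * ENNReal.ofReal (√(t - s))⁻¹) *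
      fun s => Φ s ^ (1 / 4 : ℝ)) s = Φ s * ENNReal.ofReal (√(t - s))⁻¹ := by
    intro s
    simp only [Pi.mul_apply]
    rw [mul_right_comm, ← ENNReal.rpow_add_of_nonneg _ _ (by norm_num) (by norm_num)]
    norm_num
  have e2 : ∀ s, (Φ s ^ (3 / 4 : ℝ) * ENNReal.ofReal (√(t - s))⁻¹) ^ (4 / 3 : ℝ) =
      Φ s * ENNReal.ofReal (√(t - s))⁻¹ ^ (4 / 3 : ℝ) := by
    intro s
    rw [ENNReal.mul_rpow_of_nonneg _ _ (by norm_num), ← ENNReal.rpow_mul]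
    norm_num
  have e3 : ∀ s, (Φ s ^ (1 / 4 : ℝ)) ^ (4 : ℝ) = Φ s := by
    intro s
    rw [← ENNReal.rpow_mul]; norm_num
  simp only [e1, e2, e3] at h
  have h' := ENNReal.rpow_le_rpow h (show (0:ℝ) ≤ 4 / 3 by norm_num)
  rw [ENNReal.mul_rpow_of_nonneg _ _ (by norm_num), ← ENNReal.rpow_mul, ← ENNReal.rpow_mul] at h'
  norm_num at h'
  exact h'

/-- The `4/3` power of `t^{-1/2}` is `t^{-2/3}`, which is integrable near zero. Convolution with an
integrable `Φ` preserves this, by `abel_rpow_le` and Tonelli's theorem. -/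
lemma memLp_lipMaj {α C : ℝ≥0∞} {Φ : ℝ → ℝ≥0∞} (hα : α ≠ ⊤) (hC : C ≠ ⊤) (hΦm : Measurable Φ)
    (hΦ : ∫⁻ s, Φ s ≠ ⊤) (T l : ℝ) :
    ∫⁻ t in Icc 0 T, lipMaj α Φ C l t ^ (4 / 3 : ℝ) ≠ ⊤ := by
  set c := ENNReal.ofReal T +
      ∫⁻ r, (Iio (1:ℝ)).indicator (fun r => ENNReal.ofReal (√r)⁻¹ ^ (4 / 3 : ℝ)) r with hc
  have hc' : c ≠ ⊤ := ENNReal.add_ne_top.2 ⟨ENNReal.ofReal_ne_top, lintegral_inv_sqrt_rpow_ne_top⟩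
  have m2 := measurable_abel hΦm
  have f1 : ∫⁻ t in Icc 0 T, (α * ENNReal.ofReal (√t)⁻¹) ^ (4 / 3 : ℝ) ≠ ⊤ := by
    have e : ∀ t : ℝ, (α * ENNReal.ofReal (√t)⁻¹) ^ (4 / 3 : ℝ) =
        α ^ (4 / 3 : ℝ) * ENNReal.ofReal (√(t - 0))⁻¹ ^ (4 / 3 : ℝ) := fun t => by
      rw [ENNReal.mul_rpow_of_nonneg _ _ (by norm_num), sub_zero]
    simp_rw [e]
    rw [lintegral_const_mul _ (by fun_prop)]
    exact ENNReal.mul_ne_top (ENNReal.rpow_ne_top_of_nonneg (by norm_num) hα)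
      ((lintegral_inv_sqrt_rpow_shift_le T 0).trans_lt hc'.lt_top).ne
  have f2 : ∫⁻ t in Icc 0 T, abel Φ t ^ (4 / 3 : ℝ) ≠ ⊤ := by
    have hm : Measurable (Function.uncurry fun t s : ℝ =>
        Φ s * ENNReal.ofReal (√(t - s))⁻¹ ^ (4 / 3 : ℝ)) := by
      have : Measurable fun q : ℝ × ℝ => Φ q.2 := hΦm.comp measurable_snd
      exact this.mul (by fun_prop)
    refine ((lintegral_mono fun t => abel_rpow_le hΦm t).trans_lt ?_).ne
    rw [lintegral_mul_const _ hm.lintegral_prod_right, lintegral_lintegral_swap hm.aemeasurable]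
    refine ENNReal.mul_lt_top ?_ (ENNReal.rpow_lt_top_of_nonneg (by norm_num) hΦ)
    calc _ ≤ ∫⁻ s, Φ s * c := by
          refine lintegral_mono fun s => ?_
          rw [lintegral_const_mul _ (by fun_prop)]
          gcongr
          exact lintegral_inv_sqrt_rpow_shift_le T s
      _ = (∫⁻ s, Φ s) * c := lintegral_mul_const _ hΦm
      _ < ⊤ := ENNReal.mul_lt_top hΦ.lt_top hc'.lt_top
  have f3 : ∫⁻ t in Icc 0 T, (C * ENNReal.ofReal (Real.exp (l * t))) ^ (4 / 3 : ℝ) ≠ ⊤ := by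
    have hb : ∀ t ∈ Icc 0 T, (C * ENNReal.ofReal (Real.exp (l * t))) ^ (4 / 3 : ℝ) ≤
        (C * ENNReal.ofReal (Real.exp (|l| * T))) ^ (4 / 3 : ℝ) := by
      intro t ht
      have : l * t ≤ |l| * T := (mul_le_mul_of_nonneg_right (le_abs_self l) ht.1).trans
        (mul_le_mul_of_nonneg_left ht.2 (abs_nonneg l))
      exact ENNReal.rpow_le_rpow (mul_le_mul_right
        (ENNReal.ofReal_le_ofReal (Real.exp_le_exp.2 this)) _) (by norm_num)
    refine ((setLIntegral_mono' measurableSet_Icc hb).trans_lt ?_).ne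
    rw [setLIntegral_const]
    exact ENNReal.mul_lt_top (ENNReal.rpow_lt_top_of_nonneg (by norm_num)
      (ENNReal.mul_ne_top hC ENNReal.ofReal_ne_top)) (by simp)
  have hp : (1:ℝ) ≤ 4 / 3 := by norm_num
  have hpt : ∀ t, lipMaj α Φ C l t ^ (4 / 3 : ℝ) ≤
      2 ^ (4 / 3 - 1 : ℝ) * (2 ^ (4 / 3 - 1 : ℝ) * ((α * ENNReal.ofReal (√t)⁻¹) ^ (4 / 3 : ℝ) +
        abel Φ t ^ (4 / 3 : ℝ)) + (C * ENNReal.ofReal (Real.exp (l * t))) ^ (4 / 3 : ℝ)) := by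
    intro t
    refine (ENNReal.rpow_add_le_mul_rpow_add_rpow _ _ hp).trans ?_
    gcongr
    exact ENNReal.rpow_add_le_mul_rpow_add_rpow _ _ hp
  have h2 : (2:ℝ≥0∞) ^ (4 / 3 - 1 : ℝ) ≠ ⊤ := ENNReal.rpow_ne_top_of_nonneg (by norm_num) (by simp)
  refine ((lintegral_mono hpt).trans_lt ?_).ne
  rw [lintegral_const_mul _ (by fun_prop), lintegral_add_left (by fun_prop),
    lintegral_const_mul _ (by fun_prop), lintegral_add_left (by fun_prop)]
  exact ENNReal.mul_lt_top h2.lt_top (ENNReal.add_lt_top.2 ⟨ENNReal.mul_lt_top h2.lt_top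
    (ENNReal.add_lt_top.2 ⟨f1.lt_top, f2.lt_top⟩), f3.lt_top⟩)

/-- Existence of a mild solution of the truncated problem. -/
lemma MildData.exists_fixedPoint (md : MildData T U G u0 FF g φ κ) (hμ : 0 < μ) (hK : 0 ≤ K) :
    ∃ (u : ℝ → ℝ → ℝ) (B l : ℝ) (V : ℝ → ℝ≥0∞), 0 ≤ B ∧ 0 < l ∧ Iterate B l V u ∧ Measurable V ∧
      ∫⁻ t in Icc 0 T, V t ^ (4 / 3 : ℝ) ≠ ⊤ ∧ ∀ t x, u t x = pic μ T K u0 FF g u t x := by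
  have hG : 0 ≤ G := (abs_nonneg _).trans (md.g_le 0 0)
  have hU : 0 ≤ U := (abs_nonneg _).trans (md.u0_le 0)
  have hc := hkc_nonneg μ
  -- This choice makes `√(π / l) = 1 / (2 hkc μ K + 1)`, so the contraction factor is at most one
  -- half even when `hkc μ * K` vanishes.
  set l : ℝ := Real.pi * (2 * hkc μ * K + 1) ^ 2 with hl
  have hl0 : 0 < l := by positivity
  have hθ : hkc μ * K * √(Real.pi / l) ≤ 1 / 2 := by
    have e : √(Real.pi / l) = (2 * hkc μ * K + 1)⁻¹ := by
      rw [hl, ← div_div, div_self Real.pi_pos.ne', one_div, Real.sqrt_inv,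
        Real.sqrt_sq (by positivity)]
    rw [e, ← div_eq_mul_inv, div_le_div_iff₀ (by positivity) (by norm_num)]
    linarith
  set α := ENNReal.ofReal U * ENNReal.ofReal (hkc μ) with hα
  set Φ : ℝ → ℝ≥0∞ := fun s => ENNReal.ofReal (hkc μ) * ENNReal.ofReal (φ s) +
      ENNReal.ofReal (hkc μ * K) * ENNReal.ofReal (κ s) with hΦ
  set C := 2 * (ENNReal.ofReal (hkc μ * K) * (4 * α + 4 * ∫⁻ s, Φ s)) with hC
  set P := U + (∫⁻ s, ENNReal.ofReal (φ s)).toReal + G with hP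
  have hP0 : 0 ≤ P := by positivity
  have mφ : Measurable fun s => ENNReal.ofReal (φ s) := md.φ_meas.ennreal_ofReal
  have mκ : Measurable fun s => ENNReal.ofReal (κ s) := md.κ_meas.ennreal_ofReal
  have mΦ : Measurable Φ := by rw [hΦ]; fun_prop
  have hα' : α ≠ ⊤ := ENNReal.mul_ne_top ENNReal.ofReal_ne_top ENNReal.ofReal_ne_top
  have hΦ' : ∫⁻ s, Φ s ≠ ⊤ := by
    rw [hΦ, lintegral_add_left (mφ.const_mul _), lintegral_const_mul _ mφ, lintegral_const_mul _ mκ]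
    exact ENNReal.add_ne_top.2 ⟨ENNReal.mul_ne_top ENNReal.ofReal_ne_top md.φ_int,
      ENNReal.mul_ne_top ENNReal.ofReal_ne_top md.κ_int⟩
  have hC' : C ≠ ⊤ := ENNReal.mul_ne_top (by simp) (ENNReal.mul_ne_top ENNReal.ofReal_ne_top
    (ENNReal.add_ne_top.2 ⟨ENNReal.mul_ne_top (by simp) hα', ENNReal.mul_ne_top (by simp) hΦ'⟩))
  have m0 : Measurable (Function.uncurry fun _ _ : ℝ => (0:ℝ)) := measurable_const
  -- The image of zero has weighted norm at most `P`, and the factor one half makes the ball of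
  -- radius `2P` invariant.
  have step : ∀ w, Iterate (2 * P) l (lipMaj α Φ C l) w →
      Iterate (2 * P) l (lipMaj α Φ C l) (pic μ T K u0 FF g w) := by
    intro w hw
    refine ⟨md.measurable_pic hw.meas, fun t ht x => md.pic_of_nonpos hμ ht w x, fun t x => ?_,
      fun t x h => md.lip_pic hμ hK hl0 hθ hα hΦ hC (by positivity) hw t x h⟩
    have h1 := md.abs_pic_zero_le hμ hK hl0 hθ t x
    have h2 := md.abs_pic_sub_le (w := w) (w' := fun _ _ => 0) hμ hK hl0 hθ (B := 2 * P) (D := 2 * P)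
      (by positivity) (by positivity) hw.meas hw.abs_le m0 (fun t x => by rw [abs_zero]; positivity)
      (fun t x => by rw [sub_zero]; exact hw.abs_le t x) t x
    have h3 := abs_add_le (pic μ T K u0 FF g w t x - pic μ T K u0 FF g (fun _ _ => 0) t x)
      (pic μ T K u0 FF g (fun _ _ => 0) t x)
    rw [sub_add_cancel] at h3
    linarith
  set a : ℕ → ℝ → ℝ → ℝ := fun n => (pic μ T K u0 FF g)^[n] (fun _ _ => 0) with ha
  have ha1 : ∀ n, a (n + 1) = pic μ T K u0 FF g (a n) := fun n =>
    Function.iterate_succ_apply' _ _ _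
  have hit : ∀ n, Iterate (2 * P) l (lipMaj α Φ C l) (a n) := by
    intro n
    induction n with
    | zero =>
      refine ⟨m0, fun _ _ _ => rfl, fun t x => ?_, fun t x h => ?_⟩
      · change |(0:ℝ)| ≤ _
        rw [abs_zero]; positivity
      · change ‖(0:ℝ) - 0‖ₑ ≤ _
        simp
    | succ n ih => rw [ha1]; exact step _ ih
  have hdiff : ∀ n t x, |a n t x - a (n + 1) t x| ≤ 4 * P * (1 / 2) ^ n * Real.exp (l * t) := by
    intro n
    induction n with
    | zero =>
      intro t x
      have h1 := (hit 0).abs_le t x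
      have h2 := (hit 1).abs_le t x
      refine (abs_sub _ _).trans ?_
      rw [pow_zero]
      simp only [zero_add]
      linarith
    | succ n ih =>
      intro t x
      have := md.abs_pic_sub_le hμ hK hl0 hθ (B := 2 * P) (by positivity) (by positivity)
        (hit n).meas (hit n).abs_le (hit (n + 1)).meas (hit (n + 1)).abs_le ih t x
      rw [← ha1, ← ha1] at this
      refine this.trans (le_of_eq ?_)
      rw [pow_succ]; ring
  have hdist : ∀ t x n, dist (a n t x) (a (n + 1) t x) ≤ 4 * P * Real.exp (l * t) * (1 / 2) ^ n := by
    intro t x n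
    rw [Real.dist_eq]
    exact (hdiff n t x).trans (le_of_eq (by ring))
  have hlim : ∀ t x, ∃ y, Tendsto (fun n => a n t x) atTop (𝓝 y) := fun t x =>
    cauchySeq_tendsto_of_complete (cauchySeq_of_le_geometric _ _ (by norm_num) (hdist t x))
  choose u hu using hlim
  have hclose : ∀ n t x, |a n t x - u t x| ≤ 8 * P * (1 / 2) ^ n * Real.exp (l * t) := by
    intro n t x
    have := dist_le_of_le_geometric_of_tendsto _ _ (by norm_num) (hdist t x) (hu t x) n
    rw [Real.dist_eq] at this
    refine this.trans (le_of_eq ?_)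
    ring
  -- All clauses of `Iterate` survive pointwise limits, so no complete function space is needed.
  have hI : Iterate (2 * P) l (lipMaj α Φ C l) u := by
    refine ⟨?_, fun t ht x => ?_, fun t x => ?_, fun t x h => ?_⟩
    · exact measurable_of_tendsto_metrizable (fun n => (hit n).meas)
        (tendsto_pi_nhds.2 fun q => hu q.1 q.2)
    · exact tendsto_nhds_unique (hu t x) (by simp [fun n => (hit n).nonpos t ht x])
    · exact le_of_tendsto (hu t x).abs (Eventually.of_forall fun n => (hit n).abs_le t x)
    · exact le_of_tendsto ((hu t (x + h)).sub (hu t x)).enorm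
        (Eventually.of_forall fun n => (hit n).lip t x h)
  refine ⟨u, 2 * P, l, lipMaj α Φ C l, by positivity, hl0, hI, measurable_lipMaj α mΦ C l,
    memLp_lipMaj hα' hC' mΦ hΦ' T l, fun t x => ?_⟩
  have h1 : ∀ n, |a (n + 1) t x - pic μ T K u0 FF g u t x| ≤
      8 * P * (1 / 2) ^ n / 2 * Real.exp (l * t) := by
    intro n
    rw [ha1]
    exact md.abs_pic_sub_le hμ hK hl0 hθ (B := 2 * P) (by positivity) (by positivity)
      (hit n).meas (hit n).abs_le hI.meas hI.abs_le (hclose n) t x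
  have h2 : Tendsto (fun n : ℕ => 8 * P * (1 / 2 : ℝ) ^ n / 2 * Real.exp (l * t)) atTop (𝓝 0) := by
    have := (((tendsto_pow_atTop_nhds_zero_of_lt_one (r := (1 / 2 : ℝ)) (by norm_num)
      (by norm_num)).const_mul (8 * P)).div_const 2).mul_const (Real.exp (l * t))
    simpa using this
  have h3 : Tendsto (fun n => a (n + 1) t x) atTop (𝓝 (pic μ T K u0 FF g u t x)) := by
    rw [tendsto_iff_dist_tendsto_zero]
    exact squeeze_zero (fun _ => dist_nonneg) (fun n => by rw [Real.dist_eq]; exact h1 n) h2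
  exact tendsto_nhds_unique ((tendsto_add_atTop_iff_nat 1).2 (hu t x)) h3

end

section

/-! ### Mild solutions are distributional solutions -/

/-- Fubini's theorem: pairing a kernel integral with `ψ` is the same as pairing `H` with the dual
integral of `ψ`. The bound is required only where `ψ` does not vanish, since the Duhamel integrals
grow exponentially in time. -/
lemma integral_kernel_duality {Y : Type*} [MeasurableSpace Y] {ν : Measure Y} [SFinite ν]
    {ψ : ℝ × ℝ → ℝ} (hψ : IsTest ψ) {k : ℝ × ℝ → Y → ℝ} (hk : Measurable (Function.uncurry k))
    {H : Y → ℝ} (hH : Measurable H) {C : ℝ≥0∞} (hC : C ≠ ⊤)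
    (hle : ∀ p, ψ p ≠ 0 → ∫⁻ q, ‖H q * k p q‖ₑ ∂ν ≤ C) {L : Y → ℝ}
    (hL : ∀ q, ∫ t, ∫ x, ψ (t, x) * k (t, x) q = L q) :
    Integrable (fun p => ψ p * ∫ q, H q * k p q ∂ν) ∧ Integrable (fun q => H q * L q) ν ∧
      ∫ p, ψ p * (∫ q, H q * k p q ∂ν) = ∫ q, H q * L q ∂ν := by
  have hψi : Integrable ψ := hψ.continuous.integrable_of_hasCompactSupport hψ.supp
  have hm : Measurable fun z : (ℝ × ℝ) × Y => ψ z.1 * (H z.2 * k z.1 z.2) :=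
    (hψ.continuous.measurable.comp measurable_fst).mul ((hH.comp measurable_snd).mul hk)
  have hI : Integrable (fun z : (ℝ × ℝ) × Y => ψ z.1 * (H z.2 * k z.1 z.2)) (volume.prod ν) := by
    refine ⟨hm.aestronglyMeasurable, ?_⟩
    rw [hasFiniteIntegral_iff_enorm, lintegral_prod _ hm.enorm.aemeasurable]
    calc _ ≤ ∫⁻ p, ‖ψ p‖ₑ * C := by
          refine lintegral_mono fun p => ?_
          simp only [enorm_mul (ψ p)]
          rw [lintegral_const_mul' _ _ enorm_ne_top]
          by_cases h : ψ p = 0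
          · simp [h]
          · gcongr
            exact hle p h
      _ = (∫⁻ p, ‖ψ p‖ₑ) * C := lintegral_mul_const' _ _ hC
      _ < ⊤ := ENNReal.mul_lt_top hψi.2 hC.lt_top
  have e1 : ∀ᵐ q ∂ν, ∫ p, ψ p * (H q * k p q) = H q * L q := by
    filter_upwards [hI.prod_left_ae] with q hq
    have hq : Integrable (fun p => ψ p * (H q * k p q)) := hq
    -- Fubini's theorem gives integrability of the slice multiplied by `H q`; this factor can be
    -- divided out only where it is nonzero.
    by_cases h : H q = 0
    · simp [h]
    have hq' : Integrable (fun p => ψ p * k p q) := by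
      refine (hq.const_mul (H q)⁻¹).congr (ae_of_all _ fun p => ?_)
      simp only
      field_simp
    rw [← hL q]
    have : ∀ p, ψ p * (H q * k p q) = H q * (ψ p * k p q) := fun p => by ring
    simp_rw [this]
    rw [integral_const_mul, Measure.volume_eq_prod, integral_prod _ hq']
  refine ⟨?_, hI.integral_prod_right.congr e1, ?_⟩
  · refine hI.integral_prod_left.congr (ae_of_all _ fun p => ?_)
    change ∫ q, ψ p * (H q * k p q) ∂ν = ψ p * ∫ q, H q * k p q ∂ν
    exact integral_const_mul _ _
  · rw [← integral_congr_ae e1, ← integral_integral_swap hI]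
    congr 1 with p
    exact (integral_const_mul _ _).symm

variable {μ T U G K l B : ℝ} {u0 : ℝ → ℝ} {FF g u : ℝ → ℝ → ℝ} {φ κ : ℝ → ℝ} {V : ℝ → ℝ≥0∞}

/-- The mild formula is tested with `adj μ Φ`. By duality the kernels turn `adj μ Φ` into `-Φ` for
the initial value and the source, and into `Φₓ` for the flux term. -/
lemma MildData.weak_identity (md : MildData T U G u0 FF g φ κ) (hμ : 0 < μ) (hK : 0 ≤ K)
    (hl : 0 < l) (hB : 0 ≤ B) (hu : Iterate B l V u) (hfix : ∀ t x, u t x = pic μ T K u0 FF g u t x)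
    {Φ : ℝ × ℝ → ℝ} (hΦ : IsTest Φ) (hs : tsupport Φ ⊆ Ioo 0 T ×ˢ univ) :
    ∫ q, (u q.1 q.2 * adj μ Φ q + FF q.1 q.2 * Φ q +
      ftr K (u q.1 q.2 + g q.1 q.2) * pd (0, 1) Φ q) ∂strip T = 0 := by
  have hG : 0 ≤ G := (abs_nonneg _).trans (md.g_le 0 0)
  have hA := hΦ.adj μ
  obtain ⟨R, hR0, hR⟩ := hA.exists_box
  have mS := measurable_src (T := T) (K := K) md.g_meas hu.meas
  have bS := md.abs_src_le_exp hK hl hB hu.abs_le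
  have m1 : Measurable (Function.uncurry fun (p : ℝ × ℝ) (y : ℝ) => hk μ p.1 (p.2 - y)) :=
    (measurable_hk μ).comp ((measurable_fst.comp measurable_fst).prodMk
      ((measurable_snd.comp measurable_fst).sub measurable_snd))
  have m2 : Measurable (Function.uncurry fun (p q : ℝ × ℝ) => hk μ (p.1 - q.1) (p.2 - q.2)) :=
    (measurable_hk μ).comp (((measurable_fst.comp measurable_fst).sub
      (measurable_fst.comp measurable_snd)).prodMk
      ((measurable_snd.comp measurable_fst).sub (measurable_snd.comp measurable_snd)))
  have m3 : Measurable (Function.uncurry fun (p q : ℝ × ℝ) => hkx μ (p.1 - q.1) (p.2 - q.2)) :=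
    (measurable_hkx μ).comp (((measurable_fst.comp measurable_fst).sub
      (measurable_fst.comp measurable_snd)).prodMk
      ((measurable_snd.comp measurable_fst).sub (measurable_snd.comp measurable_snd)))
  obtain ⟨i1, -, e1⟩ := integral_kernel_duality (ν := volume) hA m1 md.u0_meas
    (C := ENNReal.ofReal U) ENNReal.ofReal_ne_top (fun p _ => by
      calc _ ≤ ∫⁻ y, ENNReal.ofReal U * ‖hk μ p.1 (p.2 - y)‖ₑ := by
            refine lintegral_mono fun y => ?_
            rw [enorm_mul]
            gcongr
            rw [Real.enorm_eq_ofReal_abs]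
            exact ENNReal.ofReal_le_ofReal (md.u0_le y)
        _ ≤ ENNReal.ofReal U := by
            rw [lintegral_const_mul' _ _ ENNReal.ofReal_ne_top,
              lintegral_sub_left_eq_self (fun y => ‖hk μ p.1 y‖ₑ)]
            exact mul_le_of_le_one_right' (lintegral_hk_le hμ _))
    (L := fun y => -Φ (0, y)) (fun y => by simpa using integral_adj_mul_hk hμ hΦ 0 y)
  obtain ⟨i2, j2, e2⟩ := integral_kernel_duality (ν := volume) hA m2 md.FF_meas md.φ_int
    (fun p _ => (lintegral_duh_le hμ md.FF_meas md.FF_enorm_le p.1 p.2).trans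
      (setLIntegral_le_lintegral _ _))
    (L := fun q => -Φ q) (fun q => integral_adj_mul_hk hμ hΦ q.1 q.2)
  have hb : ∀ᵐ s, ∀ᵐ y, ‖src T K g u s y‖ₑ ≤
      ENNReal.ofReal (K * (B + G)) * ENNReal.ofReal (Real.exp (l * s)) := by
    refine ae_of_all _ fun s => ae_of_all _ fun y => ?_
    rw [Real.enorm_eq_ofReal_abs, ← ENNReal.ofReal_mul (by positivity)]
    exact ENNReal.ofReal_le_ofReal (bS s y)
  obtain ⟨i3, j3, e3⟩ := integral_kernel_duality (ν := volume) hA m3 mS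
    (C := ENNReal.ofReal (hkc μ) * (ENNReal.ofReal (K * (B + G)) *
      ENNReal.ofReal (√(Real.pi / l) * Real.exp (l * R))))
    (ENNReal.mul_ne_top ENNReal.ofReal_ne_top
      (ENNReal.mul_ne_top ENNReal.ofReal_ne_top ENNReal.ofReal_ne_top))
    (fun p hp => by
      -- On the support of the test function time is at most `R`, which bounds the exponential
      -- growth.
      have hpR : p.1 ≤ R := by
        by_contra h
        exact hp (hR p.1 p.2 (Or.inl ((not_le.1 h).le.trans (le_abs_self _))))
      refine (lintegral_duhx_le hμ mS hb (by fun_prop) p.1 p.2).trans ?_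
      rw [abel_const_mul (by fun_prop), abel_exp hl]
      gcongr)
    (L := pd (0, 1) Φ) (fun q => integral_adj_mul_hkx hμ hΦ q.1 q.2)
  -- The test function vanishes at time zero, so the initial value contributes nothing.
  have z0 : ∀ y, Φ (0, y) = 0 := fun y => image_eq_zero_of_notMem_tsupport fun h =>
    lt_irrefl _ (hs h).1.1
  simp only [z0, neg_zero, mul_zero, integral_zero] at e1
  have hu1 : ∀ p : ℝ × ℝ, u p.1 p.2 * adj μ Φ p =
      adj μ Φ p * (∫ y, u0 y * hk μ p.1 (p.2 - y)) +
      adj μ Φ p * (∫ q : ℝ × ℝ, Function.uncurry FF q * hk μ (p.1 - q.1) (p.2 - q.2)) -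
      adj μ Φ p * (∫ q : ℝ × ℝ, Function.uncurry (src T K g u) q * hkx μ (p.1 - q.1) (p.2 - q.2)) := by
    intro p
    rw [hfix, pic, heat, duh, duhx]
    simp only [Function.uncurry]
    ring
  have iu : Integrable fun p : ℝ × ℝ => u p.1 p.2 * adj μ Φ p :=
    ((i1.add i2).sub i3).congr (ae_of_all _ fun p => (hu1 p).symm)
  have eu : ∫ p : ℝ × ℝ, u p.1 p.2 * adj μ Φ p = (∫ q : ℝ × ℝ, Function.uncurry FF q * -Φ q) -
      ∫ q, Function.uncurry (src T K g u) q * pd (0, 1) Φ q := by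
    have i12 : Integrable fun p : ℝ × ℝ => adj μ Φ p * (∫ y, u0 y * hk μ p.1 (p.2 - y)) +
      adj μ Φ p * (∫ q : ℝ × ℝ, Function.uncurry FF q * hk μ (p.1 - q.1) (p.2 - q.2)) := i1.add i2
    simp_rw [hu1]
    rw [integral_sub i12 i3, integral_add i1 i2, e1, e2, e3, zero_add]
  have supp0 : ∀ q : ℝ × ℝ, q ∉ Icc 0 T ×ˢ (univ : Set ℝ) → Φ q = 0 ∧ pd (0, 1) Φ q = 0 ∧
      adj μ Φ q = 0 := by
    intro q hq
    have hn : q ∉ tsupport Φ := fun h => hq ⟨Ioo_subset_Icc_self (hs h).1, mem_univ _⟩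
    have z : ∀ v, pd v Φ q = 0 := fun v =>
      image_eq_zero_of_notMem_tsupport fun h => hn (tsupport_fderiv_apply_subset ℝ v h)
    have z2 : pd (0, 1) (pd (0, 1) Φ) q = 0 := image_eq_zero_of_notMem_tsupport fun h =>
      hn (tsupport_fderiv_apply_subset ℝ _ (tsupport_fderiv_apply_subset ℝ _ h))
    exact ⟨image_eq_zero_of_notMem_tsupport hn, z _, by rw [adj, z, z2]; simp⟩
  have e4 : ∫ q, (u q.1 q.2 * adj μ Φ q + FF q.1 q.2 * Φ q +
      ftr K (u q.1 q.2 + g q.1 q.2) * pd (0, 1) Φ q) ∂strip T =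
      ∫ q : ℝ × ℝ, (u q.1 q.2 * adj μ Φ q - Function.uncurry FF q * -Φ q +
        Function.uncurry (src T K g u) q * pd (0, 1) Φ q) := by
    refine Eq.trans ?_ (setIntegral_eq_integral_of_forall_compl_eq_zero
      (s := Icc (0:ℝ) T ×ˢ (univ : Set ℝ)) fun q hq => ?_)
    · rw [strip]
      refine setIntegral_congr_fun (measurableSet_Icc.prod MeasurableSet.univ) fun q hq => ?_
      have : src T K g u q.1 q.2 = ftr K (u q.1 q.2 + g q.1 q.2) := if_pos hq.1
      simp only [Function.uncurry_def, this]
      ring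
    · obtain ⟨h1, h2, h3⟩ := supp0 q hq
      rw [h1, h2, h3]; ring
  have iu2 : Integrable fun q : ℝ × ℝ => u q.1 q.2 * adj μ Φ q - Function.uncurry FF q * -Φ q :=
    iu.sub j2
  rw [e4, integral_add iu2 j3, integral_sub iu j2, eu]
  ring

end

section

/-! ### Continuity in time of the mild solution -/

/-- Pointwise convergence together with convergence of the norms implies convergence in `L¹`: the
difference is bounded by the sum of the absolute values, whose integrals converge. It is applied to
kernels with a singularity moving with time, for which their explicit masses are easier to handle
than a common majorant. -/
lemma tendsto_lintegral_enorm_sub {α : Type*} [MeasurableSpace α] {ν : Measure α} {k : ℝ → α → ℝ}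
    {t : ℝ} (hm : ∀ s, Measurable (k s)) (hfin : ∀ s, ∫⁻ q, ‖k s q‖ₑ ∂ν ≠ ⊤)
    (hae : ∀ᵐ q ∂ν, Tendsto (fun s => k s q) (𝓝 t) (𝓝 (k t q)))
    (hint : Tendsto (fun s => ∫⁻ q, ‖k s q‖ₑ ∂ν) (𝓝 t) (𝓝 (∫⁻ q, ‖k t q‖ₑ ∂ν))) :
    Tendsto (fun s => ∫⁻ q, ‖k s q - k t q‖ₑ ∂ν) (𝓝 t) (𝓝 0) := by
  have hi : ∀ s, Integrable (k s) ν := fun s => ⟨(hm s).aestronglyMeasurable, (hfin s).lt_top⟩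
  refine tendsto_of_seq_tendsto fun x hx => ?_
  have h1 : ∀ s, ∫ q, |k s q| ∂ν = (∫⁻ q, ‖k s q‖ₑ ∂ν).toReal := fun s =>
    integral_norm_eq_lintegral_enorm (hm s).aestronglyMeasurable
  have key := tendsto_integral_of_generalized_dominated (ν := ν)
    (F := fun n q => |k (x n) q - k t q|) (f := fun _ => 0)
    (G := fun n q => |k (x n) q| + |k t q|) (g := fun q => |k t q| + |k t q|)
    (fun n => (((hm _).sub (hm t)).abs).aestronglyMeasurable)
    (fun n => (hi _).abs.add (hi t).abs) ((hi t).abs.add (hi t).abs)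
    (fun n => ae_of_all _ fun q => by rw [abs_abs]; exact abs_sub _ _)
    (hae.mono fun q hq => by
      have := ((hq.comp hx).sub_const (k t q)).abs
      simpa using this)
    (hae.mono fun q hq => ((hq.comp hx).abs).add_const _)
    (by
      have e : ∀ s, ∫ q, |k s q| + |k t q| ∂ν = ∫ q, |k s q| ∂ν + ∫ q, |k t q| ∂ν := fun s =>
        integral_add (hi s).abs (hi t).abs
      simp only [e, h1]
      exact (((ENNReal.tendsto_toReal (hfin t)).comp hint).comp hx).add_const _)
  have e2 : ∀ n, ∫⁻ q, ‖k (x n) q - k t q‖ₑ ∂ν = ENNReal.ofReal (∫ q, |k (x n) q - k t q| ∂ν) :=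
    fun n => (ofReal_integral_norm_eq_lintegral_enorm ((hi _).sub (hi t))).symm
  simp only [Function.comp_def, e2]
  rw [← ENNReal.ofReal_zero]
  simp only [integral_zero] at key
  exact ENNReal.tendsto_ofReal key

variable {μ T U G K l B : ℝ} {u0 : ℝ → ℝ} {FF g u : ℝ → ℝ → ℝ} {φ κ : ℝ → ℝ} {V : ℝ → ℝ≥0∞}

lemma continuousAt_hk (hμ : 0 < μ) {r : ℝ} (hr : r ≠ 0) (y : ℝ) :
    ContinuousAt (fun r => hk μ r y) r := by
  rcases lt_or_gt_of_ne hr with h | h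
  · refine (continuousAt_const (y := (0:ℝ))).congr ?_
    filter_upwards [Iio_mem_nhds h] with s hs
    exact (hk_of_nonpos hμ (le_of_lt hs) y).symm
  · unfold hk
    have h1 : √(4 * Real.pi * μ * r) ≠ 0 := (Real.sqrt_pos.2 (by positivity)).ne'
    have h2 : 4 * μ * r ≠ 0 := by positivity
    exact ((by fun_prop : ContinuousAt (fun r => √(4 * Real.pi * μ * r)) r).inv₀ h1).mul
      (Real.continuous_exp.continuousAt.comp
        (continuousAt_const.div (by fun_prop : ContinuousAt (fun r => 4 * μ * r) r) h2))

lemma continuousAt_hkx (hμ : 0 < μ) {r : ℝ} (hr : r ≠ 0) (y : ℝ) :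
    ContinuousAt (fun r => hkx μ r y) r := by
  unfold hkx
  exact (continuousAt_const.div (by fun_prop : ContinuousAt (fun r => 2 * μ * r) r)
    (by positivity)).neg.mul (continuousAt_hk hμ hr y)

lemma ae_fst_ne (t : ℝ) : ∀ᵐ q : ℝ × ℝ, q.1 ≠ t := by
  have h : ∀ᵐ s : ℝ, s ≠ t := by simp [ae_iff]
  exact (Measure.quasiMeasurePreserving_fst (μ := (volume : Measure ℝ))
    (ν := (volume : Measure ℝ))).ae h

lemma lintegral_weight_mul {b : ℝ → ℝ} (hb : Measurable b) {k : ℝ × ℝ → ℝ} (hk : Measurable k) :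
    ∫⁻ q : ℝ × ℝ, ‖b q.1 * k q‖ₑ = ∫⁻ s, ‖b s‖ₑ * ∫⁻ y, ‖k (s, y)‖ₑ := by
  have hm : Measurable fun q : ℝ × ℝ => ‖b q.1 * k q‖ₑ := ((hb.comp measurable_fst).mul hk).enorm
  rw [Measure.volume_eq_prod, lintegral_prod _ hm.aemeasurable]
  congr 1 with s
  simp only [enorm_mul]
  exact lintegral_const_mul _ (hk.comp measurable_prodMk_left).enorm

/-- Duhamel integrals of two kernels, compared uniformly in space. -/
lemma enorm_convolution_sub_le {H : ℝ → ℝ → ℝ} (hH : Measurable (Function.uncurry H)) {b : ℝ → ℝ}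
    (hb : Measurable b) (hHb : ∀ᵐ s, ∀ᵐ y, ‖H s y‖ₑ ≤ ‖b s‖ₑ) {k k' : ℝ × ℝ → ℝ}
    (hk : Measurable k) (hk' : Measurable k') (x : ℝ)
    (hi : Integrable fun q : ℝ × ℝ => H q.1 q.2 * k (q.1, x - q.2))
    (hi' : Integrable fun q : ℝ × ℝ => H q.1 q.2 * k' (q.1, x - q.2)) :
    ‖(∫ q : ℝ × ℝ, H q.1 q.2 * k (q.1, x - q.2)) - ∫ q : ℝ × ℝ, H q.1 q.2 * k' (q.1, x - q.2)‖ₑ ≤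
      ∫⁻ q : ℝ × ℝ, ‖b q.1 * k q - b q.1 * k' q‖ₑ := by
  rw [← integral_sub hi hi']
  simp only [← mul_sub]
  refine (enorm_integral_le_lintegral_enorm _).trans ?_
  have m : Measurable fun q : ℝ × ℝ => (q.1, x - q.2) :=
    measurable_fst.prodMk (measurable_const.sub measurable_snd)
  refine (lintegral_mul_kernel_le hH hHb ((hk.comp m).sub (hk'.comp m))).trans (le_of_eq ?_)
  refine Eq.trans ?_ (lintegral_weight_mul hb (hk.sub hk')).symm
  congr 1 with s
  congr 1
  exact lintegral_sub_left_eq_self (fun y => ‖k (s, y) - k' (s, y)‖ₑ) x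

lemma tendsto_lintegral_Iio {b : ℝ → ℝ≥0∞} (hb : Measurable b) (hfin : ∫⁻ s, b s ≠ ⊤) (t : ℝ) :
    Tendsto (fun r => ∫⁻ s in Iio r, b s) (𝓝 t) (𝓝 (∫⁻ s in Iio t, b s)) := by
  simp only [← lintegral_indicator measurableSet_Iio]
  refine tendsto_lintegral_filter_of_dominated_convergence b
    (Eventually.of_forall fun r => hb.indicator measurableSet_Iio)
    (Eventually.of_forall fun r => ae_of_all _ fun s => indicator_le_self' (by simp) s) hfin ?_
  have h : ∀ᵐ s : ℝ, s ≠ t := by simp [ae_iff]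
  filter_upwards [h] with s hs
  refine tendsto_const_nhds.congr' ?_
  rcases lt_or_gt_of_ne hs with h | h
  · filter_upwards [Ioi_mem_nhds h] with r hr
    rw [indicator_of_mem (by exact h), indicator_of_mem (by exact hr)]
  · filter_upwards [Iio_mem_nhds h] with r hr
    rw [indicator_of_notMem (by simpa using h.le), indicator_of_notMem (by
      simpa using (le_of_lt (by exact hr)))]

/-- Since each positive-time heat kernel has mass one, the weighted kernel has total mass `∫_{s < r}
|b|`, which is continuous in `r`; pointwise convergence holds off the line `s = t`. -/
lemma tendsto_duh_kernel (hμ : 0 < μ) {b : ℝ → ℝ} (hb : Measurable b) (hfin : ∫⁻ s, ‖b s‖ₑ ≠ ⊤)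
    (t : ℝ) : Tendsto (fun r => ∫⁻ q : ℝ × ℝ,
      ‖b q.1 * hk μ (r - q.1) q.2 - b q.1 * hk μ (t - q.1) q.2‖ₑ) (𝓝 t) (𝓝 0) := by
  have m : ∀ r, Measurable fun q : ℝ × ℝ => hk μ (r - q.1) q.2 := fun r =>
    (measurable_hk μ).comp ((measurable_const.sub measurable_fst).prodMk measurable_snd)
  have e : ∀ r, ∫⁻ q : ℝ × ℝ, ‖b q.1 * hk μ (r - q.1) q.2‖ₑ = ∫⁻ s in Iio r, ‖b s‖ₑ := by
    intro r
    rw [lintegral_weight_mul hb (m r), ← lintegral_indicator measurableSet_Iio]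
    congr 1 with s
    by_cases hs : s < r
    · rw [indicator_of_mem (by exact hs), ← ofReal_integral_norm_eq_lintegral_enorm
        (integrable_hk hμ (r - s))]
      simp only [Real.norm_eq_abs, abs_of_nonneg (hk_nonneg μ _ _)]
      rw [integral_hk hμ (sub_pos.2 hs)]; simp
    · rw [indicator_of_notMem (by exact hs)]
      simp [hk_of_nonpos hμ (sub_nonpos.2 (not_lt.1 hs))]
  refine tendsto_lintegral_enorm_sub (k := fun r (q : ℝ × ℝ) => b q.1 * hk μ (r - q.1) q.2)
    (fun r => (hb.comp measurable_fst).mul (m r)) (fun r => ?_) ?_ ?_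
  · rw [e]
    exact ((setLIntegral_le_lintegral _ _).trans_lt hfin.lt_top).ne
  · filter_upwards [ae_fst_ne t] with q hq
    refine Tendsto.const_mul _ ?_
    exact (continuousAt_hk hμ (sub_ne_zero.2 hq.symm) q.2).tendsto.comp
      (by fun_prop : ContinuousAt (fun r => r - q.1) t).tendsto
  · simp only [e]
    exact tendsto_lintegral_Iio hb.enorm hfin t

lemma abel_indicator_le (t : ℝ) :
    abel ((Ioi 0).indicator fun _ => 1) t = ENNReal.ofReal (2 * √t) := by
  rcases le_or_gt 0 t with ht | ht
  · exact abel_indicator ht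
  · rw [Real.sqrt_eq_zero_of_nonpos ht.le, abel, mul_zero, ENNReal.ofReal_zero]
    refine (lintegral_congr fun s => ?_).trans lintegral_zero
    by_cases hs : s ∈ Ioi (0:ℝ)
    · rw [Real.sqrt_eq_zero_of_nonpos (by linarith [show (0:ℝ) < s from hs])]; simp
    · rw [indicator_of_notMem hs, zero_mul]

/-- The total mass is a constant multiple of `√r`, hence continuous in `r`, despite the singularity
of the kernel. -/
lemma tendsto_duhx_kernel (hμ : 0 < μ) (S t : ℝ) : Tendsto (fun r => ∫⁻ q : ℝ × ℝ,
      ‖(Ioi 0).indicator (fun _ => S) q.1 * hkx μ (r - q.1) q.2 -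
        (Ioi 0).indicator (fun _ => S) q.1 * hkx μ (t - q.1) q.2‖ₑ) (𝓝 t) (𝓝 0) := by
  have m : ∀ r, Measurable fun q : ℝ × ℝ => hkx μ (r - q.1) q.2 := fun r =>
    (measurable_hkx μ).comp ((measurable_const.sub measurable_fst).prodMk measurable_snd)
  have hb : Measurable ((Ioi (0:ℝ)).indicator fun _ => S) := measurable_const.indicator measurableSet_Ioi
  have e : ∀ r, ∫⁻ q : ℝ × ℝ, ‖(Ioi 0).indicator (fun _ => S) q.1 * hkx μ (r - q.1) q.2‖ₑ =
      ‖S‖ₑ * ENNReal.ofReal (hkc μ) * ENNReal.ofReal (2 * √r) := by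
    intro r
    rw [lintegral_weight_mul hb (m r), ← abel_indicator_le, abel,
      ← lintegral_const_mul' _ _ (ENNReal.mul_ne_top enorm_ne_top ENNReal.ofReal_ne_top)]
    congr 1 with s
    simp only
    rw [lintegral_hkx hμ, ENNReal.ofReal_mul (hkc_nonneg μ)]
    by_cases hs : s ∈ Ioi (0:ℝ)
    · rw [indicator_of_mem hs, indicator_of_mem hs]; ring
    · rw [indicator_of_notMem hs, indicator_of_notMem hs]; simp
  refine tendsto_lintegral_enorm_sub
    (k := fun r (q : ℝ × ℝ) => (Ioi 0).indicator (fun _ => S) q.1 * hkx μ (r - q.1) q.2)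
    (fun r => (hb.comp measurable_fst).mul (m r)) (fun r => ?_) ?_ ?_
  · rw [e]
    exact ENNReal.mul_ne_top (ENNReal.mul_ne_top enorm_ne_top ENNReal.ofReal_ne_top)
      ENNReal.ofReal_ne_top
  · filter_upwards [ae_fst_ne t] with q hq
    refine Tendsto.const_mul _ ?_
    exact (continuousAt_hkx hμ (sub_ne_zero.2 hq.symm) q.2).tendsto.comp
      (by fun_prop : ContinuousAt (fun r => r - q.1) t).tendsto
  · simp only [e]
    refine ENNReal.Tendsto.const_mul ?_
      (Or.inr (ENNReal.mul_ne_top enorm_ne_top ENNReal.ofReal_ne_top))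
    exact ENNReal.tendsto_ofReal (by fun_prop : ContinuousAt (fun r => 2 * √r) t).tendsto

lemma tendsto_heat_kernel (hμ : 0 < μ) {t : ℝ} (ht : 0 < t) :
    Tendsto (fun r => ∫⁻ y, ‖hk μ r y - hk μ t y‖ₑ) (𝓝 t) (𝓝 0) := by
  refine tendsto_lintegral_enorm_sub (k := hk μ) (fun r => measurable_hk_right μ r)
    (fun r => ((lintegral_hk_le hμ r).trans_lt ENNReal.one_lt_top).ne)
    (ae_of_all _ fun y => (continuousAt_hk hμ ht.ne' y).tendsto) ?_
  refine tendsto_const_nhds.congr' ?_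
  have e : ∀ r, 0 < r → ∫⁻ y, ‖hk μ r y‖ₑ = 1 := fun r hr => by
    rw [← ofReal_integral_norm_eq_lintegral_enorm (integrable_hk hμ r)]
    simp only [Real.norm_eq_abs, abs_of_nonneg (hk_nonneg μ _ _)]
    rw [integral_hk hμ hr]; simp
  filter_upwards [Ioi_mem_nhds ht] with r hr
  rw [e t ht, e r hr]

lemma enorm_heat_sub_le (hμ : 0 < μ) (hu : Measurable u0) (hU : ∀ x, |u0 x| ≤ U) (r t x : ℝ) :
    ‖heat μ u0 r x - heat μ u0 t x‖ₑ ≤ ENNReal.ofReal U * ∫⁻ y, ‖hk μ r y - hk μ t y‖ₑ := by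
  unfold heat
  rw [← integral_sub (integrable_heat hμ hu hU r x) (integrable_heat hμ hu hU t x)]
  refine (enorm_integral_le_lintegral_enorm _).trans ?_
  rw [← lintegral_const_mul' _ _ ENNReal.ofReal_ne_top,
    ← lintegral_sub_left_eq_self (fun y => ENNReal.ofReal U * ‖hk μ r y - hk μ t y‖ₑ) x]
  refine lintegral_mono fun y => ?_
  simp only
  rw [← mul_sub, enorm_mul]
  gcongr
  rw [Real.enorm_eq_ofReal_abs]
  exact ENNReal.ofReal_le_ofReal (hU y)

lemma MildData.src_enorm_le (md : MildData T U G u0 FF g φ κ) (hK : 0 ≤ K) (hl : 0 < l)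
    (hB : 0 ≤ B) (hu : Iterate B l V u) : ∀ᵐ s, ∀ᵐ y, ‖src T K g u s y‖ₑ ≤
      ‖(Ioi (0:ℝ)).indicator (fun _ => K * (B + G) * Real.exp (l * T)) s‖ₑ := by
  have hG : 0 ≤ G := (abs_nonneg _).trans (md.g_le 0 0)
  have h0 : ∀ᵐ s : ℝ, s ≠ 0 := by simp [ae_iff]
  filter_upwards [h0] with s hs
  refine ae_of_all _ fun y => ?_
  by_cases h : s ∈ Icc 0 T
  · rw [indicator_of_mem (show s ∈ Ioi 0 from lt_of_le_of_ne h.1 hs.symm), Real.enorm_eq_ofReal_abs,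
      Real.enorm_eq_ofReal_abs]
    refine ENNReal.ofReal_le_ofReal ((md.abs_src_le_exp hK hl hB hu.abs_le s y).trans ?_)
    rw [abs_of_nonneg (by positivity)]
    gcongr
    exact h.2
  · simp [src, h]

lemma MildData.φ_enorm (md : MildData T U G u0 FF g φ κ) (s : ℝ) :
    ‖φ s‖ₑ = ENNReal.ofReal (φ s) := by
  rw [Real.enorm_eq_ofReal_abs, abs_of_nonneg (md.φ_nonneg s)]

/-- The mild solution is continuous in time, uniformly in space, at positive times. -/
lemma MildData.tendsto_iSup_sub (md : MildData T U G u0 FF g φ κ) (hμ : 0 < μ) (hK : 0 ≤ K)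
    (hl : 0 < l) (hB : 0 ≤ B) (hu : Iterate B l V u) (hfix : ∀ t x, u t x = pic μ T K u0 FF g u t x)
    {t : ℝ} (ht : 0 < t) : Tendsto (fun r => ⨆ x, ‖u r x - u t x‖ₑ) (𝓝 t) (𝓝 0) := by
  have hG : 0 ≤ G := (abs_nonneg _).trans (md.g_le 0 0)
  set S := K * (B + G) * Real.exp (l * T) with hS
  have mS := measurable_src (T := T) (K := K) md.g_meas hu.meas
  have bS := md.abs_src_le_exp hK hl hB hu.abs_le
  have hφ : ∫⁻ s, ‖φ s‖ₑ ≠ ⊤ := by simp only [md.φ_enorm]; exact md.φ_int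
  have hF : ∀ᵐ s, ∀ᵐ y, ‖FF s y‖ₑ ≤ ‖φ s‖ₑ := by simp only [md.φ_enorm]; exact md.FF_enorm_le
  have m1 : ∀ r, Measurable fun q : ℝ × ℝ => hk μ (r - q.1) q.2 := fun r =>
    (measurable_hk μ).comp ((measurable_const.sub measurable_fst).prodMk measurable_snd)
  have m2 : ∀ r, Measurable fun q : ℝ × ℝ => hkx μ (r - q.1) q.2 := fun r =>
    (measurable_hkx μ).comp ((measurable_const.sub measurable_fst).prodMk measurable_snd)
  have t1 := ENNReal.Tendsto.const_mul (a := ENNReal.ofReal U) (tendsto_heat_kernel hμ ht)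
    (Or.inr ENNReal.ofReal_ne_top)
  have lim := (t1.add (tendsto_duh_kernel hμ md.φ_meas hφ t)).add (tendsto_duhx_kernel hμ S t)
  simp only [mul_zero, add_zero] at lim
  refine tendsto_of_tendsto_of_tendsto_of_le_of_le tendsto_const_nhds lim (fun _ => zero_le)
    fun r => iSup_le fun x => ?_
  have c2 := enorm_convolution_sub_le md.FF_meas md.φ_meas hF (m1 r) (m1 t) x
    (integrable_duh hμ md.FF_meas hF hφ r x) (integrable_duh hμ md.FF_meas hF hφ t x)
  have c3 := enorm_convolution_sub_le mS (measurable_const.indicator measurableSet_Ioi)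
    (md.src_enorm_le hK hl hB hu) (m2 r) (m2 t) x
    (duhx_of_abs_le_exp hμ hl mS (by positivity) bS r x).1
    (duhx_of_abs_le_exp hμ hl mS (by positivity) bS t x).1
  have c1 := enorm_heat_sub_le hμ md.u0_meas md.u0_le r t x
  have e : u r x - u t x = (heat μ u0 r x - heat μ u0 t x) + (duh μ FF r x - duh μ FF t x) -
      (duhx μ (src T K g u) r x - duhx μ (src T K g u) t x) := by
    rw [hfix, hfix t, pic, pic]; ring
  rw [e]
  exact (enorm_sub_le).trans (add_le_add ((enorm_add_le _ _).trans (add_le_add c1 c2)) c3)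

/-- At time zero only the deviation from the heat flow of `u0` tends to zero uniformly; the initial
value is merely bounded, so the heat flow itself is treated in `L²_loc`. -/
lemma MildData.tendsto_iSup_sub_heat (md : MildData T U G u0 FF g φ κ) (hμ : 0 < μ) (hK : 0 ≤ K)
    (hl : 0 < l) (hB : 0 ≤ B) (hu : Iterate B l V u)
    (hfix : ∀ t x, u t x = pic μ T K u0 FF g u t x) :
    Tendsto (fun r => ⨆ x, ‖u r x - heat μ u0 r x‖ₑ) (𝓝 0) (𝓝 0) := by
  set S := K * (B + G) * Real.exp (l * T) with hS
  have mS := measurable_src (T := T) (K := K) md.g_meas hu.meas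
  have t1 := tendsto_lintegral_Iio (ENNReal.measurable_ofReal.comp md.φ_meas) md.φ_int 0
  have e1 : ∫⁻ s in Iio 0, (ENNReal.ofReal ∘ φ) s = 0 := by
    rw [setLIntegral_congr_fun measurableSet_Iio (g := fun _ => 0) (fun s hs => by
      simp [md.φ_zero s (fun h => (not_le.2 (show s < 0 from hs)) h.1)])]
    simp
  rw [e1] at t1
  have t2 : Tendsto (fun r : ℝ => ENNReal.ofReal (hkc μ) * (‖S‖ₑ * ENNReal.ofReal (2 * √r)))
      (𝓝 0) (𝓝 0) := by
    have c : Tendsto (fun r : ℝ => ENNReal.ofReal (2 * √r)) (𝓝 0) (𝓝 0) := by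
      have := ENNReal.tendsto_ofReal (by fun_prop : ContinuousAt (fun r : ℝ => 2 * √r) 0).tendsto
      simpa using this
    have := ENNReal.Tendsto.const_mul (a := ENNReal.ofReal (hkc μ))
      (ENNReal.Tendsto.const_mul (a := ‖S‖ₑ) c (Or.inr enorm_ne_top)) (Or.inr ENNReal.ofReal_ne_top)
    simpa using this
  have lim := t1.add t2
  rw [add_zero] at lim
  refine tendsto_of_tendsto_of_tendsto_of_le_of_le tendsto_const_nhds lim (fun _ => zero_le)
    fun r => iSup_le fun x => ?_
  have c1 := enorm_duh_le hμ md.FF_meas md.FF_enorm_le r x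
  have hb : ∀ᵐ s, ∀ᵐ y, ‖src T K g u s y‖ₑ ≤ ‖S‖ₑ * (Ioi (0:ℝ)).indicator (fun _ => 1) s := by
    filter_upwards [md.src_enorm_le hK hl hB hu] with s hs
    filter_upwards [hs] with y hy
    refine hy.trans (le_of_eq ?_)
    by_cases h : s ∈ Ioi (0:ℝ)
    · rw [indicator_of_mem h, indicator_of_mem h, mul_one]
    · rw [indicator_of_notMem h, indicator_of_notMem h]; simp
  have mi : Measurable ((Ioi (0:ℝ)).indicator fun _ => (1:ℝ≥0∞)) :=
    measurable_const.indicator measurableSet_Ioi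
  have c2 := enorm_duhx_le hμ mS hb (mi.const_mul _) r x
  rw [abel_const_mul mi, abel_indicator_le] at c2
  have e : u r x - heat μ u0 r x = duh μ FF r x - duhx μ (src T K g u) r x := by
    rw [hfix, pic]; ring
  rw [e]
  exact enorm_sub_le.trans (add_le_add c1 c2)

/-! ### The heat semigroup at small times -/

lemma tendsto_lintegral_translate {v : ℝ → ℝ} (hv : MemLp v 1 volume) :
    Tendsto (fun h => ∫⁻ x, ‖v (x - h) - v x‖ₑ) (𝓝 0) (𝓝 0) := by
  have : Fact ((1:ℝ≥0∞) ≠ ⊤) := ⟨ENNReal.one_ne_top⟩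
  have hc : Continuous fun h : ℝ => DomAddAct.mk (-h) +ᵥ hv.toLp v :=
    (DomAddAct.continuous_mk.comp continuous_neg).vadd continuous_const
  have h1 := (hc.tendsto 0)
  rw [tendsto_iff_edist_tendsto_0] at h1
  refine h1.congr fun h => ?_
  rw [DomAddAct.mk_vadd_toLp, DomAddAct.mk_vadd_toLp, Lp.edist_toLp_toLp, eLpNorm_one_eq_lintegral_enorm]
  congr 1 with x
  simp [sub_eq_neg_add]

lemma tendsto_lintegral_Icc_translate (hu : Measurable u0) (hU : ∀ x, |u0 x| ≤ U) (r : ℝ) :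
    Tendsto (fun h => ∫⁻ x in Icc (-r) r, ‖u0 (x - h) - u0 x‖ₑ) (𝓝 0) (𝓝 0) := by
  have hv : MemLp ((Icc (-(r + 1)) (r + 1)).indicator u0) 1 volume := by
    refine memLp_one_iff_integrable.2 ((integrable_indicator_iff measurableSet_Icc).2 ?_)
    exact Measure.integrableOn_of_bounded (M := U) (by simp) hu.aestronglyMeasurable (ae_of_all _ hU)
  refine tendsto_of_tendsto_of_tendsto_of_le_of_le' tendsto_const_nhds
    (tendsto_lintegral_translate hv) (Eventually.of_forall fun _ => zero_le) ?_
  filter_upwards [Ioo_mem_nhds (show (-1:ℝ) < 0 by norm_num) one_pos] with h hh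
  refine le_trans (le_of_eq ?_) (setLIntegral_le_lintegral (Icc (-r) r) _)
  refine setLIntegral_congr_fun measurableSet_Icc fun x hx => ?_
  rw [indicator_of_mem, indicator_of_mem]
  · constructor <;> linarith [hx.1, hx.2]
  · constructor <;> linarith [hx.1, hx.2, hh.1, hh.2]

lemma enorm_heat_sub_self_le (hμ : 0 < μ) (hu : Measurable u0) (hU : ∀ x, |u0 x| ≤ U) {t : ℝ}
    (ht : 0 < t) (x : ℝ) :
    ‖heat μ u0 t x - u0 x‖ₑ ≤ ∫⁻ z, ‖u0 (x - √t * z) - u0 x‖ₑ * ‖hk μ 1 z‖ₑ := by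
  have e : heat μ u0 t x - u0 x = ∫ z, (u0 (x - √t * z) - u0 x) * hk μ 1 z := by
    rw [← integral_scale ht (fun y => u0 (x - y) - u0 x), heat]
    rw [← integral_sub_left_eq_self (fun y => (u0 (x - y) - u0 x) * hk μ t y) volume x]
    simp only [sub_sub_cancel, sub_mul]
    rw [integral_sub (integrable_heat hμ hu hU t x)
      (((integrable_hk hμ t).comp_sub_left x).const_mul _), integral_const_mul,
      integral_sub_left_eq_self (hk μ t), integral_hk hμ ht, mul_one]
  rw [e]
  refine (enorm_integral_le_lintegral_enorm _).trans (le_of_eq ?_)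
  simp only [enorm_mul]

/-- The heat semigroup is continuous at time zero in the locally square integrable functions. -/
lemma tendsto_heat_zero (hμ : 0 < μ) (hu : Measurable u0) (hU : ∀ x, |u0 x| ≤ U) (r : ℝ) :
    Tendsto (fun t => eLpNorm (fun x => heat μ u0 t x - u0 x) 2 (volume.restrict (Icc (-r) r)))
      (𝓝[>] 0) (𝓝 0) := by
  have hb : ∀ a b, ‖u0 a - u0 b‖ₑ ≤ ENNReal.ofReal (2 * U) := fun a b => by
    rw [Real.enorm_eq_ofReal_abs]
    exact ENNReal.ofReal_le_ofReal ((abs_sub _ _).trans (by linarith [hU a, hU b]))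
  have m : ∀ t : ℝ, Measurable fun q : ℝ × ℝ => ‖u0 (q.1 - √t * q.2) - u0 q.1‖ₑ * ‖hk μ 1 q.2‖ₑ :=
    fun t => ((hu.comp (by fun_prop)).sub (hu.comp measurable_fst)).enorm.mul
      ((measurable_hk_right μ 1).comp measurable_snd).enorm
  have L1 : Tendsto (fun t : ℝ => ∫⁻ z, (∫⁻ x in Icc (-r) r, ‖u0 (x - √t * z) - u0 x‖ₑ) *
      ‖hk μ 1 z‖ₑ) (𝓝[>] 0) (𝓝 0) := by
    have key := tendsto_lintegral_filter_of_dominated_convergence (μ := volume) (l := 𝓝[>] (0:ℝ))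
      (F := fun t z => (∫⁻ x in Icc (-r) r, ‖u0 (x - √t * z) - u0 x‖ₑ) * ‖hk μ 1 z‖ₑ)
      (f := fun _ => 0)
      (fun z => ENNReal.ofReal (2 * U) * volume (Icc (-r) r) * ‖hk μ 1 z‖ₑ)
      (Eventually.of_forall fun t => by
        refine (Measurable.lintegral_prod_left' (μ := volume.restrict (Icc (-r) r))
          (f := fun q : ℝ × ℝ => ‖u0 (q.1 - √t * q.2) - u0 q.1‖ₑ)
          (((hu.comp (by fun_prop)).sub (hu.comp measurable_fst)).enorm)).mul
          (measurable_hk_right μ 1).enorm)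
      (Eventually.of_forall fun t => ae_of_all _ fun z => by
        gcongr
        refine (setLIntegral_mono measurable_const fun x _ => hb _ _).trans ?_
        rw [setLIntegral_const]) ?_ ?_
    · simpa using key
    · rw [lintegral_const_mul' _ _ (ENNReal.mul_ne_top ENNReal.ofReal_ne_top (by simp))]
      exact ENNReal.mul_ne_top (ENNReal.mul_ne_top ENNReal.ofReal_ne_top (by simp))
        ((lintegral_hk_le hμ 1).trans_lt ENNReal.one_lt_top).ne
    · refine ae_of_all _ fun z => ?_
      have c : Tendsto (fun t : ℝ => √t * z) (𝓝[>] 0) (𝓝 0) := by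
        have := (by fun_prop : ContinuousAt (fun t : ℝ => √t * z) 0).tendsto
        simp only [Real.sqrt_zero, zero_mul] at this
        exact this.mono_left nhdsWithin_le_nhds
      have := ENNReal.Tendsto.mul_const (b := ‖hk μ 1 z‖ₑ)
        ((tendsto_lintegral_Icc_translate hu hU r).comp c) (Or.inr enorm_ne_top)
      simpa using this
  -- Both functions are bounded by `U`, so the square of the difference is at most `2U` times its
  -- absolute value, and convergence in `L¹_loc` suffices.
  have L2 : Tendsto (fun t => eLpNorm (fun x => heat μ u0 t x - u0 x) 2
      (volume.restrict (Icc (-r) r)) ^ 2) (𝓝[>] 0) (𝓝 0) := by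
    have L3 := ENNReal.Tendsto.const_mul (a := ENNReal.ofReal (2 * U)) L1
      (Or.inr ENNReal.ofReal_ne_top)
    rw [mul_zero] at L3
    refine tendsto_of_tendsto_of_tendsto_of_le_of_le' tendsto_const_nhds L3
      (Eventually.of_forall fun _ => zero_le) ?_
    filter_upwards [self_mem_nhdsWithin] with t ht
    rw [eLpNorm_two_sq, ← lintegral_const_mul' _ _ ENNReal.ofReal_ne_top]
    calc _ ≤ ∫⁻ x in Icc (-r) r, ENNReal.ofReal (2 * U) *
          ∫⁻ z, ‖u0 (x - √t * z) - u0 x‖ₑ * ‖hk μ 1 z‖ₑ := by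
          refine lintegral_mono fun x => ?_
          simp only
          rw [sq]
          refine mul_le_mul' ?_ (enorm_heat_sub_self_le hμ hu hU ht x)
          rw [Real.enorm_eq_ofReal_abs]
          exact ENNReal.ofReal_le_ofReal ((abs_sub _ _).trans
            (by linarith [hU x, abs_heat_le hμ hU ht x]))
      _ = ENNReal.ofReal (2 * U) * ∫⁻ x in Icc (-r) r,
          ∫⁻ z, ‖u0 (x - √t * z) - u0 x‖ₑ * ‖hk μ 1 z‖ₑ :=
          lintegral_const_mul' _ _ ENNReal.ofReal_ne_top
      _ = ENNReal.ofReal (2 * U) * ∫⁻ z, ∫⁻ x in Icc (-r) r,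
          ‖u0 (x - √t * z) - u0 x‖ₑ * ‖hk μ 1 z‖ₑ := by
          rw [lintegral_lintegral_swap (m t).aemeasurable]
      _ ≤ _ := by
          rw [← lintegral_const_mul' _ _ ENNReal.ofReal_ne_top]
          refine lintegral_mono fun z => ?_
          simp only
          rw [lintegral_mul_const' _ _ enorm_ne_top]
  have L4 := L2.ennrpow_const (1 / 2 : ℝ)
  refine (L4.congr fun t => ?_).trans_eq ?_
  · rw [← ENNReal.rpow_natCast, ← ENNReal.rpow_mul]; norm_num
  · simp

end

section

/-! ### Square integrability of the derivative -/

variable {T M μ : ℝ} {z zx A B : ℝ → ℝ → ℝ}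

lemma moll_const_mul (n : ℕ) (c : ℝ) (f : ℝ → ℝ) (x : ℝ) :
    moll n (fun y => c * f y) x = c * moll n f x := by
  unfold moll
  rw [← integral_const_mul]
  congr 1 with y
  ring

lemma Evolution.nonneg (h : Evolution T M z zx A B) (hT : 0 ≤ T) : 0 ≤ M := by
  obtain ⟨x, hx⟩ := (h.z_le 0 ⟨le_rfl, hT⟩).exists
  exact (abs_nonneg _).trans hx

lemma abs_integral_le_of_support {f : ℝ → ℝ} {a b C : ℝ} (hab : a ≤ b)
    (h0 : ∀ x, x ∉ Icc a b → f x = 0) (hC : ∀ᵐ x, |f x| ≤ C) : |∫ x, f x| ≤ C * (b - a) := by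
  rw [← setIntegral_eq_integral_of_forall_compl_eq_zero h0]
  have := norm_setIntegral_le_of_norm_le_const_ae' (μ := volume) (s := Icc a b) (f := f) (C := C)
    (by simp) (hC.mono fun x hx _ => hx)
  rwa [Real.norm_eq_abs, Measure.real, Real.volume_Icc, ENNReal.toReal_ofReal (by linarith)] at this

/-- The mollified derivatives are bounded in `L²` uniformly in the mollification. -/
lemma Evolution.lintegral_moll_zx_sq_le (h : Evolution T M z zx (fun s x => μ * zx s x) B)
    (hμ : 0 < μ) (hT : 0 ≤ T) {b : ℝ → ℝ} (hbi : IntegrableOn b (Icc 0 T))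
    (hzx : ∀ᵐ s ∂volume.restrict (Icc 0 T), ∀ᵐ x, |zx s x| ≤ b s)
    (hB : ∀ᵐ s ∂volume.restrict (Icc 0 T), ∀ᵐ x, |B s x| ≤ b s)
    {c : ℝ} (hc : ∀ y x, |deriv (cutoff y) x| ≤ c) (y : ℝ) (n : ℕ) :
    ∫⁻ s in Icc 0 T, ∫⁻ x in Icc y (y + 1), ‖moll n (zx s) x‖ₑ ^ 2 ≤
      ENNReal.ofReal ((3 * M ^ 2 + (6 * μ * c * M + 3 * M) * ∫ s in Icc 0 T, b s) / μ) := by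
  have hM := h.nonneg hT
  have hc0 : 0 ≤ c := (abs_nonneg _).trans (hc 0 0)
  set ρ : ℝ → ℝ := fun x => cutoff y x ^ 2 with hρ
  have cρ : Continuous ρ := (cutoff_sq_contDiff y).continuous
  have cρ' : Continuous (deriv ρ) := (cutoff_sq_contDiff y).continuous_deriv (by simp)
  have sρ : HasCompactSupport ρ := cutoff_sq_hasCompactSupport y
  have ρ0 : ∀ x, 0 ≤ ρ x := fun x => sq_nonneg _
  have ρ1 : ∀ x, ρ x ≤ 1 := fun x => by
    have := cutoff_nonneg y x
    have := cutoff_le_one y x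
    simp only [hρ]; nlinarith
  have ρz : ∀ x, x ∉ Icc (y - 1) (y + 2) → ρ x = 0 := fun x hx => by
    simp [hρ, cutoff_eq_zero hx]
  have ρz' : ∀ x, x ∉ Icc (y - 1) (y + 2) → deriv ρ x = 0 := fun x hx => by
    rw [hρ, deriv_cutoff_sq, cutoff_eq_zero hx]; ring
  have ρ' : ∀ x, |deriv ρ x| ≤ 2 * c := fun x => by
    rw [hρ, deriv_cutoff_sq, abs_mul, abs_mul, abs_two, abs_of_nonneg (cutoff_nonneg y x)]
    calc 2 * cutoff y x * |deriv (cutoff y) x| ≤ 2 * 1 * c := by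
          gcongr
          · exact cutoff_le_one y x
          · exact hc y x
      _ = 2 * c := by ring
  have Zle : ∀ s ∈ Icc 0 T, ∀ x, |moll n (z s) x| ≤ M := fun s hs => moll_abs_le (h.z_le s hs)
  have cZ : ∀ s ∈ Icc 0 T, Continuous (moll n (z s)) := fun s hs =>
    moll_continuous n (h.z_locallyIntegrable hs)
  obtain ⟨D, hD0, hD1, hD2⟩ := exists_abs_mker_le n
  set p : ℝ → ℝ := fun s => ∫ x, ρ x * moll n (zx s) x ^ 2 with hp
  set q : ℝ → ℝ := fun s => ∫ x, (-(μ * moll n (zx s) x * (deriv ρ x * moll n (z s) x)) +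
    moll n (B s) x * (ρ x * moll n (z s) x)) with hq
  have hz := aestronglyMeasurable_kernel_integral h.z_meas (mker_contDiff n).continuous
  rw [strip_eq_prod] at hz
  have hz' : AEStronglyMeasurable (fun p : ℝ × ℝ => moll n (z p.1) p.2)
      ((volume.restrict (Icc 0 T)).prod volume) := hz
  have m0 := (measurable_kernel_integral h.zx_meas
    (mker_contDiff n).continuous).aestronglyMeasurable
    (μ := (volume.restrict (Icc 0 T)).prod volume)
  have m2 := (measurable_kernel_integral h.B_meas
    (mker_contDiff n).continuous).aestronglyMeasurable
    (μ := (volume.restrict (Icc 0 T)).prod volume)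
  have m3 := (cρ.comp continuous_snd).aestronglyMeasurable
    (μ := (volume.restrict (Icc 0 T)).prod (volume : Measure ℝ))
  have m4 := (cρ'.comp continuous_snd).aestronglyMeasurable
    (μ := (volume.restrict (Icc 0 T)).prod (volume : Measure ℝ))
  have mp : AEStronglyMeasurable p (volume.restrict (Icc 0 T)) :=
    (m3.mul (m0.pow 2)).integral_prod_right'
  have mq : AEStronglyMeasurable q (volume.restrict (Icc 0 T)) :=
    (((m0.const_mul μ).mul (m4.mul hz')).neg.add (m2.mul (m3.mul hz'))).integral_prod_right'
  have slice : ∀ᵐ s ∂volume.restrict (Icc 0 T),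
      Continuous (moll n (zx s)) ∧ Continuous (moll n (B s)) ∧
      (∀ x, |moll n (zx s) x| ≤ M * D * 2) ∧ (∀ x, |moll n (zx s) x| ≤ b s) ∧
      (∀ x, |moll n (B s) x| ≤ b s) := by
    filter_upwards [h.z_deriv, h.B_int.ae_locallyIntegrable, hzx, hB,
      ae_restrict_mem measurableSet_Icc] with s h1 h2 h3 h4 h5
    refine ⟨moll_continuous n h1.locInt', moll_continuous n h2, fun x => ?_, moll_abs_le h3,
      moll_abs_le h4⟩
    -- With the derivative on the kernel, the mollified `zₓ` is bounded by a constant depending on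
    -- `n`. This serves only to make `p` integrable; the estimate uniform in `n` uses `b`.
    rw [(h1.moll_hasDerivAt n x).unique (moll_hasDerivAt n h1.locInt x)]
    have e := abs_integral_le_of_support (f := fun w => z s w * deriv (mker n) (x - w))
      (a := x - 1) (b := x + 1) (C := M * D) (by linarith) (fun w hw => ?_) ?_
    · refine e.trans (le_of_eq ?_)
      ring
    · rw [deriv_mker_eq_zero, mul_zero]
      by_contra hc
      have := abs_le.1 (not_lt.1 hc)
      exact hw ⟨by linarith [this.2], by linarith [this.1]⟩
    · filter_upwards [h.z_le s h5] with w hw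
      rw [abs_mul]
      exact mul_le_mul hw (hD2 _) (abs_nonneg _) hM
  have ip : IntegrableOn p (Icc 0 T) := by
    refine Integrable.mono' (g := fun _ => (M * D * 2) ^ 2 * (y + 2 - (y - 1)))
      (integrableOn_const (by simp)) mp ?_
    filter_upwards [slice] with s hs
    refine abs_integral_le_of_support (by linarith) (fun x hx => by rw [ρz x hx, zero_mul])
      (ae_of_all _ fun x => ?_)
    rw [abs_mul, abs_of_nonneg (ρ0 x), abs_pow]
    calc ρ x * |moll n (zx s) x| ^ 2 ≤ 1 * (M * D * 2) ^ 2 := by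
          gcongr
          · exact ρ1 x
          · exact hs.2.2.1 x
      _ = _ := one_mul _
  -- The cross term `μ zₓ ρ' z` is bounded through `|z| ≤ M` and `|zₓ| ≤ b`, linearly in `b`. Hence
  -- an integrable majorant of `zₓ` is enough to obtain square integrability.
  have qle : ∀ᵐ s ∂volume.restrict (Icc 0 T), |q s| ≤ (6 * μ * c * M + 3 * M) * b s := by
    filter_upwards [slice, ae_restrict_mem measurableSet_Icc] with s hs hsT
    have hb0 : 0 ≤ b s := (abs_nonneg _).trans (hs.2.2.2.1 0)
    calc |q s| ≤ (μ * b s * (2 * c * M) + b s * (1 * M)) * (y + 2 - (y - 1)) := by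
          refine abs_integral_le_of_support (by linarith)
            (fun x hx => by rw [ρz x hx, ρz' x hx]; ring) (ae_of_all _ fun x => ?_)
          refine (abs_add_le _ _).trans ?_
          rw [abs_neg, abs_mul, abs_mul, abs_mul, abs_mul, abs_mul, abs_of_pos hμ,
            abs_of_nonneg (ρ0 x)]
          gcongr
          · exact hs.2.2.2.1 x
          · exact ρ' x
          · exact Zle s hsT x
          · exact hs.2.2.2.2 x
          · exact ρ1 x
          · exact Zle s hsT x
      _ = _ := by ring
  have iq : IntegrableOn q (Icc 0 T) := Integrable.mono' (hbi.const_mul _) mq qle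
  have hT' : T ∈ Icc 0 T := ⟨hT, le_rfl⟩
  have en := h.energy_moll (η := fun v => v ^ 2 / 2) (η' := fun v => v) (η'' := fun _ => 1)
    (fun v => by
      have := (hasDerivAt_pow 2 v).div_const 2
      refine this.congr_deriv (by norm_num)) (fun v => hasDerivAt_id v) continuous_const
    (cutoff_sq_contDiff y) sρ n hT'
  have eslice : ∀ᵐ s ∂volume.restrict (Icc 0 T),
      ∫ x, energyIntegrand (fun v => v) (fun _ => 1) ρ (moll n (z s)) (moll n (zx s))
        (moll n (fun x => μ * zx s x)) (moll n (B s)) x = -(μ * p s) + q s := by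
    filter_upwards [slice, ae_restrict_mem measurableSet_Icc] with s hs hsT
    have c1 := hs.1
    have c2 := hs.2.1
    have c3 := cZ s hsT
    have i1 : Integrable fun x => ρ x * moll n (zx s) x ^ 2 :=
      (cρ.mul (c1.pow 2)).integrable_of_hasCompactSupport sρ.mul_right
    have i2 : Integrable fun x => -(μ * moll n (zx s) x * (deriv ρ x * moll n (z s) x)) +
        moll n (B s) x * (ρ x * moll n (z s) x) := by
      refine Integrable.add (Integrable.neg ?_) ?_
      · exact (by fun_prop : Continuous _).integrable_of_hasCompactSupport
          (sρ.deriv.mul_right.mul_left)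
      · exact (by fun_prop : Continuous _).integrable_of_hasCompactSupport
          (sρ.mul_right.mul_left)
    rw [hp, hq]
    simp only
    have i3 : Integrable fun x => -(μ * (ρ x * moll n (zx s) x ^ 2)) := (i1.const_mul μ).neg
    rw [← integral_const_mul, ← integral_neg, ← integral_add i3 i2]
    congr 1 with x
    rw [energyIntegrand, moll_const_mul]
    ring
  have ip' : IntegrableOn (fun s => -(μ * p s)) (Icc 0 T) := (ip.const_mul μ).neg
  rw [integral_congr_ae eslice, integral_add ip' iq, integral_neg,
    integral_const_mul] at en
  have e0 : ∀ s ∈ Icc 0 T, |∫ x, ρ x * (moll n (z s) x ^ 2 / 2)| ≤ 1 * (M ^ 2 / 2) * (y + 2 - (y - 1)) := by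
    intro s hs
    refine abs_integral_le_of_support (by linarith) (fun x hx => by rw [ρz x hx, zero_mul])
      (ae_of_all _ fun x => ?_)
    rw [abs_mul, abs_of_nonneg (ρ0 x), abs_div, abs_pow, abs_two]
    gcongr
    · exact ρ1 x
    · exact Zle s hs x
  have e1 := e0 T hT'
  have e2 := e0 0 ⟨le_rfl, hT⟩
  have e3 : |∫ s in Icc 0 T, q s| ≤ (6 * μ * c * M + 3 * M) * ∫ s in Icc 0 T, b s := by
    rw [← integral_const_mul]
    exact norm_integral_le_of_norm_le (f := q) (hbi.const_mul _) qle
  have fin : ∫ s in Icc 0 T, p s ≤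
      (3 * M ^ 2 + (6 * μ * c * M + 3 * M) * ∫ s in Icc 0 T, b s) / μ := by
    rw [le_div_iff₀ hμ]
    linarith [abs_le.1 e1, abs_le.1 e2, abs_le.1 e3]
  refine le_trans ?_ (ENNReal.ofReal_le_ofReal fin)
  have p0 : ∀ s, 0 ≤ p s := fun s => integral_nonneg fun x => mul_nonneg (ρ0 x) (sq_nonneg _)
  rw [ofReal_integral_eq_lintegral_ofReal ip (ae_of_all _ p0)]
  refine lintegral_mono_ae ?_
  filter_upwards [slice] with s hs
  have i1 : Integrable fun x => ρ x * moll n (zx s) x ^ 2 :=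
    (cρ.mul (hs.1.pow 2)).integrable_of_hasCompactSupport sρ.mul_right
  rw [ofReal_integral_eq_lintegral_ofReal i1
    (ae_of_all _ fun x => mul_nonneg (ρ0 x) (sq_nonneg _))]
  refine le_trans (le_of_eq ?_) (setLIntegral_le_lintegral (Icc y (y + 1)) _)
  refine setLIntegral_congr_fun measurableSet_Icc fun x hx => ?_
  simp only [hρ, cutoff_eq_one hx, enorm_sq_eq_ofReal]
  norm_num

/-- Fatou's lemma, first in space and then in time, carries the bound for the mollified derivatives
to the limit; square integrability is a conclusion here and not an assumption, as it is in
`Evolution.energy`. -/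
lemma Evolution.l2ulL2_zx_lt_top (h : Evolution T M z zx (fun s x => μ * zx s x) B)
    (hμ : 0 < μ) (hT : 0 ≤ T) {b : ℝ → ℝ} (hbi : IntegrableOn b (Icc 0 T))
    (hzx : ∀ᵐ s ∂volume.restrict (Icc 0 T), ∀ᵐ x, |zx s x| ≤ b s)
    (hB : ∀ᵐ s ∂volume.restrict (Icc 0 T), ∀ᵐ x, |B s x| ≤ b s) : l2ulL2 T zx < ⊤ := by
  obtain ⟨c, -, hc⟩ := exists_abs_deriv_cutoff_le
  set C := (3 * M ^ 2 + (6 * μ * c * M + 3 * M) * ∫ s in Icc 0 T, b s) / μ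
  refine lt_of_le_of_lt (b := ENNReal.ofReal (√C)) (iSup_le fun y => ?_) ENNReal.ofReal_lt_top
  have key : ∫⁻ s in Icc 0 T, ∫⁻ x in Icc y (y + 1), ‖zx s x‖ₑ ^ 2 ≤ ENNReal.ofReal C := by
    have mm : ∀ n, Measurable fun q : ℝ × ℝ => ‖moll n (zx q.1) q.2‖ₑ ^ 2 := fun n =>
      (measurable_kernel_integral h.zx_meas (mker_contDiff n).continuous).enorm.pow_const 2
    calc _ ≤ ∫⁻ s in Icc 0 T, liminf (fun n =>
          ∫⁻ x in Icc y (y + 1), ‖moll n (zx s) x‖ₑ ^ 2) atTop := by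
          refine lintegral_mono_ae ?_
          filter_upwards [h.z_deriv] with s hs
          refine le_trans ?_ (lintegral_liminf_le fun n => (mm n).comp measurable_prodMk_left)
          refine lintegral_mono_ae ?_
          filter_upwards [ae_restrict_of_ae (moll_ae_tendsto hs.locInt')] with x hx
          exact (((ENNReal.continuous_pow 2).tendsto _).comp hx.enorm).liminf_eq.ge
      _ ≤ liminf (fun n => ∫⁻ s in Icc 0 T,
          ∫⁻ x in Icc y (y + 1), ‖moll n (zx s) x‖ₑ ^ 2) atTop :=
          lintegral_liminf_le fun n => (mm n).lintegral_prod_right'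
      _ ≤ ENNReal.ofReal C := by
          refine liminf_le_of_frequently_le' (Frequently.of_forall fun n => ?_)
          exact h.lintegral_moll_zx_sq_le hμ hT hbi hzx hB hc y n
  have e : eLpNorm (Function.uncurry zx) 2 (volume.restrict (Icc 0 T ×ˢ Icc y (y + 1))) ^ 2 ≤
      ENNReal.ofReal C := by
    rw [eLpNorm_two_sq, Measure.volume_eq_prod, ← Measure.prod_restrict,
      lintegral_prod _ (h.zx_meas.enorm.pow_const 2).aemeasurable]
    exact key
  rcases le_total 0 C with h0 | h0
  · exact le_ofReal_of_sq_le (Real.sqrt_nonneg _) (by rwa [Real.sq_sqrt h0])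
  · rw [ENNReal.ofReal_of_nonpos h0, nonpos_iff_eq_zero, pow_eq_zero_iff two_ne_zero] at e
    rw [e]; exact zero_le

end

section

/-! ### Difference quotients -/

/-- The limit inferior of the forward difference quotients. -/
noncomputable def dq (f : ℝ → ℝ) (x : ℝ) : ℝ :=
  liminf (fun n : ℕ => ((n : ℝ) + 1) * (f (x + 1 / ((n : ℝ) + 1)) - f x)) atTop

lemma HasDerivAt.dq_eq {f : ℝ → ℝ} {f' x : ℝ} (h : HasDerivAt f f' x) : dq f x = f' := by
  have h1 := h.tendsto_slope_zero
  have h2 : Tendsto (fun n : ℕ => 1 / ((n : ℝ) + 1)) atTop (𝓝[≠] 0) :=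
    tendsto_nhdsWithin_iff.2 ⟨tendsto_one_div_add_atTop_nhds_zero_nat,
      Eventually.of_forall fun n => (by positivity : (1 / ((n : ℝ) + 1)) ≠ 0)⟩
  have h3 := h1.comp h2
  refine Tendsto.liminf_eq (h3.congr fun n => ?_)
  simp

/-- A Lipschitz function is differentiable almost everywhere, and there the difference quotients
converge. The version `dq` of the derivative is preferred because it is visibly jointly measurable
in time and space. -/
lemma LipschitzWith.hasWeakDeriv_dq {f : ℝ → ℝ} {K : ℝ≥0} (h : LipschitzWith K f) :
    HasWeakDeriv f (dq f) ∧ ∀ᵐ x, |dq f x| ≤ K := by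
  have e : deriv f =ᵐ[volume] dq f := by
    filter_upwards [h.ae_differentiableAt_real] with x hx
    exact (HasDerivAt.dq_eq hx.hasDerivAt).symm
  refine ⟨(hasWeakDeriv_of_lipschitz h).congr EventuallyEq.rfl e, ?_⟩
  filter_upwards [e] with x hx
  rw [← hx]
  exact norm_deriv_le_of_lipschitz h

lemma measurable_dq {u : ℝ → ℝ → ℝ} (hu : Measurable (Function.uncurry u)) :
    Measurable (Function.uncurry fun t => dq (u t)) := by
  have : ∀ n : ℕ, Measurable fun q : ℝ × ℝ =>
      ((n : ℝ) + 1) * (u q.1 (q.2 + 1 / ((n : ℝ) + 1)) - u q.1 q.2) := fun n =>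
    measurable_const.mul ((hu.comp (measurable_fst.prodMk (measurable_snd.add_const _))).sub hu)
  exact Measurable.liminf this

/-! ### Testing on the strip -/

lemma LocIntStrip.integrable_mul_test {T : ℝ} {A : ℝ → ℝ → ℝ} (hA : LocIntStrip T A)
    {Φ : ℝ × ℝ → ℝ} (hΦ : IsTest Φ) : Integrable (fun q => A q.1 q.2 * Φ q) (strip T) := by
  obtain ⟨R, hR0, hR⟩ := hΦ.exists_box
  obtain ⟨C, hC0, hC⟩ := hΦ.exists_abs_le
  have h1 : IntegrableOn (fun q : ℝ × ℝ => A q.1 q.2 * Φ q) (Icc 0 T ×ˢ Icc (-R) R) :=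
    Integrable.mul_bdd (c := C) (hA R) hΦ.continuous.aestronglyMeasurable (ae_of_all _ hC)
  refine IntegrableOn.of_forall_sdiff_eq_zero h1 (measurableSet_Icc.prod MeasurableSet.univ)
    fun q hq => ?_
  have : R ≤ |q.2| := by
    by_contra hc
    exact hq.2 ⟨hq.1.1, abs_le.1 (not_le.1 hc).le⟩
  rw [show q = (q.1, q.2) from rfl, hR _ _ (Or.inr this), mul_zero]

lemma integral_strip_pd {T : ℝ} {w wx : ℝ → ℝ → ℝ} (hw : LocIntStrip T w) (hwx : LocIntStrip T wx)
    (hd : ∀ᵐ s ∂volume.restrict (Icc 0 T), HasWeakDeriv (w s) (wx s)) {Φ : ℝ × ℝ → ℝ}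
    (hΦ : IsTest Φ) :
    ∫ q, w q.1 q.2 * pd (0, 1) Φ q ∂strip T = -∫ q, wx q.1 q.2 * Φ q ∂strip T := by
  have i1 := hw.integrable_mul_test (hΦ.pd (0, 1))
  have i2 := hwx.integrable_mul_test hΦ
  rw [strip_eq_prod] at *
  rw [integral_prod _ i1, integral_prod _ i2, ← integral_neg]
  refine integral_congr_ae ?_
  filter_upwards [hd] with s hs
  have hc : ContDiff ℝ ∞ fun x => Φ (s, x) := hΦ.smooth.comp (contDiff_const.prodMk contDiff_id)
  obtain ⟨R, hR0, hR⟩ := hΦ.exists_box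
  have hsupp : HasCompactSupport fun x => Φ (s, x) :=
    HasCompactSupport.intro (isCompact_Icc (a := -R) (b := R)) fun x hx => by
      refine hR s x (Or.inr ?_)
      by_contra hc
      exact hx (abs_le.1 (not_le.1 hc).le)
  have := hs.integral_eq _ hc hsupp
  simp only [(hΦ.hasDerivAt_right s _).deriv] at this
  exact this

/-! ### Regularity of the mild solution -/

/-- The mild solution `u` of the truncated problem with its data and bounds. -/
structure MildSol (μ T U G K B l : ℝ) (u0 : ℝ → ℝ) (FF g gx : ℝ → ℝ → ℝ) (φ κ : ℝ → ℝ)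
    (V : ℝ → ℝ≥0∞) (u : ℝ → ℝ → ℝ) : Prop where
  md : MildData T U G u0 FF g φ κ
  gx_meas : Measurable (Function.uncurry gx)
  gx_le : ∀ s y, |gx s y| ≤ κ s
  gx_deriv : ∀ᵐ s ∂volume.restrict (Icc 0 T), HasWeakDeriv (g s) (gx s)
  hμ : 0 < μ
  hT : 0 < T
  hK : 0 ≤ K
  hB : 0 ≤ B
  hl : 0 < l
  it : Iterate B l V u
  V_meas : Measurable V
  V_int : ∫⁻ t in Icc 0 T, V t ^ (4 / 3 : ℝ) ≠ ⊤
  fix : ∀ t x, u t x = pic μ T K u0 FF g u t x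

open Classical in
/-- The mild solution with the prescribed initial value. -/
noncomputable def withInit (u0 : ℝ → ℝ) (u : ℝ → ℝ → ℝ) (t x : ℝ) : ℝ :=
  if t = 0 then u0 x else u t x

variable {μ T U G K B l : ℝ} {u0 : ℝ → ℝ} {FF g gx u : ℝ → ℝ → ℝ} {φ κ : ℝ → ℝ} {V : ℝ → ℝ≥0∞}

lemma withInit_zero : withInit u0 u 0 = u0 := funext fun _ => if_pos rfl

lemma withInit_of_ne {t : ℝ} (ht : t ≠ 0) : withInit u0 u t = u t := funext fun _ => if_neg ht

lemma ae_ne_zero (T : ℝ) : ∀ᵐ s ∂volume.restrict (Icc 0 T), s ≠ 0 :=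
  ae_restrict_of_ae (by simp [ae_iff])

namespace MildSol

lemma U_nonneg (h : MildSol μ T U G K B l u0 FF g gx φ κ V u) : 0 ≤ U :=
  (abs_nonneg _).trans (h.md.u0_le 0)

lemma meas (h : MildSol μ T U G K B l u0 FF g gx φ κ V u) :
    Measurable (Function.uncurry (withInit u0 u)) :=
  Measurable.ite (measurable_fst (measurableSet_singleton 0)) (h.md.u0_meas.comp measurable_snd)
    h.it.meas

lemma abs_le (h : MildSol μ T U G K B l u0 FF g gx φ κ V u) {t : ℝ} (ht : t ∈ Icc 0 T) (x : ℝ) :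
    |withInit u0 u t x| ≤ max U (B * Real.exp (l * T)) := by
  by_cases h0 : t = 0
  · rw [h0, withInit_zero]
    exact (h.md.u0_le x).trans (le_max_left _ _)
  · rw [withInit_of_ne h0]
    refine (h.it.abs_le t x).trans (le_trans ?_ (le_max_right _ _))
    have := h.hB
    have := h.hl
    gcongr
    exact ht.2

lemma lintegral_V (h : MildSol μ T U G K B l u0 FF g gx φ κ V u) :
    ∫⁻ t in Icc 0 T, V t ≠ ⊤ := by
  have e : ∀ t, V t ≤ 1 + V t ^ (4 / 3 : ℝ) := fun t => by
    rcases le_total (V t) 1 with h | h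
    · exact h.trans le_self_add
    · refine le_trans ?_ le_add_self
      calc V t = V t ^ (1:ℝ) := (ENNReal.rpow_one _).symm
        _ ≤ _ := ENNReal.rpow_le_rpow_of_exponent_le h (by norm_num)
  refine ((lintegral_mono e).trans_lt ?_).ne
  rw [lintegral_add_left measurable_const]
  exact ENNReal.add_lt_top.2 ⟨by simp, h.V_int.lt_top⟩

lemma dq_spec (h : MildSol μ T U G K B l u0 FF g gx φ κ V u) :
    ∀ᵐ t ∂volume.restrict (Icc 0 T), V t ≠ ⊤ ∧ HasWeakDeriv (withInit u0 u t) (dq (u t)) ∧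
      ∀ᵐ x, |dq (u t) x| ≤ (V t).toReal := by
  filter_upwards [ae_lt_top h.V_meas h.lintegral_V, ae_ne_zero T] with t ht h0
  have hL : LipschitzWith (V t).toNNReal (u t) := by
    intro x y
    have := h.it.lip t y (x - y)
    rw [add_sub_cancel] at this
    rw [ENNReal.coe_toNNReal ht.ne, edist_eq_enorm_sub, edist_eq_enorm_sub, mul_comm]
    exact this
  rw [withInit_of_ne h0]
  exact ⟨ht.ne, LipschitzWith.hasWeakDeriv_dq hL⟩

lemma integrableOn_V (h : MildSol μ T U G K B l u0 FF g gx φ κ V u) :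
    IntegrableOn (fun t => (V t).toReal) (Icc 0 T) :=
  integrable_toReal_of_lintegral_ne_top h.V_meas.aemeasurable h.lintegral_V

lemma integrable_φ (h : MildSol μ T U G K B l u0 FF g gx φ κ V u) : Integrable φ :=
  ⟨h.md.φ_meas.aestronglyMeasurable, by
    rw [hasFiniteIntegral_iff_enorm]
    simp only [h.md.φ_enorm]
    exact h.md.φ_int.lt_top⟩

lemma integrable_κ (h : MildSol μ T U G K B l u0 FF g gx φ κ V u) : Integrable κ :=
  ⟨h.md.κ_meas.aestronglyMeasurable, by
    rw [hasFiniteIntegral_iff_enorm]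
    simp only [Real.enorm_eq_ofReal_abs, abs_of_nonneg (h.md.κ_nonneg _)]
    exact h.md.κ_int.lt_top⟩

/-- The integrable majorant of the derivatives. -/
lemma integrableOn_maj (h : MildSol μ T U G K B l u0 FF g gx φ κ V u) :
    IntegrableOn (fun s => φ s + (K + 1) * ((V s).toReal + κ s)) (Icc 0 T) :=
  h.integrable_φ.integrableOn.add ((h.integrableOn_V.add h.integrable_κ.integrableOn).const_mul _)

lemma eLpNorm_le (f : ℝ → ℝ) (a b : ℝ) : eLpNorm f 2 (volume.restrict (Icc a b)) ≤
    (⨆ x, ‖f x‖ₑ) * ENNReal.ofReal (b - a) ^ (1 / 2 : ℝ) := by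
  refine (eLpNorm_le_of_ae_enorm_bound (ae_of_all _ fun x => le_iSup (fun x => ‖f x‖ₑ) x)).trans ?_
  simp

lemma tendsto_initial (h : MildSol μ T U G K B l u0 FF g gx φ κ V u) (r : ℝ) :
    Tendsto (fun t => eLpNorm (fun x => withInit u0 u t x - u0 x) 2 (volume.restrict (Icc (-r) r)))
      (𝓝[>] 0) (𝓝 0) := by
  have t1 := (h.md.tendsto_iSup_sub_heat h.hμ h.hK h.hl h.hB h.it h.fix).mono_left
    (nhdsWithin_le_nhds (s := Ioi 0))
  have t2 := ENNReal.Tendsto.mul_const (b := ENNReal.ofReal (r - -r) ^ (1 / 2 : ℝ)) t1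
    (Or.inr (ENNReal.rpow_ne_top_of_nonneg (by norm_num) ENNReal.ofReal_ne_top))
  have t3 := t2.add (tendsto_heat_zero h.hμ h.md.u0_meas h.md.u0_le r)
  rw [zero_mul, zero_add] at t3
  refine tendsto_of_tendsto_of_tendsto_of_le_of_le' tendsto_const_nhds t3
    (Eventually.of_forall fun _ => zero_le) ?_
  filter_upwards [self_mem_nhdsWithin] with t ht
  have m1 : Measurable (u t) := h.it.meas.comp measurable_prodMk_left
  have m2 : Measurable (heat μ u0 t) := (measurable_heat h.md.u0_meas).comp measurable_prodMk_left
  rw [withInit_of_ne (ne_of_gt (by exact ht))]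
  have e : (fun x => u t x - u0 x) = (fun x => u t x - heat μ u0 t x) +
      fun x => heat μ u0 t x - u0 x := by ext x; simp
  rw [e]
  exact (eLpNorm_add_le (m1.sub m2).aestronglyMeasurable
    (m2.sub h.md.u0_meas).aestronglyMeasurable (by norm_num)).trans
    (add_le_add_left (eLpNorm_le _ _ _) _)

lemma tendsto_pos (h : MildSol μ T U G K B l u0 FF g gx φ κ V u) {t : ℝ} (ht : 0 < t) :
    Tendsto (fun s => ⨆ x, ‖withInit u0 u s x - withInit u0 u t x‖ₑ) (𝓝 t) (𝓝 0) := by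
  refine (h.md.tendsto_iSup_sub h.hμ h.hK h.hl h.hB h.it h.fix ht).congr' ?_
  filter_upwards [Ioi_mem_nhds ht] with s hs
  rw [withInit_of_ne ht.ne', withInit_of_ne (ne_of_gt (by exact hs))]

lemma meas_slice (h : MildSol μ T U G K B l u0 FF g gx φ κ V u) (t : ℝ) :
    Measurable (withInit u0 u t) := h.meas.comp measurable_prodMk_left

lemma locCont (h : MildSol μ T U G K B l u0 FF g gx φ κ V u) : LocCont T (withInit u0 u) := by
  intro t ht r hr
  rcases eq_or_lt_of_le ht.1 with h0 | h0
  · subst h0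
    rw [withInit_zero]
    exact (h.tendsto_initial r).mono_left (nhdsWithin_mono _ fun x hx => hx.1)
  · have t2 := ENNReal.Tendsto.mul_const (b := ENNReal.ofReal (r - -r) ^ (1 / 2 : ℝ))
      (h.tendsto_pos h0)
      (Or.inr (ENNReal.rpow_ne_top_of_nonneg (by norm_num) ENNReal.ofReal_ne_top))
    rw [zero_mul] at t2
    exact (tendsto_of_tendsto_of_tendsto_of_le_of_le tendsto_const_nhds t2 (fun _ => zero_le)
      fun s => eLpNorm_le _ _ _).mono_left nhdsWithin_le_nhds

lemma l2ul_le (f : ℝ → ℝ) : l2ul f ≤ ⨆ x, ‖f x‖ₑ := iSup_le fun y => by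
  simpa using eLpNorm_le f y (y + 1)

lemma memCStar (h : MildSol μ T U G K B l u0 FF g gx φ κ V u) : MemCStar T (withInit u0 u) := by
  have hb : ∀ t ∈ Icc 0 T, l2ul (withInit u0 u t) ≤
      ((max U (B * Real.exp (l * T))).toNNReal : ℝ≥0∞) := fun t ht =>
    (l2ul_le _).trans (iSup_le fun x => by
      rw [Real.enorm_eq_ofReal_abs]
      exact ENNReal.ofReal_le_ofReal (h.abs_le ht x))
  refine ⟨fun t _ => (h.meas_slice t).aestronglyMeasurable, fun t ht =>
    (hb t ht).trans_lt ENNReal.coe_lt_top, ⟨_, fun t ht => hb t ⟨ht.1.le, ht.2⟩⟩, fun t ht => ?_,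
    ⟨u0, fun r hr => ⟨?_, h.tendsto_initial r⟩⟩⟩
  · exact (tendsto_of_tendsto_of_tendsto_of_le_of_le tendsto_const_nhds (h.tendsto_pos ht.1)
      (fun _ => zero_le) fun s => l2ul_le _).mono_left nhdsWithin_le_nhds
  · exact MemLp.of_bound h.md.u0_meas.aestronglyMeasurable U (ae_of_all _ h.md.u0_le)

/-- The mild solution satisfies the equation tested with smooth functions, one derivative being
moved on the solution. -/
lemma test_eq (h : MildSol μ T U G K B l u0 FF g gx φ κ V u) {Φ : ℝ × ℝ → ℝ} (hΦ : IsTest Φ)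
    (hs : tsupport Φ ⊆ Ioo 0 T ×ˢ univ) :
    LocIntStrip T (withInit u0 u) ∧ LocIntStrip T (fun t => dq (u t)) ∧
    LocIntStrip T (fun s x => FF s x - clamp K (withInit u0 u s x + g s x) * (dq (u s) x + gx s x)) ∧
    -(∫ q, withInit u0 u q.1 q.2 * pd (1, 0) Φ q ∂strip T) +
      (∫ q, (μ * dq (u q.1) q.2) * pd (0, 1) Φ q ∂strip T) -
      (∫ q, (FF q.1 q.2 - clamp K (withInit u0 u q.1 q.2 + g q.1 q.2) *
        (dq (u q.1) q.2 + gx q.1 q.2)) * Φ q ∂strip T) = 0 := by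
  have mw := h.meas
  have mx := measurable_dq h.it.meas
  have lw : LocIntStrip T (withInit u0 u) := locIntStrip_of_bounded
    mw.aestronglyMeasurable (ae_strip_abs_le mw.aestronglyMeasurable (by
      filter_upwards [ae_restrict_mem measurableSet_Icc] with s hs
      exact ae_of_all _ (h.abs_le hs)))
  have lx : LocIntStrip T (fun t => dq (u t)) := locIntStrip_of_ae_le mx.aestronglyMeasurable
    (b := V) (by
      filter_upwards [h.dq_spec] with s hs
      filter_upwards [hs.2.2] with x hx
      rw [Real.enorm_eq_ofReal_abs]
      exact ENNReal.ofReal_le_of_le_toReal hx) h.lintegral_V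
  have lgx : LocIntStrip T gx := locIntStrip_of_ae_le h.gx_meas.aestronglyMeasurable
    (b := fun s => ENNReal.ofReal (κ s)) (ae_of_all _ fun s => ae_of_all _ fun x => by
      rw [Real.enorm_eq_ofReal_abs]
      exact ENNReal.ofReal_le_ofReal (h.gx_le s x))
    ((setLIntegral_le_lintegral _ _).trans_lt h.md.κ_int.lt_top).ne
  have lF : LocIntStrip T FF := locIntStrip_of_ae_le h.md.FF_meas.aestronglyMeasurable
    (ae_restrict_of_ae h.md.FF_enorm_le)
    ((setLIntegral_le_lintegral _ _).trans_lt h.md.φ_int.lt_top).ne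
  have mwg : Measurable fun q : ℝ × ℝ => withInit u0 u q.1 q.2 + g q.1 q.2 := mw.add h.md.g_meas
  have lN : LocIntStrip T fun s x => clamp K (withInit u0 u s x + g s x) * (dq (u s) x + gx s x) := by
    have := (lx.add lgx).mul_bounded (M := K) (z := fun s x => clamp K (withInit u0 u s x + g s x))
      ((continuous_clamp K).measurable.comp mwg).aestronglyMeasurable
      (ae_of_all _ fun q => abs_clamp_le h.hK _)
    simpa only [mul_comm] using this
  have lf : LocIntStrip T fun s x => ftr K (withInit u0 u s x + g s x) := by
    have mf : AEStronglyMeasurable (Function.uncurry fun s x => ftr K (withInit u0 u s x + g s x))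
      (strip T) := ((measurable_ftr K).comp mwg).aestronglyMeasurable
    refine locIntStrip_of_bounded (M := K * (max U (B * Real.exp (l * T)) + G)) mf
      (ae_strip_abs_le mf ?_)
    filter_upwards [ae_restrict_mem measurableSet_Icc] with s hs
    refine ae_of_all _ fun x => ?_
    have := abs_ftr_sub_le h.hK (withInit u0 u s x + g s x) 0
    rw [ftr_zero, sub_zero, sub_zero] at this
    refine this.trans (mul_le_mul_of_nonneg_left ?_ h.hK)
    exact (abs_add_le _ _).trans (add_le_add (h.abs_le hs x) (h.md.g_le s x))
  have lB := lF.sub lN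
  refine ⟨lw, lx, lB, ?_⟩
  have hx1 := hΦ.pd (0, 1)
  have hx2 := hx1.pd (0, 1)
  have ht1 := hΦ.pd (1, 0)
  have d1 : ∀ᵐ s ∂volume.restrict (Icc 0 T), HasWeakDeriv (withInit u0 u s) (dq (u s)) :=
    h.dq_spec.mono fun s hs => hs.2.1
  have e1 := integral_strip_pd lw lx d1 hx1
  -- The chain rule applies to `ftr K`, which is `C¹` with derivative `clamp K`.
  have e2 := integral_strip_pd lf lN (by
    filter_upwards [d1, h.gx_deriv] with s h1 h2
    have := (h1.add h2).comp (contDiff_ftr K)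
    simpa only [deriv_ftr] using this) hΦ
  have key := h.md.weak_identity h.hμ h.hK h.hl h.hB h.it h.fix hΦ hs
  have ne0 : ∀ᵐ q ∂strip T, q.1 ≠ 0 := ae_restrict_of_ae (ae_fst_ne 0)
  have key2 : ∫ q, (((withInit u0 u q.1 q.2 * pd (1, 0) Φ q +
      μ * (withInit u0 u q.1 q.2 * pd (0, 1) (pd (0, 1) Φ) q)) + FF q.1 q.2 * Φ q) +
      ftr K (withInit u0 u q.1 q.2 + g q.1 q.2) * pd (0, 1) Φ q) ∂strip T = 0 := by
    refine Eq.trans (integral_congr_ae ?_) key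
    filter_upwards [ne0] with q hq
    rw [withInit_of_ne hq, adj]
    ring
  have i1 := lw.integrable_mul_test ht1
  have i2 := (lw.integrable_mul_test hx2).const_mul μ
  have i3 := lF.integrable_mul_test hΦ
  have i4 := lf.integrable_mul_test hx1
  have i12 : Integrable (fun q : ℝ × ℝ => withInit u0 u q.1 q.2 * pd (1, 0) Φ q +
      μ * (withInit u0 u q.1 q.2 * pd (0, 1) (pd (0, 1) Φ) q)) (strip T) := i1.add i2
  have i123 : Integrable (fun q : ℝ × ℝ => (withInit u0 u q.1 q.2 * pd (1, 0) Φ q +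
      μ * (withInit u0 u q.1 q.2 * pd (0, 1) (pd (0, 1) Φ) q)) + FF q.1 q.2 * Φ q) (strip T) :=
    i12.add i3
  rw [integral_add i123 i4, integral_add i12 i3, integral_add i1 i2, integral_const_mul, e1, e2]
    at key2
  simp only [sub_mul, mul_assoc]
  have i5 := lN.integrable_mul_test hΦ
  simp only [mul_assoc] at i5 key2
  rw [integral_sub i3 i5, integral_const_mul]
  linarith

lemma evolution (h : MildSol μ T U G K B l u0 FF g gx φ κ V u) :
    Evolution T (max U (B * Real.exp (l * T))) (withInit u0 u) (fun t => dq (u t))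
      (fun s x => μ * dq (u s) x)
      (fun s x => FF s x - clamp K (withInit u0 u s x + g s x) * (dq (u s) x + gx s x)) := by
  have mx := measurable_dq h.it.meas
  -- The zero test function extracts the local integrability statements, which do not depend on the
  -- test function.
  have zt : IsTest (fun _ : ℝ × ℝ => (0:ℝ)) := ⟨contDiff_const, HasCompactSupport.zero⟩
  obtain ⟨lw, lx, lB, -⟩ := h.test_eq zt (by simp [tsupport])
  have hc : ∀ χ : ℝ → ℝ, ContDiff ℝ ∞ χ → HasCompactSupport χ →
      ContinuousOn (fun t => ∫ x, withInit u0 u t x * χ x) (Icc 0 T) := fun χ h1 h2 =>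
    h.locCont.continuousOn_integral (fun t _ => (h.meas_slice t).aestronglyMeasurable)
      (fun t ht => ae_of_all _ (h.abs_le ht)) h1.continuous h2
  refine ⟨h.meas.aestronglyMeasurable, fun t _ => (h.meas_slice t).aestronglyMeasurable,
    fun t ht => ae_of_all _ (h.abs_le ht), mx, mx.const_mul μ,
    h.md.FF_meas.sub (((continuous_clamp K).measurable.comp (h.meas.add h.md.g_meas)).mul
      (mx.add h.gx_meas)), lx.const_mul μ, lB, h.dq_spec.mono fun s hs => hs.2.1,
    evol_of_weak h.hT hc lw (lx.const_mul μ) lB fun θ χ h1 h2 h3 hχ hχc => ?_⟩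
  obtain ⟨a1, a2, a3⟩ := tensor_test h1 h2 h3 hχ hχc
  have ht : IsTest (Function.uncurry fun s x => θ s * χ x) := ⟨a1, a2⟩
  have p1 : ∀ q : ℝ × ℝ, pd (1, 0) (Function.uncurry fun s x => θ s * χ x) q =
      deriv θ q.1 * χ q.2 := fun q =>
    (ht.hasDerivAt_left q.1 q.2).unique
      (((h1.differentiable (by simp)) q.1).hasDerivAt.mul_const (χ q.2))
  have p2 : ∀ q : ℝ × ℝ, pd (0, 1) (Function.uncurry fun s x => θ s * χ x) q =
      θ q.1 * deriv χ q.2 := fun q =>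
    (ht.hasDerivAt_right q.1 q.2).unique
      (((hχ.differentiable (by simp)) q.2).hasDerivAt.const_mul (θ q.1))
  have := (h.test_eq ht a3).2.2.2
  simp only [p1, p2] at this
  exact this

lemma B_le (h : MildSol μ T U G K B l u0 FF g gx φ κ V u) :
    ∀ᵐ s ∂volume.restrict (Icc 0 T), ∀ᵐ x, |FF s x - clamp K (withInit u0 u s x + g s x) *
      (dq (u s) x + gx s x)| ≤ φ s + (K + 1) * ((V s).toReal + κ s) := by
  filter_upwards [h.dq_spec] with s hs
  filter_upwards [hs.2.2] with x hx
  have h1 : |dq (u s) x + gx s x| ≤ (V s).toReal + κ s :=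
    (abs_add_le _ _).trans (add_le_add hx (h.gx_le s x))
  have h2 := (abs_nonneg _).trans h1
  refine (abs_sub _ _).trans (add_le_add (h.md.FF_le s x) ?_)
  rw [abs_mul]
  have := abs_clamp_le h.hK (withInit u0 u s x + g s x)
  have := h.hK
  gcongr
  linarith

/-- A single majorant has to dominate both the derivative, by `V`, and the lower order term, by `φ +
K(V + κ)`; this is why its factor is `K + 1`. -/
lemma l2ulL2_dq (h : MildSol μ T U G K B l u0 FF g gx φ κ V u) :
    l2ulL2 T (fun t => dq (u t)) < ⊤ := by
  refine h.evolution.l2ulL2_zx_lt_top h.hμ h.hT.le h.integrableOn_maj ?_ h.B_le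
  filter_upwards [h.dq_spec] with s hs
  filter_upwards [hs.2.2] with x hx
  have := h.md.φ_nonneg s
  have := h.md.κ_nonneg s
  have := h.hK
  nlinarith [ENNReal.toReal_nonneg (a := V s)]

end MildSol

end

section

/-! ### A comparison principle -/

/-- The cube of the positive part has dissipation `6 μ z ζ² v²`. Half of it absorbs the cutoff term
and half the term `K |v|`, through the two squares `s1` and `s2`; what remains is a multiple of
`z³`. -/
lemma cubic_energy_pointwise {μ K c κ ζ ζ' z v b : ℝ} (hμ : 0 < μ) (hK : 0 ≤ K) (hκ : 0 ≤ κ)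
    (hζ0 : 0 ≤ ζ) (hζ : ζ ≤ 1) (hζ' : |ζ'| ≤ c) (hb : 0 < z → b ≤ K * |v| + κ * z) :
    -(μ * v * (2 * ζ * ζ' * (3 * max z 0 ^ 2) + ζ ^ 2 * (6 * max z 0 * v))) +
      b * (ζ ^ 2 * (3 * max z 0 ^ 2)) ≤
      (3 * μ * c ^ 2 + 3 * K ^ 2 / (4 * μ) + 3 * κ) * max z 0 ^ 3 := by
  rcases le_or_gt z 0 with hz | hz
  · rw [max_eq_right hz]; simp
  rw [max_eq_left hz.le]
  have hc : 0 ≤ c := (abs_nonneg _).trans hζ'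
  set a := |v| * ζ with ha
  have ha0 : 0 ≤ a := mul_nonneg (abs_nonneg _) hζ0
  have hζ2 : ζ ^ 2 ≤ 1 := by nlinarith
  have e1 : -(μ * v * (2 * ζ * ζ' * (3 * z ^ 2))) ≤ 6 * μ * c * a * z ^ 2 := by
    calc _ ≤ |μ * v * (2 * ζ * ζ' * (3 * z ^ 2))| := neg_le_abs _
      _ = 6 * μ * |ζ'| * a * z ^ 2 := by
          rw [abs_mul, abs_mul, abs_mul, abs_mul, abs_mul, abs_of_pos hμ, abs_two,
            abs_of_nonneg hζ0, abs_of_nonneg (by positivity : 0 ≤ 3 * z ^ 2), ha]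
          ring
      _ ≤ _ := by gcongr
  have e2 : b * (ζ ^ 2 * (3 * z ^ 2)) ≤ 3 * K * a * z ^ 2 + 3 * κ * z ^ 3 := by
    calc _ ≤ (K * |v| + κ * z) * (ζ ^ 2 * (3 * z ^ 2)) := by gcongr; exact hb hz
      _ = 3 * K * (a * ζ) * z ^ 2 + 3 * κ * ζ ^ 2 * z ^ 3 := by rw [ha]; ring
      _ ≤ 3 * K * (a * 1) * z ^ 2 + 3 * κ * 1 * z ^ 3 := by gcongr
      _ = _ := by ring
  have e3 : μ * v * (ζ ^ 2 * (6 * z * v)) = 6 * μ * z * a ^ 2 := by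
    rw [ha, mul_pow, sq_abs]; ring
  have s1 : 0 ≤ 3 * μ * z * (a - c * z) ^ 2 := by positivity
  have s2 : 0 ≤ 3 * z / (4 * μ) * (2 * μ * a - K * z) ^ 2 := by positivity
  have s2' : 3 * z / (4 * μ) * (2 * μ * a - K * z) ^ 2 =
      3 * μ * z * a ^ 2 - 3 * K * a * z ^ 2 + 3 * K ^ 2 / (4 * μ) * z ^ 3 := by
    field_simp; ring
  nlinarith

/-- The cube of the positive part is twice continuously differentiable, as the energy identity
requires, whereas the square is only once so. -/
lemma hasDerivAt_max_pow (n : ℕ) (x : ℝ) :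
    HasDerivAt (fun v : ℝ => max v 0 ^ (n + 2)) ((n + 2) * max x 0 ^ (n + 1)) x := by
  rcases lt_trichotomy x 0 with h | h | h
  · refine ((hasDerivAt_const x (0:ℝ)).congr_of_eventuallyEq ?_).congr_deriv ?_
    · filter_upwards [Iio_mem_nhds h] with v hv
      rw [max_eq_right (le_of_lt (by exact hv))]; simp
    · rw [max_eq_right h.le]; simp
  · subst h
    rw [hasDerivAt_iff_tendsto_slope_zero]
    have : Tendsto (fun t : ℝ => |t|) (𝓝[≠] 0) (𝓝 0) := by
      have := (continuous_abs.tendsto (0:ℝ)).mono_left (nhdsWithin_le_nhds (s := {0}ᶜ))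
      simpa using this
    have h1 : Tendsto (fun t : ℝ => |t| ^ (n + 1)) (𝓝[≠] 0) (𝓝 0) := by
      simpa using this.pow (n + 1)
    simp only [zero_add, max_self, smul_eq_mul]
    rw [zero_pow (show n + 1 ≠ 0 by omega), zero_pow (show n + 2 ≠ 0 by omega), mul_zero]
    refine squeeze_zero_norm' ?_ h1
    filter_upwards [self_mem_nhdsWithin] with t ht
    have ht0 : 0 < |t| := abs_pos.2 (by exact ht)
    rw [sub_zero, norm_mul, norm_inv, Real.norm_eq_abs, Real.norm_eq_abs, inv_mul_le_iff₀ ht0,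
      abs_pow, ← pow_succ']
    refine pow_le_pow_left₀ (abs_nonneg _) ?_ _
    rw [abs_of_nonneg (le_max_right _ _)]
    exact max_le (le_abs_self _) (abs_nonneg _)
  · refine ((hasDerivAt_pow (n + 2) x).congr_of_eventuallyEq ?_).congr_deriv ?_
    · filter_upwards [Ioi_mem_nhds h] with v hv
      rw [max_eq_left (le_of_lt (by exact hv))]
    · rw [max_eq_left h.le]; push_cast; rfl

variable {T M μ K : ℝ} {z zx B : ℝ → ℝ → ℝ}

/-- Sub-solutions that are initially nonpositive remain nonpositive. -/
lemma Evolution.nonpos (h : Evolution T M z zx (fun s x => μ * zx s x) B) (hμ : 0 < μ)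
    (hT : 0 ≤ T) (hK : 0 ≤ K) (hzx2 : LocIntStrip T (fun s x => zx s x ^ 2)) {κ : ℝ → ℝ}
    (hκ : ∀ s, 0 ≤ κ s) (hκi : IntegrableOn κ (Icc 0 T))
    (hB : ∀ᵐ s ∂volume.restrict (Icc 0 T), ∀ᵐ x, 0 < z s x → B s x ≤ K * |zx s x| + κ s * z s x)
    (h0 : ∀ᵐ x, z 0 x ≤ 0) : ∀ t ∈ Icc 0 T, ∀ᵐ x, z t x ≤ 0 := by
  have hM := h.nonneg hT
  obtain ⟨c, hc0, hc⟩ := exists_abs_deriv_cutoff_le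
  -- The rate from `cubic_energy_pointwise`. Its primitive `ψ` supplies the exponential weight,
  -- which handles rates merely integrable in time.
  set b : ℝ → ℝ := fun s => 3 * μ * c ^ 2 + 3 * K ^ 2 / (4 * μ) + 3 * κ s with hb
  have hb0 : ∀ s, 0 ≤ b s := fun s => by have := hκ s; simp only [hb]; positivity
  have hbi : IntegrableOn b (Icc 0 T) := (integrableOn_const (by simp)).add (hκi.const_mul 3)
  set ψ : ℝ → ℝ := fun t => ∫ s in (0:ℝ)..t, b s with hψ
  have hη : ∀ x, HasDerivAt (fun v : ℝ => max v 0 ^ 3) (3 * max x 0 ^ 2) x := fun x =>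
    (hasDerivAt_max_pow 1 x).congr_deriv (by norm_num)
  have hη' : ∀ x, HasDerivAt (fun v : ℝ => 3 * max v 0 ^ 2) (6 * max x 0) x := fun x =>
    ((hasDerivAt_max_pow 0 x).const_mul 3).congr_deriv (by norm_num; ring)
  have hA2 : LocIntStrip T (fun s x => (μ * zx s x) ^ 2) := by
    simpa only [mul_pow] using hzx2.const_mul (μ ^ 2)
  have lz : ∀ t ∈ Icc 0 T, LocallyIntegrable (fun x => max (z t x) 0 ^ 3) volume := by
    intro t ht
    refine (locallyIntegrable_const (M ^ 3)).mono
      ((by fun_prop : Continuous fun v : ℝ => max v 0 ^ 3).comp_aestronglyMeasurable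
        (h.z_meas_slice t ht)) ?_
    filter_upwards [h.z_le t ht] with x hx
    rw [Real.norm_eq_abs, Real.norm_eq_abs, abs_of_nonneg (by positivity), abs_of_nonneg (by positivity)]
    gcongr
    exact max_le ((le_abs_self _).trans hx) hM
  have nz : ∀ t x, 0 ≤ max (z t x) 0 ^ 3 := fun t x => pow_nonneg (le_max_right _ _) 3
  -- The three neighbouring cells give the factor `3`, and integrating `exp(6ψ) b` gives `1/6`; so
  -- any weighted bound `S` improves to `S / 2`.
  have step : ∀ S : ℝ, 0 ≤ S → (∀ s ∈ Icc 0 T, ∀ y, ∫ x in Icc y (y + 1), max (z s x) 0 ^ 3 ≤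
      S * Real.exp (6 * ψ s)) → ∀ t ∈ Icc 0 T, ∀ y, ∫ x in Icc y (y + 1), max (z t x) 0 ^ 3 ≤
      S / 2 * Real.exp (6 * ψ t) := by
    intro S hS hle t ht y
    have hsub : Icc 0 t ⊆ Icc 0 T := Icc_subset_Icc_right ht.2
    have hac : (volume.restrict (Icc 0 t)) ≪ volume.restrict (Icc 0 T) :=
      Measure.absolutelyContinuous_of_le (Measure.restrict_mono hsub le_rfl)
    obtain ⟨ie, ee⟩ := h.energy hA2 hzx2 hη hη' (by fun_prop) (cutoff_sq_contDiff y)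
      (cutoff_sq_hasCompactSupport y) ht
    have bI : IntervalIntegrable b volume 0 t := by
      rw [intervalIntegrable_iff, uIoc_of_le ht.1]
      exact hbi.mono_set (Ioc_subset_Icc_self.trans hsub)
    have cψ : ContinuousOn ψ (Icc 0 t) := by
      have := intervalIntegral.continuousOn_primitive_interval (a := 0) (b := t)
        (μ := volume) (f := b) (by rw [uIcc_of_le ht.1]; exact hbi.mono_set hsub)
      rwa [uIcc_of_le ht.1] at this
    have slice : ∀ᵐ s ∂volume.restrict (Icc 0 t), ∫ x, energyIntegrand (fun v => 3 * max v 0 ^ 2)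
        (fun v => 6 * max v 0) (fun x => cutoff y x ^ 2) (z s) (zx s) (fun x => μ * zx s x) (B s) x ≤
        3 * S * (Real.exp (6 * ψ s) * b s) := by
      filter_upwards [hac.ae_le h.z_deriv, hac.ae_le h.A_int.ae_locallyIntegrable,
        hac.ae_le h.B_int.ae_locallyIntegrable, hac.ae_le hA2.ae_locallyIntegrable,
        hac.ae_le hzx2.ae_locallyIntegrable, hac.ae_le hB, ae_restrict_mem measurableSet_Icc]
        with s h1 h2 h3 h4 h5 h6 h7
      have hs := hsub h7
      have iE := integrable_energyIntegrand (η' := fun v => 3 * max v 0 ^ 2)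
        (η'' := fun v => 6 * max v 0) (by fun_prop) (by fun_prop) (cutoff_sq_contDiff y)
        (cutoff_sq_hasCompactSupport y) (h.z_meas_slice s hs) (h.z_le s hs)
        h1.locInt'.aestronglyMeasurable h5 h2 h4 h3
      have iZ : IntegrableOn (fun x => b s * max (z s x) 0 ^ 3) (Icc (y - 1) (y + 2)) :=
        ((lz s hs).integrableOn_isCompact isCompact_Icc).const_mul _
      calc _ ≤ ∫ x, (Icc (y - 1) (y + 2)).indicator (fun x => b s * max (z s x) 0 ^ 3) x := by
            refine integral_mono_ae iE (iZ.integrable_indicator measurableSet_Icc) ?_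
            filter_upwards [h6] with x hx
            by_cases hxy : x ∈ Icc (y - 1) (y + 2)
            · rw [indicator_of_mem hxy, energyIntegrand, deriv_cutoff_sq]
              exact cubic_energy_pointwise hμ hK (hκ s) (cutoff_nonneg y x) (cutoff_le_one y x)
                (hc y x) hx
            · rw [indicator_of_notMem hxy, energyIntegrand, deriv_cutoff_sq, cutoff_eq_zero hxy]
              simp
        _ = b s * ∫ x in Icc (y - 1) (y + 2), max (z s x) 0 ^ 3 := by
            rw [integral_indicator measurableSet_Icc, integral_const_mul]
        _ ≤ b s * (3 * (S * Real.exp (6 * ψ s))) := by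
            refine mul_le_mul_of_nonneg_left ?_ (hb0 s)
            exact integral_Icc_three_le (lz s hs) (hle s hs) y
        _ = _ := by ring
    have iR : IntegrableOn (fun s => Real.exp (6 * ψ s) * b s) (Icc 0 t) :=
      (hbi.mono_set hsub).continuousOn_mul (by fun_prop) isCompact_Icc
    have cp := chain_primitive (b := b) (c := 0) (m := ψ) (η := fun v => Real.exp (6 * v) / 6)
      (η' := fun v => Real.exp (6 * v)) bI (fun v => by
        have := (((hasDerivAt_id v).const_mul 6).exp).div_const 6
        refine this.congr_deriv ?_
        simp) (by fun_prop) (fun s _ => by simp [hψ])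
    have ψ0 : ψ 0 = 0 := by simp [hψ]
    have z0 : ∫ x, cutoff y x ^ 2 * max (z 0 x) 0 ^ 3 = 0 := by
      refine integral_eq_zero_of_ae ?_
      filter_upwards [h0] with x hx
      rw [max_eq_right hx]; simp
    calc _ ≤ ∫ x, cutoff y x ^ 2 * max (z t x) 0 ^ 3 :=
          le_integral_cutoff_sq_mul (lz t ht) (nz t) y
      _ ≤ ∫ s in Icc 0 t, 3 * S * (Real.exp (6 * ψ s) * b s) := by
          rw [ee, z0, zero_add]
          exact integral_mono_ae ie (iR.const_mul _) slice
      _ = 3 * S * (Real.exp (6 * ψ t) / 6 - 1 / 6) := by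
          rw [integral_const_mul, ← integral_interval_eq_Icc ht.1, ← cp, ψ0]
          simp
      _ ≤ _ := by linarith
  -- Halving repeatedly from the crude bound `M³` forces every cell integral of the positive part to
  -- vanish.
  have hn : ∀ n : ℕ, ∀ t ∈ Icc 0 T, ∀ y, ∫ x in Icc y (y + 1), max (z t x) 0 ^ 3 ≤
      M ^ 3 / 2 ^ n * Real.exp (6 * ψ t) := by
    intro n
    induction n with
    | zero =>
      intro t ht y
      have ψn : 0 ≤ ψ t := intervalIntegral.integral_nonneg ht.1 fun s _ => hb0 s
      calc _ ≤ ∫ x in Icc y (y + 1), M ^ 3 := by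
            refine integral_mono_ae ((lz t ht).integrableOn_isCompact isCompact_Icc)
              (integrableOn_const (by simp)) (ae_restrict_of_ae ?_)
            filter_upwards [h.z_le t ht] with x hx
            have : max (z t x) 0 ≤ M := max_le ((le_abs_self _).trans hx) hM
            gcongr
        _ = M ^ 3 / 2 ^ 0 * 1 := by simp
        _ ≤ _ := by
            gcongr
            exact Real.one_le_exp (by positivity)
    | succ n ih =>
      intro t ht y
      have := step (M ^ 3 / 2 ^ n) (by positivity) ih t ht y
      rwa [div_div, ← pow_succ] at this
  intro t ht
  have hz : ∀ y, ∫ x in Icc y (y + 1), max (z t x) 0 ^ 3 = 0 := by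
    intro y
    refine le_antisymm ?_ (integral_nonneg fun x => nz t x)
    have lim : Tendsto (fun n : ℕ => M ^ 3 / 2 ^ n * Real.exp (6 * ψ t)) atTop (𝓝 0) := by
      have := ((tendsto_pow_atTop_nhds_zero_of_lt_one (r := (1 / 2 : ℝ)) (by norm_num)
        (by norm_num)).const_mul (M ^ 3)).mul_const (Real.exp (6 * ψ t))
      simp only [mul_zero, zero_mul] at this
      refine this.congr fun n => ?_
      rw [one_div, inv_pow]; rfl
    exact ge_of_tendsto' lim fun n => hn n t ht y
  have hcell : ∀ n : ℤ, ∀ᵐ x, x ∈ Icc (n:ℝ) (n + 1) → z t x ≤ 0 := by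
    intro n
    have := (setIntegral_eq_zero_iff_of_nonneg_ae (ae_of_all _ fun x => nz t x)
      ((lz t ht).integrableOn_isCompact isCompact_Icc)).1 (hz n)
    filter_upwards [(ae_restrict_iff' measurableSet_Icc).1 this] with x hx hxn
    have e : max (z t x) 0 ^ 3 = 0 := hx hxn
    exact (le_max_left _ _).trans (pow_eq_zero_iff (by norm_num) |>.1 e).le
  filter_upwards [ae_all_iff.2 hcell] with x hx
  exact hx ⌊x⌋ ⟨Int.floor_le x, (Int.lt_floor_add_one x).le⟩

end

section

/-! ### Uniform bounds of the mild solution -/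

section

variable {T M : ℝ} {z zx A B : ℝ → ℝ → ℝ}

lemma LocIntStrip.intervalIntegrable_mul {T t : ℝ} {A : ℝ → ℝ → ℝ} (hA : LocIntStrip T A)
    {χ : ℝ → ℝ} (hχ : Continuous χ) (hχc : HasCompactSupport χ) (ht : t ∈ Icc 0 T) :
    IntervalIntegrable (fun s => ∫ x, A s x * χ x) volume 0 t := by
  have h := integrable_strip_mul hA (continuous_const (y := (1:ℝ))) hχ hχc
  rw [strip_eq_prod] at h
  have h1 := h.integral_prod_left
  simp only [one_mul] at h1
  rw [intervalIntegrable_iff, uIoc_of_le ht.1]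
  exact IntegrableOn.mono_set (t := Icc 0 T) h1
    (Ioc_subset_Icc_self.trans (Icc_subset_Icc_right ht.2))

/-- The comparison principle is applied to `±u` minus a barrier depending on time only; such a
barrier changes the lower order term but not the flux. -/
lemma Evolution.affine (h : Evolution T M z zx A B) (σ : ℝ) {p m : ℝ → ℝ} (pm : Measurable p)
    (hp : IntegrableOn p (Icc 0 T)) (hm : Continuous m)
    (hm' : ∀ t ∈ Icc 0 T, m t = m 0 + ∫ s in (0:ℝ)..t, p s) {M' : ℝ}
    (hM : ∀ t ∈ Icc 0 T, |m t| ≤ M') :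
    Evolution T (|σ| * M + M') (fun t x => σ * z t x - m t) (fun t x => σ * zx t x)
      (fun t x => σ * A t x) (fun t x => σ * B t x - p t) := by
  have lp : LocIntStrip T fun s _ => p s := locIntStrip_of_ae_le (b := fun s => ‖p s‖ₑ)
    (pm.comp measurable_fst).aestronglyMeasurable (ae_of_all _ fun s => ae_of_all _ fun _ => le_rfl)
    hp.2.ne
  refine ⟨(h.z_meas.const_mul σ).sub (hm.measurable.comp measurable_fst).aestronglyMeasurable,
    fun t ht => ((h.z_meas_slice t ht).const_mul σ).sub aestronglyMeasurable_const, fun t ht => ?_,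
    h.zx_meas.const_mul σ, h.A_meas.const_mul σ, (h.B_meas.const_mul σ).sub (pm.comp measurable_fst),
    h.A_int.const_mul σ, (h.B_int.const_mul σ).sub lp, ?_, fun χ h1 h2 t ht => ?_⟩
  · filter_upwards [h.z_le t ht] with x hx
    refine (abs_sub _ _).trans (add_le_add ?_ (hM t ht))
    rw [abs_mul]
    gcongr
  · filter_upwards [h.z_deriv] with t ht
    simpa using (ht.const_mul σ).sub (hasWeakDeriv_const (m t))
  · have c1 := h1.continuous
    have c2 := h1.continuous_deriv (n := ∞) (by simp)
    have h0 : (0:ℝ) ∈ Icc 0 T := ⟨le_rfl, ht.1.trans ht.2⟩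
    have hχ : Integrable χ := c1.integrable_of_hasCompactSupport h2
    have e : ∀ s ∈ Icc 0 T, ∫ x, (σ * z s x - m s) * χ x = σ * (∫ x, z s x * χ x) -
        m s * ∫ x, χ x := by
      intro s hs
      have i1 := integrable_mul_of_hasCompactSupport (h.z_locallyIntegrable hs) c1 h2
      rw [← integral_const_mul, ← integral_const_mul,
        ← integral_sub (i1.const_mul σ) (hχ.const_mul _)]
      congr 1 with x
      ring
    have iA := h.A_int.intervalIntegrable_mul c2 h2.deriv ht
    have iB := h.B_int.intervalIntegrable_mul c1 h2 ht
    have hsub : Icc 0 t ⊆ Icc 0 T := Icc_subset_Icc_right ht.2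
    have ip : IntervalIntegrable p volume 0 t := by
      rw [intervalIntegrable_iff, uIoc_of_le ht.1]
      exact hp.mono_set (Ioc_subset_Icc_self.trans hsub)
    have hac : (volume.restrict (Icc 0 t)) ≪ volume.restrict (Icc 0 T) :=
      Measure.absolutelyContinuous_of_le (Measure.restrict_mono hsub le_rfl)
    have e1 : ∫ s in (0:ℝ)..t, ∫ x, (-(A s x * deriv χ x) + B s x * χ x) =
        ∫ s in (0:ℝ)..t, (-(∫ x, A s x * deriv χ x) + ∫ x, B s x * χ x) := by
      rw [integral_interval_eq_Icc ht.1, integral_interval_eq_Icc ht.1]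
      refine integral_congr_ae ?_
      filter_upwards [hac.ae_le h.A_int.ae_locallyIntegrable,
        hac.ae_le h.B_int.ae_locallyIntegrable] with s hA hB
      have i1 : Integrable fun x => -(A s x * deriv χ x) :=
        (integrable_mul_of_hasCompactSupport hA c2 h2.deriv).neg
      rw [← integral_neg, integral_add i1 (integrable_mul_of_hasCompactSupport hB c1 h2)]
    have e2 : ∫ s in (0:ℝ)..t, ∫ x, (-(σ * A s x * deriv χ x) + (σ * B s x - p s) * χ x) =
        ∫ s in (0:ℝ)..t, (σ * (-(∫ x, A s x * deriv χ x) + ∫ x, B s x * χ x) -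
          p s * ∫ x, χ x) := by
      rw [integral_interval_eq_Icc ht.1, integral_interval_eq_Icc ht.1]
      refine integral_congr_ae ?_
      filter_upwards [hac.ae_le h.A_int.ae_locallyIntegrable,
        hac.ae_le h.B_int.ae_locallyIntegrable] with s hA hB
      have i1 : Integrable fun x => -(A s x * deriv χ x) :=
        (integrable_mul_of_hasCompactSupport hA c2 h2.deriv).neg
      have i2 := integrable_mul_of_hasCompactSupport hB c1 h2
      have i3 : Integrable fun x => σ * (-(A s x * deriv χ x) + B s x * χ x) :=
        (i1.add i2).const_mul σ
      rw [← integral_neg, ← integral_add i1 i2, ← integral_const_mul, ← integral_const_mul,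
        ← integral_sub i3 (hχ.const_mul _)]
      congr 1 with x
      ring
    have iAB : IntervalIntegrable (fun s => -(∫ x, A s x * deriv χ x) + ∫ x, B s x * χ x)
      volume 0 t := iA.neg.add iB
    rw [e t ht, e 0 h0, h.evol χ h1 h2 t ht, hm' t ht, e1, e2,
      intervalIntegral.integral_sub (iAB.const_mul σ) (ip.mul_const _),
      intervalIntegral.integral_const_mul, intervalIntegral.integral_mul_const]
    ring

end

variable {μ T U G K B l : ℝ} {u0 : ℝ → ℝ} {FF g gx u : ℝ → ℝ → ℝ} {φ κ : ℝ → ℝ} {V : ℝ → ℝ≥0∞}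

namespace MildSol

lemma abs_le_comparison (h : MildSol μ T U G K B l u0 FF g gx φ κ V u) {t : ℝ} (ht : t ∈ Icc 0 T) :
    ∀ᵐ x, |withInit u0 u t x| + G ≤
      (U + G + 1) * Real.exp (∫ s in (0:ℝ)..t, (κ s + φ s)) := by
  have hG : 0 ≤ G := (abs_nonneg _).trans (h.md.g_le 0 0)
  have hU := h.U_nonneg
  have hP : Integrable fun s => κ s + φ s := h.integrable_κ.add h.integrable_φ
  have hP0 : ∀ s, 0 ≤ κ s + φ s := fun s => add_nonneg (h.md.κ_nonneg s) (h.md.φ_nonneg s)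
  set ψ : ℝ → ℝ := fun t => ∫ s in (0:ℝ)..t, (κ s + φ s) with hψ
  have cψ : Continuous ψ := intervalIntegral.continuous_primitive
    (fun a b => hP.intervalIntegrable) 0
  -- The barrier solves `m' = (m + G)(κ + φ)`. The summand one makes `m + G ≥ 1`, so that this rate
  -- also dominates the source bound `φ`.
  set m : ℝ → ℝ := fun t => (U + G + 1) * Real.exp (ψ t) - G with hm
  have cm : Continuous m := by fun_prop
  have ψ0 : ∀ t, 0 ≤ t → 0 ≤ ψ t := fun t ht => intervalIntegral.integral_nonneg ht fun s _ => hP0 s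
  have m1 : ∀ t, 0 ≤ t → U + 1 ≤ m t := fun t ht => by
    have := Real.one_le_exp (ψ0 t ht)
    simp only [hm]
    nlinarith
  set p : ℝ → ℝ := fun s => (m s + G) * (κ s + φ s) with hp
  have pm : Measurable p := (cm.measurable.add_const G).mul (h.md.κ_meas.add h.md.φ_meas)
  have ip : IntegrableOn p (Icc 0 T) :=
    hP.integrableOn.continuousOn_mul (by fun_prop) isCompact_Icc
  have hm' : ∀ t ∈ Icc 0 T, m t = m 0 + ∫ s in (0:ℝ)..t, p s := by
    intro t ht
    have := chain_primitive (b := fun s => κ s + φ s) (c := 0) (m := ψ) (t := t)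
      (η := fun v => (U + G + 1) * Real.exp v - G) (η' := fun v => (U + G + 1) * Real.exp v)
      hP.intervalIntegrable (fun v => ((Real.hasDerivAt_exp v).const_mul _).sub_const G)
      (by fun_prop) (fun s _ => by simp [hψ])
    rw [← sub_eq_iff_eq_add', hm]
    refine this.trans ?_
    simp only [hp, hm, sub_add_cancel]
  obtain ⟨M', hM'⟩ := (isCompact_Icc (a := (0:ℝ)) (b := T)).exists_bound_of_continuousOn
    cm.continuousOn
  have sgn : ∀ σ : ℝ, |σ| = 1 → ∀ᵐ x, σ * withInit u0 u t x - m t ≤ 0 := by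
    intro σ hσ
    have ev := h.evolution.affine σ pm ip cm hm' hM'
    have eA : (fun t x => σ * (μ * dq (u t) x)) = fun t x => μ * (σ * dq (u t) x) := by
      ext t x; ring
    rw [eA] at ev
    have hz2 := (locIntStrip_sq_of_l2ulL2 (measurable_dq h.it.meas).aestronglyMeasurable
      h.l2ulL2_dq).const_mul (σ ^ 2)
    simp only [← mul_pow] at hz2
    refine ev.nonpos h.hμ h.hT.le h.hK hz2 h.md.κ_nonneg h.integrable_κ.integrableOn ?_ ?_ t ht
    · filter_upwards [ae_restrict_mem measurableSet_Icc] with s hs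
      refine ae_of_all _ fun x hx => ?_
      have hms := m1 s hs.1
      set w := withInit u0 u s x with hw
      have hwz : |w| = (σ * w - m s) + m s := by
        rw [sub_add_cancel, ← abs_of_pos (by linarith : 0 < σ * w), abs_mul, hσ, one_mul]
      have hcl : |clamp K (w + g s x)| ≤ (σ * w - m s) + m s + G :=
        (abs_clamp_le_abs h.hK _).trans ((abs_add_le _ _).trans
          (by rw [hwz]; exact add_le_add_right (h.md.g_le s x) _))
      have a1 : σ * FF s x ≤ φ s := by
        refine (le_abs_self _).trans ?_
        rw [abs_mul, hσ, one_mul]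
        exact h.md.FF_le s x
      have a2 : -(σ * (clamp K (w + g s x) * dq (u s) x)) ≤ K * |σ * dq (u s) x| := by
        refine (neg_le_abs _).trans ?_
        rw [abs_mul, abs_mul, abs_mul, hσ, one_mul, one_mul]
        exact mul_le_mul_of_nonneg_right (abs_clamp_le h.hK _) (abs_nonneg _)
      have a3 : -(σ * (clamp K (w + g s x) * gx s x)) ≤ ((σ * w - m s) + m s + G) * κ s := by
        refine (neg_le_abs _).trans ?_
        rw [abs_mul, abs_mul, hσ, one_mul]
        exact mul_le_mul hcl (h.gx_le s x) (abs_nonneg _) ((abs_nonneg _).trans hcl)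
      have a4 : φ s ≤ (m s + G) * φ s :=
        le_mul_of_one_le_left (h.md.φ_nonneg s) (by linarith)
      simp only [hp]
      nlinarith
    · refine ae_of_all _ fun x => ?_
      rw [withInit_zero]
      have h1 := m1 0 le_rfl
      have h2 : σ * u0 x ≤ U := by
        refine (le_abs_self _).trans ?_
        rw [abs_mul, hσ, one_mul]
        exact h.md.u0_le x
      linarith
  filter_upwards [sgn 1 (by simp), sgn (-1) (by simp)] with x h1 h2
  have : |withInit u0 u t x| ≤ m t := _root_.abs_le.2 ⟨by linarith, by linarith⟩
  simp only [hm] at this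
  linarith

end MildSol

/-! ### Uniformly local norms of the slices -/

/-- A cell starting at `y` is covered by one with rational start and an arbitrarily short interval,
on which a bounded `W` has small integral. The countable supremum makes the `H¹_ul` norm measurable
in time. -/
lemma iSup_lintegral_Icc_eq {W : ℝ → ℝ≥0∞} {c : ℝ≥0∞} (hc : c ≠ ⊤) (hW : ∀ᵐ x, W x ≤ c) :
    ⨆ y : ℝ, (∫⁻ x in Icc y (y + 1), W x) ^ (1 / 2 : ℝ) =
      ⨆ q : ℚ, (∫⁻ x in Icc (q : ℝ) (q + 1), W x) ^ (1 / 2 : ℝ) := by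
  refine le_antisymm (iSup_le fun y => ?_) (iSup_le fun q =>
    le_iSup (fun y : ℝ => (∫⁻ x in Icc y (y + 1), W x) ^ (1 / 2 : ℝ)) q)
  have e : ⨆ q : ℚ, (∫⁻ x in Icc (q : ℝ) (q + 1), W x) ^ (1 / 2 : ℝ) =
      (⨆ q : ℚ, ∫⁻ x in Icc (q : ℝ) (q + 1), W x) ^ (1 / 2 : ℝ) :=
    ((ENNReal.orderIsoRpow (1 / 2 : ℝ) (by norm_num)).map_iSup _).symm
  rw [e]
  refine ENNReal.rpow_le_rpow ?_ (by norm_num)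
  have key : ∀ ε : ℝ, 0 < ε → ∫⁻ x in Icc y (y + 1), W x ≤
      (⨆ q : ℚ, ∫⁻ x in Icc (q : ℝ) (q + 1), W x) + c * ENNReal.ofReal ε := by
    intro ε hε
    obtain ⟨q, hq1, hq2⟩ := exists_rat_btwn (show y - ε < y by linarith)
    have hsub : Icc y (y + 1) ⊆ Icc (q : ℝ) (q + 1) ∪ Ioc ((q : ℝ) + 1) (q + 1 + ε) := by
      intro x hx
      rcases le_or_gt x (q + 1) with h | h
      · exact Or.inl ⟨by linarith [hx.1], h⟩
      · exact Or.inr ⟨h, by linarith [hx.2]⟩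
    calc _ ≤ ∫⁻ x in Icc (q : ℝ) (q + 1) ∪ Ioc ((q : ℝ) + 1) (q + 1 + ε), W x :=
          lintegral_mono_set hsub
      _ ≤ (∫⁻ x in Icc (q : ℝ) (q + 1), W x) + ∫⁻ x in Ioc ((q : ℝ) + 1) (q + 1 + ε), W x :=
          lintegral_union_le _ _ _
      _ ≤ _ := by
          refine add_le_add (le_iSup (fun q : ℚ => ∫⁻ x in Icc (q : ℝ) (q + 1), W x) q) ?_
          refine (lintegral_mono_ae (ae_restrict_of_ae hW)).trans ?_
          rw [setLIntegral_const, Real.volume_Ioc, add_sub_cancel_left]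
  have lim : Tendsto (fun n : ℕ => (⨆ q : ℚ, ∫⁻ x in Icc (q : ℝ) (q + 1), W x) +
      c * ENNReal.ofReal (1 / ((n : ℝ) + 1))) atTop
      (𝓝 (⨆ q : ℚ, ∫⁻ x in Icc (q : ℝ) (q + 1), W x)) := by
    have := (ENNReal.Tendsto.const_mul (a := c) (ENNReal.tendsto_ofReal
      (tendsto_one_div_add_atTop_nhds_zero_nat (𝕜 := ℝ))) (Or.inr hc)).const_add
      (⨆ q : ℚ, ∫⁻ x in Icc (q : ℝ) (q + 1), W x)
    simpa using this
  exact ge_of_tendsto' lim fun n => key _ (by positivity)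

lemma h1ul_eq (f f' : ℝ → ℝ) (hf : Measurable f) : h1ul f f' =
    ⨆ y : ℝ, (∫⁻ x in Icc y (y + 1), (‖f x‖ₑ ^ 2 + ‖f' x‖ₑ ^ 2)) ^ (1 / 2 : ℝ) := by
  unfold h1ul
  congr 1 with y
  rw [eLpNorm_two_sq, eLpNorm_two_sq, lintegral_add_left (hf.enorm.pow_const 2)]

/-- Cells have length one, so the `H¹_ul` norm at almost every time is at most a constant plus
`V(t)`, and `V` lies in `L^{4/3}`. -/
lemma MildSol.mem_h1ul (h : MildSol μ T U G K B l u0 FF g gx φ κ V u) {p : ℝ≥0∞}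
    (hp : p < 4 / 3) : MemLp (fun t => h1ul (withInit u0 u t) (dq (u t))) p
      (volume.restrict (Icc 0 T)) := by
  set M : ℝ≥0∞ := ENNReal.ofReal (max U (B * Real.exp (l * T))) with hM
  have hMt : M ≠ ⊤ := ENNReal.ofReal_ne_top
  have mx := measurable_dq h.it.meas
  have bd : ∀ᵐ t ∂volume.restrict (Icc 0 T), V t ≠ ⊤ ∧
      ∀ᵐ x, ‖withInit u0 u t x‖ₑ ^ 2 + ‖dq (u t) x‖ₑ ^ 2 ≤ (M + V t) ^ 2 := by
    filter_upwards [h.dq_spec, ae_restrict_mem measurableSet_Icc] with t ht htT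
    refine ⟨ht.1, ?_⟩
    filter_upwards [ht.2.2] with x hx
    have e1 : ‖withInit u0 u t x‖ₑ ≤ M := by
      rw [Real.enorm_eq_ofReal_abs]
      exact ENNReal.ofReal_le_ofReal (h.abs_le htT x)
    have e2 : ‖dq (u t) x‖ₑ ≤ V t := by
      rw [Real.enorm_eq_ofReal_abs]
      exact ENNReal.ofReal_le_of_le_toReal hx
    calc _ ≤ M ^ 2 + V t ^ 2 := by gcongr
      _ ≤ M ^ 2 + V t ^ 2 + 2 * M * V t := le_self_add
      _ = (M + V t) ^ 2 := by ring
  have hfin : IsFiniteMeasure (volume.restrict (Icc 0 T)) := ⟨by simp⟩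
  refine MemLp.mono_exponent (q := 4 / 3) ⟨?_, ?_⟩ hp.le
  · have m1 : Measurable fun q : ℝ × ℝ => ‖withInit u0 u q.1 q.2‖ₑ ^ 2 + ‖dq (u q.1) q.2‖ₑ ^ 2 :=
      (h.meas.enorm.pow_const 2).add (mx.enorm.pow_const 2)
    have m2 : Measurable fun t : ℝ => ⨆ q : ℚ, (∫⁻ x in Icc (q : ℝ) (q + 1),
        (‖withInit u0 u t x‖ₑ ^ 2 + ‖dq (u t) x‖ₑ ^ 2)) ^ (1 / 2 : ℝ) :=
      Measurable.iSup fun q => (m1.lintegral_prod_right').pow_const _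
    refine m2.aestronglyMeasurable.congr ?_
    filter_upwards [bd] with t ht
    rw [h1ul_eq _ _ (h.meas_slice t)]
    exact (iSup_lintegral_Icc_eq (ENNReal.pow_ne_top (ENNReal.add_ne_top.2 ⟨hMt, ht.1⟩)) ht.2).symm
  · have e43 : (4 / 3 : ℝ≥0∞) ≠ ⊤ := ENNReal.div_ne_top (by simp) (by simp)
    have e43r : (4 / 3 : ℝ≥0∞).toReal = 4 / 3 := by rw [ENNReal.toReal_div]; norm_num
    rw [eLpNorm_lt_top_iff_lintegral_rpow_enorm_lt_top (by simp) e43, e43r]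
    have le1 : ∀ᵐ t ∂volume.restrict (Icc 0 T), h1ul (withInit u0 u t) (dq (u t)) ≤ M + V t := by
      filter_upwards [bd] with t ht
      rw [h1ul_eq _ _ (h.meas_slice t)]
      refine iSup_le fun y => ?_
      calc _ ≤ ((M + V t) ^ 2) ^ (1 / 2 : ℝ) := by
            refine ENNReal.rpow_le_rpow ?_ (by norm_num)
            refine (lintegral_mono_ae (ae_restrict_of_ae ht.2)).trans ?_
            simp
        _ = M + V t := by
            rw [← ENNReal.rpow_natCast, ← ENNReal.rpow_mul]; norm_num
    calc _ ≤ ∫⁻ t in Icc 0 T, 2 ^ ((4 / 3 : ℝ) - 1) * (M ^ (4 / 3 : ℝ) + V t ^ (4 / 3 : ℝ)) := by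
          refine lintegral_mono_ae ?_
          filter_upwards [le1] with t ht
          rw [enorm_eq_self]
          exact (ENNReal.rpow_le_rpow ht (by norm_num)).trans
            (ENNReal.rpow_add_le_mul_rpow_add_rpow _ _ (by norm_num))
      _ < ⊤ := by
          have c1 : (2:ℝ≥0∞) ^ ((4 / 3 : ℝ) - 1) ≠ ⊤ :=
            ENNReal.rpow_ne_top_of_nonneg (by norm_num) (by simp)
          rw [lintegral_const_mul' _ _ c1, lintegral_add_left measurable_const]
          refine ENNReal.mul_lt_top c1.lt_top (ENNReal.add_lt_top.2 ⟨?_, h.V_int.lt_top⟩)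
          rw [lintegral_const]
          exact ENNReal.mul_lt_top (ENNReal.rpow_ne_top_of_nonneg (by norm_num) hMt).lt_top
            (by simp)

end

section

/-! ### Existence of a bounded solution -/

lemma ae_strip_eq {T : ℝ} {A A' : ℝ → ℝ → ℝ}
    (hA : AEStronglyMeasurable (Function.uncurry A) (strip T))
    (hA' : AEStronglyMeasurable (Function.uncurry A') (strip T))
    (h : ∀ᵐ s ∂volume.restrict (Icc 0 T), A' s =ᵐ[volume] A s) :
    ∀ᵐ q ∂strip T, A' q.1 q.2 = A q.1 q.2 := by
  have hm : AEStronglyMeasurable (Function.uncurry fun s x => A' s x - A s x) (strip T) := hA'.sub hA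
  filter_upwards [ae_strip_abs_le (M := 0) hm (by
    filter_upwards [h] with s hs
    filter_upwards [hs] with x hx
    rw [hx, sub_self, abs_zero])] with q hq
  exact sub_eq_zero.1 (abs_nonpos_iff.1 hq)

/-- A measurable representative with a measurable bound of its slices. -/
lemma exists_bounded_representative {T : ℝ} {A : ℝ → ℝ → ℝ}
    (hA : AEStronglyMeasurable (Function.uncurry A) (strip T)) {R : ℝ≥0}
    (hR : ∫⁻ s in Icc 0 T, linf (A s) ≤ R) :
    ∃ (A' : ℝ → ℝ → ℝ) (a : ℝ → ℝ), Measurable (Function.uncurry A') ∧ Measurable a ∧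
      (∀ s y, |A' s y| ≤ a s) ∧ (∀ s, 0 ≤ a s) ∧ (∀ s, s ∉ Icc 0 T → a s = 0) ∧
      ∫⁻ s, ENNReal.ofReal (a s) ≤ R ∧ ∀ᵐ s ∂volume.restrict (Icc 0 T), A' s =ᵐ[volume] A s := by
  have hN := aemeasurable_linf hA
  set N := hN.mk _ with hNdef
  have mN : Measurable N := hN.measurable_mk
  have eN : ∀ᵐ s ∂volume.restrict (Icc 0 T), linf (A s) = N s := hN.ae_eq_mk
  set a : ℝ → ℝ := fun s => ((Icc 0 T).indicator N s).toReal with ha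
  have ma : Measurable a := (mN.indicator measurableSet_Icc).ennreal_toReal
  have a0 : ∀ s, 0 ≤ a s := fun s => ENNReal.toReal_nonneg
  set A₁ := hA.mk _ with hA₁
  have mA : Measurable A₁ := hA.stronglyMeasurable_mk.measurable
  have fin : ∀ᵐ s ∂volume.restrict (Icc 0 T), N s < ⊤ := by
    refine ae_lt_top mN ?_
    rw [← lintegral_congr_ae eN]
    exact (hR.trans_lt ENNReal.coe_lt_top).ne
  have e1 : ∀ᵐ s ∂volume.restrict (Icc 0 T), ∀ᵐ y, A s y = A₁ (s, y) := by
    have h : ∀ᵐ q ∂strip T, Function.uncurry A q = A₁ q := hA.ae_eq_mk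
    clear_value A₁
    rw [strip_eq_prod] at h
    exact Measure.ae_ae_of_ae_prod h
  -- Clamping a measurable representative at the measurable slice norm turns almost everywhere
  -- bounds into bounds at every point, without changing almost every slice up to null sets.
  refine ⟨fun s y => clamp (a s) (A₁ (s, y)), a, ?_, ma, fun s y => abs_clamp_le (a0 s) _, a0,
    fun s hs => by simp [ha, hs], ?_, ?_⟩
  · have m1 : Measurable fun q : ℝ × ℝ => a q.1 := ma.comp measurable_fst
    exact m1.neg.max (m1.min mA)
  · calc _ ≤ ∫⁻ s, (Icc 0 T).indicator N s := lintegral_mono fun s => ENNReal.ofReal_toReal_le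
      _ = ∫⁻ s in Icc 0 T, linf (A s) := by
          rw [lintegral_indicator measurableSet_Icc, lintegral_congr_ae eN]
      _ ≤ R := hR
  · filter_upwards [e1, fin, eN, ae_restrict_mem measurableSet_Icc] with s h1 h2 h3 h4
    filter_upwards [h1, ae_enorm_le_linf (A s)] with y hy hy2
    rw [← hy]
    refine clamp_eq_self ?_
    rw [ha]
    simp only
    rw [indicator_of_mem h4, ← h3, ← Real.norm_eq_abs, ← toReal_enorm]
    exact ENNReal.toReal_mono (by rw [h3]; exact h2.ne) hy2

variable {μ T : ℝ} {d : Data} {R : ℝ≥0}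

lemma Data.InBall.lintegral_le (hd : d.InBall T R) :
    ∫⁻ s in Icc 0 T, linf (d.f s) ≤ R ∧ ∫⁻ s in Icc 0 T, linf (d.gx s) ≤ R ∧
      ∫⁻ s in Icc 0 T, linf (d.gxx s) ≤ R := by
  have h1 := hd.f_le
  have h2 := hd.g_w2_le
  rw [timeNorm_one] at h1 h2
  exact ⟨h1, (lintegral_mono fun s => le_add_self.trans le_self_add).trans h2,
    (lintegral_mono fun s => le_add_self).trans h2⟩

lemma lintegral_ofReal_add_le {a b : ℝ → ℝ} (ha : Measurable a) (ha0 : ∀ s, 0 ≤ a s)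
    (hb0 : ∀ s, 0 ≤ b s) {c : ℝ} (hc : 0 ≤ c) {R S : ℝ≥0} (hR : ∫⁻ s, ENNReal.ofReal (a s) ≤ R)
    (hS : ∫⁻ s, ENNReal.ofReal (b s) ≤ S) :
    ∫⁻ s, ENNReal.ofReal (a s + c * b s) ≤ R + ENNReal.ofReal c * S := by
  simp only [fun s => ENNReal.ofReal_add (ha0 s) (mul_nonneg hc (hb0 s)),
    fun s => ENNReal.ofReal_mul (q := b s) hc]
  rw [lintegral_add_left (by fun_prop), lintegral_const_mul' _ _ ENNReal.ofReal_ne_top]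
  gcongr

/-- The hypothesis on `K` makes the clamp inactive, and integrating by parts twice turns the source
`μ gₓₓ` back into `μ ∂ₓ² g`. -/
lemma solvesEquation_of_mildSol {U G K B l : ℝ} {u0 : ℝ → ℝ} {f' g' gx' gxx' u : ℝ → ℝ → ℝ}
    {φ κ : ℝ → ℝ} {V : ℝ → ℝ≥0∞} (hd : d.Admissible T)
    (h : MildSol μ T U G K B l u0 (fun s x => f' s x + μ * gxx' s x) g' gx' φ κ V u)
    (mf : Measurable (Function.uncurry f')) (mgxx : Measurable (Function.uncurry gxx'))
    (ef : ∀ᵐ s ∂volume.restrict (Icc 0 T), f' s =ᵐ[volume] d.f s)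
    (eg : ∀ᵐ q ∂strip T, g' q.1 q.2 = d.g q.1 q.2)
    (egx : ∀ᵐ s ∂volume.restrict (Icc 0 T), gx' s =ᵐ[volume] d.gx s)
    (egxx : ∀ᵐ s ∂volume.restrict (Icc 0 T), gxx' s =ᵐ[volume] d.gxx s)
    (hK : ∀ᵐ q ∂strip T, |withInit u0 u q.1 q.2 + g' q.1 q.2| ≤ K) :
    SolvesEquation μ T d (withInit u0 u) fun t => dq (u t) := by
  intro φ h1 h2 h3
  have hΦ : IsTest (Function.uncurry φ) := ⟨h1, h2⟩
  set Φ := Function.uncurry φ with hΦdef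
  have hx1 := hΦ.pd (0, 1)
  have hx2 := hx1.pd (0, 1)
  have ht1 := hΦ.pd (1, 0)
  obtain ⟨lw, lx, lB, key⟩ := h.test_eq hΦ h3
  have d1 : ∀ᵐ s ∂volume.restrict (Icc 0 T), HasWeakDeriv (withInit u0 u s) (dq (u s)) :=
    h.dq_spec.mono fun s hs => hs.2.1
  have sf := ae_strip_eq hd.f_meas mf.aestronglyMeasurable ef
  have sgx := ae_strip_eq hd.gx_meas h.gx_meas.aestronglyMeasurable egx
  have sgxx := ae_strip_eq hd.gxx_meas mgxx.aestronglyMeasurable egxx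
  have lg : LocIntStrip T g' := hd.g_int.congr (by
    filter_upwards [eg] with q hq using hq.symm)
  have lgx : LocIntStrip T gx' := hd.gx_int.congr (by
    filter_upwards [sgx] with q hq using hq.symm)
  have lgxx : LocIntStrip T gxx' := hd.gxx_int.congr (by
    filter_upwards [sgxx] with q hq using hq.symm)
  have dgx : ∀ᵐ s ∂volume.restrict (Icc 0 T), HasWeakDeriv (gx' s) (gxx' s) := by
    filter_upwards [hd.gxx_deriv, egx, egxx] with s a1 a2 a3
    exact a1.congr a2.symm a3.symm
  have e1 := integral_strip_pd lw lx d1 hx1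
  have e2 := integral_strip_pd lg lgx h.gx_deriv hx1
  have e3 := integral_strip_pd lgx lgxx dgx hΦ
  have i1 := lw.integrable_mul_test ht1
  have i2 := lw.integrable_mul_test hx2
  have i3 := lg.integrable_mul_test hx2
  have i4 := lB.integrable_mul_test hΦ
  have i5 := lgxx.integrable_mul_test hΦ
  have j1 : Integrable (fun q : ℝ × ℝ => μ * (withInit u0 u q.1 q.2 * pd (0, 1) (pd (0, 1) Φ) q) +
      μ * (g' q.1 q.2 * pd (0, 1) (pd (0, 1) Φ) q)) (strip T) := (i2.const_mul μ).add (i3.const_mul μ)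
  have j2 : Integrable (fun q : ℝ × ℝ => withInit u0 u q.1 q.2 * pd (1, 0) Φ q +
      (μ * (withInit u0 u q.1 q.2 * pd (0, 1) (pd (0, 1) Φ) q) +
      μ * (g' q.1 q.2 * pd (0, 1) (pd (0, 1) Φ) q))) (strip T) := i1.add j1
  have j3 : Integrable (fun q : ℝ × ℝ => ((f' q.1 q.2 + μ * gxx' q.1 q.2) -
      clamp K (withInit u0 u q.1 q.2 + g' q.1 q.2) * (dq (u q.1) q.2 + gx' q.1 q.2)) * Φ q -
      μ * (gxx' q.1 q.2 * Φ q)) (strip T) := i4.sub (i5.const_mul μ)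
  have goal_eq : ∫ z : ℝ × ℝ, (-(withInit u0 u z.1 z.2 * deriv (fun s => φ s z.2) z.1)
        - μ * ((withInit u0 u z.1 z.2 + d.g z.1 z.2) * iteratedDeriv 2 (φ z.1) z.2)
        + (withInit u0 u z.1 z.2 + d.g z.1 z.2) * (dq (u z.1) z.2 + d.gx z.1 z.2) * φ z.1 z.2
        - d.f z.1 z.2 * φ z.1 z.2) ∂(strip T) =
      ∫ q : ℝ × ℝ, (-(withInit u0 u q.1 q.2 * pd (1, 0) Φ q +
      (μ * (withInit u0 u q.1 q.2 * pd (0, 1) (pd (0, 1) Φ) q) +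
      μ * (g' q.1 q.2 * pd (0, 1) (pd (0, 1) Φ) q))) -
      (((f' q.1 q.2 + μ * gxx' q.1 q.2) -
      clamp K (withInit u0 u q.1 q.2 + g' q.1 q.2) * (dq (u q.1) q.2 + gx' q.1 q.2)) * Φ q -
      μ * (gxx' q.1 q.2 * Φ q))) ∂(strip T) := by
    refine integral_congr_ae ?_
    filter_upwards [sf, sgx, eg, hK] with q a1 a2 a3 a4
    have p1 : deriv (fun s => φ s q.2) q.1 = pd (1, 0) Φ q := (hΦ.hasDerivAt_left q.1 q.2).deriv
    have p2 : iteratedDeriv 2 (φ q.1) q.2 = pd (0, 1) (pd (0, 1) Φ) q := by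
      have : deriv (φ q.1) = fun x => pd (0, 1) Φ (q.1, x) :=
        funext fun x => (hΦ.hasDerivAt_right q.1 x).deriv
      rw [iteratedDeriv_succ, iteratedDeriv_one, this]
      exact (hx1.hasDerivAt_right q.1 q.2).deriv
    rw [p1, p2, clamp_eq_self a4, ← a1, ← a2, ← a3, show φ q.1 q.2 = Φ q from rfl]
    ring
  have j2n : Integrable (fun q : ℝ × ℝ => -(withInit u0 u q.1 q.2 * pd (1, 0) Φ q +
      (μ * (withInit u0 u q.1 q.2 * pd (0, 1) (pd (0, 1) Φ) q) +
      μ * (g' q.1 q.2 * pd (0, 1) (pd (0, 1) Φ) q)))) (strip T) := j2.neg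
  rw [goal_eq, integral_sub j2n j3, integral_neg, integral_add i1 j1,
    integral_add (i2.const_mul μ) (i3.const_mul μ), integral_sub i4 (i5.const_mul μ),
    integral_const_mul, integral_const_mul, integral_const_mul, e1, e2, e3]
  simp only [mul_assoc] at key ⊢
  rw [integral_const_mul] at key
  linarith

/-- The mild problem is solved for everywhere bounded representatives of the data with truncation
height equal to the comparison bound, so the truncation is never felt. -/
lemma exists_solution (hμ : 0 < μ) (hT : 0 < T) (hd : d.Admissible T) (hR : d.InBall T R) :
    ∃ u ux : ℝ → ℝ → ℝ, (∀ p : ℝ≥0∞, 1 ≤ p → p < 4 / 3 → IsSolution μ T d p u ux) ∧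
      ∀ᵐ q ∂strip T, |u q.1 q.2 + d.g q.1 q.2| ≤ (2 * R + 1) * Real.exp ((2 + μ) * R) := by
  obtain ⟨If, Igx, Igxx⟩ := hR.lintegral_le
  obtain ⟨f', φ₁, mf, mφ₁, f_le, φ₁0, φ₁z, φ₁i, ef⟩ := exists_bounded_representative hd.f_meas If
  obtain ⟨gx', κ, mgx, mκ, gx_le, κ0, -, κi, egx⟩ := exists_bounded_representative hd.gx_meas Igx
  obtain ⟨gxx', φ₂, mgxx, mφ₂, gxx_le, φ₂0, φ₂z, φ₂i, egxx⟩ :=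
    exists_bounded_representative hd.gxx_meas Igxx
  set G₁ := hd.g_mem.1.mk _ with hG₁
  have mG₁ : Measurable G₁ := hd.g_mem.1.stronglyMeasurable_mk.measurable
  set g' : ℝ → ℝ → ℝ := fun s x => clamp R (G₁ (s, x)) with hg'
  have mg' : Measurable (Function.uncurry g') := (continuous_clamp _).measurable.comp mG₁
  have eg : ∀ᵐ q ∂strip T, g' q.1 q.2 = d.g q.1 q.2 := by
    filter_upwards [hd.g_mem.1.ae_eq_mk, ae_strip_abs_le_of_eLpNorm (M := R) R.2
      (by rw [ENNReal.ofReal_coe_nnreal]; exact hR.g_le)] with q h1 h2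
    have e : G₁ q = d.g q.1 q.2 := h1.symm
    simp only [hg', Prod.mk.eta, e]
    exact clamp_eq_self h2
  have eg' : ∀ᵐ s ∂volume.restrict (Icc 0 T), g' s =ᵐ[volume] d.g s := by
    have := eg
    rw [strip_eq_prod] at this
    exact Measure.ae_ae_of_ae_prod this
  set u₁ := hd.u0_mem.1.mk _ with hu₁
  have mu₁ : Measurable u₁ := hd.u0_mem.1.stronglyMeasurable_mk.measurable
  set u0 : ℝ → ℝ := fun x => clamp R (u₁ x) with hu0
  have eu0 : u0 =ᵐ[volume] d.u0 := by
    filter_upwards [hd.u0_mem.1.ae_eq_mk, ae_enorm_le_linf d.u0] with x h1 h2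
    have e : u₁ x = d.u0 x := h1.symm
    simp only [hu0, e]
    refine clamp_eq_self ?_
    have := h2.trans hR.u0_le
    rw [Real.enorm_eq_ofReal_abs, ← ENNReal.ofReal_coe_nnreal] at this
    exact (ENNReal.ofReal_le_ofReal_iff R.2).1 this
  have φi := lintegral_ofReal_add_le mφ₁ φ₁0 φ₂0 hμ.le φ₁i φ₂i
  have g_deriv : ∀ᵐ s ∂volume.restrict (Icc 0 T), HasWeakDeriv (g' s) (gx' s) := by
    filter_upwards [hd.gx_deriv, eg', egx] with s a1 a2 a3
    exact a1.congr a2.symm a3.symm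
  have md : MildData T R R u0 (fun s x => f' s x + μ * gxx' s x) g' (fun s => φ₁ s + μ * φ₂ s) κ :=
    { u0_meas := (continuous_clamp _).measurable.comp mu₁
      u0_le := fun x => abs_clamp_le R.2 _
      FF_meas := mf.add (mgxx.const_mul μ)
      FF_le := fun s y => (abs_add_le _ _).trans (add_le_add (f_le s y) (by
        rw [abs_mul, abs_of_pos hμ]
        exact mul_le_mul_of_nonneg_left (gxx_le s y) hμ.le))
      φ_meas := mφ₁.add (mφ₂.const_mul μ)
      φ_zero := fun s hs => by rw [φ₁z s hs, φ₂z s hs]; simp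
      φ_int := (φi.trans_lt (ENNReal.add_lt_top.2 ⟨ENNReal.coe_lt_top,
        ENNReal.mul_lt_top ENNReal.ofReal_lt_top ENNReal.coe_lt_top⟩)).ne
      g_meas := mg'
      g_le := fun s y => abs_clamp_le R.2 _
      κ_meas := mκ
      κ_nonneg := κ0
      κ_int := (κi.trans_lt ENNReal.coe_lt_top).ne
      g_lip := by
        filter_upwards [(ae_restrict_iff' measurableSet_Icc).1 g_deriv] with s hs hsT h
        exact (hs hsT).abs_sub_le (ae_of_all _ (gx_le s)) h }
  -- This is the comparison bound with `U = G = R`: the integral of `κ` is at most `R` and that of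
  -- the source bound at most `R + μ R`.
  set K : ℝ := (2 * R + 1) * Real.exp ((2 + μ) * R) with hK
  have hK0 : 0 ≤ K := by positivity
  obtain ⟨u, B, l, V, hB, hl, hit, hV, hVi, hfix⟩ := md.exists_fixedPoint hμ hK0
  have h : MildSol μ T R R K B l u0 (fun s x => f' s x + μ * gxx' s x) g' gx'
      (fun s => φ₁ s + μ * φ₂ s) κ V u :=
    ⟨md, mgx, gx_le, g_deriv, hμ, hT, hK0, hB, hl, hit, hV, hVi, hfix⟩
  have bound : ∀ᵐ q ∂strip T, |withInit u0 u q.1 q.2 + g' q.1 q.2| ≤ K := by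
    have hm : AEStronglyMeasurable (Function.uncurry fun s x => withInit u0 u s x + g' s x)
      (strip T) := (h.meas.add mg').aestronglyMeasurable
    refine ae_strip_abs_le hm ?_
    filter_upwards [ae_restrict_mem measurableSet_Icc] with t ht
    filter_upwards [h.abs_le_comparison ht] with x hx
    have hP : Integrable fun s => κ s + (φ₁ s + μ * φ₂ s) := h.integrable_κ.add h.integrable_φ
    have hP0 : ∀ s, 0 ≤ κ s + (φ₁ s + μ * φ₂ s) := fun s =>
      add_nonneg (κ0 s) (h.md.φ_nonneg s)
    have hint : ∫ s in (0:ℝ)..t, (κ s + (φ₁ s + μ * φ₂ s)) ≤ (2 + μ) * R := by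
      rw [integral_interval_eq_Icc ht.1]
      refine (setIntegral_le_integral hP (ae_of_all _ hP0)).trans ?_
      rw [← ENNReal.ofReal_le_ofReal_iff (by positivity),
        ofReal_integral_eq_lintegral_ofReal hP (ae_of_all _ hP0)]
      simp only [fun s => ENNReal.ofReal_add (κ0 s) (h.md.φ_nonneg s)]
      rw [lintegral_add_left (by fun_prop)]
      refine (add_le_add κi φi).trans (le_of_eq ?_)
      rw [← ENNReal.ofReal_coe_nnreal, ← ENNReal.ofReal_mul hμ.le, ← ENNReal.ofReal_add (by positivity)
        (by positivity), ← ENNReal.ofReal_add (by positivity) (by positivity)]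
      congr 1
      ring
    calc |withInit u0 u t x + g' t x| ≤ |withInit u0 u t x| + R :=
          (abs_add_le _ _).trans (add_le_add_right (abs_clamp_le R.2 _) _)
      _ ≤ _ := hx
      _ ≤ (R + R + 1) * Real.exp ((2 + μ) * R) := by gcongr
      _ = K := by rw [hK]; ring
  -- The construction does not depend on `p`, so one function serves all exponents.
  refine ⟨withInit u0 u, fun t => dq (u t), fun p hp1 hp => ⟨?_, h.memCStar,
    (measurable_dq hit.meas).aestronglyMeasurable, h.dq_spec.mono fun s hs => hs.2.1, h.mem_h1ul hp,
    h.l2ulL2_dq, solvesEquation_of_mildSol hd h mf mgxx ef eg egx egxx bound, ?_, fun r _ => ?_⟩, ?_⟩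
  · refine memLp_top_of_bound h.meas.aestronglyMeasurable (max (R:ℝ) (B * Real.exp (l * T))) ?_
    exact ae_strip_abs_le h.meas.aestronglyMeasurable (by
      filter_upwards [ae_restrict_mem measurableSet_Icc] with s hs
      exact ae_of_all _ (h.abs_le hs))
  · rw [withInit_zero]; exact eu0
  · refine (h.tendsto_initial r).congr fun t => eLpNorm_congr_ae (ae_restrict_of_ae ?_)
    filter_upwards [eu0] with x hx
    rw [hx]
  · filter_upwards [bound, eg] with q h1 h2
    rw [← h2]; exact h1

end

/-! ### The a priori bound of all solutions over a ball of data -/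

section

variable {μ T : ℝ} {d : Data} {R : ℝ≥0} {p : ℝ≥0∞} {u ux : ℝ → ℝ → ℝ}

lemma Data.Admissible.exists_inBall (hd : d.Admissible T) : ∃ R : ℝ≥0, d.InBall T R := by
  have key : ∀ a : ℝ≥0∞, a < ⊤ → ∃ r : ℝ≥0, ∀ r' ≥ r, a ≤ r' := fun a ha =>
    ⟨a.toNNReal, fun r' hr => by rw [← ENNReal.coe_toNNReal ha.ne]; exact_mod_cast hr⟩
  obtain ⟨a, ha⟩ := key _ hd.u0_mem.2
  obtain ⟨b, hb⟩ := key _ hd.f_mem.2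
  obtain ⟨c, hc⟩ := key _ hd.g_mem.2
  obtain ⟨e, he⟩ := key _ hd.g_mem_w1.2
  obtain ⟨k, hk⟩ := key _ hd.g_mem_w2.2
  exact ⟨a ⊔ b ⊔ c ⊔ e ⊔ k, ha _ (by simp), hb _ (by simp), hc _ (by simp), he _ (by simp),
    hk _ (by simp)⟩

/-- The a priori bound of a solution in terms of the radius of the ball of data. -/
lemma IsSolution.ae_add_g_le (hμ : 0 < μ) (hT : 0 < T) (hd : d.Admissible T) (hR : d.InBall T R)
    (hp1 : 1 ≤ p) (hp : p < 4 / 3) (h : IsSolution μ T d p u ux) :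
    ∀ᵐ q ∂strip T, |u q.1 q.2 + d.g q.1 q.2| ≤ (2 * R + 1) * Real.exp ((2 + μ) * R) := by
  obtain ⟨v, vx, hv, hb⟩ := exists_solution hμ hT hd hR
  have hv' := hv p hp1 hp
  -- Uniqueness identifies the given solution with the constructed one at every time, hence almost
  -- everywhere on the strip, and the bound is inherited.
  have e := ae_strip_eq hv'.bounded.1 h.bounded.1 (by
    filter_upwards [ae_restrict_mem measurableSet_Icc] with t ht
    exact h.unique hμ hT hd hv' t ht)
  filter_upwards [hb, e] with q h1 h2
  rwa [h2]

end

end UlBurgers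

theorem theorem3p2 (μ T : ℝ) (hμ : 0 < μ) (hT : 0 < T) :
    (∀ d : UlBurgers.Data, d.Admissible T →
      ∃ u ux : ℝ → ℝ → ℝ,
        (∀ p : ℝ≥0∞, 1 ≤ p → p < 4 / 3 → UlBurgers.IsSolution μ T d p u ux) ∧
        ∀ p : ℝ≥0∞, 1 ≤ p → p < 4 / 3 → ∀ w wx : ℝ → ℝ → ℝ,
          UlBurgers.IsSolution μ T d p w wx → ∀ t ∈ Icc 0 T, w t =ᵐ[volume] u t) ∧
    ∀ R : ℝ≥0, ∃ C : ℝ≥0, ∀ d₁ d₂ : UlBurgers.Data,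
      d₁.Admissible T → d₂.Admissible T → d₁.InBall T R → d₂.InBall T R →
      ∀ p : ℝ≥0∞, 1 ≤ p → p < 4 / 3 → ∀ u₁ u₁x u₂ u₂x : ℝ → ℝ → ℝ,
        UlBurgers.IsSolution μ T d₁ p u₁ u₁x → UlBurgers.IsSolution μ T d₂ p u₂ u₂x →
        ∀ t ∈ Icc 0 T,
          (⨆ s ∈ Icc 0 t, UlBurgers.l2ul (u₁ s - u₂ s)) + UlBurgers.l2ulL2 t (u₁x - u₂x) ≤
            C * (UlBurgers.l2ul (d₁.u0 - d₂.u0) +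
              min (UlBurgers.l2ulL2 t (d₁.f - d₂.f))
                (UlBurgers.timeNorm 1 t (fun s => UlBurgers.linf (d₁.f s - d₂.f s))) +
              UlBurgers.tripleNorm t (d₁.g - d₂.g) (d₁.gx - d₂.gx) (d₁.gxx - d₂.gxx)) := by
  refine ⟨fun d hd => ?_, fun R => ?_⟩
  · obtain ⟨R, hR⟩ := hd.exists_inBall
    obtain ⟨u, ux, hu, -⟩ := UlBurgers.exists_solution hμ hT hd hR
    exact ⟨u, ux, hu, fun p hp1 hp w wx hw => hw.unique hμ hT hd (hu p hp1 hp)⟩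
  -- The bound of the solutions depends on `R` and `μ` only, so the constant depends on `R`, `T` and
  -- `μ` only.
  · obtain ⟨C, hC⟩ := UlBurgers.lipschitz_of_bounded hμ hT
      (M := (2 * R + 1) * Real.exp ((2 + μ) * R)) (by positivity)
    exact ⟨C, fun d₁ d₂ hd₁ hd₂ hR₁ hR₂ p hp1 hp u₁ u₁x u₂ u₂x h₁ h₂ =>
      hC d₁ d₂ p u₁ u₁x u₂ u₂x hd₁ hd₂ h₁ h₂ (h₁.ae_add_g_le hμ hT hd₁ hR₁ hp1 hp)
        (h₂.ae_add_g_le hμ hT hd₂ hR₂ hp1 hp)⟩
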